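/- Consider the problem $$(g g')'' = \tfrac13\, z\, g' \quad\text{on } \mathbb{R}, \qquad \lim_{z\to-\infty} g(z) = 1, \quad \lim_{z\to+\infty} g(z) = -1,$$ where a solution is a differentiable function $g:\mathbb{R}\to\mathbb{R}$ such that $g g'$ is twice differentiable and the equation holds at every $z\in\mathbb{R}$. This problem has exactly one solution $g$. The solution $g$ is odd, real analytic on all of $\mathbb{R}$, and satisfies $g(z)>0$ for all $z<0$. -/

import Mathlib

open Filter Topology

/-- `g : ℝ → ℝ` solves the shock-profile problem
`(g g')'' = (1/3) z g'` on `ℝ`, `g(-∞) = 1`, `g(+∞) = -1`.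
Solutions are classical, in the weakest sense in which the equation can be read pointwise:
`g` is differentiable, the flux `g g'` is twice differentiable, and the equation holds at every
point (in particular at the zeros of `g`, where the equation degenerates). -/
structure IsShockProfile (g : ℝ → ℝ) : Prop where
  /-- `g'` exists everywhere. -/
  differentiable : Differentiable ℝ g
  /-- `(g g')'` exists everywhere. -/
  differentiable_flux : Differentiable ℝ (fun z => g z * deriv g z)
  /-- `(g g')''` exists everywhere and equals `(1/3) z g'`. -/
  ode : ∀ z : ℝ, HasDerivAt (deriv (fun y => g y * deriv g y)) (1 / 3 * z * deriv g z) z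
  /-- `g(-∞) = 1`. -/
  tendsto_atBot : Tendsto g atBot (𝓝 1)
  /-- `g(+∞) = -1`. -/
  tendsto_atTop : Tendsto g atTop (𝓝 (-1))

/-! ### Comparison lemmas -/

/-! To the right of a zero of a profile, `y = -g` satisfies `(y y')' = (J - x y)/3` with `J' = y`.
Two facts carry the proof. First, `I = 3 J y² - 2 x y³ - 9 (y y')²` is an antiderivative of `y³`.
Hence for each constant `c ≥ 0` the energy `E_c = 3 J c² - I - 2 x c³` decreases, with derivative
`-(y - c)² (y + 2c)`, and `E_c = 9 (y y')²` wherever `y = c`. So for `x ≤ x'` the cubic `c ↦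
E_c(x)`, taken at `c = y(x')`, dominates `9 (y y')²` at `x'`: the state at one point bounds all
later values and slopes. Second, `l³ y(x / l)` is again a solution.

Existence. The equation is singular where `y = 0`, but the recursion for the Taylor coefficients of
`y / x` with slope 1 is solvable and convergent, and gives an odd germ. Where `y ≠ 0` the equation
is a quadratic system in `1, x, 1/y, y'/y, (y y')'/y`; its solutions are analytic, and the energy
excludes blow-up. Comparing `E_c` for two values `c` taken by `y` shows that `y` has a limit, which
is positive because `I > 0`. Scaling makes the limit 1, and the odd reflection is the profile.

Uniqueness. An antiderivative of `f³` vanishes at every zero of `f`, so by Rolle the zeros form an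
interval. The energy makes the last zero nondegenerate if it is `≥ 0`, and by reflection the first
one if it is `≤ 0`; hence there is a single transversal zero `b`. The right half and the reflected
left half are half profiles that start from `b` and `-b` with the same slope and the same limit. If
`b = 0`, both are the slope-one half profile up to scaling (a contraction near the origin,
`HalfProfile.eqOn_start`), and the limit fixes the scale.

The core is `HalfProfile.false_of_shift`: half profiles started at `-a` and `a` with `a > 0` and
equal slopes have different limits. Scale the slope to 1. For `a ≥ 0.8` an account of the energy
spent while climbing to the limit and overshooting it gives a contradiction. For `a ≤ 0.8` let `y`
start at `-a` and `v` at `a`, with `J' = y` and `K' = v`. Their difference has an oscillating part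
and a slow part `n`, the difference of the running means `J/x` and `K/x` with two corrections, for
which `n' = -9 (y² - v²)/x⁴`. Equal limits force `n → 0`. But `n` is positive and stays so.
Polynomial enclosures reach abscissa 5. Barriers for `n` and the oscillating energy reach `[12,
15.2]`. After scaling the limit to 1, a modulated energy controls the gap beyond 10 and gives `y² -
v² = O(n₀ x^(3/2))`, with `n₀` the value of `n` at 10, so that `n` changes by less than `0.9 n₀` in
total. -/

theorem le_of_hasDerivAt_nonneg {f f' : ℝ → ℝ} {a b : ℝ} (hab : a ≤ b)
    (hc : ContinuousOn f (Set.Icc a b)) (hd : ∀ x ∈ Set.Ioo a b, HasDerivAt f (f' x) x)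
    (h : ∀ x ∈ Set.Ioo a b, 0 ≤ f' x) : f a ≤ f b := by
  have : MonotoneOn f (Set.Icc a b) := by
    apply monotoneOn_of_deriv_nonneg (convex_Icc a b) hc
    · intro x hx
      rw [interior_Icc] at hx
      exact (hd x hx).differentiableAt.differentiableWithinAt
    · intro x hx
      rw [interior_Icc] at hx
      rw [(hd x hx).deriv]
      exact h x hx
  exact this (Set.left_mem_Icc.2 hab) (Set.right_mem_Icc.2 hab) hab

theorem lt_of_hasDerivAt_pos {f f' : ℝ → ℝ} {a b : ℝ} (hab : a < b)
    (hc : ContinuousOn f (Set.Icc a b)) (hd : ∀ x ∈ Set.Ioo a b, HasDerivAt f (f' x) x)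
    (h : ∀ x ∈ Set.Ioo a b, 0 < f' x) : f a < f b := by
  have : StrictMonoOn f (Set.Icc a b) := by
    apply strictMonoOn_of_deriv_pos (convex_Icc a b) hc
    intro x hx
    rw [interior_Icc] at hx
    rw [(hd x hx).deriv]
    exact h x hx
  exact this (Set.left_mem_Icc.2 hab.le) (Set.right_mem_Icc.2 hab.le) hab

/-- Integrating an inequality between derivatives. -/
theorem sub_le_sub_of_hasDerivAt {f f' g g' : ℝ → ℝ} {a b : ℝ} (hab : a ≤ b)
    (hf : ContinuousOn f (Set.Icc a b)) (hg : ContinuousOn g (Set.Icc a b))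
    (hdf : ∀ x ∈ Set.Ioo a b, HasDerivAt f (f' x) x)
    (hdg : ∀ x ∈ Set.Ioo a b, HasDerivAt g (g' x) x)
    (h : ∀ x ∈ Set.Ioo a b, f' x ≤ g' x) : f b - f a ≤ g b - g a := by
  have := le_of_hasDerivAt_nonneg (f := fun x => g x - f x) (f' := fun x => g' x - f' x) hab
    (hg.sub hf) (fun x hx => (hdg x hx).sub (hdf x hx)) (fun x hx => sub_nonneg.2 (h x hx))
  linarith

/-- Continuous induction: finitely many (here: one) continuous margins that stay positive as long
as they have been positive so far stay positive up to the end. -/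
theorem forall_pos_of_bootstrap {h : ℝ → ℝ} {a b : ℝ}
    (hc : ContinuousOn h (Set.Icc a b)) (h0 : ∀ᶠ x in 𝓝[>] a, 0 < h x)
    (hs : ∀ t ∈ Set.Ioc a b, (∀ x ∈ Set.Ioo a t, 0 < h x) → 0 < h t) :
    ∀ x ∈ Set.Ioc a b, 0 < h x := by
  by_contra hcon
  push Not at hcon
  obtain ⟨x, hx, hxn⟩ := hcon
  obtain ⟨δ, hδ, hpos⟩ : ∃ δ > a, ∀ x ∈ Set.Ioo a δ, 0 < h x := by
    rw [eventually_nhdsWithin_iff] at h0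
    obtain ⟨ε, hε, hb⟩ := Metric.eventually_nhds_iff.1 h0
    refine ⟨a + ε, by linarith, fun x hx => hb ?_ hx.1⟩
    rw [Real.dist_eq, abs_lt]
    constructor <;> linarith [hx.1, hx.2]
  -- The cut at `min δ x` keeps the infimum away from `a`, where `h` itself may vanish.
  set Z := {t | t ∈ Set.Icc a b ∧ h t ≤ 0} ∩ Set.Ici (min δ x) with hZ
  have hxδ : δ ≤ x := by
    by_contra hlt
    push Not at hlt
    exact absurd (hpos x ⟨hx.1, hlt⟩) (not_lt.2 hxn)
  have hne : Z.Nonempty := ⟨x, ⟨⟨⟨hx.1.le, hx.2⟩, hxn⟩, by simp⟩⟩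
  have hcl : IsClosed Z := by
    refine IsClosed.inter ?_ isClosed_Ici
    have := hc.preimage_isClosed_of_isClosed isClosed_Icc (isClosed_Iic (a := (0:ℝ)))
    have heq : {t | t ∈ Set.Icc a b ∧ h t ≤ 0} = Set.Icc a b ∩ h ⁻¹' Set.Iic 0 := by
      ext t; simp
    rw [heq]; exact this
  have hbd : BddBelow Z := ⟨a, fun t ht => ht.1.1.1⟩
  have hm := hcl.csInf_mem hne hbd
  set m := sInf Z with hmdef
  have hma : a < m := by
    have := hm.2
    simp only [Set.mem_Ici, min_eq_left hxδ] at this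
    linarith
  have := hs m ⟨hma, hm.1.1.2⟩ (by
    intro y hy
    by_contra hny
    push Not at hny
    rcases lt_or_ge y δ with hyδ | hyδ
    · exact absurd (hpos y ⟨hy.1, hyδ⟩) (not_lt.2 hny)
    · have : m ≤ y := csInf_le hbd ⟨⟨⟨hy.1.le, hy.2.le.trans hm.1.1.2⟩, hny⟩,
        by simp [min_eq_left hxδ, hyδ]⟩
      linarith [hy.2])
  linarith [hm.1.2]

/-! ### Profiles on half-lines -/

/-- A positive solution of the profile equation on `(T, ∞)` after reflection:
`(y y')' = (J - x y) / 3` with `J' = y`. -/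
structure ProfileOn (T : ℝ) (y y1 J : ℝ → ℝ) : Prop where
  pos : ∀ x, T < x → 0 < y x
  dy : ∀ x, T < x → HasDerivAt y (y1 x) x
  dJ : ∀ x, T < x → HasDerivAt J (y x) x
  dy1 : ∀ x, T < x → HasDerivAt y1 (((J x - x * y x) / 3 - y1 x ^ 2) / y x) x

/-- A profile which starts at the point `T` from the value `0` with slope `α`. -/
structure HalfProfile (T α : ℝ) (y y1 J : ℝ → ℝ) : Prop extends ProfileOn T y y1 J where
  cy : ContinuousOn y (Set.Ici T)
  cy1 : ContinuousOn y1 (Set.Ici T)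
  cJ : ContinuousOn J (Set.Ici T)
  y_start : y T = 0
  y1_start : y1 T = α
  -- At a zero of `y` with slope `α` the derivative of `y y'` is `α²`, and it must equal `J / 3`
  -- there. This fixes the constant of integration in `J`.
  J_start : J T = 3 * α ^ 2

/-- The first integral `∫ y³`. -/
def cubeInt (y y1 J : ℝ → ℝ) (x : ℝ) : ℝ :=
  3 * J x * y x ^ 2 - 2 * x * y x ^ 3 - 9 * (y x * y1 x) ^ 2

/-- The energy `E_c`. -/
def energy (y y1 J : ℝ → ℝ) (c x : ℝ) : ℝ :=
  3 * J x * c ^ 2 - cubeInt y y1 J x - 2 * x * c ^ 3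

namespace ProfileOn
variable {T : ℝ} {y y1 J : ℝ → ℝ}

theorem mono (h : ProfileOn T y y1 J) {T' : ℝ} (hT : T ≤ T') : ProfileOn T' y y1 J :=
  ⟨fun x hx => h.pos x (hT.trans_lt hx), fun x hx => h.dy x (hT.trans_lt hx),
    fun x hx => h.dJ x (hT.trans_lt hx), fun x hx => h.dy1 x (hT.trans_lt hx)⟩

theorem dflux (h : ProfileOn T y y1 J) {x : ℝ} (hx : T < x) :
    HasDerivAt (fun x => y x * y1 x) ((J x - x * y x) / 3) x := by
  have hy := (h.pos x hx).ne'
  refine ((h.dy x hx).mul (h.dy1 x hx)).congr_deriv ?_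
  field_simp
  ring

theorem dforce (h : ProfileOn T y y1 J) {x : ℝ} (hx : T < x) :
    HasDerivAt (fun x => (J x - x * y x) / 3) (-(x / 3) * y1 x) x := by
  refine (((h.dJ x hx).sub ((hasDerivAt_id' x).mul (h.dy x hx))).div_const 3).congr_deriv ?_
  ring

/-- Differentiating `9 (y y')²` through `(y y')' = (J - x y)/3` cancels every term with `y'`; what
is left is `3y³ - 2y³`. -/
theorem dcubeInt (h : ProfileOn T y y1 J) {x : ℝ} (hx : T < x) :
    HasDerivAt (cubeInt y y1 J) (y x ^ 3) x := by
  have h1 := ((h.dJ x hx).const_mul 3).mul ((h.dy x hx).pow 2)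
  have h2 := ((hasDerivAt_id' x).const_mul 2).mul ((h.dy x hx).pow 3)
  have h3 := ((h.dflux hx).pow 2).const_mul 9
  refine ((h1.sub h2).sub h3).congr_deriv ?_
  simp only [Pi.pow_apply]
  push_cast
  ring

/-- The linear term `-2 x c³` gives the cubic `y³ - 3c² y + 2c³` a double root at `y = c`, hence a
definite sign for `y, c ≥ 0`. -/
theorem denergy (h : ProfileOn T y y1 J) (c : ℝ) {x : ℝ} (hx : T < x) :
    HasDerivAt (energy y y1 J c) (-((y x - c) ^ 2 * (y x + 2 * c))) x := by
  have h1 := ((h.dJ x hx).const_mul 3).mul_const (c ^ 2)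
  have h2 := ((hasDerivAt_id' x).const_mul 2).mul_const (c ^ 3)
  refine ((h1.sub (h.dcubeInt hx)).sub h2).congr_deriv ?_
  ring

/-- With `c` the current value only the kinetic part survives. Its nonnegativity, transported back
by monotonicity, is the source of the a priori bounds. -/
theorem energy_self (x : ℝ) : energy y y1 J (y x) x = 9 * (y x * y1 x) ^ 2 := by
  simp only [energy, cubeInt]; ring

theorem dy1' (h : ProfileOn T y y1 J) {x : ℝ} (hx : T < x) :
    HasDerivAt y1 (-(x / 9) + cubeInt y y1 J x / (9 * y x ^ 3)) x := by
  have hy := (h.pos x hx).ne'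
  refine (h.dy1 x hx).congr_deriv ?_
  simp only [cubeInt]
  field_simp
  ring

theorem energy_antitone (h : ProfileOn T y y1 J) {c : ℝ} (hc : 0 ≤ c) {x x' : ℝ} (hx : T < x)
    (hxx : x ≤ x') : energy y y1 J c x' ≤ energy y y1 J c x := by
  have := le_of_hasDerivAt_nonneg (f := fun x => - energy y y1 J c x) hxx
    (fun t ht => (h.denergy c (hx.trans_le ht.1)).neg.continuousAt.continuousWithinAt)
    (fun t ht => (h.denergy c (hx.trans ht.1)).neg) (fun t ht => by
      have := (h.pos t (hx.trans ht.1)).le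
      rw [neg_neg]; positivity)
  linarith

/-- The energy at an earlier time bounds the slope later. -/
theorem slope_sq_le_energy (h : ProfileOn T y y1 J) {x x' : ℝ} (hx : T < x) (hxx : x ≤ x') :
    9 * (y x' * y1 x') ^ 2 ≤ energy y y1 J (y x') x := by
  have := h.energy_antitone (h.pos x' (hx.trans_le hxx)).le hx hxx
  rwa [energy_self] at this

end ProfileOn

namespace HalfProfile
variable {T α : ℝ} {y y1 J : ℝ → ℝ}

theorem continuousOn_cubeInt (h : HalfProfile T α y y1 J) :
    ContinuousOn (cubeInt y y1 J) (Set.Ici T) := by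
  have := h.cy; have := h.cy1; have := h.cJ
  unfold cubeInt
  fun_prop

theorem continuousOn_energy (h : HalfProfile T α y y1 J) (c : ℝ) :
    ContinuousOn (energy y y1 J c) (Set.Ici T) := by
  have := h.continuousOn_cubeInt; have := h.cJ
  unfold energy
  fun_prop

theorem cubeInt_start (h : HalfProfile T α y y1 J) : cubeInt y y1 J T = 0 := by
  simp [cubeInt, h.y_start]

theorem energy_start (h : HalfProfile T α y y1 J) (c : ℝ) :
    energy y y1 J c T = 9 * α ^ 2 * c ^ 2 - 2 * T * c ^ 3 := by
  simp only [energy, h.cubeInt_start, h.J_start]; ring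

theorem nonneg (h : HalfProfile T α y y1 J) {x : ℝ} (hx : T ≤ x) : 0 ≤ y x := by
  rcases hx.eq_or_lt with rfl | hx
  · exact h.y_start.ge
  · exact (h.pos x hx).le

theorem cubeInt_pos (h : HalfProfile T α y y1 J) {x : ℝ} (hx : T < x) : 0 < cubeInt y y1 J x := by
  have := lt_of_hasDerivAt_pos hx (h.continuousOn_cubeInt.mono Set.Icc_subset_Ici_self)
    (fun t ht => h.dcubeInt ht.1) (fun t ht => pow_pos (h.pos t ht.1) 3)
  rwa [h.cubeInt_start] at this

theorem energy_antitone' (h : HalfProfile T α y y1 J) {c : ℝ} (hc : 0 ≤ c) {x x' : ℝ} (hx : T ≤ x)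
    (hxx : x ≤ x') : energy y y1 J c x' ≤ energy y y1 J c x := by
  have := le_of_hasDerivAt_nonneg (f := fun x => - energy y y1 J c x) hxx
    ((h.continuousOn_energy c).neg.mono (fun t ht => hx.trans ht.1))
    (fun t ht => (h.denergy c (hx.trans_lt ht.1)).neg) (fun t ht => by
      have := (h.pos t (hx.trans_lt ht.1)).le
      rw [neg_neg]; positivity)
  linarith

/-- At the starting zero the energy is explicit, `9 α² c² - 2 T c³`; take `c = y x` and divide by `9
y²`. -/
theorem slope_sq_le (h : HalfProfile T α y y1 J) {x : ℝ} (hx : T < x) :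
    y1 x ^ 2 ≤ α ^ 2 - 2 * T * y x / 9 := by
  have hy := h.pos x hx
  have h1 := h.energy_antitone' hy.le le_rfl hx.le
  rw [ProfileOn.energy_self, h.energy_start] at h1
  have : 0 ≤ y x ^ 2 * (9 * (α ^ 2 - 2 * T * y x / 9 - y1 x ^ 2)) := by nlinarith
  have := nonneg_of_mul_nonneg_right this (by positivity)
  linarith

end HalfProfile

/-! ### The asymptotic regime of a single profile -/

/-- A function with nonpositive derivative which tends to `L` stays above `L`. -/
theorem le_of_hasDerivAt_nonpos_of_tendsto {f f' : ℝ → ℝ} {x0 L : ℝ}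
    (hd : ∀ x, x0 ≤ x → HasDerivAt f (f' x) x) (h : ∀ x, x0 ≤ x → f' x ≤ 0)
    (hl : Tendsto f atTop (𝓝 L)) : L ≤ f x0 := by
  refine le_of_tendsto hl ?_
  filter_upwards [eventually_ge_atTop x0] with x hx
  have := le_of_hasDerivAt_nonneg (f := fun x => - f x) hx
    (fun t ht => (hd t ht.1).neg.continuousAt.continuousWithinAt)
    (fun t ht => (hd t ht.1.le).neg) (fun t ht => neg_nonneg.2 (h t ht.1.le))
  linarith

/-- If `f' → L` then `f x / x → L`. -/
theorem tendsto_div_self_of_hasDerivAt {f f' : ℝ → ℝ} {x0 L : ℝ}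
    (hd : ∀ x, x0 < x → HasDerivAt f (f' x) x) (hl : Tendsto f' atTop (𝓝 L)) :
    Tendsto (fun x => f x / x) atTop (𝓝 L) := by
  rw [Metric.tendsto_atTop]
  intro ε hε
  obtain ⟨N, hN⟩ := Metric.tendsto_atTop.1 hl (ε / 2) (by positivity)
  set a := max (max N (x0 + 1)) 1 with ha
  have haN : N ≤ a := (le_max_left _ _).trans (le_max_left _ _)
  have hax : x0 + 1 ≤ a := (le_max_right _ _).trans (le_max_left _ _)
  have ha1 : 1 ≤ a := le_max_right _ _
  refine ⟨max a (2 * (|f a - L * a| + 1) / ε), fun x hx => ?_⟩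
  have hxa : a ≤ x := (le_max_left _ _).trans hx
  have hxb : 2 * (|f a - L * a| + 1) / ε ≤ x := (le_max_right _ _).trans hx
  have hx0 : 0 < x := by linarith
  rw [div_le_iff₀ hε] at hxb
  have hcont : ContinuousOn f (Set.Icc a x) := fun t ht =>
    (hd t (by linarith [ht.1])).continuousAt.continuousWithinAt
  have hf' : ∀ t ∈ Set.Ioo a x, |f' t - L| < ε / 2 := fun t ht => by
    have := hN t (haN.trans ht.1.le)
    rwa [Real.dist_eq] at this
  have h1 := sub_le_sub_of_hasDerivAt (g := fun t => (L + ε / 2) * t) (g' := fun _ => L + ε / 2)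
    hxa hcont (by fun_prop)
    (fun t ht => hd t (by linarith [ht.1]))
    (fun t _ => by simpa using (hasDerivAt_id' t).const_mul (L + ε / 2))
    (fun t ht => by linarith [(abs_lt.1 (hf' t ht)).2])
  have h2 := sub_le_sub_of_hasDerivAt (f := fun t => (L - ε / 2) * t) (f' := fun _ => L - ε / 2)
    hxa (by fun_prop) hcont
    (fun t _ => by simpa using (hasDerivAt_id' t).const_mul (L - ε / 2))
    (fun t ht => hd t (by linarith [ht.1]))
    (fun t ht => by linarith [(abs_lt.1 (hf' t ht)).1])
  rw [Real.dist_eq]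
  have h3 : f x / x - L = (f x - L * x) / x := by field_simp
  rw [h3, abs_div, abs_of_pos hx0, div_lt_iff₀ hx0, abs_lt]
  have h4 := neg_abs_le (f a - L * a)
  have h5 := le_abs_self (f a - L * a)
  have h6 : 0 ≤ ε * a := by positivity
  constructor <;> nlinarith

/-- In the regime `y → 1`: the defect `(J - x)/3` equals `- y y' / x` up to `O(x⁻²)`. -/
theorem ProfileOn.abs_defect_add_le {T : ℝ} {y y1 J : ℝ → ℝ} (h : ProfileOn T y y1 J)
    {x0 M : ℝ} (hT : T < x0) (hx0 : 0 < x0) (hlim : Tendsto y atTop (𝓝 1))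
    (hM : ∀ x, x0 ≤ x → |y x ^ 2 - 1| ≤ M) {x : ℝ} (hx : x0 ≤ x) :
    |(J x - x) / 3 + y x * y1 x / x| ≤ 2 * M / x ^ 2 := by
  -- The two corrections cancel successively the terms of order `1/x` and `1/x³` in the derivative
  -- of the first quotient. The remaining derivative `-3 (y² - 1)/x⁴` is integrable, and `R → 0`, so
  -- `|R| ≤ M / x³`; multiplying by `x` gives the claim.
  set R : ℝ → ℝ := fun x => (J x - x) / 3 / x + y x * y1 x / x ^ 2 + (y x ^ 2 - 1) / x ^ 3 with hR
  have hRd : ∀ t, x0 ≤ t → HasDerivAt R (-3 * (y t ^ 2 - 1) / t ^ 4) t := by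
    intro t ht
    have htT : T < t := hT.trans_le ht
    have ht0 : t ≠ 0 := (hx0.trans_le ht).ne'
    have d1 := (((h.dJ t htT).sub (hasDerivAt_id' t)).div_const 3).div (hasDerivAt_id' t) ht0
    have d2 := (h.dflux htT).div (hasDerivAt_pow 2 t) (pow_ne_zero 2 ht0)
    have d3 := (((h.dy t htT).pow 2).sub_const 1).div (hasDerivAt_pow 3 t) (pow_ne_zero 3 ht0)
    refine ((d1.add d2).add d3).congr_deriv ?_
    simp only [Pi.pow_apply, Pi.sub_apply]
    push_cast
    field_simp
    ring
  have hM0 : 0 ≤ M := (abs_nonneg _).trans (hM x0 le_rfl)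
  have hRlim : Tendsto R atTop (𝓝 0) := by
    have hinv : Tendsto (fun x : ℝ => x⁻¹) atTop (𝓝 0) := tendsto_inv_atTop_zero
    have t1 : Tendsto (fun x => (J x - x) / 3 / x) atTop (𝓝 0) := by
      refine tendsto_div_self_of_hasDerivAt (x0 := T) (f' := fun x => (y x - 1) / 3)
        (fun x hx => ((h.dJ x hx).sub (hasDerivAt_id' x)).div_const 3) ?_
      simpa using (hlim.sub_const 1).div_const 3
    have t2 : Tendsto (fun x => y x * y1 x / x ^ 2) atTop (𝓝 0) := by
      have hb : ∀ t, x0 ≤ t → ‖y t * y1 t‖ ≤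
          1 + (3 * |J x0| * (1 + M) + |cubeInt y y1 J x0|) := by
        intro t ht
        have h1 := h.slope_sq_le_energy hT ht
        have h2 := (abs_le.1 (hM t ht)).2
        have hyt := h.pos t (hT.trans_le ht)
        have h3 : 9 * (y t * y1 t) ^ 2 ≤ 3 * |J x0| * (1 + M) + |cubeInt y y1 J x0| := by
          simp only [energy] at h1
          have e1 : 3 * J x0 * y t ^ 2 ≤ 3 * |J x0| * (1 + M) := by
            have := le_abs_self (J x0)
            have := abs_nonneg (J x0)
            have : y t ^ 2 ≤ 1 + M := by linarith
            nlinarith [sq_nonneg (y t)]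
          have e2 := neg_abs_le (cubeInt y y1 J x0)
          have e3 : 0 ≤ 2 * x0 * y t ^ 3 := by positivity
          linarith
        rw [Real.norm_eq_abs]
        nlinarith [sq_abs (y t * y1 t), sq_nonneg (|y t * y1 t| - 1), abs_nonneg (y t * y1 t)]
      have hinv2 : Tendsto (fun x : ℝ => (x ^ 2)⁻¹) atTop (𝓝 0) := by
        have := hinv.pow 2
        simpa using this
      have := isBoundedUnder_of_eventually_le (f := atTop) (u := fun t => ‖y t * y1 t‖)
        (a := 1 + (3 * |J x0| * (1 + M) + |cubeInt y y1 J x0|))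
        (by filter_upwards [eventually_ge_atTop x0] with t ht using hb t ht)
      have := hinv2.zero_mul_isBoundedUnder_le this
      simpa [div_eq_mul_inv, mul_comm] using this
    have t3 : Tendsto (fun x => (y x ^ 2 - 1) / x ^ 3) atTop (𝓝 0) := by
      have := ((hlim.pow 2).sub_const 1).mul (hinv.pow 3)
      simpa [div_eq_mul_inv] using this
    simpa using (t1.add t2).add t3
  have hpow : ∀ t : ℝ, x0 ≤ t → HasDerivAt (fun x : ℝ => M / x ^ 3) (-3 * M / t ^ 4) t := by
    intro t ht
    have ht0 : t ≠ 0 := (hx0.trans_le ht).ne'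
    refine ((hasDerivAt_const t M).div (hasDerivAt_pow 3 t) (pow_ne_zero 3 ht0)).congr_deriv ?_
    push_cast
    field_simp
    ring
  have hpl : Tendsto (fun x : ℝ => M / x ^ 3) atTop (𝓝 0) := by
    have := (tendsto_inv_atTop_zero (𝕜 := ℝ)).pow 3 |>.const_mul M
    simpa [div_eq_mul_inv] using this
  have hRb : |R x| ≤ M / x ^ 3 := by
    rw [abs_le]
    constructor
    · have := le_of_hasDerivAt_nonpos_of_tendsto (f := fun x => R x + M / x ^ 3) (x0 := x) (L := 0)
        (fun t ht => (hRd t (hx.trans ht)).add (hpow t (hx.trans ht))) (fun t ht => by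
          have ht0 : 0 < t := hx0.trans_le (hx.trans ht)
          have := (abs_le.1 (hM t (hx.trans ht))).1
          rw [← add_div]
          exact div_nonpos_of_nonpos_of_nonneg (by linarith) (by positivity))
        (by simpa using hRlim.add hpl)
      linarith
    · have := le_of_hasDerivAt_nonpos_of_tendsto (f := fun x => M / x ^ 3 - R x) (x0 := x) (L := 0)
        (fun t ht => (hpow t (hx.trans ht)).sub (hRd t (hx.trans ht))) (fun t ht => by
          have ht0 : 0 < t := hx0.trans_le (hx.trans ht)
          have := (abs_le.1 (hM t (hx.trans ht))).2
          rw [← sub_div]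
          exact div_nonpos_of_nonpos_of_nonneg (by linarith) (by positivity))
        (by simpa using hpl.sub hRlim)
      linarith
  have hxp : 0 < x := hx0.trans_le hx
  have hid : (J x - x) / 3 + y x * y1 x / x = x * R x - (y x ^ 2 - 1) / x ^ 2 := by
    simp only [hR]
    field_simp
    ring
  have hMx := hM x hx
  rw [hid]
  calc |x * R x - (y x ^ 2 - 1) / x ^ 2| ≤ |x * R x| + |(y x ^ 2 - 1) / x ^ 2| := abs_sub _ _
    _ ≤ x * (M / x ^ 3) + M / x ^ 2 := by
        rw [abs_mul, abs_of_pos hxp, abs_div, abs_of_pos (pow_pos hxp 2)]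
        gcongr
    _ = 2 * M / x ^ 2 := by field_simp; ring

/-- The energy at the limit value splits into a positive part and a small oscillating one. -/
theorem energy_one (y y1 J : ℝ → ℝ) (x : ℝ) :
    energy y y1 J 1 x = 9 * (y x * y1 x) ^ 2 + x * (y x - 1) ^ 2 * (1 + 2 * y x)
      - 9 * (y x ^ 2 - 1) * ((J x - x) / 3) := by
  simp only [energy, cubeInt]; ring

/-- `E_1` stays at most 2. In `energy_one` the indefinite term is split as `ψ s = ψ (s + b/x) - ψ
b/x`: the first part is small by the defect bound (`9 · 2M/x² ≤ 0.18 M`), the second is absorbed by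
the kinetic term `9 b²` at the cost `(9/4) ψ²/x² ≤ 0.0225 ψ²`. -/
theorem ProfileOn.amplitude_step {T : ℝ} {y y1 J : ℝ → ℝ} (h : ProfileOn T y y1 J)
    (hT : T < 10) (hlim : Tendsto y atTop (𝓝 1)) (hE : energy y y1 J 1 10 ≤ 2) {M : ℝ}
    (hM : ∀ x, 10 ≤ x → |y x ^ 2 - 1| ≤ M) {x : ℝ} (hx : 10 ≤ x) :
    10 * (y x - 1) ^ 2 * (1 + 2 * y x) ≤
      2 + 0.0225 * (y x ^ 2 - 1) ^ 2 + 0.18 * M * |y x ^ 2 - 1| := by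
  have h1 := h.abs_defect_add_le hT (by norm_num) hlim hM hx
  have h2 := h.energy_antitone zero_le_one hT hx
  have hy := h.pos x (hT.trans_le hx)
  rw [energy_one] at h2
  set s := (J x - x) / 3
  set b := y x * y1 x
  set ψ := y x ^ 2 - 1
  have hx0 : 0 < x := by linarith
  have hM0 : 0 ≤ M := (abs_nonneg _).trans (hM x hx)
  have e1 : 2 * M / x ^ 2 ≤ 0.02 * M := by
    have := mul_le_mul hx hx (by norm_num) hx0.le
    rw [div_le_iff₀ (by positivity)]; nlinarith
  have e2 : 9 * ψ * (s + b / x) ≤ 0.18 * M * |ψ| := by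
    have : ψ * (s + b / x) ≤ |ψ| * (0.02 * M) := by
      calc ψ * (s + b / x) ≤ |ψ * (s + b / x)| := le_abs_self _
        _ = |ψ| * |s + b / x| := abs_mul _ _
        _ ≤ _ := by gcongr; exact h1.trans e1
    linarith
  have e3 : -(9 * ψ * (b / x)) ≤ 9 * b ^ 2 + 0.0225 * ψ ^ 2 := by
    have h5 : (ψ / x) ^ 2 ≤ 0.01 * ψ ^ 2 := by
      have := mul_le_mul hx hx (by norm_num) hx0.le
      rw [div_pow, div_le_iff₀ (by positivity)]; nlinarith [sq_nonneg ψ]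
    have : ψ * (b / x) = (ψ / x) * b := by ring
    nlinarith [sq_nonneg (b + ψ / x / 2)]
  have e4 : 10 * (y x - 1) ^ 2 * (1 + 2 * y x) ≤ x * (y x - 1) ^ 2 * (1 + 2 * y x) := by
    gcongr
  linarith

/-- `amplitude_step` is used twice: `y ≤ 4` allows `M = 15`, which yields `|y² - 1| ≤ 1`, and `M =
1` then yields the final range. -/
theorem ProfileOn.amplitude_le {T : ℝ} {y y1 J : ℝ → ℝ} (h : ProfileOn T y y1 J)
    (hT : T < 10) (hlim : Tendsto y atTop (𝓝 1)) (hE : energy y y1 J 1 10 ≤ 2)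
    (hy4 : ∀ x, 10 ≤ x → y x ≤ 4) {x : ℝ} (hx : 10 ≤ x) :
    0.7 ≤ y x ∧ y x ≤ 1.25 := by
  have hM15 : ∀ x, 10 ≤ x → |y x ^ 2 - 1| ≤ 15 := fun x hx => by
    have := h.pos x (hT.trans_le hx)
    have := hy4 x hx
    rw [abs_le]; constructor <;> nlinarith
  have hM1 : ∀ x, 10 ≤ x → |y x ^ 2 - 1| ≤ 1 := fun x hx => by
    have hp := h.pos x (hT.trans_le hx)
    have h4 := hy4 x hx
    have hs := h.amplitude_step hT hlim hE hM15 hx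
    rw [abs_le]
    refine ⟨by nlinarith, ?_⟩
    by_contra hc
    push Not at hc
    have h14 : 1.41 < y x := by nlinarith
    rw [abs_of_pos (by linarith)] at hs
    obtain ⟨d, hd⟩ : ∃ d, y x = 1.41 + d := ⟨y x - 1.41, by ring⟩
    have hd0 : 0 < d := by linarith
    have hd1 : d ≤ 2.59 := by linarith
    rw [hd] at hs
    nlinarith [mul_pos hd0 hd0, mul_pos hd0 (mul_pos hd0 hd0),
      mul_nonneg (mul_pos hd0 (mul_pos hd0 hd0)).le (sub_nonneg.2 hd1)]
  have hp := h.pos x (hT.trans_le hx)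
  have hs := h.amplitude_step hT hlim hE hM1 hx
  have h2 : y x ≤ 1.42 := by nlinarith [(abs_le.1 (hM1 x hx)).2]
  constructor
  · by_contra hc
    push Not at hc
    rw [abs_of_neg (by nlinarith)] at hs
    obtain ⟨d, hd⟩ : ∃ d, y x = 0.7 - d := ⟨0.7 - y x, by ring⟩
    have hd0 : 0 < d := by linarith
    have hd1 : d ≤ 0.7 := by linarith
    rw [hd] at hs
    nlinarith [mul_pos hd0 hd0, mul_pos hd0 (mul_pos hd0 hd0),
      mul_nonneg (mul_pos hd0 (mul_pos hd0 hd0)).le (sub_nonneg.2 hd1),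
      mul_nonneg hd0.le (sub_nonneg.2 hd1), mul_nonneg (mul_pos hd0 hd0).le (sub_nonneg.2 hd1)]
  · by_contra hc
    push Not at hc
    rw [abs_of_pos (by nlinarith)] at hs
    obtain ⟨d, hd⟩ : ∃ d, y x = 1.25 + d := ⟨y x - 1.25, by ring⟩
    have hd0 : 0 < d := by linarith
    have hd1 : d ≤ 0.17 := by linarith
    rw [hd] at hs
    nlinarith [mul_pos hd0 hd0, mul_pos hd0 (mul_pos hd0 hd0),
      mul_nonneg (mul_pos hd0 (mul_pos hd0 hd0)).le (sub_nonneg.2 hd1)]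

/-- The oscillation amplitude of a profile. -/
def profileOsc (y y1 : ℝ → ℝ) (x : ℝ) : ℝ :=
  9 * (y x * y1 x) ^ 2 + x * (y x - 1) ^ 2 * (1 + 2 * y x)

theorem ProfileOn.defect_le {T : ℝ} {y y1 J : ℝ → ℝ} (h : ProfileOn T y y1 J)
    (hT : T < 10) (hlim : Tendsto y atTop (𝓝 1)) (hE : energy y y1 J 1 10 ≤ 2)
    (hy4 : ∀ x, 10 ≤ x → y x ≤ 4) {x : ℝ} (hx : 10 ≤ x) :
    |(J x - x) / 3 + y x * y1 x / x| ≤ 1.125 / x ^ 2 := by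
  -- `0.5625 = 1.25² - 1` dominates also `1 - 0.7²`; the result is `2 · 0.5625 / x²`.
  have := h.abs_defect_add_le hT (by norm_num) hlim (M := 0.5625) (fun t ht => by
    obtain ⟨h1, h2⟩ := h.amplitude_le hT hlim hE hy4 ht
    rw [abs_le]; constructor <;> nlinarith) hx
  norm_num at this ⊢
  exact this

/-- `|ψ b|` is controlled by the oscillation. -/
theorem psi_mul_flux_le {x y b W : ℝ} (hx : 10 ≤ x) (h1 : 0.7 ≤ y) (h2 : y ≤ 1.25)
    (hW : W = 9 * b ^ 2 + x * (y - 1) ^ 2 * (1 + 2 * y)) :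
    |(y ^ 2 - 1) * b| ≤ 0.201 * W / √x := by
  have hx0 : 0 < x := by linarith
  have hsx := Real.sq_sqrt hx0.le
  have hsp : 0 < √x := Real.sqrt_pos.2 hx0
  have hW0 : 0 ≤ W := by rw [hW]; positivity
  rw [le_div_iff₀ hsp]
  have hab : |(y ^ 2 - 1) * b| * √x = |(y ^ 2 - 1) * b * √x| := by
    rw [abs_mul _ (√x), abs_of_pos hsp]
  rw [hab]
  refine abs_le_of_sq_le_sq ?_ (by positivity)
  -- With `e2` (arithmetic-geometric mean) this gives the square of the claim, since `1.453 / 36 ≤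
  -- 0.201²`.
  have e1 : (y + 1) ^ 2 ≤ 1.453 * (1 + 2 * y) := by nlinarith
  have e2 : 36 * (b ^ 2 * (x * (y - 1) ^ 2 * (1 + 2 * y))) ≤ W ^ 2 := by
    rw [hW]; nlinarith [sq_nonneg (9 * b ^ 2 - x * (y - 1) ^ 2 * (1 + 2 * y))]
  have e3 : b ^ 2 * (x * (y - 1) ^ 2 * (y + 1) ^ 2) ≤
      1.453 * (b ^ 2 * (x * (y - 1) ^ 2 * (1 + 2 * y))) := by
    have : 0 ≤ b ^ 2 * (x * (y - 1) ^ 2) := by positivity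
    nlinarith
  calc ((y ^ 2 - 1) * b * √x) ^ 2 = b ^ 2 * ((√x) ^ 2 * (y - 1) ^ 2 * (y + 1) ^ 2) := by ring
    _ = b ^ 2 * (x * (y - 1) ^ 2 * (y + 1) ^ 2) := by rw [hsx]
    _ ≤ _ := by nlinarith

/-- With `v = t^(1/4)` the hypothesis reads `p ≤ √3 / v³`, so `t p³ ≤ 3√3 v³ / v⁸`. Bounding `3√3
v³` by `1.96 v⁴ + 10.4` trades the power `t^(-5/4)` for integer powers, which match
`hasDerivAt_barrier` after division by `√t`. -/
theorem mul_cube_le {t p : ℝ} (ht : 10 ≤ t) (hp : 0 ≤ p) (h : 3 * t * p ^ 2 ≤ 9 / √t) :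
    t * p ^ 3 ≤ 1.96 / t + 10.4 / t ^ 2 := by
  have ht0 : 0 < t := by linarith
  have hst : 0 < √t := Real.sqrt_pos.2 ht0
  have hsx := Real.sq_sqrt ht0.le
  obtain ⟨v, hv⟩ : ∃ v, v = √(√t) := ⟨_, rfl⟩
  have hv0 : 0 < v := by rw [hv]; exact Real.sqrt_pos.2 hst
  have hv2 : v ^ 2 = √t := by rw [hv]; exact Real.sq_sqrt hst.le
  have hv4 : v ^ 4 = t := by rw [← hsx, ← hv2]; ring
  have f2 : p ≤ 1.7321 / v ^ 3 := by
    rw [le_div_iff₀ (by positivity)]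
    refine le_of_sq_le_sq ?_ (by norm_num)
    rw [← hv2, le_div_iff₀ (by positivity), ← hv4] at h
    nlinarith
  have f3 : t * p ^ 3 ≤ v ^ 4 * (1.7321 / v ^ 3) ^ 3 := by
    rw [hv4]; gcongr
  have f4 : v ^ 4 * (1.7321 / v ^ 3) ^ 3 = 1.7321 ^ 3 * v ^ 3 / v ^ 8 := by
    field_simp
  have f5 : (1.96 : ℝ) / t + 10.4 / t ^ 2 = (1.96 * v ^ 4 + 10.4) / v ^ 8 := by
    rw [← hv4]; field_simp
  rw [f5]
  rw [f4] at f3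
  refine f3.trans ?_
  gcongr
  nlinarith [sq_nonneg (v - 2), sq_nonneg (v * (v - 2)), sq_nonneg (v ^ 2 - 4), hv0,
    mul_pos hv0 hv0]

theorem hasDerivAt_barrier (A B : ℝ) {r : ℝ} (hr0 : 0 < r) :
    HasDerivAt (fun r : ℝ => - (2 * A / √r) - 2 / 3 * B / (r * √r))
      (A / (r * √r) + B / (r ^ 2 * √r)) r := by
  have hsr : 0 < √r := Real.sqrt_pos.2 hr0
  have d0 := Real.hasDerivAt_sqrt hr0.ne'
  have d1 := ((hasDerivAt_const r (2 * A)).div d0 hsr.ne').neg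
  have d2 := (hasDerivAt_const r (2 / 3 * B)).div ((hasDerivAt_id' r).mul d0)
    (mul_pos hr0 hsr).ne'
  refine (d1.sub d2).congr_deriv ?_
  have hsx := Real.sq_sqrt hr0.le
  simp only [Pi.mul_apply]
  obtain ⟨q, hq⟩ : ∃ q, q = √r := ⟨_, rfl⟩
  rw [← hq] at hsx hsr ⊢
  rw [← hsx]
  field_simp
  ring

set_option maxHeartbeats 1000000 in
-- The frequency of the oscillation around 1 grows like `√x`, and its energy decays like `1/√x`. The
-- bound is proved by bootstrap: `√x W ≤ 9` up to a point makes the derivative of the corrected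
-- quantity `Z` integrable with a small integral, and then `√x W < 8.8` there.
theorem ProfileOn.osc_le {T : ℝ} {y y1 J : ℝ → ℝ} (h : ProfileOn T y y1 J)
    (hT : T < 10) (hlim : Tendsto y atTop (𝓝 1)) (hE : energy y y1 J 1 10 ≤ 2)
    (hy4 : ∀ x, 10 ≤ x → y x ≤ 4) {x : ℝ} (hx : 10 ≤ x) :
    profileOsc y y1 x ≤ 9 / √x := by
  set s : ℝ → ℝ := fun x => (J x - x) / 3 with hs
  set b : ℝ → ℝ := fun x => y x * y1 x with hb
  set ψ : ℝ → ℝ := fun x => y x ^ 2 - 1 with hψ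
  set W : ℝ → ℝ := profileOsc y y1 with hW
  -- To leading order `√x E_1` changes at the rate `(9 b² - 3 x (y - 1)²)/(2√x)`, kinetic minus
  -- potential energy. This averages out: it is the leading part of the derivative of `(9/4) ψ b /
  -- √x`, which is therefore subtracted.
  set Z : ℝ → ℝ := fun x => √x * energy y y1 J 1 x - 9 / 4 * (ψ x * b x) / √x with hZ
  have hrange : ∀ t, 10 ≤ t → 0.7 ≤ y t ∧ y t ≤ 1.25 := fun t ht =>
    h.amplitude_le hT hlim hE hy4 ht
  have hρ : ∀ t, 10 ≤ t → |s t + b t / t| ≤ 1.125 / t ^ 2 := fun t ht =>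
    h.defect_le hT hlim hE hy4 ht
  have hψb : ∀ t, 10 ≤ t → |ψ t * b t| ≤ 0.201 * W t / √t := fun t ht =>
    psi_mul_flux_le ht (hrange t ht).1 (hrange t ht).2 rfl
  have hψ1 : ∀ t, 10 ≤ t → |ψ t| ≤ 0.5625 := fun t ht => by
    obtain ⟨h1, h2⟩ := hrange t ht
    simp only [hψ]
    rw [abs_le]; constructor <;> nlinarith
  have hW0 : ∀ t, 10 ≤ t → 0 ≤ W t := fun t ht => by
    have := (hrange t ht).1
    simp only [hW, profileOsc]; positivity
  have hψρ : ∀ t, 10 ≤ t → |ψ t * (s t + b t / t)| ≤ 0.633 / t ^ 2 := fun t ht => by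
    rw [abs_mul]
    have : 0 < t := by linarith
    calc _ ≤ 0.5625 * (1.125 / t ^ 2) := by gcongr; exacts [hψ1 t ht, hρ t ht]
      _ = 0.6328125 / t ^ 2 := by ring
      _ ≤ _ := by gcongr; norm_num
  have hEW : ∀ t, 10 ≤ t → energy y y1 J 1 t = W t + 9 * (ψ t * b t) / t
      - 9 * (ψ t * (s t + b t / t)) := fun t ht => by
    rw [energy_one]; simp only [hW, profileOsc, hψ, hs, hb]; ring
  have hs10 : (3.162:ℝ) ≤ √10 ∧ √10 ≤ (3.1623:ℝ) :=
    ⟨Real.le_sqrt_of_sq_le (by norm_num), Real.sqrt_le_iff.2 ⟨by norm_num, by norm_num⟩⟩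
  have hsq : ∀ t, 10 ≤ t → 3.162 ≤ √t := fun t ht => hs10.1.trans (Real.sqrt_le_sqrt ht)
  -- initial value
  have hZ10 : Z 10 ≤ 6.45 := by
    have e0 := hEW 10 le_rfl
    have e1 := abs_le.1 (hψb 10 le_rfl)
    have e2 := abs_le.1 (hψρ 10 le_rfl)
    have e3 := hW0 10 le_rfl
    have e4 : 0.201 * W 10 / √10 ≤ 0.0636 * W 10 := by
      rw [div_le_iff₀ (by linarith)]; nlinarith
    have e5 : W 10 ≤ 2.2 := by norm_num at e2; linarith
    have e6 : -(9 / 4 * (ψ 10 * b 10) / √10) ≤ 0.1 := by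
      rw [neg_le, le_div_iff₀ (by linarith)]
      nlinarith
    have e7 : √10 * energy y y1 J 1 10 ≤ 6.33 := by nlinarith
    simp only [hZ]; linarith
  -- derivative
  set Z' : ℝ → ℝ := fun t => (1 / √t) * (3 / 4 * t * (y t - 1) ^ 3 - 27 / 4 * (ψ t * s t)
    + 9 / 8 * (ψ t * b t) / t) with hZ'
  have hZd : ∀ t, 10 ≤ t → HasDerivAt Z (Z' t) t := by
    intro t ht
    have ht0 : 0 < t := by linarith
    have htT : T < t := by linarith
    have hst : 0 < √t := Real.sqrt_pos.2 ht0
    have d0 := Real.hasDerivAt_sqrt ht0.ne'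
    have d1 := d0.mul (h.denergy 1 htT)
    have d2 := (((((h.dy t htT).pow 2).sub_const 1).mul (h.dflux htT)).const_mul (9 / 4)).div d0
      hst.ne'
    refine (d1.sub d2).congr_deriv ?_
    simp only [hZ', hψ, hb, hs, Pi.pow_apply, energy_one, Pi.mul_apply]
    push_cast
    have hsx := Real.sq_sqrt ht0.le
    obtain ⟨r, hr⟩ : ∃ r, r = √t := ⟨_, rfl⟩
    rw [← hr] at hsx hst ⊢
    rw [← hsx]
    field_simp
    ring
  -- bound of the derivative while the oscillation is under control
  have hZ'le : ∀ t, 10 ≤ t → √t * W t ≤ 9 → Z' t ≤ 1.47 / (t * √t) + 26.5 / (t ^ 2 * √t) := by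
    intro t ht hc
    have ht0 : 0 < t := by linarith
    have hst : 0 < √t := Real.sqrt_pos.2 ht0
    have hsx := Real.sq_sqrt ht0.le
    obtain ⟨h1, h2⟩ := hrange t ht
    have e1 := abs_le.1 (hψb t ht)
    have e2 := abs_le.1 (hψρ t ht)
    have eW : W t ≤ 9 / √t := by rw [le_div_iff₀ hst]; linarith
    have e3 : 0.201 * W t / √t ≤ 1.809 / t := by
      calc 0.201 * W t / √t ≤ 0.201 * (9 / √t) / √t := by gcongr
        _ = 1.809 / (√t) ^ 2 := by field_simp; norm_num
        _ = _ := by rw [hsx]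
    have e4 : t * (y t - 1) ^ 3 ≤ 1.96 / t + 10.4 / t ^ 2 := by
      rcases le_or_gt (y t) 1 with hy1 | hy1
      · have : t * (y t - 1) ^ 3 ≤ 0 := by
          have : (y t - 1) ^ 3 ≤ 0 := Odd.pow_nonpos (by decide) (by linarith)
          exact mul_nonpos_of_nonneg_of_nonpos ht0.le this
        have : 0 ≤ 1.96 / t + 10.4 / t ^ 2 := by positivity
        linarith
      · have f1 : 3 * t * (y t - 1) ^ 2 ≤ 9 / √t := by
          have : 3 * t * (y t - 1) ^ 2 ≤ W t := by
            simp only [hW, profileOsc]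
            have : t * (y t - 1) ^ 2 * 3 ≤ t * (y t - 1) ^ 2 * (1 + 2 * y t) := by
              gcongr; linarith
            nlinarith [sq_nonneg (y t * y1 t)]
          exact this.trans eW
        exact mul_cube_le ht (by linarith) f1
    have e5 : -(27 / 4 * (ψ t * s t)) + 9 / 8 * (ψ t * b t) / t =
        63 / 8 * (ψ t * b t) / t - 27 / 4 * (ψ t * (s t + b t / t)) := by ring
    have e6 : 63 / 8 * (ψ t * b t) / t ≤ 14.3 / t ^ 2 := by
      rw [div_le_div_iff₀ ht0 (by positivity)]
      have : ψ t * b t ≤ 1.809 / t := e1.2.trans e3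
      rw [le_div_iff₀ ht0] at this
      nlinarith
    have e7 : 3 / 4 * t * (y t - 1) ^ 3 - 27 / 4 * (ψ t * s t) + 9 / 8 * (ψ t * b t) / t ≤
        1.47 / t + 26.5 / t ^ 2 := by
      have : (1.47:ℝ) / t = 3 / 4 * (1.96 / t) := by ring
      have : (26.5:ℝ) / t ^ 2 = 3 / 4 * (10.4 / t ^ 2) + 14.3 / t ^ 2 + 4.4 / t ^ 2 := by ring
      have : (4.4:ℝ) / t ^ 2 ≥ 27 / 4 * (0.633 / t ^ 2) := by
        rw [ge_iff_le, ← mul_div_assoc]; gcongr; norm_num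
      linarith
    calc Z' t ≤ (1 / √t) * (1.47 / t + 26.5 / t ^ 2) :=
          mul_le_mul_of_nonneg_left e7 (by positivity)
      _ = _ := by rw [mul_add, div_mul_div_comm, div_mul_div_comm, one_mul, one_mul, mul_comm t,
                    mul_comm (t ^ 2)]
  -- bootstrap
  have hZcont : ContinuousOn Z (Set.Ici 10) := fun t ht =>
    (hZd t ht).continuousAt.continuousWithinAt
  have hWcont : ContinuousOn W (Set.Ici 10) := fun t ht => by
    have htT : T < t := lt_of_lt_of_le hT ht
    have c1 := (h.dy t htT).continuousAt
    have c2 := (h.dy1 t htT).continuousAt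
    refine ContinuousAt.continuousWithinAt ?_
    simp only [hW]; unfold profileOsc; fun_prop
  have key : ∀ t, 10 ≤ t → (∀ r ∈ Set.Ioo 10 t, √r * W r ≤ 9) → √t * W t < 8.8 := by
    intro t ht hr
    have ht0 : 0 < t := by linarith
    have hst : 0 < √t := Real.sqrt_pos.2 ht0
    have hsx := Real.sq_sqrt ht0.le
    -- The initial value `6.45` plus at most `0.93 + 0.56` from the barrier. Undoing the correction
    -- below costs a factor `1/(1 - 0.0432)` and an addend `0.1803`.
    have hZt : Z t ≤ 7.95 := by
      have := sub_le_sub_of_hasDerivAt ht (hZcont.mono Set.Icc_subset_Ici_self)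
        (fun r hr => (hasDerivAt_barrier 1.47 26.5
          (by linarith [hr.1])).continuousAt.continuousWithinAt)
        (fun r hr => hZd r hr.1.le) (fun r hr => hasDerivAt_barrier 1.47 26.5
          (by linarith [hr.1]))
        (fun r hr' => hZ'le r hr'.1.le (hr r hr'))
      have e1 : 0 ≤ 2 * 1.47 / √t := by positivity
      have e2 : 0 ≤ 2 / 3 * 26.5 / (t * √t) := by positivity
      have e3 : (2 * 1.47:ℝ) / √10 ≤ 0.93 := by rw [div_le_iff₀ (by linarith)]; linarith
      have e4 : (2 / 3 * 26.5:ℝ) / (10 * √10) ≤ 0.56 := by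
        rw [div_le_iff₀ (by linarith)]; linarith
      linarith
    have e1 := abs_le.1 (hψb t ht)
    have e2 := abs_le.1 (hψρ t ht)
    have e3 : √t * W t = Z t - 27 / 4 * (ψ t * b t) / √t + 9 * √t * (ψ t * (s t + b t / t)) := by
      simp only [hZ]
      rw [hEW t ht]
      obtain ⟨r, hr⟩ : ∃ r, r = √t := ⟨_, rfl⟩
      rw [← hr] at hsx hst ⊢
      rw [← hsx]
      field_simp
      ring
    have e4 : -(27 / 4 * (ψ t * b t) / √t) ≤ 0.0432 * (√t * W t) := by
      rw [neg_le, le_div_iff₀ hst]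
      have : -(0.201 * W t / √t) * √t = -(0.201 * W t) := by field_simp
      have h31 := hsq t ht
      have h32 : (31.6:ℝ) ≤ √t ^ 3 := by
        calc (31.6:ℝ) ≤ 3.162 ^ 3 := by norm_num
          _ ≤ _ := by gcongr
      have h33 := hW0 t ht
      have h34 : -(ψ t * b t) ≤ 0.201 * W t / √t := by linarith [e1.1]
      have h35 : 0.201 * W t / √t ≤ 0.0064 * W t * √t ^ 2 := by
        rw [div_le_iff₀ hst]; nlinarith
      nlinarith
    have e5 : 9 * √t * (ψ t * (s t + b t / t)) ≤ 0.1803 := by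
      have h31 := hsq t ht
      have : 9 * √t * (0.633 / t ^ 2) ≤ 0.1803 := by
        have h32 : (31.6:ℝ) ≤ √t ^ 3 := by
          calc (31.6:ℝ) ≤ 3.162 ^ 3 := by norm_num
            _ ≤ _ := by gcongr
        rw [← mul_div_assoc, div_le_iff₀ (by positivity)]
        obtain ⟨r, hr⟩ : ∃ r, r = √t := ⟨_, rfl⟩
        rw [← hr] at hsx hst h32 ⊢
        rw [← hsx]
        nlinarith [mul_le_mul_of_nonneg_left h32 hst.le]
      refine le_trans ?_ this
      gcongr
      exact e2.2
    nlinarith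
  have hfin := forall_pos_of_bootstrap (h := fun r => 9 - √r * W r) (a := 10) (b := x + 1)
    (by
      have := hWcont.mono (fun r hr => hr.1 : Set.Icc 10 (x + 1) ⊆ Set.Ici 10)
      fun_prop)
    (by
      have h0 : √10 * W 10 < 8.8 := key 10 le_rfl (by simp)
      have hc : ContinuousWithinAt (fun r => 9 - √r * W r) (Set.Ici 10) 10 := by
        have := hWcont 10 (Set.mem_Ici.2 le_rfl)
        fun_prop
      have : ∀ᶠ r in 𝓝[≥] (10:ℝ), 0 < 9 - √r * W r :=
        hc.eventually_const_lt (by linarith)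
      exact this.filter_mono (nhdsWithin_mono _ Set.Ioi_subset_Ici_self))
    (fun t ht hr => by
      have := key t ht.1.le (fun r hr' => by have := hr r hr'; linarith)
      linarith)
  have hst : 0 < √x := Real.sqrt_pos.2 (by linarith)
  rw [le_div_iff₀ hst]
  have := key x hx (fun r hr => by
    have := hfin r ⟨hr.1, by linarith [hr.2]⟩
    linarith)
  linarith

/-! ### Pairs of profiles -/

/-- `(y² - v²)'`. -/
noncomputable def fluxGap (y y1 v v1 : ℝ → ℝ) (x : ℝ) : ℝ := 2 * (y x * y1 x - v x * v1 x)

/-- The difference of the running means. -/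
noncomputable def meanGap (J K : ℝ → ℝ) (x : ℝ) : ℝ := (J x - K x) / x

/-- The corrected difference of the running means, which varies slowly. -/
noncomputable def slowGap (y y1 J v v1 K : ℝ → ℝ) (x : ℝ) : ℝ :=
  meanGap J K x + 3 / 2 * fluxGap y y1 v v1 x / x ^ 2 + 3 * (y x ^ 2 - v x ^ 2) / x ^ 3

section pair
variable {T : ℝ} {y y1 J v v1 K : ℝ → ℝ}

theorem hasDerivAt_sqGap (hy : ProfileOn T y y1 J) (hv : ProfileOn T v v1 K) {x : ℝ} (hx : T < x) :
    HasDerivAt (fun x => y x ^ 2 - v x ^ 2) (fluxGap y y1 v v1 x) x := by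
  refine (((hy.dy x hx).pow 2).sub ((hv.dy x hx).pow 2)).congr_deriv ?_
  simp only [fluxGap]; push_cast; ring

theorem hasDerivAt_fluxGap (hy : ProfileOn T y y1 J) (hv : ProfileOn T v v1 K) {x : ℝ}
    (hx : T < x) (hx0 : x ≠ 0) :
    HasDerivAt (fluxGap y y1 v v1) (2 * x / 3 * (meanGap J K x - (y x - v x))) x := by
  refine (((hy.dflux hx).sub (hv.dflux hx)).const_mul 2).congr_deriv ?_
  simp only [meanGap]; field_simp; ring

theorem hasDerivAt_meanGap (hy : ProfileOn T y y1 J) (hv : ProfileOn T v v1 K) {x : ℝ}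
    (hx : T < x) (hx0 : x ≠ 0) :
    HasDerivAt (meanGap J K) ((y x - v x - meanGap J K x) / x) x := by
  refine (((hy.dJ x hx).sub (hv.dJ x hx)).div (hasDerivAt_id' x) hx0).congr_deriv ?_
  simp only [meanGap, Pi.sub_apply]; field_simp

/-- With `N` the mean gap, `P` the flux gap and `D = y - v`, `N' = (D - N)/x` is cancelled by the
leading part of `((3/2) P/x²)'`, since `P' = (2x/3)(N - D)`. The leftover `-3 P/x³` is cancelled by
the `3 (y² - v²)/x³` correction. -/
theorem hasDerivAt_slowGap (hy : ProfileOn T y y1 J) (hv : ProfileOn T v v1 K) {x : ℝ}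
    (hx : T < x) (hx0 : x ≠ 0) :
    HasDerivAt (slowGap y y1 J v v1 K) (-9 * (y x ^ 2 - v x ^ 2) / x ^ 4) x := by
  have d1 := hasDerivAt_meanGap hy hv hx hx0
  have d2 := ((hasDerivAt_fluxGap hy hv hx hx0).const_mul (3 / 2)).div (hasDerivAt_pow 2 x)
    (pow_ne_zero 2 hx0)
  have d3 := ((hasDerivAt_sqGap hy hv hx).const_mul 3).div (hasDerivAt_pow 3 x)
    (pow_ne_zero 3 hx0)
  refine ((d1.add d2).add d3).congr_deriv ?_
  push_cast
  field_simp
  ring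

/-- The weight of the modulated energy. -/
noncomputable def weight (y v : ℝ → ℝ) (x : ℝ) : ℝ := (y x ^ 2 + v x ^ 2 + 4) / 6
noncomputable def weight1 (y y1 v v1 : ℝ → ℝ) (x : ℝ) : ℝ := (y x * y1 x + v x * v1 x) / 3
noncomputable def weight2 (y J v K : ℝ → ℝ) (x : ℝ) : ℝ := ((J x - x * y x) / 3 + (K x - x * v x) / 3) / 3

/-- The modulated energy of the difference of two profiles. -/
noncomputable def gapEnergy (y y1 J v v1 K : ℝ → ℝ) (x : ℝ) : ℝ :=
  1 / 2 * weight y v x * fluxGap y y1 v v1 x ^ 2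
  - 1 / 2 * weight1 y y1 v v1 x * (y x ^ 2 - v x ^ 2) * fluxGap y y1 v v1 x
  + 1 / 4 * weight2 y J v K x * (y x ^ 2 - v x ^ 2) ^ 2
  + x / 3 * weight y v x * (y x ^ 2 - v x ^ 2) * (y x - v x - 2 * meanGap J K x)

/-- The coefficient of `(y - v)²` in the derivative of the modulated energy. -/
noncomputable def gapRate (x y y1 v v1 : ℝ) : ℝ :=
  x * (y1 + v1) * ((y + v) ^ 2 - 4 - (y - v) ^ 2 / 2) / 18 + x * (y + v) / 9 * (y - v) * (y1 - v1)
    - (y ^ 2 + v ^ 2 + 4) / 6 * (y + v) / 3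

/-- The multipliers are a weight `u` and its derivatives `u', u''`; in this combination all terms
with the flux gap cancel. For `u = (y² + v² + 4)/6` the coefficient of `y' + v'` in `gapRate`
vanishes at `y = v = 1`, so each `y'` or `v'` comes with a factor that is small near the limit. -/
theorem hasDerivAt_gapEnergy (hy : ProfileOn T y y1 J) (hv : ProfileOn T v v1 K) {x : ℝ}
    (hx : T < x) (hx0 : x ≠ 0) :
    HasDerivAt (gapEnergy y y1 J v v1 K) (gapRate x (y x) (y1 x) (v x) (v1 x) * (y x - v x) ^ 2
      - x * weight1 y y1 v v1 x * (y x ^ 2 - v x ^ 2) * meanGap J K x) x := by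
  have du : HasDerivAt (weight y v) (weight1 y y1 v v1 x) x := by
    refine (((((hy.dy x hx).pow 2).add ((hv.dy x hx).pow 2)).add_const 4).div_const 6).congr_deriv ?_
    simp only [weight1]; push_cast; ring
  have du1 : HasDerivAt (weight1 y y1 v v1) (weight2 y J v K x) x :=
    ((hy.dflux hx).add (hv.dflux hx)).div_const 3
  have du2 : HasDerivAt (weight2 y J v K) (-(x / 9) * (y1 x + v1 x)) x := by
    refine (((hy.dforce hx).add (hv.dforce hx)).div_const 3).congr_deriv ?_
    ring
  have dP := hasDerivAt_fluxGap hy hv hx hx0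
  have dB := hasDerivAt_sqGap hy hv hx
  have dN := hasDerivAt_meanGap hy hv hx hx0
  have t1 := (du.const_mul (1 / 2)).mul (dP.pow 2)
  have t2 := ((du1.const_mul (1 / 2)).mul dB).mul dP
  have t3 := (du2.const_mul (1 / 4)).mul (dB.pow 2)
  have t4 := ((((hasDerivAt_id' x).div_const 3).mul du).mul dB).mul
    (((hy.dy x hx).sub (hv.dy x hx)).sub (dN.const_mul 2))
  refine (((t1.sub t2).add t3).add t4).congr_deriv ?_
  simp only [gapRate, weight, weight1, fluxGap, Pi.pow_apply, Pi.mul_apply, Pi.sub_apply]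
  push_cast
  field_simp
  ring

end pair

/-! ### Algebraic estimates in the asymptotic regime -/

/-- Consequences of a bound on the oscillation. -/
theorem osc_consequences {x y y1 v : ℝ} (hx : 10 ≤ x) (hy : 0.7 ≤ y) (hv : 0.7 ≤ v)
    {Wv : ℝ} (hW : 9 * (y * y1) ^ 2 + x * (y - 1) ^ 2 * (1 + 2 * y) ≤ 9 / √x)
    (hWv : Wv + x * (v - 1) ^ 2 * (1 + 2 * v) ≤ 9 / √x) (hWv0 : 0 ≤ Wv) :
    |x * (y - 1) * y1| ≤ 1.3834 ∧ |x * (v - 1) * y1| ≤ 2.7667 ∧ |y * y1| ≤ 0.5625 := by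
  have hx0 : 0 < x := by linarith
  have hst : 0 < √x := Real.sqrt_pos.2 hx0
  have hsx := Real.sq_sqrt hx0.le
  have h1 : (9 / √x) ^ 2 = 81 / x := by rw [div_pow, hsx]; norm_num
  set A := 9 * (y * y1) ^ 2 with hA
  set P := x * (y - 1) ^ 2 * (1 + 2 * y) with hP
  set Q := x * (v - 1) ^ 2 * (1 + 2 * v) with hQ
  have hA0 : 0 ≤ A := by positivity
  have hP0 : 0 ≤ P := by positivity
  have hQ0 : 0 ≤ Q := by positivity
  have e1 : 4 * (A * P) ≤ 81 / x := by
    rw [← h1]; nlinarith [sq_nonneg (A - P)]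
  have e2 : A * Q ≤ 81 / x := by
    rw [← h1, sq]; exact mul_le_mul (by linarith) (by linarith) hQ0 (by positivity)
  rw [le_div_iff₀ hx0] at e1 e2
  -- `10.584 = 9 · 0.7² · (1 + 2 · 0.7)`. Combined with `e1` and `e2` it gives `81/(4 · 10.584) ≤
  -- 1.3834²` and `81/10.584 ≤ 2.7667²`.
  have low : ∀ w : ℝ, 0.7 ≤ w → 10.584 * (x * (w - 1) * y1) ^ 2 ≤
      A * (x * (w - 1) ^ 2 * (1 + 2 * w)) * x := by
    intro w hw
    have e3 : A * (x * (w - 1) ^ 2 * (1 + 2 * w)) * x =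
      (9 * y ^ 2 * (1 + 2 * w)) * (x * (w - 1) * y1) ^ 2 := by rw [hA]; ring
    rw [e3]
    refine mul_le_mul_of_nonneg_right ?_ (sq_nonneg _)
    have : 0.49 ≤ y ^ 2 := by nlinarith
    nlinarith
  refine ⟨abs_le_of_sq_le_sq ?_ (by norm_num), abs_le_of_sq_le_sq ?_ (by norm_num),
    abs_le_of_sq_le_sq ?_ (by norm_num)⟩
  · have := low y hy; linarith
  · have := low v hv; linarith
  · have h3 : (3.162:ℝ) ≤ √x := (Real.le_sqrt_of_sq_le (by norm_num)).trans (Real.sqrt_le_sqrt hx)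
    have h4 : 9 / √x ≤ 2.847 := by rw [div_le_iff₀ hst]; linarith
    linarith

/-- Expanding around `y = v = 1` writes the first two terms of the rate through the four products `x
(y - 1) y'`, `x (v - 1) y'` and their mirror images, which stay bounded although `x` grows; `1.6219`
bounds `(4/9) · 2 · 1.8246`. -/
theorem gapRate_le {x y y1 v v1 : ℝ} (hy : 0.7 ≤ y) (hv : 0.7 ≤ v)
    (hy2 : y ≤ 1.25) (hv2 : v ≤ 1.25)
    (h1 : |x * (y - 1) * y1| ≤ 1.3834) (h2 : |x * (v - 1) * y1| ≤ 2.7667)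
    (h3 : |x * (v - 1) * v1| ≤ 1.3834) (h4 : |x * (y - 1) * v1| ≤ 2.7667) :
    gapRate x y y1 v v1 ≤ 1.6219 - (y ^ 2 + v ^ 2 + 4) / 6 * (y + v) / 3 := by
  have main : ∀ p q a b : ℝ, |p| ≤ 0.3 → |q| ≤ 0.3 → |a| ≤ 1.3834 → |b| ≤ 2.7667 →
      a * (1 + (2.5 * p + 3 * q) / 8) - 1.5 * q * b / 8 ≤ 1.8246 := by
    intro p q a b hp hq ha hb
    have e1 : a * (1 + (2.5 * p + 3 * q) / 8) ≤ 1.3834 * 1.20625 := by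
      have : 0 ≤ 1 + (2.5 * p + 3 * q) / 8 := by linarith [(abs_le.1 hp).1, (abs_le.1 hq).1]
      refine mul_le_mul (abs_le.1 ha).2 ?_ this (by norm_num)
      linarith [(abs_le.1 hp).2, (abs_le.1 hq).2]
    have e2 : -(q * b) ≤ 0.3 * 2.7667 := by
      have : |q * b| ≤ 0.3 * 2.7667 := by rw [abs_mul]; gcongr
      linarith [(abs_le.1 this).1]
    linarith
  have hp : |y - 1| ≤ 0.3 := by rw [abs_le]; constructor <;> linarith
  have hq : |v - 1| ≤ 0.3 := by rw [abs_le]; constructor <;> linarith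
  have m1 := main _ _ _ _ hp hq h1 h2
  have m2 := main _ _ _ _ hq hp h3 h4
  have : gapRate x y y1 v v1 = 4 / 9 *
     ((x * (y - 1) * y1 * (1 + (2.5 * (y - 1) + 3 * (v - 1)) / 8)
        - 1.5 * (v - 1) * (x * (v - 1) * y1) / 8)
      + (x * (v - 1) * v1 * (1 + (2.5 * (v - 1) + 3 * (y - 1)) / 8)
        - 1.5 * (y - 1) * (x * (y - 1) * v1) / 8)) - (y ^ 2 + v ^ 2 + 4) / 6 * (y + v) / 3 := by
    simp only [gapRate]; ring
  rw [this]
  linarith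

/-- Elimination of a cross term. -/
theorem cross_le {A B C p q : ℝ} (hA : 0 < A) (h : C ^ 2 ≤ 4 * A * B) :
    0 ≤ A * p ^ 2 + C * (p * q) + B * q ^ 2 := by
  have h1 : 0 ≤ (A * p + C / 2 * q) ^ 2 := sq_nonneg _
  have h2 : 0 ≤ (4 * A * B - C ^ 2) * q ^ 2 := mul_nonneg (by linarith) (sq_nonneg _)
  have : A * (A * p ^ 2 + C * (p * q) + B * q ^ 2) =
    (A * p + C / 2 * q) ^ 2 + (4 * A * B - C ^ 2) * q ^ 2 / 4 := by ring
  have h3 : 0 ≤ A * (A * p ^ 2 + C * (p * q) + B * q ^ 2) := by rw [this]; positivity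
  exact nonneg_of_mul_nonneg_right h3 hA

set_option maxHeartbeats 1000000 in
/-- The differential inequality for the modulated energy, as an inequality between reals:
`S = y + v`, `D = y - v`, `P` the flux gap, `n` the slow gap, `u, u', u''` the weight. -/
theorem gap_quadratic_nonneg {x S D P n u u1 u2 Br : ℝ} (hx : 10 ≤ x) (hS : 1.4 ≤ S)
    (hu : (S ^ 2 + 8) / 12 ≤ u) (hu' : u ≤ 1.21) (hu1 : |u1| ≤ 0.375)
    (hu2 : |u2 + x * (S - 2) / 9| ≤ 0.0451) (hBr : Br ≤ 1.6219 - u * S / 3) :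
    0 ≤ 2 * u * P ^ 2 - 2 * u1 * (S * D) * P + u2 * (S * D) ^ 2
      + 4 * x / 3 * u * (S * D) * (D - 2 * (n - 3 / 2 * P / x ^ 2 - 3 * (S * D) / x ^ 3))
      - x * (Br * D ^ 2 - x * u1 * (S * D) * (n - 3 / 2 * P / x ^ 2 - 3 * (S * D) / x ^ 3))
      + 0.8 * x ^ 3 * n ^ 2 := by
  have hx0 : 0 < x := by linarith
  obtain ⟨ξ, hξ⟩ : ∃ ξ, ξ = 1 / x := ⟨_, rfl⟩
  have hξ0 : 0 < ξ := by rw [hξ]; positivity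
  have hξ1 : ξ ≤ 0.1 := by rw [hξ, div_le_iff₀ hx0]; linarith
  have hu0 : 0.83 ≤ u := by
    linarith [mul_le_mul hS hS (by norm_num) (by linarith : 0 ≤ S)]
  -- expanded form
  have hexp : 2 * u * P ^ 2 - 2 * u1 * (S * D) * P + u2 * (S * D) ^ 2
      + 4 * x / 3 * u * (S * D) * (D - 2 * (n - 3 / 2 * P / x ^ 2 - 3 * (S * D) / x ^ 3))
      - x * (Br * D ^ 2 - x * u1 * (S * D) * (n - 3 / 2 * P / x ^ 2 - 3 * (S * D) / x ^ 3))
      + 0.8 * x ^ 3 * n ^ 2 =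
      (2 * u * P ^ 2 + S * (4 * u * ξ - 3.5 * u1) * (P * D) + 0.49 * S ^ 2 * D ^ 2)
      + D ^ 2 * (u2 * S ^ 2 + 4 * x / 3 * u * S - x * Br + 8 * u * S ^ 2 * ξ ^ 2
          - 3 * u1 * S ^ 2 * ξ - 0.49 * S ^ 2
          - x * (S ^ 3 / 36 + 0.1566 * S ^ 2 + 1.1111 * S - 1.6219))
      + x * ((S ^ 3 / 36 + 0.1566 * S ^ 2 + 1.1111 * S - 1.6219) * D ^ 2
          + S * (u1 - 8 / 3 * u * ξ) * (D * (x * n)) + 0.8 * (x * n) ^ 2) := by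
    rw [hξ]; field_simp; ring
  rw [hexp]
  obtain ⟨ha, hb⟩ := abs_le.1 hu1
  -- The coefficient of `D²` is shared out: `0.49 S²` absorbs the cross term with `P` here, `x`
  -- times a cubic in `S` absorbs the cross term with `n` in `c2`, and `c3` checks that both shares
  -- are covered. Inserting the bounds for `u`, `u2` and `Br`, the part proportional to `x` is
  -- `S³/36 + (2/9) S² + (10/9) S - 1.6219`; lowering `2/9` to `0.1566` pays for the terms without a
  -- factor `x`.
  have c1 : 0 ≤ 2 * u * P ^ 2 + S * (4 * u * ξ - 3.5 * u1) * (P * D) + 0.49 * S ^ 2 * D ^ 2 := by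
    have := cross_le (A := 2 * u) (B := 0.49 * S ^ 2) (C := S * (4 * u * ξ - 3.5 * u1)) (p := P)
      (q := D) (by linarith) (by
        have h1 : u * ξ ≤ 0.121 := by linarith [mul_le_mul hu' hξ1 hξ0.le (by norm_num)]
        have h1' : 0 ≤ u * ξ := by positivity
        have : (4 * u * ξ - 3.5 * u1) ^ 2 ≤ 1.797 ^ 2 := by
          apply sq_le_sq' <;> linarith
        have h3 := mul_le_mul_of_nonneg_right this (sq_nonneg S)
        have h4 := mul_le_mul_of_nonneg_right hu0 (sq_nonneg S)
        linarith [sq_nonneg S])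
    linarith
  have hpos : 0 < S ^ 3 / 36 + 0.1566 * S ^ 2 + 1.1111 * S - 1.6219 := by
    have h2 := mul_le_mul hS hS (by norm_num) (by linarith : 0 ≤ S)
    have h3 : 0 ≤ S ^ 3 := by positivity
    linarith
  have c2 : 0 ≤ x * ((S ^ 3 / 36 + 0.1566 * S ^ 2 + 1.1111 * S - 1.6219) * D ^ 2
          + S * (u1 - 8 / 3 * u * ξ) * (D * (x * n)) + 0.8 * (x * n) ^ 2) := by
    refine mul_nonneg hx0.le (cross_le hpos ?_)
    have h1 : u * ξ ≤ 0.121 := by linarith [mul_le_mul hu' hξ1 hξ0.le (by norm_num)]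
    have h1' : 0 ≤ u * ξ := by positivity
    have : (u1 - 8 / 3 * u * ξ) ^ 2 ≤ 0.6977 ^ 2 := by
      apply sq_le_sq' <;> linarith
    have h2 : 0.6977 ^ 2 * S ^ 2 ≤ 4 * (S ^ 3 / 36 + 0.1566 * S ^ 2 + 1.1111 * S - 1.6219) * 0.8 := by
      have k2 : 1.4 ^ 2 ≤ S ^ 2 := by gcongr
      have k3 : 1.4 ^ 3 ≤ S ^ 3 := by gcongr
      linarith only [hS, k2, k3]
    have h3 := mul_le_mul_of_nonneg_right this (sq_nonneg S)
    linarith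
  have c3 : 0 ≤ D ^ 2 * (u2 * S ^ 2 + 4 * x / 3 * u * S - x * Br + 8 * u * S ^ 2 * ξ ^ 2
          - 3 * u1 * S ^ 2 * ξ - 0.49 * S ^ 2
          - x * (S ^ 3 / 36 + 0.1566 * S ^ 2 + 1.1111 * S - 1.6219)) := by
    refine mul_nonneg (sq_nonneg _) ?_
    have hS0 : 0 < S ^ 2 := by positivity
    have e1 : -(x * (S - 2) / 9) * S ^ 2 - 0.0451 * S ^ 2 ≤ u2 * S ^ 2 := by
      have := mul_le_mul_of_nonneg_right (abs_le.1 hu2).1 hS0.le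
      linarith
    have e2 : x * (5 / 3 * ((S ^ 2 + 8) / 12) * S - 1.6219) ≤ 4 * x / 3 * u * S - x * Br := by
      have h1 := mul_le_mul_of_nonneg_right hu (by linarith : 0 ≤ S)
      have : 5 / 3 * ((S ^ 2 + 8) / 12) * S - 1.6219 ≤ 4 / 3 * u * S - Br := by linarith
      have := mul_le_mul_of_nonneg_left this hx0.le
      linarith
    have e3 : 3 * u1 * S ^ 2 * ξ ≤ 0.1125 * S ^ 2 := by
      have h1 : u1 * ξ ≤ 0.0375 := by
        linarith [mul_le_mul (abs_le.1 hu1).2 hξ1 hξ0.le (by norm_num)]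
      have := mul_le_mul_of_nonneg_right h1 hS0.le
      linarith
    have e4 : 0 ≤ 8 * u * S ^ 2 * ξ ^ 2 := by positivity
    have e5 : 10 * (0.15746 * S ^ 2 - 0.1566 * S ^ 2) ≤
        x * (0.15746 * S ^ 2 - 0.1566 * S ^ 2) := by
      linarith [mul_le_mul_of_nonneg_right hx hS0.le]
    have e6 : 10 * (0.06476 * S ^ 2) ≤ x * (0.06476 * S ^ 2) := by gcongr
    have e7 : 0 ≤ x * S := by positivity
    linarith
  linarith

set_option maxHeartbeats 1000000 in
/-- Coercivity of the modulated energy. -/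
theorem gap_quadratic_coercive {x S D P n u u1 u2 : ℝ} (hx : 10 ≤ x) (hS : 1.4 ≤ S)
    (hS2 : S ≤ 2.5) (hu : (S ^ 2 + 8) / 12 ≤ u) (hu' : u ≤ 1.21) (hu1 : |u1| ≤ 0.375)
    (hu2 : |u2 + x * (S - 2) / 9| ≤ 0.0451) :
    0.13 * x * (S * D) ^ 2 ≤ 1 / 2 * u * P ^ 2 - 1 / 2 * u1 * (S * D) * P
      + 1 / 4 * u2 * (S * D) ^ 2
      + x / 3 * u * (S * D) * (D - 2 * (n - 3 / 2 * P / x ^ 2 - 3 * (S * D) / x ^ 3))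
      + 0.8 * x ^ 3 * n ^ 2 := by
  have hx0 : 0 < x := by linarith
  obtain ⟨ξ, hξ⟩ : ∃ ξ, ξ = 1 / x := ⟨_, rfl⟩
  have hξ0 : 0 < ξ := by rw [hξ]; positivity
  have hξ1 : ξ ≤ 0.1 := by rw [hξ, div_le_iff₀ hx0]; linarith
  have hu0 : 0.83 ≤ u := by
    linarith [mul_le_mul hS hS (by norm_num) (by linarith : 0 ≤ S)]
  obtain ⟨ha, hb⟩ := abs_le.1 hu1
  have hexp : 1 / 2 * u * P ^ 2 - 1 / 2 * u1 * (S * D) * P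
      + 1 / 4 * u2 * (S * D) ^ 2
      + x / 3 * u * (S * D) * (D - 2 * (n - 3 / 2 * P / x ^ 2 - 3 * (S * D) / x ^ 3))
      + 0.8 * x ^ 3 * n ^ 2 =
      (1 / 2 * u * P ^ 2 + S * (u * ξ - u1 / 2) * (P * D) + 0.06 * S ^ 2 * D ^ 2)
      + (0.8 * x ^ 3 * n ^ 2 - 2 / 3 * u * x * (n * (S * D)) + 0.005 * x * (S * D) ^ 2)
      + D ^ 2 * (1 / 4 * u2 * S ^ 2 + x / 3 * u * S + 2 * u * S ^ 2 * ξ ^ 2 - 0.06 * S ^ 2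
          - 0.005 * x * S ^ 2) := by
    rw [hξ]; field_simp; ring
  rw [hexp]
  have c1 : 0 ≤ 1 / 2 * u * P ^ 2 + S * (u * ξ - u1 / 2) * (P * D) + 0.06 * S ^ 2 * D ^ 2 := by
    have := cross_le (A := 1 / 2 * u) (B := 0.06 * S ^ 2) (C := S * (u * ξ - u1 / 2)) (p := P)
      (q := D) (by linarith) (by
        have h1 : u * ξ ≤ 0.121 := by linarith [mul_le_mul hu' hξ1 hξ0.le (by norm_num)]
        have h1' : 0 ≤ u * ξ := by positivity
        have : (u * ξ - u1 / 2) ^ 2 ≤ 0.3085 ^ 2 := by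
          apply sq_le_sq' <;> linarith
        have h3 := mul_le_mul_of_nonneg_right this (sq_nonneg S)
        have h4 := mul_le_mul_of_nonneg_right hu0 (sq_nonneg S)
        linarith [sq_nonneg S])
    linarith
  have c2 : 0 ≤ 0.8 * x ^ 3 * n ^ 2 - 2 / 3 * u * x * (n * (S * D)) + 0.005 * x * (S * D) ^ 2 := by
    have := cross_le (A := 0.8 * x ^ 3) (B := 0.005 * x) (C := -(2 / 3 * u * x)) (p := n)
      (q := S * D) (by positivity) (by
        have : u ^ 2 ≤ 1.21 ^ 2 := by apply sq_le_sq' <;> linarith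
        have h2 : 100 ≤ x ^ 2 := by linarith [mul_le_mul hx hx (by norm_num) hx0.le]
        have h3 : 0 ≤ x ^ 2 := by positivity
        linarith [mul_le_mul_of_nonneg_right this h3, mul_le_mul_of_nonneg_right h2 h3])
    linarith
  have c3 : 0.13 * x * (S * D) ^ 2 ≤ D ^ 2 * (1 / 4 * u2 * S ^ 2 + x / 3 * u * S
      + 2 * u * S ^ 2 * ξ ^ 2 - 0.06 * S ^ 2 - 0.005 * x * S ^ 2) := by
    have hS0 : 0 < S ^ 2 := by positivity
    have e1 : -(x * (S - 2) / 9) * S ^ 2 - 0.0451 * S ^ 2 ≤ u2 * S ^ 2 := by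
      have := mul_le_mul_of_nonneg_right (abs_le.1 hu2).1 hS0.le
      linarith
    have e2 : x / 3 * ((S ^ 2 + 8) / 12 * S) ≤ x / 3 * u * S := by
      have h1 := mul_le_mul_of_nonneg_right hu (by linarith : 0 ≤ S)
      have := mul_le_mul_of_nonneg_left h1 hx0.le
      linarith
    have e4 : 0 ≤ 2 * u * S ^ 2 * ξ ^ 2 := by positivity
    have e6 : 10 * (0.00713 * S ^ 2) ≤ x * (0.00713 * S ^ 2) := by gcongr
    have e7 : 0 ≤ x * S * (0.2222 - 0.0867 * S) := by
      apply mul_nonneg (by positivity); linarith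
    have : 0.13 * x * S ^ 2 ≤ 1 / 4 * u2 * S ^ 2 + x / 3 * u * S
      + 2 * u * S ^ 2 * ξ ^ 2 - 0.06 * S ^ 2 - 0.005 * x * S ^ 2 := by
      have e8 : 0 ≤ x * S := by positivity
      have e9 : 0 ≤ x * S ^ 2 := by positivity
      linarith
    calc 0.13 * x * (S * D) ^ 2 = D ^ 2 * (0.13 * x * S ^ 2) := by ring
      _ ≤ _ := by gcongr
  linarith

/-- Hypotheses on a profile entering the asymptotic regime. -/
structure LateProfile (T : ℝ) (y y1 J : ℝ → ℝ) : Prop extends ProfileOn T y y1 J where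
  start : T < 10
  lim : Tendsto y atTop (𝓝 1)
  energy_le : energy y y1 J 1 10 ≤ 2
  le_four : ∀ x, 10 ≤ x → y x ≤ 4

namespace LateProfile
variable {T : ℝ} {y y1 J v v1 K : ℝ → ℝ}

theorem range (h : LateProfile T y y1 J) {x : ℝ} (hx : 10 ≤ x) : 0.7 ≤ y x ∧ y x ≤ 1.25 :=
  h.amplitude_le h.start h.lim h.energy_le h.le_four hx

theorem osc (h : LateProfile T y y1 J) {x : ℝ} (hx : 10 ≤ x) :
    9 * (y x * y1 x) ^ 2 + x * (y x - 1) ^ 2 * (1 + 2 * y x) ≤ 9 / √x :=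
  h.osc_le h.start h.lim h.energy_le h.le_four hx

theorem self_bounds (h : LateProfile T y y1 J) {x : ℝ} (hx : 10 ≤ x) :
    |x * (y x - 1) * y1 x| ≤ 1.3834 ∧ |y x * y1 x| ≤ 0.5625 :=
  have := osc_consequences (y := y x) (y1 := y1 x) hx (h.range hx).1 (h.range hx).1 (h.osc hx)
    (h.osc hx) (by positivity)
  ⟨this.1, this.2.2⟩

theorem cross_bound (h : LateProfile T y y1 J) (g : LateProfile T v v1 K) {x : ℝ} (hx : 10 ≤ x) :
    |x * (v x - 1) * y1 x| ≤ 2.7667 :=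
  (osc_consequences hx (h.range hx).1 (g.range hx).1 (h.osc hx) (g.osc hx) (by positivity)).2.1

theorem force_bound (h : LateProfile T y y1 J) {x : ℝ} (hx : 10 ≤ x) :
    |(J x - x * y x) / 3 + x * (y x - 1) / 3| ≤ 0.0676 := by
  have h1 := h.defect_le h.start h.lim h.energy_le h.le_four hx
  have h2 := (h.self_bounds hx).2
  have hx0 : 0 < x := by linarith
  have e1 : |y x * y1 x / x| ≤ 0.05625 := by
    rw [abs_div, abs_of_pos hx0, div_le_iff₀ hx0]; linarith
  have e2 : 1.125 / x ^ 2 ≤ 0.01125 := by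
    rw [div_le_iff₀ (by positivity)]; nlinarith
  have e3 : (J x - x * y x) / 3 + x * (y x - 1) / 3 =
    ((J x - x) / 3 + y x * y1 x / x) - y x * y1 x / x := by ring
  rw [e3]
  refine (abs_sub _ _).trans ?_
  linarith

theorem tendsto_meanValue (h : LateProfile T y y1 J) : Tendsto (fun x => J x / x) atTop (𝓝 1) :=
  tendsto_div_self_of_hasDerivAt (fun x hx => h.dJ x hx) h.lim

theorem tendsto_slowGap (h : LateProfile T y y1 J) (g : LateProfile T v v1 K) :
    Tendsto (slowGap y y1 J v v1 K) atTop (𝓝 0) := by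
  have hinv : Tendsto (fun x : ℝ => x⁻¹) atTop (𝓝 0) := tendsto_inv_atTop_zero
  have t1 : Tendsto (meanGap J K) atTop (𝓝 0) := by
    have := h.tendsto_meanValue.sub g.tendsto_meanValue
    simp only [sub_self] at this
    refine this.congr (fun x => ?_)
    simp only [meanGap]; ring
  have t2 : Tendsto (fun x => 3 / 2 * fluxGap y y1 v v1 x / x ^ 2) atTop (𝓝 0) := by
    have hb := isBoundedUnder_of_eventually_le (f := atTop)
      (u := fun t => ‖3 / 2 * fluxGap y y1 v v1 t‖) (a := 4)
      (by
        filter_upwards [eventually_ge_atTop 10] with t ht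
        have h1 := abs_le.1 (h.self_bounds ht).2
        have h2 := abs_le.1 (g.self_bounds ht).2
        rw [Real.norm_eq_abs, abs_le]
        simp only [fluxGap]
        constructor <;> linarith)
    have hinv2 : Tendsto (fun x : ℝ => (x ^ 2)⁻¹) atTop (𝓝 0) := by
      simpa using hinv.pow 2
    have := hinv2.zero_mul_isBoundedUnder_le hb
    refine this.congr (fun x => ?_)
    ring
  have t3 : Tendsto (fun x => 3 * (y x ^ 2 - v x ^ 2) / x ^ 3) atTop (𝓝 0) := by
    have := (((h.lim.pow 2).sub (g.lim.pow 2)).const_mul 3).mul (hinv.pow 3)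
    simpa [div_eq_mul_inv] using this
  have := (t1.add t2).add t3
  simp only [add_zero] at this
  exact this

/-- The difference of two profiles with the same limit cannot carry a positive slow mode. -/
theorem false_of_slowGap_pos (h : LateProfile T y y1 J) (g : LateProfile T v v1 K)
    (hn : 0 < slowGap y y1 J v v1 K 10)
    (hH : gapEnergy y y1 J v v1 K 10 ≤ 26000 * slowGap y y1 J v v1 K 10 ^ 2) : False := by
  set n : ℝ → ℝ := slowGap y y1 J v v1 K with hndef
  set n0 := n 10 with hn0
  set H : ℝ → ℝ := gapEnergy y y1 J v v1 K with hHdef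
  set H' : ℝ → ℝ := fun x => gapRate x (y x) (y1 x) (v x) (v1 x) * (y x - v x) ^ 2
      - x * weight1 y y1 v v1 x * (y x ^ 2 - v x ^ 2) * meanGap J K x with hH'
  have hTx : ∀ x : ℝ, 10 ≤ x → T < x := fun x hx => h.start.trans_le hx
  have hHd : ∀ x, 10 ≤ x → HasDerivAt H (H' x) x := fun x hx =>
    hasDerivAt_gapEnergy h.toProfileOn g.toProfileOn (hTx x hx) (by linarith)
  have hnd : ∀ x, 10 ≤ x → HasDerivAt n (-9 * (y x ^ 2 - v x ^ 2) / x ^ 4) x := fun x hx =>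
    hasDerivAt_slowGap h.toProfileOn g.toProfileOn (hTx x hx) (by linarith)
  have hmean : ∀ x : ℝ, meanGap J K x = n x - 3 / 2 * fluxGap y y1 v v1 x / x ^ 2
      - 3 * ((y x + v x) * (y x - v x)) / x ^ 3 := fun x => by
    simp only [hndef, slowGap]; ring
  have hwt : ∀ x, 10 ≤ x → |weight1 y y1 v v1 x| ≤ 0.375 ∧
      |weight2 y J v K x + x * ((y x + v x) - 2) / 9| ≤ 0.0451 ∧
      ((y x + v x) ^ 2 + 8) / 12 ≤ weight y v x ∧ weight y v x ≤ 1.21 := by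
    intro x hx
    obtain ⟨a1, a2⟩ := abs_le.1 (h.self_bounds hx).2
    obtain ⟨b1, b2⟩ := abs_le.1 (g.self_bounds hx).2
    obtain ⟨c1, c2⟩ := abs_le.1 (h.force_bound hx)
    obtain ⟨d1, d2⟩ := abs_le.1 (g.force_bound hx)
    obtain ⟨r1, r2⟩ := h.range hx
    obtain ⟨s1, s2⟩ := g.range hx
    refine ⟨?_, ?_, ?_, ?_⟩
    · rw [abs_le]; simp only [weight1]; constructor <;> linarith
    · rw [abs_le]; simp only [weight2]; constructor <;> linarith
    · simp only [weight]; nlinarith [sq_nonneg (y x - v x)]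
    · simp only [weight]; nlinarith
  have hrate : ∀ x, 10 ≤ x → 0 ≤ 4 * H x - x * H' x + 0.8 * x ^ 3 * n x ^ 2 := by
    intro x hx
    obtain ⟨r1, r2⟩ := h.range hx
    obtain ⟨s1, s2⟩ := g.range hx
    obtain ⟨w1, w2, w3, w4⟩ := hwt x hx
    have hBr := gapRate_le (x := x) r1 s1 r2 s2 (h.self_bounds hx).1 (h.cross_bound g hx)
      (g.self_bounds hx).1 (g.cross_bound h hx)
    have := gap_quadratic_nonneg (x := x) (S := y x + v x) (D := y x - v x)
      (P := fluxGap y y1 v v1 x) (n := n x) hx (by linarith) w3 w4 w1 w2 hBr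
    rw [← hmean x] at this
    simp only [hH', hHdef, gapEnergy]
    refine this.trans_eq ?_
    ring
  have hcoer : ∀ x, 10 ≤ x → 0.13 * x * (y x ^ 2 - v x ^ 2) ^ 2 ≤ H x + 0.8 * x ^ 3 * n x ^ 2 := by
    intro x hx
    obtain ⟨r1, r2⟩ := h.range hx
    obtain ⟨s1, s2⟩ := g.range hx
    obtain ⟨w1, w2, w3, w4⟩ := hwt x hx
    have := gap_quadratic_coercive (x := x) (S := y x + v x) (D := y x - v x)
      (P := fluxGap y y1 v v1 x) (n := n x) hx (by linarith) (by linarith) w3 w4 w1 w2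
    rw [← hmean x] at this
    simp only [hHdef, gapEnergy]
    refine le_trans (le_of_eq (by ring)) (this.trans_eq ?_)
    ring
  -- By `hrate`, `G` does not increase as long as `|n| ≤ 1.9 n0`: the modulated energy grows at most
  -- like `x⁴`. The initial bound is `(26000 + 800 · 1.9²)/10⁴ = 2.8888`.
  set G : ℝ → ℝ := fun x => (H x + 0.8 * x ^ 3 * (1.9 * n0) ^ 2) / x ^ 4 with hG
  have hGd : ∀ x, 10 ≤ x → HasDerivAt G
      (-(4 * H x - x * H' x + 0.8 * x ^ 3 * (1.9 * n0) ^ 2) / x ^ 5) x := by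
    intro x hx
    have hx0 : x ≠ 0 := by linarith
    have d1 := ((hHd x hx).add (((hasDerivAt_pow 3 x).const_mul 0.8).mul_const
      ((1.9 * n0) ^ 2))).div (hasDerivAt_pow 4 x) (pow_ne_zero 4 hx0)
    refine d1.congr_deriv ?_
    simp only [Pi.add_apply]
    push_cast
    field_simp
    ring
  have hG10 : G 10 ≤ 2.8888 * n0 ^ 2 := by
    simp only [hG]
    rw [div_le_iff₀ (by norm_num)]
    linarith
  have key : ∀ t, 10 ≤ t → (∀ r ∈ Set.Ioo 10 t, |n r - n0| ≤ 0.9 * n0) →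
      |n t - n0| ≤ 0.895 * n0 := by
    intro t ht hr
    have hB : ∀ r ∈ Set.Ioo 10 t, |9 * (y r ^ 2 - v r ^ 2) / r ^ 4| ≤
        0 / (r * √r) + (42.4278 * n0) / (r ^ 2 * √r) := by
      intro r hr'
      have hr10 : 10 ≤ r := hr'.1.le
      have hr0 : 0 < r := by linarith
      have hGr : G r ≤ 2.8888 * n0 ^ 2 := by
        have := le_of_hasDerivAt_nonneg (f := fun x => - G x) hr10
          (fun s hs => (hGd s hs.1).neg.continuousAt.continuousWithinAt)
          (fun s hs => (hGd s hs.1.le).neg) (fun s hs => by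
            have hs0 : 0 < s := by linarith [hs.1]
            have h1 := hrate s hs.1.le
            have h2 := abs_le.1 (hr s ⟨hs.1, hs.2.trans hr'.2⟩)
            have h3 : n s ^ 2 ≤ (1.9 * n0) ^ 2 := by apply sq_le_sq' <;> linarith
            have h4 : 0.8 * s ^ 3 * n s ^ 2 ≤ 0.8 * s ^ 3 * (1.9 * n0) ^ 2 := by gcongr
            rw [neg_div, neg_neg]
            apply div_nonneg _ (by positivity)
            linarith)
        linarith
      have h1 := hcoer r hr10
      have h2 := abs_le.1 (hr r hr')
      have h3 : n r ^ 2 ≤ (1.9 * n0) ^ 2 := by apply sq_le_sq' <;> linarith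
      have h4 : 0.8 * r ^ 3 * n r ^ 2 ≤ 0.8 * r ^ 3 * (1.9 * n0) ^ 2 := by gcongr
      simp only [hG] at hGr
      rw [div_le_iff₀ (by positivity)] at hGr
      -- Coercivity turns the `x⁴` growth of the energy into `x^(3/2)` growth of `y² - v²`. Hence
      -- `|n'| ≤ 9 · 4.7142 n0 r^(-5/2)`, whose integral over `[10, ∞)` is at most `0.895 n0`.
      have h5 : (y r ^ 2 - v r ^ 2) ^ 2 ≤ (4.7142 * n0 * (r * √r)) ^ 2 := by
        have hsr := Real.sq_sqrt hr0.le
        have e1 : (4.7142 * n0 * (r * √r)) ^ 2 = 22.22368164 * n0 ^ 2 * r ^ 2 * √r ^ 2 := by ring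
        rw [e1, hsr]
        have e2 : 0.13 * r * (y r ^ 2 - v r ^ 2) ^ 2 ≤
          0.13 * r * (22.22368164 * n0 ^ 2 * r ^ 2 * r) := by
          have : 0 ≤ n0 ^ 2 * r ^ 4 := by positivity
          linarith
        exact le_of_mul_le_mul_left e2 (by positivity)
      have h6 := abs_le_of_sq_le_sq h5 (by positivity)
      have hsr := Real.sqrt_pos.2 hr0
      rw [abs_div, abs_mul, abs_of_pos (by positivity : (0:ℝ) < r ^ 4), zero_div, zero_add,
        div_le_div_iff₀ (by positivity) (by positivity), abs_of_pos (by norm_num : (0:ℝ) < 9)]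
      have e3 : 42.4278 * n0 * r ^ 4 = 9 * (4.7142 * n0 * (r * √r)) * (r ^ 2 * √r) := by
        have hsr := Real.sq_sqrt hr0.le
        have : 9 * (4.7142 * n0 * (r * √r)) * (r ^ 2 * √r) = 42.4278 * n0 * r ^ 3 * √r ^ 2 := by ring
        rw [this, hsr]; ring
      rw [e3]
      gcongr
    have hbar : ∀ r ∈ Set.Icc 10 t, HasDerivAt
        (fun r : ℝ => - (2 * 0 / √r) - 2 / 3 * (42.4278 * n0) / (r * √r))
        (0 / (r * √r) + (42.4278 * n0) / (r ^ 2 * √r)) r := fun r hr =>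
      hasDerivAt_barrier 0 (42.4278 * n0) (by linarith [hr.1])
    have hncont : ContinuousOn n (Set.Icc 10 t) := fun r hr =>
      (hnd r hr.1).continuousAt.continuousWithinAt
    have hbc : ContinuousOn (fun r : ℝ => - (2 * 0 / √r) - 2 / 3 * (42.4278 * n0) / (r * √r))
        (Set.Icc 10 t) := fun r hr => (hbar r hr).continuousAt.continuousWithinAt
    have u1 := sub_le_sub_of_hasDerivAt ht hncont hbc (fun r hr => hnd r hr.1.le)
      (fun r hr => hbar r ⟨hr.1.le, hr.2.le⟩) (fun r hr => by
        have := (abs_le.1 (hB r hr)).1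
        have e : -9 * (y r ^ 2 - v r ^ 2) / r ^ 4 = -(9 * (y r ^ 2 - v r ^ 2) / r ^ 4) := by ring
        rw [e]; linarith)
    have u2 := sub_le_sub_of_hasDerivAt (f := fun r => - n r) ht hncont.neg hbc
      (fun r hr => (hnd r hr.1.le).neg)
      (fun r hr => hbar r ⟨hr.1.le, hr.2.le⟩) (fun r hr => by
        have := (abs_le.1 (hB r hr)).2
        have e : -(-9 * (y r ^ 2 - v r ^ 2) / r ^ 4) = 9 * (y r ^ 2 - v r ^ 2) / r ^ 4 := by ring
        rw [e]; linarith)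
    have hs10 : (3.162:ℝ) ≤ √10 := Real.le_sqrt_of_sq_le (by norm_num)
    have e1 : 0 ≤ 2 / 3 * (42.4278 * n0) / (t * √t) := by positivity
    have e2 : 2 / 3 * (42.4278 * n0) / (10 * √10) ≤ 0.895 * n0 := by
      rw [div_le_iff₀ (by positivity)]; nlinarith
    simp only [mul_zero, zero_div, neg_zero, zero_sub] at u1 u2
    rw [abs_le]
    constructor <;> linarith
  have hboot : ∀ x, 10 ≤ x → |n x - n0| ≤ 0.9 * n0 := by
    intro x hx
    have hfin := forall_pos_of_bootstrap (h := fun r => 0.9 * n0 - |n r - n0|) (a := 10)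
      (b := x + 1)
      (by
        have : ContinuousOn n (Set.Icc 10 (x + 1)) := fun r hr =>
          (hnd r hr.1).continuousAt.continuousWithinAt
        fun_prop)
      (by
        have hc : ContinuousAt (fun r => 0.9 * n0 - |n r - n0|) 10 := by
          have := (hnd 10 le_rfl).continuousAt
          fun_prop
        have : ∀ᶠ r in 𝓝 (10:ℝ), 0 < 0.9 * n0 - |n r - n0| := by
          refine hc.eventually_const_lt ?_
          simp only [hn0, sub_self, abs_zero, sub_zero]
          positivity
        exact this.filter_mono nhdsWithin_le_nhds)
      (fun t ht hr => by
        have := key t ht.1.le (fun r hr' => by have := hr r hr'; linarith)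
        linarith)
    rcases hx.eq_or_lt with rfl | hx
    · simp only [hn0, sub_self, abs_zero]
      positivity
    · have := hfin x ⟨hx, by linarith⟩
      linarith
  -- The slow gap never falls below `0.1 n0 > 0`, yet it tends to 0.
  have := ge_of_tendsto (h.tendsto_slowGap g) (b := 0.1 * n0) (by
    filter_upwards [eventually_ge_atTop 10] with x hx
    have := (abs_le.1 (hboot x hx)).1
    linarith)
  linarith

end LateProfile

/-! ### Growth of the gap between two profiles at moderate distances -/

/-- These products form the Bernstein basis of `[a, b]`. Supplied to `linarith` in one degree, they
certify polynomial inequalities on the interval by a nonnegative combination. -/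
theorem chordProd_nonneg {a b t : ℝ} (h1 : a ≤ t) (h2 : t ≤ b) (i j : ℕ) :
    0 ≤ (t - a) ^ i * (b - t) ^ j :=
  mul_nonneg (pow_nonneg (sub_nonneg.2 h1) _) (pow_nonneg (sub_nonneg.2 h2) _)

/-- Barrier for the energy of the gap. -/
noncomputable def gapBarrier (x : ℝ) : ℝ :=
  9.8 + 8.3 * (x - 5) + 1.2 * (x - 5) ^ 2 + 0.028 * (x - 5) ^ 3
noncomputable def gapBarrier1 (x : ℝ) : ℝ := 8.3 + 2.4 * (x - 5) + 0.084 * (x - 5) ^ 2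
/-- Barriers for the slow gap. -/
noncomputable def slowUpper (x : ℝ) : ℝ := 3.2 + 8.7 * (0.2 - 1 / x)
noncomputable def slowLower (x : ℝ) : ℝ := 2.55 - 6.8 * (0.2 - 1 / x) - 26 * (0.04 - 1 / x ^ 2)

theorem gapBarrier_pos {x : ℝ} (hx : 5 ≤ x) : 0 < gapBarrier x := by
  have : 0 ≤ x - 5 := by linarith
  unfold gapBarrier; positivity

/-- This is the tangent at 9, a point inside the working interval `[5, 15.2]`; it makes the barrier
inequalities below polynomial. -/
theorem sqrt_le_chord {x : ℝ} (hx : 0 ≤ x) : √x ≤ (x + 9) / 6 := by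
  nlinarith [Real.sq_sqrt hx, sq_nonneg (√x - 3)]

theorem inv_sqrt_le_chord {x : ℝ} (hx : 0 < x) : 1 / √x ≤ (x + 9) / (6 * x) := by
  have h := sqrt_le_chord hx.le
  have hs := Real.sqrt_pos.2 hx
  have : 1 / √x = √x / x := by
    rw [div_eq_div_iff hs.ne' hx.ne', one_mul, Real.mul_self_sqrt hx.le]
  rw [this, div_le_div_iff₀ hx (by positivity)]
  nlinarith

/-- Correction to the slow gap in units of the barrier. -/
noncomputable def meanCorr (x : ℝ) : ℝ :=
  1.5924 * gapBarrier x / x ^ 2 + 8.6283 * gapBarrier x / x ^ 3 * (1 / √x)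

theorem meanCorr_le {x : ℝ} (hx : 5 ≤ x) : meanCorr x ≤
    1.5924 * gapBarrier x / x ^ 2 + 8.6283 * gapBarrier x / x ^ 3 * ((x + 9) / (6 * x)) := by
  have := gapBarrier_pos hx
  have hx0 : 0 < x := by linarith
  have := inv_sqrt_le_chord hx0
  unfold meanCorr
  gcongr

/-- `gapBarrier` is a supersolution of the linear inequality that `phase_rate` gives for the square
root of phase energy times `√S`. After multiplication by `x³` the claim is a polynomial inequality.
-/
theorem barrier_ineq_energy {x : ℝ} (hx : 5 ≤ x) (hx' : x ≤ 15.2) :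
    0.094 * gapBarrier x + 0.6935 * (√x * (slowUpper x + meanCorr x)) ≤ gapBarrier1 x := by
  have hw := gapBarrier_pos hx
  have hx0 : 0 < x := by linarith
  have hs := Real.sqrt_pos.2 hx0
  have hU : 0 ≤ slowUpper x := by
    have : 1 / x ≤ 0.2 := by rw [div_le_iff₀ hx0]; linarith
    unfold slowUpper; linarith
  have e1 : √x * (slowUpper x + meanCorr x) ≤ (x + 9) / 6 * (slowUpper x
      + 1.5924 * gapBarrier x / x ^ 2) + 8.6283 * gapBarrier x / x ^ 3 := by
    have : √x * (slowUpper x + meanCorr x) = √x * (slowUpper x + 1.5924 * gapBarrier x / x ^ 2)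
        + 8.6283 * gapBarrier x / x ^ 3 := by
      have h1 : √x * (1 / √x) = 1 := mul_one_div_cancel hs.ne'
      unfold meanCorr; linear_combination 8.6283 * gapBarrier x / x ^ 3 * h1
    rw [this]
    have := sqrt_le_chord hx0.le
    gcongr
  have e2 : 0.094 * gapBarrier x + 0.6935 * ((x + 9) / 6 * (slowUpper x
      + 1.5924 * gapBarrier x / x ^ 2) + 8.6283 * gapBarrier x / x ^ 3) ≤ gapBarrier1 x := by
    have : 0 ≤ (gapBarrier1 x - (0.094 * gapBarrier x + 0.6935 * ((x + 9) / 6 * (slowUpper x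
      + 1.5924 * gapBarrier x / x ^ 2) + 8.6283 * gapBarrier x / x ^ 3))) * x ^ 3 := by
      have : (gapBarrier1 x - (0.094 * gapBarrier x + 0.6935 * ((x + 9) / 6 * (slowUpper x
        + 1.5924 * gapBarrier x / x ^ 2) + 8.6283 * gapBarrier x / x ^ 3))) * x ^ 3 =
        gapBarrier1 x * x ^ 3 - (0.094 * gapBarrier x * x ^ 3 + 0.6935 * ((x + 9) / 6 *
         (4.94 * x ^ 3 - 8.7 * x ^ 2 + 1.5924 * gapBarrier x * x) + 8.6283 * gapBarrier x)) := by
        unfold slowUpper; field_simp; ring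
      rw [this]
      unfold gapBarrier gapBarrier1
      have B := fun i j => chordProd_nonneg hx hx' i j
      linarith [B 0 7, B 1 6, B 2 5, B 3 4, B 4 3, B 5 2, B 6 1, B 7 0]
    have := nonneg_of_mul_nonneg_left this (by positivity)
    linarith
  linarith

/-- Since `n' = -9 (y² - v²)/x⁴`, the slow gap rises only if `y² - v²` is negative. The left side
bounds `-9 (y² - v²)`, and `8.7 x²` is `x⁴` times the slope of `slowUpper`. -/
theorem barrier_ineq_upper {x : ℝ} (hx : 5 ≤ x) (hx' : x ≤ 15.2) :
    9 * (7.6 * meanCorr x + 2.8761 * gapBarrier x * (1 / √x)) ≤ 8.7 * x ^ 2 := by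
  have hw := gapBarrier_pos hx
  have hx0 : 0 < x := by linarith
  have e1 := meanCorr_le hx
  have e2 := inv_sqrt_le_chord hx0
  have e3 : 2.8761 * gapBarrier x * (1 / √x) ≤ 2.8761 * gapBarrier x * ((x + 9) / (6 * x)) := by
    gcongr
  have : 0 ≤ (8.7 * x ^ 2 - 9 * (7.6 * (1.5924 * gapBarrier x / x ^ 2 + 8.6283 * gapBarrier x /
     x ^ 3 * ((x + 9) / (6 * x))) + 2.8761 * gapBarrier x * ((x + 9) / (6 * x)))) * x ^ 4 := by
    have : (8.7 * x ^ 2 - 9 * (7.6 * (1.5924 * gapBarrier x / x ^ 2 + 8.6283 * gapBarrier x /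
     x ^ 3 * ((x + 9) / (6 * x))) + 2.8761 * gapBarrier x * ((x + 9) / (6 * x)))) * x ^ 4 =
     8.7 * x ^ 6 - 9 * (7.6 * (1.5924 * gapBarrier x * x ^ 2 + 8.6283 * gapBarrier x *
      ((x + 9) / 6)) + 2.8761 * gapBarrier x * ((x + 9) / 6) * x ^ 3) := by
      field_simp
    rw [this]
    unfold gapBarrier
    have B := fun i j => chordProd_nonneg hx hx' i j
    linarith [B 0 7, B 1 6, B 2 5, B 3 4, B 4 3, B 5 2, B 6 1, B 7 0]
  have := nonneg_of_mul_nonneg_left this (by positivity)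
  linarith

/-- The counterpart for descent: now the mean gap itself also pushes `n` down, so its upper bound
`slowUpper + meanCorr` enters, and the right side is `x⁴` times the rate at which `slowLower` falls.
-/
theorem barrier_ineq_lower {x : ℝ} (hx : 5 ≤ x) (hx' : x ≤ 15.2) :
    9 * (7.6 * (slowUpper x + meanCorr x) + 2.8761 * gapBarrier x * (1 / √x)) ≤
      6.8 * x ^ 2 + 52 * x := by
  have hw := gapBarrier_pos hx
  have hx0 : 0 < x := by linarith
  have e1 := meanCorr_le hx
  have e2 := inv_sqrt_le_chord hx0
  have e3 : 2.8761 * gapBarrier x * (1 / √x) ≤ 2.8761 * gapBarrier x * ((x + 9) / (6 * x)) := by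
    gcongr
  have : 0 ≤ (6.8 * x ^ 2 + 52 * x - 9 * (7.6 * (slowUpper x + (1.5924 * gapBarrier x / x ^ 2 +
     8.6283 * gapBarrier x /
     x ^ 3 * ((x + 9) / (6 * x)))) + 2.8761 * gapBarrier x * ((x + 9) / (6 * x)))) * x ^ 4 := by
    have : (6.8 * x ^ 2 + 52 * x - 9 * (7.6 * (slowUpper x + (1.5924 * gapBarrier x / x ^ 2 +
     8.6283 * gapBarrier x /
     x ^ 3 * ((x + 9) / (6 * x)))) + 2.8761 * gapBarrier x * ((x + 9) / (6 * x)))) * x ^ 4 =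
     6.8 * x ^ 6 + 52 * x ^ 5 - 9 * (7.6 * ((4.94 * x ^ 4 - 8.7 * x ^ 3) +
      (1.5924 * gapBarrier x * x ^ 2 + 8.6283 * gapBarrier x *
      ((x + 9) / 6))) + 2.8761 * gapBarrier x * ((x + 9) / 6) * x ^ 3) := by
      unfold slowUpper; field_simp; ring
    rw [this]
    unfold gapBarrier
    have B := fun i j => chordProd_nonneg hx hx' i j
    linarith [B 0 7, B 1 6, B 2 5, B 3 4, B 4 3, B 5 2, B 6 1, B 7 0]
  have := nonneg_of_mul_nonneg_left this (by positivity)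
  linarith

/-- For a limit `m³` with `1.2 ≤ m ≤ 1.52` the abscissa `x = 10 m` becomes 10 after scaling;
`(10/x)⁴` is the scaling factor between phase energy and squared slow gap. The constant `171.1` is
chosen so that `171.1² ≤ 16500 · 1.7748`. -/
theorem barrier_ineq_final {x : ℝ} (hx : 12 ≤ x) (hx' : x ≤ 15.2) :
    0 < slowLower x ∧ (10 / x) ^ 4 * (gapBarrier x ^ 2 / 1.7748) ≤ 16500 * slowLower x ^ 2 := by
  have hx0 : 0 < x := by linarith
  have h1 : slowLower x * x ^ 2 = (2.55 - 6.8 * 0.2 - 26 * 0.04) * x ^ 2 + 6.8 * x + 26 := by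
    unfold slowLower; field_simp; ring
  have h0 : 0 < slowLower x := by
    have : 0 < slowLower x * x ^ 2 := by rw [h1]; nlinarith
    exact (mul_pos_iff_of_pos_right (by positivity)).1 this
  refine ⟨h0, ?_⟩
  have h2 : 100 * gapBarrier x ≤ 171.1 * (slowLower x * x ^ 2) := by
    rw [h1]; unfold gapBarrier
    have B := fun i j => chordProd_nonneg hx hx' i j
    linarith [B 0 3, B 1 2, B 2 1, B 3 0]
  have hw := gapBarrier_pos (x := x) (by linarith)
  have h3 : (100 * gapBarrier x) ^ 2 ≤ (171.1 * (slowLower x * x ^ 2)) ^ 2 := by gcongr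
  have e : (10 / x) ^ 4 * (gapBarrier x ^ 2 / 1.7748) =
    (100 * gapBarrier x) ^ 2 / (1.7748 * x ^ 4) := by field_simp; ring
  rw [e, div_le_iff₀ (by positivity)]
  have : 0 ≤ slowLower x ^ 2 * x ^ 4 := by positivity
  nlinarith

/-- The energy of the difference of two profiles relative to its slow part. -/
noncomputable def phaseEnergy (y y1 J v v1 K : ℝ → ℝ) (x : ℝ) : ℝ :=
  1 / 2 * fluxGap y y1 v v1 x ^ 2
    + x / 3 * (y x + v x) * (y x - v x - meanGap J K x) ^ 2

noncomputable def phaseEnergy1 (y y1 J v v1 K : ℝ → ℝ) (x : ℝ) : ℝ :=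
  -(1 / 3) * (y x + v x) * (y x - v x - meanGap J K x) ^ 2
    - x / 3 * (y1 x + v1 x) * ((y x - v x - meanGap J K x) ^ 2
      + 2 * meanGap J K x * (y x - v x - meanGap J K x))

/-- Kinetic and potential terms exchange energy, so the flux gap drops out; growth enters only
through `(y + v)'`. -/
theorem hasDerivAt_phaseEnergy {T : ℝ} {y y1 J v v1 K : ℝ → ℝ} (hy : ProfileOn T y y1 J)
    (hv : ProfileOn T v v1 K) {x : ℝ} (hx : T < x) (hx0 : x ≠ 0) :
    HasDerivAt (phaseEnergy y y1 J v v1 K) (phaseEnergy1 y y1 J v v1 K x) x := by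
  have dP := hasDerivAt_fluxGap hy hv hx hx0
  have dN := hasDerivAt_meanGap hy hv hx hx0
  have dy := hy.dy x hx
  have dv := hv.dy x hx
  refine (((dP.pow 2).const_mul (1 / 2)).add ((((hasDerivAt_id' x).div_const 3).mul
    (dy.add dv)).mul (((dy.sub dv).sub dN).pow 2))).congr_deriv ?_
  simp only [phaseEnergy1, Pi.pow_apply, Pi.mul_apply, Pi.sub_apply, Pi.add_apply, fluxGap]
  push_cast
  field_simp
  ring

theorem hasDerivAt_gapBarrier (x : ℝ) : HasDerivAt gapBarrier (gapBarrier1 x) x := by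
  have d := (hasDerivAt_id' x).sub_const 5
  refine ((((d.const_mul 8.3).const_add 9.8).add ((d.pow 2).const_mul 1.2)).add
    ((d.pow 3).const_mul 0.028)).congr_deriv ?_
  simp only [gapBarrier1]; push_cast; ring

theorem hasDerivAt_slowUpper {x : ℝ} (hx : x ≠ 0) : HasDerivAt slowUpper (8.7 / x ^ 2) x := by
  refine (((((hasDerivAt_const x (1:ℝ)).div (hasDerivAt_id' x) hx).const_sub 0.2).const_mul
    8.7).const_add 3.2).congr_deriv ?_
  field_simp; ring

theorem hasDerivAt_slowLower {x : ℝ} (hx : x ≠ 0) :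
    HasDerivAt slowLower (-(6.8 / x ^ 2 + 52 / x ^ 3)) x := by
  refine (((((hasDerivAt_const x (1:ℝ)).div (hasDerivAt_id' x) hx).const_sub 0.2).const_mul
    6.8).const_sub 2.55 |>.sub ((((hasDerivAt_const x (1:ℝ)).div (hasDerivAt_pow 2 x)
    (pow_ne_zero 2 hx)).const_sub 0.04).const_mul 26)).congr_deriv ?_
  push_cast
  field_simp; ring

theorem slowLower_pos {x : ℝ} (hx : 5 ≤ x) : 0 < slowLower x := by
  have hx0 : 0 < x := by linarith
  have h1 : slowLower x * x ^ 2 = (2.55 - 6.8 * 0.2 - 26 * 0.04) * x ^ 2 + 6.8 * x + 26 := by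
    unfold slowLower; field_simp; ring
  have : 0 < slowLower x * x ^ 2 := by rw [h1]; nlinarith
  exact (mul_pos_iff_of_pos_right (by positivity)).1 this

/-- Bounds which follow from a bound on `F √S`. -/
theorem phase_bounds {x S P Δ N n r w a U : ℝ} (hx : 5 ≤ x) (hS : 3.15 ≤ S) (hS' : S ≤ 7.6)
    (hr : r = √S) (ha : 0 < a) (hw : 0 < w)
    (hG : (1 / 2 * P ^ 2 + x / 3 * S * Δ ^ 2) * r ≤ (a * w) ^ 2)
    (hN : N * (1 + 3 * S / x ^ 3) = n - 3 / 2 * P / x ^ 2 - 3 * (S * Δ) / x ^ 3) (hn : 0 < n)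
    (hU : n ≤ a * U) :
    |P| ≤ 1.0616 * (a * w) ∧ |S * Δ| ≤ 2.8761 * (a * w) * (1 / √x) ∧
    √x * |r * Δ| ≤ 1.3002 * (a * w) ∧
    -(a * (1.5924 * w / x ^ 2 + 8.6283 * w / x ^ 3 * (1 / √x))) ≤ N ∧
    N ≤ a * (U + (1.5924 * w / x ^ 2 + 8.6283 * w / x ^ 3 * (1 / √x))) := by
  have hx0 : 0 < x := by linarith
  have hS0 : 0 < S := by linarith
  have hr1 : 1.7748 ≤ r := by rw [hr]; exact Real.le_sqrt_of_sq_le (by norm_num; linarith)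
  have hr2 : r ≤ 2.75681 := by
    rw [hr]; exact Real.sqrt_le_iff.2 ⟨by norm_num, by norm_num; linarith⟩
  have hrS : r ^ 2 = S := by rw [hr]; exact Real.sq_sqrt hS0.le
  obtain ⟨q, hq, hq0, hqx⟩ : ∃ q, q = √x ∧ 0 < q ∧ q ^ 2 = x :=
    ⟨_, rfl, Real.sqrt_pos.2 hx0, Real.sq_sqrt hx0.le⟩
  rw [← hq]
  have haw : 0 < a * w := by positivity
  have g0 : 0 ≤ x / 3 * S * Δ ^ 2 := by positivity
  have b1 : |P| ≤ 1.0616 * (a * w) := by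
    apply abs_le_of_sq_le_sq _ (by positivity)
    have h1 : 1 / 2 * P ^ 2 * 1.7748 ≤ (a * w) ^ 2 := by
      refine le_trans ?_ hG
      have : 0 ≤ 1 / 2 * P ^ 2 := by positivity
      gcongr
      linarith
    have := sq_nonneg (a * w)
    nlinarith
  have hG2 : q ^ 2 / 3 * r ^ 2 * Δ ^ 2 * r ≤ (a * w) ^ 2 := by
    refine le_trans ?_ hG
    rw [hrS, hqx]
    have : 0 ≤ 1 / 2 * P ^ 2 := by positivity
    have : 0 < r := by linarith
    gcongr
    linarith
  have b3 : q * |r * Δ| ≤ 1.3002 * (a * w) := by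
    rw [← abs_of_pos hq0, ← abs_mul]
    apply abs_le_of_sq_le_sq _ (by positivity)
    have : q ^ 2 / 3 * r ^ 2 * Δ ^ 2 * 1.7748 ≤ (a * w) ^ 2 := by
      refine le_trans ?_ hG2
      gcongr
    have := sq_nonneg (a * w)
    have e : (q * (r * Δ)) ^ 2 = q ^ 2 * r ^ 2 * Δ ^ 2 := by ring
    rw [e]
    linarith
  have b2' : |q * (S * Δ)| ≤ 2.8761 * (a * w) := by
    apply abs_le_of_sq_le_sq _ (by positivity)
    have h1 : (q * (S * Δ)) ^ 2 = 3 * r * (q ^ 2 / 3 * r ^ 2 * Δ ^ 2 * r) := by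
      rw [← hrS]; ring
    rw [h1]
    have h2 : 3 * r * (q ^ 2 / 3 * r ^ 2 * Δ ^ 2 * r) ≤ 3 * 2.75681 * (a * w) ^ 2 := by
      have : 0 < r := by linarith
      gcongr
    have := sq_nonneg (a * w)
    linarith
  have b2 : |S * Δ| ≤ 2.8761 * (a * w) * (1 / q) := by
    rw [mul_one_div, le_div_iff₀ hq0, mul_comm, ← abs_of_pos hq0, ← abs_mul]
    exact b2'
  have c1 : |3 / 2 * P / x ^ 2| ≤ a * (1.5924 * w / x ^ 2) := by
    rw [abs_div, abs_mul, abs_of_pos (by positivity : 0 < x ^ 2), abs_of_pos (by norm_num : (0:ℝ) < 3 / 2)]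
    have e : a * (1.5924 * w / x ^ 2) = 3 / 2 * (1.0616 * (a * w)) / x ^ 2 := by ring
    rw [e]
    gcongr
  have c2 : |3 * (S * Δ) / x ^ 3| ≤ a * (8.6283 * w / x ^ 3 * (1 / q)) := by
    rw [abs_div, abs_mul, abs_of_pos (by positivity : 0 < x ^ 3), abs_of_pos (by norm_num : (0:ℝ) < 3)]
    have e : a * (8.6283 * w / x ^ 3 * (1 / q)) = 3 * (2.8761 * (a * w) * (1 / q)) / x ^ 3 := by
      ring
    rw [e]
    gcongr
  have c1' := abs_le.1 c1
  have c2' := abs_le.1 c2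
  have hc : 1 ≤ 1 + 3 * S / x ^ 3 := by
    have : 0 ≤ 3 * S / x ^ 3 := by positivity
    linarith
  refine ⟨b1, b2, b3, ?_, ?_⟩
  · rcases le_or_gt 0 N with h | h
    · refine le_trans ?_ h
      have : 0 ≤ a * (1.5924 * w / x ^ 2 + 8.6283 * w / x ^ 3 * (1 / q)) := by positivity
      linarith
    · have : N * (1 + 3 * S / x ^ 3) ≤ N * 1 := mul_le_mul_of_nonpos_left hc h.le
      linarith
  · rcases le_or_gt N 0 with h | h
    · refine h.trans ?_
      have : 0 ≤ a * (1.5924 * w / x ^ 2 + 8.6283 * w / x ^ 3 * (1 / q)) := by positivity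
      linarith
    · have : N * 1 ≤ N * (1 + 3 * S / x ^ 3) := mul_le_mul_of_nonneg_left hc h.le
      linarith

/-- The derivative of `F √S`. -/
theorem phase_rate {x S S1 P Δ N r w a M : ℝ} (hx : 5 ≤ x) (hS : 3.15 ≤ S)
    (hr : r = √S) (ha : 0 < a) (hw : 0 < w) (hM : 0 ≤ M)
    (h1 : |S1| ≤ 0.376 * S) (h2 : |S1| ≤ 1.6)
    (hG : (1 / 2 * P ^ 2 + x / 3 * S * Δ ^ 2) * r ≤ (a * w) ^ 2)
    (hΔ : √x * |r * Δ| ≤ 1.3002 * (a * w)) (hN : |N| ≤ a * M) :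
    (-(1 / 3) * S * Δ ^ 2 - x / 3 * S1 * (Δ ^ 2 + 2 * N * Δ)) * r
      + (1 / 2 * P ^ 2 + x / 3 * S * Δ ^ 2) * (S1 / (2 * r)) ≤
    2 * (a * w) * (a * (0.094 * w + 0.6935 * (√x * M))) := by
  have hx0 : 0 < x := by linarith
  have hS0 : 0 < S := by linarith
  have hr0 : 0 < r := by rw [hr]; exact Real.sqrt_pos.2 hS0
  have hrS : r ^ 2 = S := by rw [hr]; exact Real.sq_sqrt hS0.le
  obtain ⟨q, hq, hq0, hqx⟩ : ∃ q, q = √x ∧ 0 < q ∧ q ^ 2 = x :=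
    ⟨_, rfl, Real.sqrt_pos.2 hx0, Real.sq_sqrt hx0.le⟩
  rw [← hq] at hΔ ⊢
  -- The factor `√S` replaces the potential term `-x S1 Δ²/3` by half the difference of kinetic and
  -- potential energy times `S1/S`. This halves the admissible growth rate, from `0.376` to `0.188`.
  have e : (-(1 / 3) * S * Δ ^ 2 - x / 3 * S1 * (Δ ^ 2 + 2 * N * Δ)) * r
      + (1 / 2 * P ^ 2 + x / 3 * S * Δ ^ 2) * (S1 / (2 * r)) =
      -(1 / 3) * S * Δ ^ 2 * r + (S1 / S) * (1 / 4 * P ^ 2 - x / 6 * S * Δ ^ 2) * r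
        + 2 * x / 3 * (-(S1 * N * (r * Δ))) := by
    rw [← hrS]; field_simp; ring
  rw [e]
  have t1 : -(1 / 3) * S * Δ ^ 2 * r ≤ 0 := by
    have : 0 ≤ 1 / 3 * S * Δ ^ 2 * r := by positivity
    linarith
  have t2 : (S1 / S) * (1 / 4 * P ^ 2 - x / 6 * S * Δ ^ 2) * r ≤ 0.188 * (a * w) ^ 2 := by
    have k : |S1 / S| ≤ 0.376 := by
      rw [abs_div, abs_of_pos hS0, div_le_iff₀ hS0]; exact h1
    have k2 : |1 / 4 * P ^ 2 - x / 6 * S * Δ ^ 2| ≤ 1 / 4 * P ^ 2 + x / 6 * S * Δ ^ 2 := by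
      have : 0 ≤ 1 / 4 * P ^ 2 := by positivity
      have : 0 ≤ x / 6 * S * Δ ^ 2 := by positivity
      rw [abs_le]; constructor <;> linarith
    have k3 : (S1 / S) * (1 / 4 * P ^ 2 - x / 6 * S * Δ ^ 2) ≤
        0.376 * (1 / 4 * P ^ 2 + x / 6 * S * Δ ^ 2) := by
      refine (le_abs_self _).trans ?_
      rw [abs_mul]
      gcongr
    have := mul_le_mul_of_nonneg_right k3 hr0.le
    refine this.trans ?_
    linarith
  have t3 : 2 * x / 3 * (-(S1 * N * (r * Δ))) ≤ 1.387 * (a * w) * (a * (q * M)) := by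
    have k : q * (-(S1 * N * (r * Δ))) ≤ 1.6 * (a * M) * (1.3002 * (a * w)) := by
      refine (mul_le_mul_of_nonneg_left (neg_le_abs _) hq0.le).trans ?_
      have e : q * |S1 * N * (r * Δ)| = |S1| * |N| * (q * |r * Δ|) := by
        rw [abs_mul, abs_mul]; ring
      rw [e]
      gcongr
    have k2 := mul_le_mul_of_nonneg_left k hq0.le
    have : 0 ≤ a * w * (a * (q * M)) := by positivity
    rw [← hqx]
    linarith
  linarith

/-- Control of the phase energy and of the slow gap for moderate `x`. -/
theorem phase_control {T a : ℝ} {y y1 J v v1 K : ℝ → ℝ} (hy : ProfileOn T y y1 J)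
    (hv : ProfileOn T v v1 K) (hT : T < 5) (ha : 0 < a)
    (hS : ∀ x, 5 ≤ x → 3.15 ≤ y x + v x ∧ y x + v x ≤ 7.6)
    (hS1 : ∀ x, 5 ≤ x → |y1 x + v1 x| ≤ 0.376 * (y x + v x) ∧ |y1 x + v1 x| ≤ 1.6)
    (hF : phaseEnergy y y1 J v v1 K 5 * √(y 5 + v 5) < (9.8 * a) ^ 2)
    (hn : 2.55 * a < slowGap y y1 J v v1 K 5) (hn' : slowGap y y1 J v v1 K 5 < 3.2 * a)
    {X : ℝ} (hX : 12 ≤ X) (hX' : X ≤ 15.2) :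
    0 < slowGap y y1 J v v1 K X ∧
    (10 / X) ^ 4 * phaseEnergy y y1 J v v1 K X ≤ 16500 * slowGap y y1 J v v1 K X ^ 2 := by
  set F := phaseEnergy y y1 J v v1 K with hFdef
  set n := slowGap y y1 J v v1 K with hndef
  have hTx : ∀ x : ℝ, 5 ≤ x → T < x := fun x hx => hT.trans_le hx
  have hFd : ∀ x, 5 ≤ x → HasDerivAt F (phaseEnergy1 y y1 J v v1 K x) x := fun x hx =>
    hasDerivAt_phaseEnergy hy hv (hTx x hx) (by linarith)
  have hnd : ∀ x, 5 ≤ x → HasDerivAt n (-9 * (y x ^ 2 - v x ^ 2) / x ^ 4) x := fun x hx =>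
    hasDerivAt_slowGap hy hv (hTx x hx) (by linarith)
  have hGd : ∀ x, 5 ≤ x → HasDerivAt (fun x => F x * √(y x + v x))
      (phaseEnergy1 y y1 J v v1 K x * √(y x + v x)
        + F x * ((y1 x + v1 x) / (2 * √(y x + v x)))) x := fun x hx =>
    (hFd x hx).mul (((hy.dy x (hTx x hx)).add (hv.dy x (hTx x hx))).sqrt
      (by have := (hS x hx).1; simp only [Pi.add_apply]; linarith))
  have hwd : ∀ x, HasDerivAt (fun x => (a * gapBarrier x) ^ 2)
      (2 * (a * gapBarrier x) * (a * gapBarrier1 x)) x := fun x => by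
    refine (((hasDerivAt_gapBarrier x).const_mul a).pow 2).congr_deriv ?_
    push_cast; ring
  have hUd : ∀ x, 5 ≤ x → HasDerivAt (fun x => a * slowUpper x) (a * (8.7 / x ^ 2)) x :=
    fun x hx => (hasDerivAt_slowUpper (by linarith)).const_mul a
  have hLd : ∀ x, 5 ≤ x → HasDerivAt (fun x => a * slowLower x)
      (a * (-(6.8 / x ^ 2 + 52 / x ^ 3))) x :=
    fun x hx => (hasDerivAt_slowLower (by linarith)).const_mul a
  have g5 : gapBarrier 5 = 9.8 := by norm_num [gapBarrier]
  have u5 : slowUpper 5 = 3.2 := by norm_num [slowUpper]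
  have l5 : slowLower 5 = 2.55 := by norm_num [slowLower]
  -- The three margins bootstrap together: the bounds on `n` enter the growth of the phase energy,
  -- and the phase energy controls `n'`.
  set h : ℝ → ℝ := fun x => min ((a * gapBarrier x) ^ 2 - F x * √(y x + v x))
    (min (a * slowUpper x - n x) (n x - a * slowLower x)) with hh
  have hcont : ∀ x, 5 ≤ x → ContinuousAt h x := fun x hx => by
    have c1 := (hGd x hx).continuousAt
    have c2 := (hwd x).continuousAt
    have c3 := (hUd x hx).continuousAt
    have c4 := (hLd x hx).continuousAt
    have c5 := (hnd x hx).continuousAt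
    exact (c2.sub c1).min ((c3.sub c5).min (c5.sub c4))
  have h5 : 0 < h 5 := by
    simp only [hh, lt_min_iff, g5, u5, l5]
    refine ⟨by linarith, by linarith, by linarith⟩
  have hboot := forall_pos_of_bootstrap (h := h) (a := 5) (b := 15.2)
    (fun x hx => (hcont x hx.1).continuousWithinAt)
    (((hcont 5 le_rfl).eventually_const_lt h5).filter_mono nhdsWithin_le_nhds)
    (by
      intro t ht hprev
      have key : ∀ x ∈ Set.Ioo 5 t,
          (phaseEnergy1 y y1 J v v1 K x * √(y x + v x)
            + F x * ((y1 x + v1 x) / (2 * √(y x + v x))) ≤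
            2 * (a * gapBarrier x) * (a * gapBarrier1 x)) ∧
          -9 * (y x ^ 2 - v x ^ 2) / x ^ 4 ≤ a * (8.7 / x ^ 2) ∧
          a * (-(6.8 / x ^ 2 + 52 / x ^ 3)) ≤ -9 * (y x ^ 2 - v x ^ 2) / x ^ 4 := by
        intro x hx
        have hx5 : 5 ≤ x := hx.1.le
        have hx15 : x ≤ 15.2 := hx.2.le.trans ht.2
        have hx0 : 0 < x := by linarith
        have hw := gapBarrier_pos hx5
        obtain ⟨p1, p2, p3⟩ : 0 < (a * gapBarrier x) ^ 2 - F x * √(y x + v x) ∧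
            0 < a * slowUpper x - n x ∧ 0 < n x - a * slowLower x := by
          have := hprev x hx
          simp only [hh, lt_min_iff] at this
          exact this
        have hL := slowLower_pos hx5
        have hnpos : 0 < n x := by
          have := mul_pos ha hL
          linarith
        obtain ⟨s1, s2⟩ := hS x hx5
        obtain ⟨k1, k2⟩ := hS1 x hx5
        obtain ⟨b1, b2, b3, b4, b5⟩ := phase_bounds (x := x) (S := y x + v x)
          (P := fluxGap y y1 v v1 x) (Δ := y x - v x - meanGap J K x) (N := meanGap J K x)
          (n := n x) (w := gapBarrier x) (U := slowUpper x) hx5 s1 s2 rfl ha hw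
          (by simp only [hFdef, phaseEnergy] at p1; linarith)
          (by simp only [hndef, slowGap]; field_simp; ring) hnpos (by linarith)
        have hMd : meanCorr x =
          1.5924 * gapBarrier x / x ^ 2 + 8.6283 * gapBarrier x / x ^ 3 * (1 / √x) := rfl
        rw [← hMd] at b4 b5
        have hM0 : 0 ≤ meanCorr x := by rw [hMd]; positivity
        have hU0 : 0 ≤ slowUpper x := by
          have : 1 / x ≤ 0.2 := by rw [div_le_iff₀ hx0]; linarith
          unfold slowUpper; linarith
        have hB : y x ^ 2 - v x ^ 2 = (y x + v x) * meanGap J K x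
          + (y x + v x) * (y x - v x - meanGap J K x) := by ring
        have b2' := abs_le.1 b2
        have hNabs : |meanGap J K x| ≤ a * (slowUpper x + meanCorr x) := by
          rw [abs_le]
          refine ⟨?_, b5⟩
          have := mul_nonneg ha.le hU0
          linarith
        refine ⟨?_, ?_, ?_⟩
        · have := phase_rate (x := x) (S := y x + v x)
            (P := fluxGap y y1 v v1 x) (Δ := y x - v x - meanGap J K x) (N := meanGap J K x)
            (w := gapBarrier x) (M := slowUpper x + meanCorr x) hx5 s1 rfl ha hw (by positivity)
            k1 k2 (by simp only [hFdef, phaseEnergy] at p1; linarith) b3 hNabs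
          refine le_trans this ?_
          have := barrier_ineq_energy hx5 hx15
          gcongr
        · have e := barrier_ineq_upper hx5 hx15
          rw [div_le_iff₀ (by positivity)]
          have e1 : a * (8.7 / x ^ 2) * x ^ 4 = a * (8.7 * x ^ 2) := by field_simp
          rw [e1, hB]
          have e2 := mul_le_mul_of_nonneg_left e ha.le
          have e3 : -((y x + v x) * meanGap J K x) ≤ 7.6 * (a * meanCorr x) := by
            have q1 : (y x + v x) * (-(a * meanCorr x)) ≤ (y x + v x) * meanGap J K x := by
              gcongr
            have q2 : (y x + v x) * (a * meanCorr x) ≤ 7.6 * (a * meanCorr x) := by gcongr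
            linarith
          linarith [b2'.1]
        · have e := barrier_ineq_lower hx5 hx15
          rw [le_div_iff₀ (by positivity)]
          have e1 : a * (-(6.8 / x ^ 2 + 52 / x ^ 3)) * x ^ 4 = -(a * (6.8 * x ^ 2 + 52 * x)) := by
            field_simp
          rw [e1, hB]
          have e2 := mul_le_mul_of_nonneg_left e ha.le
          have e3 : (y x + v x) * meanGap J K x ≤ 7.6 * (a * (slowUpper x + meanCorr x)) := by
            have q1 : (y x + v x) * meanGap J K x ≤
              (y x + v x) * (a * (slowUpper x + meanCorr x)) := by gcongr
            have q2 : (y x + v x) * (a * (slowUpper x + meanCorr x)) ≤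
              7.6 * (a * (slowUpper x + meanCorr x)) := by gcongr
            linarith
          linarith [b2'.2]
      have c1 : ContinuousOn (fun x => F x * √(y x + v x)) (Set.Icc 5 t) := fun x hx =>
        (hGd x hx.1).continuousAt.continuousWithinAt
      have c2 : ContinuousOn (fun x => (a * gapBarrier x) ^ 2) (Set.Icc 5 t) := fun x _ =>
        (hwd x).continuousAt.continuousWithinAt
      have c3 : ContinuousOn (fun x => a * slowUpper x) (Set.Icc 5 t) := fun x hx =>
        (hUd x hx.1).continuousAt.continuousWithinAt
      have c4 : ContinuousOn (fun x => a * slowLower x) (Set.Icc 5 t) := fun x hx =>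
        (hLd x hx.1).continuousAt.continuousWithinAt
      have c5 : ContinuousOn n (Set.Icc 5 t) := fun x hx =>
        (hnd x hx.1).continuousAt.continuousWithinAt
      have i1 := sub_le_sub_of_hasDerivAt ht.1.le c1 c2 (fun x hx => hGd x hx.1.le)
        (fun x _ => hwd x) (fun x hx => (key x hx).1)
      have i2 := sub_le_sub_of_hasDerivAt ht.1.le c5 c3 (fun x hx => hnd x hx.1.le)
        (fun x hx => hUd x hx.1.le) (fun x hx => (key x hx).2.1)
      have i3 := sub_le_sub_of_hasDerivAt ht.1.le c4 c5 (fun x hx => hLd x hx.1.le)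
        (fun x hx => hnd x hx.1.le) (fun x hx => (key x hx).2.2)
      simp only [g5, u5, l5] at i1 i2 i3
      simp only [hh, lt_min_iff]
      refine ⟨by linarith, by linarith, by linarith⟩)
  obtain ⟨p1, -, p3⟩ : 0 < (a * gapBarrier X) ^ 2 - F X * √(y X + v X) ∧
      0 < a * slowUpper X - n X ∧ 0 < n X - a * slowLower X := by
    have := hboot X ⟨by linarith, hX'⟩
    simp only [hh, lt_min_iff] at this
    exact this
  have hX0 : 0 < X := by linarith
  obtain ⟨f1, f2⟩ := barrier_ineq_final hX hX'
  have hnL : a * slowLower X ≤ n X := by linarith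
  have haL := mul_pos ha f1
  refine ⟨haL.trans_le hnL, ?_⟩
  have hS3 := (hS X (by linarith)).1
  have hr : (1.7748:ℝ) ≤ √(y X + v X) := Real.le_sqrt_of_sq_le (by norm_num; linarith)
  have hF0 : 0 ≤ F X := by simp only [hFdef, phaseEnergy]; positivity
  have hFX : F X * 1.7748 ≤ (a * gapBarrier X) ^ 2 := by
    have : F X * 1.7748 ≤ F X * √(y X + v X) := by gcongr
    linarith
  calc (10 / X) ^ 4 * F X ≤ (10 / X) ^ 4 * (a ^ 2 * (gapBarrier X ^ 2 / 1.7748)) := by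
        gcongr
        rw [← mul_div_assoc, le_div_iff₀ (by norm_num)]
        linarith
    _ = a ^ 2 * ((10 / X) ^ 4 * (gapBarrier X ^ 2 / 1.7748)) := by ring
    _ ≤ a ^ 2 * (16500 * slowLower X ^ 2) := by gcongr
    _ = 16500 * (a * slowLower X) ^ 2 := by ring
    _ ≤ 16500 * n X ^ 2 := by gcongr

/-! ### Scaling, and the contradiction from two profiles with a common limit -/

/-- In `(y y')' = (J - x y)/3` every term scales like `l⁴` when `x` scales like `l`, `y` like `l³`,
`y'` like `l²` and `J` like `l⁴`. -/
theorem ProfileOn.rescale {T l : ℝ} {y y1 J : ℝ → ℝ} (h : ProfileOn T y y1 J) (hl : 0 < l) :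
    ProfileOn (l * T) (fun x => l ^ 3 * y (x / l)) (fun x => l ^ 2 * y1 (x / l))
      (fun x => l ^ 4 * J (x / l)) := by
  have hx : ∀ x, l * T < x → T < x / l := fun x hx => by
    rw [lt_div_iff₀ hl, mul_comm]; exact hx
  have hd : ∀ x : ℝ, HasDerivAt (fun x => x / l) (1 / l) x := fun x =>
    (hasDerivAt_id' x).div_const l
  refine ⟨fun x hx' => mul_pos (by positivity) (h.pos _ (hx x hx')), fun x hx' => ?_,
    fun x hx' => ?_, fun x hx' => ?_⟩
  · refine (((h.dy _ (hx x hx')).comp x (hd x)).const_mul (l ^ 3)).congr_deriv ?_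
    field_simp
  · refine (((h.dJ _ (hx x hx')).comp x (hd x)).const_mul (l ^ 4)).congr_deriv ?_
    field_simp
  · refine (((h.dy1 _ (hx x hx')).comp x (hd x)).const_mul (l ^ 2)).congr_deriv ?_
    have := (h.pos _ (hx x hx')).ne'
    field_simp

theorem HalfProfile.rescale {T α l : ℝ} {y y1 J : ℝ → ℝ} (h : HalfProfile T α y y1 J) (hl : 0 < l) :
    HalfProfile (l * T) (l ^ 2 * α) (fun x => l ^ 3 * y (x / l)) (fun x => l ^ 2 * y1 (x / l))
      (fun x => l ^ 4 * J (x / l)) := by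
  have hm : Set.MapsTo (fun x => x / l) (Set.Ici (l * T)) (Set.Ici T) := fun x hx => by
    simp only [Set.mem_Ici] at hx ⊢
    rw [le_div_iff₀ hl, mul_comm]; exact hx
  have hc : ContinuousOn (fun x : ℝ => x / l) (Set.Ici (l * T)) := continuousOn_id.div_const l
  have e : l * T / l = T := by field_simp
  refine ⟨h.toProfileOn.rescale hl, (h.cy.comp hc hm).const_mul _, (h.cy1.comp hc hm).const_mul _,
    (h.cJ.comp hc hm).const_mul _, ?_, ?_, ?_⟩
  · simp [e, h.y_start]
  · simp [e, h.y1_start]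
  · simp only [e, h.J_start]; ring

/-! ### From the phase energy to the modulated energy at abscissa 10. -/

namespace LateProfile
variable {T : ℝ} {y y1 J v v1 K : ℝ → ℝ}

set_option maxHeartbeats 1000000 in
-- At abscissa 10 the modulated energy is `u` times the phase energy, plus terms with `u'` and
-- `u''`, minus a positive multiple of the squared mean gap. A phase energy of `16500 n²` therefore
-- leaves the modulated energy below the admissible `26000 n²`.
theorem false_of_phaseEnergy_le (h : LateProfile T y y1 J) (g : LateProfile T v v1 K)
    (hn : 0 < slowGap y y1 J v v1 K 10)
    (hF : phaseEnergy y y1 J v v1 K 10 ≤ 16500 * slowGap y y1 J v v1 K 10 ^ 2) : False := by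
  refine h.false_of_slowGap_pos g hn ?_
  obtain ⟨r1, r2⟩ := h.range le_rfl
  obtain ⟨s1, s2⟩ := g.range le_rfl
  obtain ⟨a1, a2⟩ := abs_le.1 (h.self_bounds le_rfl).2
  obtain ⟨b1, b2⟩ := abs_le.1 (g.self_bounds le_rfl).2
  obtain ⟨c1, c2⟩ := abs_le.1 (h.force_bound le_rfl)
  obtain ⟨d1, d2⟩ := abs_le.1 (g.force_bound le_rfl)
  have hw1 : |weight1 y y1 v v1 10| ≤ 0.375 := by
    rw [abs_le]; simp only [weight1]; constructor <;> linarith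
  have hw2 : weight2 y J v K 10 ≤ 0.0451 - 10 * ((y 10 + v 10) - 2) / 9 := by
    simp only [weight2]; linarith
  have hw : weight y v 10 ≤ 1.21 := by simp only [weight]; nlinarith
  set n := slowGap y y1 J v v1 K 10 with hndef
  obtain ⟨P, hP⟩ : ∃ P, P = fluxGap y y1 v v1 10 := ⟨_, rfl⟩
  obtain ⟨N, hN⟩ : ∃ N, N = meanGap J K 10 := ⟨_, rfl⟩
  obtain ⟨S, hS⟩ : ∃ S, S = y 10 + v 10 := ⟨_, rfl⟩
  obtain ⟨Δ, hΔ⟩ : ∃ Δ, Δ = y 10 - v 10 - N := ⟨_, rfl⟩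
  have hS1 : 1.4 ≤ S := by rw [hS]; linarith
  have hS2 : S ≤ 2.5 := by rw [hS]; linarith
  have hFP : 1 / 2 * P ^ 2 + 10 / 3 * S * Δ ^ 2 ≤ 16500 * n ^ 2 := by
    rw [hΔ, hN, hS, hP]; exact hF
  have hNn : N * (1 + 0.003 * S) = n - 0.015 * P - 0.003 * (S * Δ) := by
    rw [hΔ, hndef]; simp only [slowGap]; rw [← hN, ← hP, hS]; ring
  have hB : y 10 ^ 2 - v 10 ^ 2 = S * (N + Δ) := by rw [hΔ, hS]; ring
  have e : gapEnergy y y1 J v v1 K 10 = weight y v 10 * (1 / 2 * P ^ 2 + 10 / 3 * S * Δ ^ 2)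
      + (-(1 / 2 * weight1 y y1 v v1 10 * (S * (N + Δ)) * P))
      + 1 / 4 * weight2 y J v K 10 * (S * (N + Δ)) ^ 2
      - 10 / 3 * weight y v 10 * S * N ^ 2 := by
    simp only [gapEnergy]
    rw [hB, ← hP, ← hN, show y 10 - v 10 - 2 * N = Δ - N by rw [hΔ]; ring]
    ring
  rw [e]
  have hw0 : 0 ≤ weight y v 10 := by unfold weight; positivity
  have q0 : 0 ≤ 10 / 3 * S * Δ ^ 2 := by positivity
  have q1 : 0 ≤ 1 / 2 * P ^ 2 := by positivity
  have hPn : |P| ≤ 181.7 * n := by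
    apply abs_le_of_sq_le_sq _ (by positivity)
    have := sq_nonneg n
    linarith
  have t1 : weight y v 10 * (1 / 2 * P ^ 2 + 10 / 3 * S * Δ ^ 2) ≤ 1.21 * (16500 * n ^ 2) := by
    gcongr
  have t4 : 0 ≤ 10 / 3 * weight y v 10 * S * N ^ 2 := by positivity
  have hPn' := abs_le.1 hPn
  have hSΔ2 : (S * Δ) ^ 2 ≤ 4950 * S * n ^ 2 := by
    have := mul_le_mul_of_nonneg_left (show 10 / 3 * S * Δ ^ 2 ≤ 16500 * n ^ 2 by linarith)
      (show 0 ≤ 0.3 * S by linarith)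
    linarith
  have hSΔ : |S * Δ| ≤ 111.3 * n := by
    apply abs_le_of_sq_le_sq _ (by positivity)
    have : 4950 * S * n ^ 2 ≤ 4950 * 2.5 * n ^ 2 := by gcongr
    have := sq_nonneg n
    linarith
  have hSΔ' := abs_le.1 hSΔ
  have hNabs : |N| ≤ 4.07 * n := by
    have h1 : |N * (1 + 0.003 * S)| ≤ 4.07 * n := by
      rw [hNn, abs_le]; constructor <;> linarith [hPn'.1, hPn'.2, hSΔ'.1, hSΔ'.2]
    rw [abs_mul, abs_of_pos (by positivity : 0 < 1 + 0.003 * S)] at h1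
    have : |N| * 1 ≤ |N| * (1 + 0.003 * S) := by gcongr; linarith
    linarith
  have fin : ∀ b : ℝ, |S * (N + Δ)| ≤ b * n → 0 ≤ b →
      -(1 / 2 * weight1 y y1 v v1 10 * (S * (N + Δ)) * P) ≤ 34.069 * b * n ^ 2 := by
    intro b hb hb0
    refine (neg_le_abs _).trans ?_
    rw [abs_mul, abs_mul, abs_mul, abs_of_pos (by norm_num : (0:ℝ) < 1 / 2)]
    have : 1 / 2 * |weight1 y y1 v v1 10| * |S * (N + Δ)| * |P| ≤
      1 / 2 * 0.375 * (b * n) * (181.7 * n) := by gcongr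
    have : 0 ≤ b * n ^ 2 := by positivity
    linarith
  have fin2 : ∀ b u : ℝ, |S * (N + Δ)| ≤ b * n → 0 ≤ b → 0 ≤ u → weight2 y J v K 10 ≤ u →
      1 / 4 * weight2 y J v K 10 * (S * (N + Δ)) ^ 2 ≤ 1 / 4 * u * b ^ 2 * n ^ 2 := by
    intro b u hb hb0 hu0 hu
    have h1 : (S * (N + Δ)) ^ 2 ≤ (b * n) ^ 2 := by
      rw [← sq_abs]; gcongr
    calc 1 / 4 * weight2 y J v K 10 * (S * (N + Δ)) ^ 2 ≤ 1 / 4 * u * (S * (N + Δ)) ^ 2 := by gcongr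
      _ ≤ 1 / 4 * u * (b * n) ^ 2 := by gcongr
      _ = _ := by ring
  have hsn := sq_nonneg n
  -- `weight2` is close to `-10 (S - 2)/9`. It is almost nonpositive for `S ≥ 2`; for `S < 2` it may
  -- reach `0.712`, but then the bound on `S Δ` improves with the smaller `S`.
  rcases le_or_gt 2 S with h2 | h2
  · have hb : |S * (N + Δ)| ≤ 121.6 * n := by
      rw [mul_add]
      refine (abs_add_le _ _).trans ?_
      rw [abs_mul, abs_of_pos (by linarith : 0 < S)]
      have : S * |N| ≤ 2.5 * (4.07 * n) := by gcongr
      linarith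
    have f1 := fin _ hb (by norm_num)
    have f2 := fin2 _ 0.0451 hb (by norm_num) (by norm_num) (by rw [← hS] at hw2; linarith)
    linarith
  · have hb' : |S * Δ| ≤ 99.5 * n := by
      apply abs_le_of_sq_le_sq _ (by positivity)
      have : 4950 * S * n ^ 2 ≤ 4950 * 2 * n ^ 2 := by gcongr
      linarith
    have hb : |S * (N + Δ)| ≤ 107.65 * n := by
      rw [mul_add]
      refine (abs_add_le _ _).trans ?_
      rw [abs_mul, abs_of_pos (by linarith : 0 < S)]
      have : S * |N| ≤ 2 * (4.07 * n) := by gcongr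
      linarith
    have f1 := fin _ hb (by norm_num)
    have f2 := fin2 _ 0.712 hb (by norm_num) (by norm_num) (by rw [← hS] at hw2; linarith)
    linarith

end LateProfile

/-- Scaling by `1/m` brings the limit to 1 and carries `10 m` to 10. As `10 m ≥ 5`, the energy bound
at 5 holds at `10 m` by monotonicity, and energies scale by `m¹⁰`. Also `6.5 ≤ 4 · 1.2³`. -/
theorem ProfileOn.late_rescale {T m : ℝ} {y y1 J : ℝ → ℝ} (h : ProfileOn T y y1 J) (hT : T < 5)
    (hm : 1.2 ≤ m) (hlim : Tendsto y atTop (𝓝 (m ^ 3)))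
    (hE : energy y y1 J (m ^ 3) 5 ≤ 2 * m ^ 10) (h6 : ∀ x, 5 ≤ x → y x ≤ 6.5) :
    LateProfile (m⁻¹ * T) (fun x => m⁻¹ ^ 3 * y (x / m⁻¹)) (fun x => m⁻¹ ^ 2 * y1 (x / m⁻¹))
      (fun x => m⁻¹ ^ 4 * J (x / m⁻¹)) := by
  have hm0 : 0 < m := by linarith
  have hdiv : ∀ x : ℝ, x / m⁻¹ = m * x := fun x => by field_simp
  refine ⟨h.rescale (inv_pos.2 hm0), ?_, ?_, ?_, ?_⟩
  · rw [inv_mul_lt_iff₀ hm0]; linarith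
  · have : Tendsto (fun x : ℝ => x / m⁻¹) atTop atTop :=
      tendsto_id.atTop_div_const (inv_pos.2 hm0)
    have := (hlim.comp this).const_mul (m⁻¹ ^ 3)
    rwa [← mul_pow, inv_mul_cancel₀ hm0.ne', one_pow] at this
  · have h1 := h.energy_antitone (c := m ^ 3) (by positivity) hT (show 5 ≤ m * 10 by linarith)
    have e : energy (fun x => m⁻¹ ^ 3 * y (x / m⁻¹)) (fun x => m⁻¹ ^ 2 * y1 (x / m⁻¹))
      (fun x => m⁻¹ ^ 4 * J (x / m⁻¹)) 1 10 = energy y y1 J (m ^ 3) (m * 10) / m ^ 10 := by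
      simp only [energy, cubeInt, hdiv]
      field_simp
    rw [e, div_le_iff₀ (by positivity)]
    linarith
  · intro x hx
    have h1 := h6 (m * x) (by nlinarith)
    rw [hdiv, inv_pow, inv_mul_le_iff₀ (by positivity)]
    have : (1.2:ℝ) ^ 3 ≤ m ^ 3 := by gcongr
    linarith

/-- Two profiles with a common limit cannot carry a positive slow mode on `[12, 15.2]`. -/
theorem ProfileOn.false_of_phaseEnergy_le {T m : ℝ} {y y1 J v v1 K : ℝ → ℝ}
    (hy : ProfileOn T y y1 J) (hv : ProfileOn T v v1 K) (hT : T < 5) (hm : 1.2 ≤ m) (hm' : m ≤ 1.52)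
    (hly : Tendsto y atTop (𝓝 (m ^ 3))) (hlv : Tendsto v atTop (𝓝 (m ^ 3)))
    (hEy : energy y y1 J (m ^ 3) 5 ≤ 2 * m ^ 10) (hEv : energy v v1 K (m ^ 3) 5 ≤ 2 * m ^ 10)
    (h6y : ∀ x, 5 ≤ x → y x ≤ 6.5) (h6v : ∀ x, 5 ≤ x → v x ≤ 6.5)
    (hF : ∀ X, 12 ≤ X → X ≤ 15.2 → 0 < slowGap y y1 J v v1 K X ∧
      (10 / X) ^ 4 * phaseEnergy y y1 J v v1 K X ≤ 16500 * slowGap y y1 J v v1 K X ^ 2) :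
    False := by
  have hm0 : 0 < m := by linarith
  have hdiv : ∀ x : ℝ, x / m⁻¹ = m * x := fun x => by field_simp
  obtain ⟨f1, f2⟩ := hF (m * 10) (by linarith) (by linarith)
  have en : slowGap (fun x => m⁻¹ ^ 3 * y (x / m⁻¹)) (fun x => m⁻¹ ^ 2 * y1 (x / m⁻¹))
      (fun x => m⁻¹ ^ 4 * J (x / m⁻¹)) (fun x => m⁻¹ ^ 3 * v (x / m⁻¹))
      (fun x => m⁻¹ ^ 2 * v1 (x / m⁻¹)) (fun x => m⁻¹ ^ 4 * K (x / m⁻¹)) 10 =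
      slowGap y y1 J v v1 K (m * 10) / m ^ 3 := by
    simp only [slowGap, meanGap, fluxGap, hdiv]
    field_simp
  have eF : phaseEnergy (fun x => m⁻¹ ^ 3 * y (x / m⁻¹)) (fun x => m⁻¹ ^ 2 * y1 (x / m⁻¹))
      (fun x => m⁻¹ ^ 4 * J (x / m⁻¹)) (fun x => m⁻¹ ^ 3 * v (x / m⁻¹))
      (fun x => m⁻¹ ^ 2 * v1 (x / m⁻¹)) (fun x => m⁻¹ ^ 4 * K (x / m⁻¹)) 10 =
      phaseEnergy y y1 J v v1 K (m * 10) / m ^ 10 := by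
    simp only [phaseEnergy, meanGap, fluxGap, hdiv]
    field_simp
  refine LateProfile.false_of_phaseEnergy_le (hy.late_rescale hT hm hly hEy h6y)
    (hv.late_rescale hT hm hlv hEv h6v) ?_ ?_
  · rw [en]; positivity
  · rw [en, eF, div_le_iff₀ (by positivity)]
    have e : (10 / (m * 10)) ^ 4 = 1 / m ^ 4 := by field_simp
    rw [e, one_div, inv_mul_le_iff₀ (by positivity)] at f2
    refine f2.trans_eq ?_
    field_simp

/-! ### Two profiles near their zeros -/

theorem le_of_hasDerivAt_le_even {f f' : ℝ → ℝ} {t c0 c2 c4 c6 c8 : ℝ} (ht : 0 ≤ t)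
    (hc : ContinuousOn f (Set.Icc 0 t)) (h0 : f 0 = 0)
    (hd : ∀ x ∈ Set.Ioo 0 t, HasDerivAt f (f' x) x)
    (h : ∀ x ∈ Set.Ioo 0 t, f' x ≤ c0 + c2 * x ^ 2 + c4 * x ^ 4 + c6 * x ^ 6 + c8 * x ^ 8) :
    f t ≤ c0 * t + c2 / 3 * t ^ 3 + c4 / 5 * t ^ 5 + c6 / 7 * t ^ 7 + c8 / 9 * t ^ 9 := by
  have hp : ∀ x : ℝ, HasDerivAt (fun x : ℝ => c0 * x + c2 / 3 * x ^ 3 + c4 / 5 * x ^ 5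
      + c6 / 7 * x ^ 7 + c8 / 9 * x ^ 9)
      (c0 + c2 * x ^ 2 + c4 * x ^ 4 + c6 * x ^ 6 + c8 * x ^ 8) x := fun x => by
    refine ((((((hasDerivAt_id' x).const_mul c0).add ((hasDerivAt_pow 3 x).const_mul _)).add
      ((hasDerivAt_pow 5 x).const_mul _)).add ((hasDerivAt_pow 7 x).const_mul _)).add
      ((hasDerivAt_pow 9 x).const_mul _)).congr_deriv ?_
    push_cast; ring
  have := sub_le_sub_of_hasDerivAt ht hc (fun x _ => (hp x).continuousAt.continuousWithinAt) hd
    (fun x _ => hp x) h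
  simp only [h0] at this
  norm_num at this
  linarith

theorem le_of_hasDerivAt_le_odd {f f' : ℝ → ℝ} {t c1 c3 c5 c7 : ℝ} (ht : 0 ≤ t)
    (hc : ContinuousOn f (Set.Icc 0 t)) (h0 : f 0 = 0)
    (hd : ∀ x ∈ Set.Ioo 0 t, HasDerivAt f (f' x) x)
    (h : ∀ x ∈ Set.Ioo 0 t, f' x ≤ c1 * x + c3 * x ^ 3 + c5 * x ^ 5 + c7 * x ^ 7) :
    f t ≤ c1 / 2 * t ^ 2 + c3 / 4 * t ^ 4 + c5 / 6 * t ^ 6 + c7 / 8 * t ^ 8 := by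
  have hp : ∀ x : ℝ, HasDerivAt (fun x : ℝ => c1 / 2 * x ^ 2 + c3 / 4 * x ^ 4 + c5 / 6 * x ^ 6
      + c7 / 8 * x ^ 8) (c1 * x + c3 * x ^ 3 + c5 * x ^ 5 + c7 * x ^ 7) x := fun x => by
    refine (((((hasDerivAt_pow 2 x).const_mul _).add ((hasDerivAt_pow 4 x).const_mul _)).add
      ((hasDerivAt_pow 6 x).const_mul _)).add ((hasDerivAt_pow 8 x).const_mul _)).congr_deriv ?_
    push_cast; ring
  have := sub_le_sub_of_hasDerivAt ht hc (fun x _ => (hp x).continuousAt.continuousWithinAt) hd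
    (fun x _ => hp x) h
  simp only [h0] at this
  norm_num at this
  linarith

/-! Polynomial bounds for the sum and the difference of the two profiles and for the quantities
derived from them. -/

/-- The true expansions start with `S = 2x - x³/36` and `D = a x²/9`. The `x³` coefficients
`553/20000 < 1/36 < 349/12500` and the `x²` coefficients `499/4500 < 1/9 < 167/1500` leave room on
both sides, so that the bootstrap can start and close strictly. The polynomials after these four
result from integrating them through the equations of `CenterPair`. -/
noncomputable def sumHi (x : ℝ) : ℝ :=
    (2) * x + (-553/20000) * x ^ 3 + (3/40000) * x ^ 5

noncomputable def sumLo (x : ℝ) : ℝ :=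
    (2) * x + (-349/12500) * x ^ 3 + (39/1000000) * x ^ 5

noncomputable def difHi (x : ℝ) : ℝ :=
    (167/1500) * x ^ 2 + (-113/900000) * x ^ 4 + (-13/9000000) * x ^ 6

noncomputable def difLo (x : ℝ) : ℝ :=
    (499/4500) * x ^ 2 + (-113/300000) * x ^ 4

noncomputable def sumIntHi (x : ℝ) : ℝ :=
    (1) * x ^ 2 + (-553/80000) * x ^ 4 + (1/80000) * x ^ 6

noncomputable def sumIntLo (x : ℝ) : ℝ :=
    (1) * x ^ 2 + (-349/50000) * x ^ 4 + (13/2000000) * x ^ 6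

noncomputable def difIntHi (x : ℝ) : ℝ :=
    (167/4500) * x ^ 3 + (-113/4500000) * x ^ 5 + (-13/63000000) * x ^ 7

noncomputable def difIntLo (x : ℝ) : ℝ :=
    (499/13500) * x ^ 3 + (-113/1500000) * x ^ 5

noncomputable def sqSumSlopeHi (a x : ℝ) : ℝ :=
    (4) * x + ((-2/9) + (167/6750) * a ^ 2) * x ^ 3 + ((2801/1000000) + (-113/6750000) * a
    ^ 2) * x ^ 5 + ((-53/21000000) + (-13/94500000) * a ^ 2) * x ^ 7

noncomputable def sqSumSlopeLo (a x : ℝ) : ℝ :=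
    (4) * x + ((-2/9) + (499/20250) * a ^ 2) * x ^ 3 + ((689/250000) + (-113/2250000) * a ^
    2) * x ^ 5 + (-137/21000000) * x ^ 7

noncomputable def prodSlopeHi (x : ℝ) : ℝ :=
    (2/3) * x ^ 2 + (-18257/1080000) * x ^ 4 + (3839/81000000) * x ^ 6 + (-13/756000000) *
    x ^ 8

noncomputable def prodSlopeLo (x : ℝ) : ℝ :=
    (2/3) * x ^ 2 + (-34523/2025000) * x ^ 4 + (803/81000000) * x ^ 6 + (13/108000000) * x
    ^ 8

noncomputable def sqSumHi (a x : ℝ) : ℝ :=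
    (2) * x ^ 2 + ((-1/18) + (167/27000) * a ^ 2) * x ^ 4 + ((2801/6000000) +
    (-113/40500000) * a ^ 2) * x ^ 6 + ((-53/168000000) + (-13/756000000) * a ^ 2) * x ^ 8

noncomputable def sqSumLo (a x : ℝ) : ℝ :=
    (2) * x ^ 2 + ((-1/18) + (499/81000) * a ^ 2) * x ^ 4 + ((689/1500000) +
    (-113/13500000) * a ^ 2) * x ^ 6 + (-137/168000000) * x ^ 8

noncomputable def prodHi (x : ℝ) : ℝ :=
    (2/9) * x ^ 3 + (-18257/5400000) * x ^ 5 + (3839/567000000) * x ^ 7 + (-13/6804000000)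
    * x ^ 9

noncomputable def prodLo (x : ℝ) : ℝ :=
    (2/9) * x ^ 3 + (-34523/10125000) * x ^ 5 + (803/567000000) * x ^ 7 + (13/972000000) *
    x ^ 9


/-- The sum `S` and the difference `D` of two profiles in coordinates centred at their zeros `∓ a`,
together with their integrals and the slopes of `(S² + D²) / 2` and `S D`. -/
structure CenterPair (a : ℝ) (S D IS ID A1 B1 : ℝ → ℝ) : Prop where
  pos : ∀ x, 0 < x → |D x| < S x
  dIS : ∀ x, 0 < x → HasDerivAt IS (S x) x
  dID : ∀ x, 0 < x → HasDerivAt ID (D x) x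
  dA : ∀ x, 0 < x → HasDerivAt (fun x => (S x ^ 2 + D x ^ 2) / 2) (A1 x) x
  dA1 : ∀ x, 0 < x → HasDerivAt A1 (2 / 3 * (6 + IS x - x * S x + a * D x)) x
  dB : ∀ x, 0 < x → HasDerivAt (fun x => S x * D x) (B1 x) x
  dB1 : ∀ x, 0 < x → HasDerivAt B1 (2 / 3 * (ID x - x * D x + a * S x)) x
  cS : ContinuousOn S (Set.Ici 0)
  cD : ContinuousOn D (Set.Ici 0)
  cIS : ContinuousOn IS (Set.Ici 0)
  cID : ContinuousOn ID (Set.Ici 0)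
  cA1 : ContinuousOn A1 (Set.Ici 0)
  cB1 : ContinuousOn B1 (Set.Ici 0)
  S0 : S 0 = 0
  D0 : D 0 = 0
  IS0 : IS 0 = 0
  ID0 : ID 0 = 0
  A10 : A1 0 = 0
  B10 : B1 0 = 0
  lim : Tendsto (fun x => S x / x) (𝓝[>] 0) (𝓝 2)

/-- The bounds propagated along the initial interval. -/
structure CenterBounds (a x S D : ℝ) : Prop where
  S_le : S ≤ sumHi x
  le_S : sumLo x ≤ S
  D_le : D ≤ a * difHi x
  le_D : a * difLo x ≤ D

/-- Integrated bounds. -/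
structure CenterBounds1 (a x S D IS ID A1 B1 : ℝ) : Prop where
  IS_le : IS ≤ sumIntHi x
  le_IS : sumIntLo x ≤ IS
  ID_le : ID ≤ a * difIntHi x
  le_ID : a * difIntLo x ≤ ID
  A1_le : A1 ≤ sqSumSlopeHi a x
  le_A1 : sqSumSlopeLo a x ≤ A1
  B1_le : B1 ≤ a * prodSlopeHi x
  le_B1 : a * prodSlopeLo x ≤ B1
  A_le : (S ^ 2 + D ^ 2) / 2 ≤ sqSumHi a x
  le_A : sqSumLo a x ≤ (S ^ 2 + D ^ 2) / 2
  B_le : S * D ≤ a * prodHi x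
  le_B : a * prodLo x ≤ S * D

/-! ### Integrating the enclosures through the equations of the pair. -/

namespace CenterPair
variable {a : ℝ} {S D IS ID A1 B1 : ℝ → ℝ}

/-- Three successive integrations: from `S, D` to `IS, ID`, then to the slopes `A1, B1`, then to
`(S² + D²)/2` and `S D`. In `A1'` the sum enters as `-x S`, so an upper bound there uses the lower
bound for `S` and vice versa; the same happens with `-x D` in `B1'`. -/
theorem bounds1 (h : CenterPair a S D IS ID A1 B1) (ha : 0 < a) {t : ℝ}
    (hb : ∀ x ∈ Set.Ioo 0 t, CenterBounds a x (S x) (D x)) :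
    ∀ x ∈ Set.Ioc 0 t, CenterBounds1 a x (S x) (D x) (IS x) (ID x) (A1 x) (B1 x) := by
  have sub : ∀ {x y : ℝ}, x ∈ Set.Ioc 0 t → y ∈ Set.Ioo 0 x → y ∈ Set.Ioo 0 t := fun hx hy =>
    ⟨hy.1, hy.2.trans_le hx.2⟩
  have c : ∀ {f : ℝ → ℝ} {x : ℝ}, ContinuousOn f (Set.Ici 0) → ContinuousOn f (Set.Icc 0 x) :=
    fun h => h.mono Set.Icc_subset_Ici_self

  have i1 : ∀ x ∈ Set.Ioc 0 t, IS x ≤ sumIntHi x := fun x hx => by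
    have := le_of_hasDerivAt_le_odd (f := (fun x => IS x))
      (c1 := (2)) (c3 := (-553/20000)) (c5 := (3/40000)) (c7 := 0)
      hx.1.le (c (h.cIS)) (by simp [h.IS0])
      (fun y hy => h.dIS y hy.1) (fun y hy => by
        have := (hb y (sub hx hy)).S_le
        simp only [sumHi] at this
        linarith)
    simp only [sumIntHi]
    linarith

  have i2 : ∀ x ∈ Set.Ioc 0 t, sumIntLo x ≤ IS x := fun x hx => by
    have := le_of_hasDerivAt_le_odd (f := (fun x => -(IS x)))
      (c1 := (-(2))) (c3 := (-(-349/12500))) (c5 := (-(39/1000000))) (c7 := 0)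
      hx.1.le (c (h.cIS).neg) (by simp [h.IS0])
      (fun y hy => (h.dIS y hy.1).neg) (fun y hy => by
        have := (hb y (sub hx hy)).le_S
        simp only [sumLo] at this
        linarith)
    simp only [sumIntLo]
    linarith

  have i3 : ∀ x ∈ Set.Ioc 0 t, ID x ≤ a * difIntHi x := fun x hx => by
    have := le_of_hasDerivAt_le_even (f := (fun x => ID x))
      (c0 := 0) (c2 := (a * (167/1500))) (c4 := (a * (-113/900000))) (c6 := (a *
      (-13/9000000))) (c8 := 0)
      hx.1.le (c (h.cID)) (by simp [h.ID0])
      (fun y hy => h.dID y hy.1) (fun y hy => by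
        have := (hb y (sub hx hy)).D_le
        simp only [difHi] at this
        linarith)
    simp only [difIntHi]
    linarith

  have i4 : ∀ x ∈ Set.Ioc 0 t, a * difIntLo x ≤ ID x := fun x hx => by
    have := le_of_hasDerivAt_le_even (f := (fun x => -(ID x)))
      (c0 := 0) (c2 := (-(a * (499/4500)))) (c4 := (-(a * (-113/300000)))) (c6 := 0) (c8 :=
      0)
      hx.1.le (c (h.cID).neg) (by simp [h.ID0])
      (fun y hy => (h.dID y hy.1).neg) (fun y hy => by
        have := (hb y (sub hx hy)).le_D
        simp only [difLo] at this
        linarith)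
    simp only [difIntLo]
    linarith

  have i5 : ∀ x ∈ Set.Ioc 0 t, A1 x ≤ sqSumSlopeHi a x := fun x hx => by
    have := le_of_hasDerivAt_le_even (f := (fun x => A1 x))
      (c0 := (4)) (c2 := ((-2/3) + (167/2250) * a ^ 2)) (c4 := ((2801/200000) +
      (-113/1350000) * a ^ 2)) (c6 := ((-53/3000000) + (-13/13500000) * a ^ 2)) (c8 := 0)
      hx.1.le (c (h.cA1)) (by simp [h.A10])
      (fun y hy => h.dA1 y hy.1) (fun y hy => by
        have b := hb y (sub hx hy)
        have hyt : y ∈ Set.Ioc 0 t := ⟨hy.1, (hy.2.trans_le hx.2).le⟩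
        have := mul_le_mul_of_nonneg_left b.le_S hy.1.le
        have := mul_le_mul_of_nonneg_left b.D_le ha.le
        have := i1 y hyt
        simp only [sumLo, difHi, sumIntHi] at *
        linarith)
    simp only [sqSumSlopeHi]
    linarith

  have i6 : ∀ x ∈ Set.Ioc 0 t, sqSumSlopeLo a x ≤ A1 x := fun x hx => by
    have := le_of_hasDerivAt_le_even (f := (fun x => -(A1 x)))
      (c0 := (-(4))) (c2 := (-((-2/3) + (499/6750) * a ^ 2))) (c4 := (-((689/50000) +
      (-113/450000) * a ^ 2))) (c6 := (-(-137/3000000))) (c8 := 0)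
      hx.1.le (c (h.cA1).neg) (by simp [h.A10])
      (fun y hy => (h.dA1 y hy.1).neg) (fun y hy => by
        have b := hb y (sub hx hy)
        have hyt : y ∈ Set.Ioc 0 t := ⟨hy.1, (hy.2.trans_le hx.2).le⟩
        have := mul_le_mul_of_nonneg_left b.S_le hy.1.le
        have := mul_le_mul_of_nonneg_left b.le_D ha.le
        have := i2 y hyt
        simp only [sumHi, difLo, sumIntLo] at *
        linarith)
    simp only [sqSumSlopeLo]
    linarith

  have i7 : ∀ x ∈ Set.Ioc 0 t, B1 x ≤ a * prodSlopeHi x := fun x hx => by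
    have := le_of_hasDerivAt_le_odd (f := (fun x => B1 x))
      (c1 := (a * (4/3))) (c3 := (a * (-18257/270000))) (c5 := (a * (3839/13500000))) (c7
      := (a * (-13/94500000)))
      hx.1.le (c (h.cB1)) (by simp [h.B10])
      (fun y hy => h.dB1 y hy.1) (fun y hy => by
        have b := hb y (sub hx hy)
        have hyt : y ∈ Set.Ioc 0 t := ⟨hy.1, (hy.2.trans_le hx.2).le⟩
        have := mul_le_mul_of_nonneg_left b.le_D hy.1.le
        have := mul_le_mul_of_nonneg_left b.S_le ha.le
        have := i3 y hyt
        simp only [sumHi, difLo, difIntHi] at *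
        linarith)
    simp only [prodSlopeHi]
    linarith

  have i8 : ∀ x ∈ Set.Ioc 0 t, a * prodSlopeLo x ≤ B1 x := fun x hx => by
    have := le_of_hasDerivAt_le_odd (f := (fun x => -(B1 x)))
      (c1 := (-(a * (4/3)))) (c3 := (-(a * (-34523/506250)))) (c5 := (-(a *
      (803/13500000)))) (c7 := (-(a * (13/13500000))))
      hx.1.le (c (h.cB1).neg) (by simp [h.B10])
      (fun y hy => (h.dB1 y hy.1).neg) (fun y hy => by
        have b := hb y (sub hx hy)
        have hyt : y ∈ Set.Ioc 0 t := ⟨hy.1, (hy.2.trans_le hx.2).le⟩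
        have := mul_le_mul_of_nonneg_left b.D_le hy.1.le
        have := mul_le_mul_of_nonneg_left b.le_S ha.le
        have := i4 y hyt
        simp only [sumLo, difHi, difIntLo] at *
        linarith)
    simp only [prodSlopeLo]
    linarith

  have cA : ContinuousOn (fun x => (S x ^ 2 + D x ^ 2) / 2) (Set.Ici 0) :=
    ((h.cS.pow 2).add (h.cD.pow 2)).div_const 2
  have cB : ContinuousOn (fun x => S x * D x) (Set.Ici 0) := h.cS.mul h.cD

  have i9 : ∀ x ∈ Set.Ioc 0 t, (S x ^ 2 + D x ^ 2) / 2 ≤ sqSumHi a x := fun x hx => by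
    have := le_of_hasDerivAt_le_odd (f := (fun x => (fun x => (S x ^ 2 + D x ^ 2) / 2) x))
      (c1 := (4)) (c3 := ((-2/9) + (167/6750) * a ^ 2)) (c5 := ((2801/1000000) +
      (-113/6750000) * a ^ 2)) (c7 := ((-53/21000000) + (-13/94500000) * a ^ 2))
      hx.1.le (c (cA)) (by simp [h.S0, h.D0])
      (fun y hy => h.dA y hy.1) (fun y hy => by
        have := i5 y ⟨hy.1, (hy.2.trans_le hx.2).le⟩
        simp only [sqSumSlopeHi] at this
        linarith)
    simp only [sqSumHi]; simp only at this
    linarith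

  have i10 : ∀ x ∈ Set.Ioc 0 t, sqSumLo a x ≤ (S x ^ 2 + D x ^ 2) / 2 := fun x hx => by
    have := le_of_hasDerivAt_le_odd (f := (fun x => -((fun x => (S x ^ 2 + D x ^ 2) / 2) x)))
      (c1 := (-(4))) (c3 := (-((-2/9) + (499/20250) * a ^ 2))) (c5 := (-((689/250000) +
      (-113/2250000) * a ^ 2))) (c7 := (-(-137/21000000)))
      hx.1.le (c (cA).neg) (by simp [h.S0, h.D0])
      (fun y hy => (h.dA y hy.1).neg) (fun y hy => by
        have := i6 y ⟨hy.1, (hy.2.trans_le hx.2).le⟩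
        simp only [sqSumSlopeLo] at this
        linarith)
    simp only [sqSumLo]; simp only at this
    linarith

  have i11 : ∀ x ∈ Set.Ioc 0 t, S x * D x ≤ a * prodHi x := fun x hx => by
    have := le_of_hasDerivAt_le_even (f := (fun x => (fun x => S x * D x) x))
      (c0 := 0) (c2 := (a * (2/3))) (c4 := (a * (-18257/1080000))) (c6 := (a *
      (3839/81000000))) (c8 := (a * (-13/756000000)))
      hx.1.le (c (cB)) (by simp [h.S0, h.D0])
      (fun y hy => h.dB y hy.1) (fun y hy => by
        have := i7 y ⟨hy.1, (hy.2.trans_le hx.2).le⟩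
        simp only [prodSlopeHi] at this
        linarith)
    simp only [prodHi]; simp only at this
    linarith

  have i12 : ∀ x ∈ Set.Ioc 0 t, a * prodLo x ≤ S x * D x := fun x hx => by
    have := le_of_hasDerivAt_le_even (f := (fun x => -((fun x => S x * D x) x)))
      (c0 := 0) (c2 := (-(a * (2/3)))) (c4 := (-(a * (-34523/2025000)))) (c6 := (-(a *
      (803/81000000)))) (c8 := (-(a * (13/108000000))))
      hx.1.le (c (cB).neg) (by simp [h.S0, h.D0])
      (fun y hy => (h.dB y hy.1).neg) (fun y hy => by
        have := i8 y ⟨hy.1, (hy.2.trans_le hx.2).le⟩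
        simp only [prodSlopeLo] at this
        linarith)
    simp only [prodLo]; simp only at this
    linarith

  exact fun x hx => ⟨i1 x hx, i2 x hx, i3 x hx, i4 x hx, i5 x hx, i6 x hx, i7 x hx, i8 x hx,
    i9 x hx, i10 x hx, i11 x hx, i12 x hx⟩

end CenterPair

/-- This closes the upper bound for the difference: if `D` touched `a · difHi` while `S ≥ sumLo`,
then `S D` would exceed its integrated bound `a · prodHi`. Dividing by `x³` leaves a polynomial in
`z = x²` on `[0, 25]`. -/
theorem prodHi_lt {x : ℝ} (hx : 0 < x) (hx' : x ≤ 5) :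
    prodHi x < difHi x * sumLo x := by
  obtain ⟨z, hz⟩ : ∃ z, z = x ^ 2 := ⟨_, rfl⟩
  have hz0 : 0 ≤ z := by rw [hz]; positivity
  have hz1 : z ≤ 25 := by rw [hz]; nlinarith
  have B := fun i j => chordProd_nonneg hz0 hz1 i j
  have key : 0 <
    (1/2250) + (14437/675000000) * z ^ 1 + (-2568653/1417500000000) * z ^ 2 +
    (6352021/170100000000000) * z ^ 3 + (-169/3000000000000) * z ^ 4 := by
    linarith [B 0 4, B 1 3, B 2 2, B 3 1, B 4 0]
  have e : difHi x * sumLo x - prodHi x = x ^ 3 * (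
    (1/2250) + (14437/675000000) * z ^ 1 + (-2568653/1417500000000) * z ^ 2 +
    (6352021/170100000000000) * z ^ 3 + (-169/3000000000000) * z ^ 4) := by
    rw [hz]; simp only [prodHi, difHi, sumLo]; ring
  have := mul_pos (pow_pos hx 3) key
  linarith

theorem lt_prodLo {x : ℝ} (hx : 0 < x) (hx' : x ≤ 5) :
    difLo x * sumHi x < prodLo x := by
  obtain ⟨z, hz⟩ : ∃ z, z = x ^ 2 := ⟨_, rfl⟩
  have hz0 : 0 ≤ z := by rw [hz]; positivity
  have hz1 : z ≤ 25 := by rw [hz]; nlinarith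
  have B := fun i j => chordProd_nonneg hz0 hz1 i j
  have key : 0 <
    (1/2250) + (331883/810000000) * z ^ 1 + (-19635521/1134000000000) * z ^ 2 +
    (40459/972000000000) * z ^ 3 := by
    linarith [B 0 3, B 1 2, B 2 1, B 3 0]
  have e : prodLo x - difLo x * sumHi x = x ^ 3 * (
    (1/2250) + (331883/810000000) * z ^ 1 + (-19635521/1134000000000) * z ^ 2 +
    (40459/972000000000) * z ^ 3) := by
    rw [hz]; simp only [prodLo, difLo, sumHi]; ring
  have := mul_pos (pow_pos hx 3) key
  linarith

/-- This closes the upper bound for the sum through `S² = 2 · (S² + D²)/2 - D²`, with the lower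
bound for `D`. The inequality is affine in `a²`, so Bernstein products are weighted by `a²` and
`0.64 - a²`. -/
theorem sqSumHi_lt {a x : ℝ} (ha : 0 ≤ a) (ha' : a ≤ 0.8) (hx : 0 < x) (hx' : x ≤ 5) :
    2 * sqSumHi a x - (a * difLo x) ^ 2 < sumHi x ^ 2 := by
  obtain ⟨z, hz⟩ : ∃ z, z = x ^ 2 := ⟨_, rfl⟩
  have hz0 : 0 ≤ z := by rw [hz]; positivity
  have hz1 : z ≤ 25 := by rw [hz]; nlinarith
  obtain ⟨s, hs⟩ : ∃ s, s = a ^ 2 := ⟨_, rfl⟩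
  have hs0 : 0 ≤ s := by rw [hs]; positivity
  have hs1 : 0 ≤ 0.64 - s := by rw [hs]; nlinarith
  have B := fun i j => chordProd_nonneg hz0 hz1 i j
  have key : 0 <
    (23/45000) + (-1499/20250000) * s + (157027/1200000000) * z ^ 1 + (-157861/2025000000)
    * z ^ 1 * s + (-29539/8400000000) * z ^ 2 + (333149/1890000000000) * z ^ 2 * s +
    (9/1600000000) * z ^ 3 := by
    linarith [mul_nonneg hs0 (B 0 3), mul_nonneg hs1 (B 0 3), mul_nonneg hs0 (B 1 2), mul_nonneg hs1 (B 1 2), mul_nonneg hs0 (B 2 1), mul_nonneg hs1 (B 2 1), mul_nonneg hs0 (B 3 0), mul_nonneg hs1 (B 3 0)]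
  have e : sumHi x ^ 2 - (2 * sqSumHi a x - (a * difLo x) ^ 2) = x ^ 4 * (
    (23/45000) + (-1499/20250000) * s + (157027/1200000000) * z ^ 1 + (-157861/2025000000)
    * z ^ 1 * s + (-29539/8400000000) * z ^ 2 + (333149/1890000000000) * z ^ 2 * s +
    (9/1600000000) * z ^ 3) := by
    rw [hz, hs]; simp only [sqSumHi, difLo, sumHi]; ring
  have := mul_pos (pow_pos hx 4) key
  linarith

theorem lt_sqSumLo {a x : ℝ} (ha : 0 ≤ a) (ha' : a ≤ 0.8) (hx : 0 < x) (hx' : x ≤ 5) :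
    sumLo x ^ 2 < 2 * sqSumLo a x - (a * difHi x) ^ 2 := by
  obtain ⟨z, hz⟩ : ∃ z, z = x ^ 2 := ⟨_, rfl⟩
  have hz0 : 0 ≤ z := by rw [hz]; positivity
  have hz1 : z ≤ 25 := by rw [hz]; nlinarith
  obtain ⟨s, hs⟩ : ∃ s, s = a ^ 2 := ⟨_, rfl⟩
  have hs0 : 0 ≤ s := by rw [hs]; positivity
  have hs1 : 0 ≤ 0.64 - s := by rw [hs]; nlinarith
  have B := fun i j => chordProd_nonneg hz0 hz1 i j
  have key : 0 <
    (16/28125) + (-1501/20250000) * s + (-7903/468750000) * z ^ 1 + (7571/675000000) * z ^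
    1 * s + (143537/262500000000) * z ^ 2 + (247751/810000000000) * z ^ 2 * s +
    (-1521/1000000000000) * z ^ 3 + (-1469/4050000000000) * z ^ 3 * s +
    (-169/81000000000000) * z ^ 4 * s := by
    linarith [mul_nonneg hs0 (B 0 4), mul_nonneg hs1 (B 0 4), mul_nonneg hs0 (B 1 3), mul_nonneg hs1 (B 1 3), mul_nonneg hs0 (B 2 2), mul_nonneg hs1 (B 2 2), mul_nonneg hs0 (B 3 1), mul_nonneg hs1 (B 3 1), mul_nonneg hs0 (B 4 0), mul_nonneg hs1 (B 4 0)]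
  have e : 2 * sqSumLo a x - (a * difHi x) ^ 2 - sumLo x ^ 2 = x ^ 4 * (
    (16/28125) + (-1501/20250000) * s + (-7903/468750000) * z ^ 1 + (7571/675000000) * z ^
    1 * s + (143537/262500000000) * z ^ 2 + (247751/810000000000) * z ^ 2 * s +
    (-1521/1000000000000) * z ^ 3 + (-1469/4050000000000) * z ^ 3 * s +
    (-169/81000000000000) * z ^ 4 * s) := by
    rw [hz, hs]; simp only [sqSumLo, difHi, sumLo]; ring
  have := mul_pos (pow_pos hx 4) key
  linarith

theorem nonneg_of_forall_Ioo {f : ℝ → ℝ} {a t : ℝ} (hat : a < t)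
    (hc : ContinuousWithinAt f (Set.Icc a t) t) (h : ∀ x ∈ Set.Ioo a t, 0 < f x) : 0 ≤ f t := by
  have h1 : Tendsto f (𝓝[Set.Ioo a t] t) (𝓝 (f t)) :=
    hc.mono_left (nhdsWithin_mono _ Set.Ioo_subset_Icc_self)
  have : (𝓝[Set.Ioo a t] t).NeBot := by
    rw [nhdsWithin_Ioo_eq_nhdsLT hat]; infer_instance
  exact ge_of_tendsto h1 (by filter_upwards [self_mem_nhdsWithin] with x hx using (h x hx).le)

theorem tendsto_div_of_hasDerivAt {f f' g g' : ℝ → ℝ} {l : ℝ}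
    (hf : ∀ x, 0 < x → HasDerivAt f (f' x) x) (hg : ∀ x, 0 < x → HasDerivAt g (g' x) x)
    (hg' : ∀ x, 0 < x → g' x ≠ 0) (hfc : ContinuousOn f (Set.Ici 0)) (hgc : ContinuousOn g (Set.Ici 0))
    (hf0 : f 0 = 0) (hg0 : g 0 = 0) (h : Tendsto (fun x => f' x / g' x) (𝓝[>] 0) (𝓝 l)) :
    Tendsto (fun x => f x / g x) (𝓝[>] 0) (𝓝 l) := by
  have lim : ∀ {u : ℝ → ℝ}, ContinuousOn u (Set.Ici 0) → u 0 = 0 → Tendsto u (𝓝[>] 0) (𝓝 0) := by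
    intro u hu hu0
    have := (hu 0 (by simp)).tendsto
    rw [hu0] at this
    exact this.mono_left (nhdsWithin_mono _ Set.Ioi_subset_Ici_self)
  exact HasDerivAt.lhopital_zero_nhdsGT
    (by filter_upwards [self_mem_nhdsWithin] with x hx using hf x hx)
    (by filter_upwards [self_mem_nhdsWithin] with x hx using hg x hx)
    (by filter_upwards [self_mem_nhdsWithin] with x hx using hg' x hx)
    (lim hfc hf0) (lim hgc hg0) h

/-! ### Germs at the common zero and propagation of the enclosures to abscissa 5. -/

namespace CenterPair
variable {a : ℝ} {S D IS ID A1 B1 : ℝ → ℝ}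

/-- The enclosures agree with `S` and `D` to leading order at 0 or vanish there with them, so
starting the bootstrap needs the next coefficient of `S` and the first of `D`. They come from
l'Hôpital, applied along the chain of equations. -/
theorem tendsto_start (h : CenterPair a S D IS ID A1 B1) :
    Tendsto (fun x => (2 * x - S x) / x ^ 3) (𝓝[>] 0) (𝓝 (1 / 36)) ∧
    Tendsto (fun x => D x / x ^ 2) (𝓝[>] 0) (𝓝 (a / 9)) := by
  have ev : ∀ {f g : ℝ → ℝ}, (∀ x, 0 < x → f x = g x) → f =ᶠ[𝓝[>] 0] g := fun h => by
    filter_upwards [self_mem_nhdsWithin] with x hx using h x hx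
  have dp : ∀ (n : ℕ) (x : ℝ), 0 < x → HasDerivAt (fun x : ℝ => x ^ n) (n * x ^ (n - 1)) x :=
    fun n x _ => hasDerivAt_pow n x
  have np : ∀ (n : ℕ), n ≠ 0 → ∀ (x : ℝ), 0 < x → (n : ℝ) * x ^ (n - 1) ≠ 0 := fun n hn x hx => by
    have : (n : ℝ) ≠ 0 := by exact_mod_cast hn
    positivity
  have cp : ∀ n : ℕ, ContinuousOn (fun x : ℝ => x ^ n) (Set.Ici 0) := fun n => by fun_prop
  have lD : Tendsto D (𝓝[>] 0) (𝓝 0) := by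
    have := (h.cD 0 (by simp)).tendsto
    rw [h.D0] at this
    exact this.mono_left (nhdsWithin_mono _ Set.Ioi_subset_Ici_self)
  have l1 : Tendsto (fun x => IS x / x ^ 2) (𝓝[>] 0) (𝓝 1) := by
    refine tendsto_div_of_hasDerivAt h.dIS (dp 2) (np 2 two_ne_zero) h.cIS (cp 2) h.IS0 (by simp) ?_
    have := h.lim.div_const 2
    norm_num at this
    refine this.congr' (ev fun x hx => ?_)
    push_cast; field_simp
  have l2 : Tendsto (fun x => ID x / x ^ 1) (𝓝[>] 0) (𝓝 0) := by
    refine tendsto_div_of_hasDerivAt h.dID (dp 1) (np 1 one_ne_zero) h.cID (cp 1) h.ID0 (by simp) ?_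
    simpa using lD
  have l3 : Tendsto (fun x => B1 x / x ^ 2) (𝓝[>] 0) (𝓝 (2 * a / 3)) := by
    refine tendsto_div_of_hasDerivAt h.dB1 (dp 2) (np 2 two_ne_zero) h.cB1 (cp 2) h.B10 (by simp) ?_
    have := ((l2.sub lD).add (h.lim.const_mul a)).const_mul (1 / 3)
    rw [show 1 / 3 * (0 - 0 + a * 2) = 2 * a / 3 by ring] at this
    refine this.congr' (ev fun x hx => ?_)
    push_cast; field_simp
  have l4 : Tendsto (fun x => (S x * D x) / x ^ 3) (𝓝[>] 0) (𝓝 (2 * a / 9)) := by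
    refine tendsto_div_of_hasDerivAt h.dB (dp 3) (np 3 three_ne_zero) (h.cS.mul h.cD) (cp 3)
      (by simp [h.S0]) (by simp) ?_
    have := l3.div_const 3
    rw [show 2 * a / 3 / 3 = 2 * a / 9 by ring] at this
    refine this.congr' (ev fun x hx => ?_)
    push_cast; field_simp
  have l5 : Tendsto (fun x => D x / x ^ 2) (𝓝[>] 0) (𝓝 (a / 9)) := by
    have := l4.div h.lim two_ne_zero
    rw [show 2 * a / 9 / 2 = a / 9 by ring] at this
    refine this.congr' (ev fun x hx => ?_)
    have : S x ≠ 0 := ((abs_nonneg _).trans_lt (h.pos x hx)).ne'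
    simp only [Pi.div_apply]
    field_simp
  have l6 : Tendsto (fun x => (A1 x - 4 * x) / x ^ 3) (𝓝[>] 0) (𝓝 (2 / 9 * (1 - 2 + a * (a / 9)))) := by
    refine tendsto_div_of_hasDerivAt (fun x hx => (h.dA1 x hx).sub ((hasDerivAt_id' x).const_mul 4))
      (dp 3) (np 3 three_ne_zero) (h.cA1.sub (by fun_prop)) (cp 3) (by simp [h.A10]) (by simp) ?_
    have := ((l1.sub h.lim).add (l5.const_mul a)).const_mul (2 / 9)
    refine this.congr' (ev fun x hx => ?_)
    push_cast; field_simp; ring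
  have cA : ContinuousOn (fun x => (S x ^ 2 + D x ^ 2) / 2) (Set.Ici 0) := by
    have := h.cS; have := h.cD; fun_prop
  have l7 : Tendsto (fun x => ((S x ^ 2 + D x ^ 2) / 2 - 2 * x ^ 2) / x ^ 4) (𝓝[>] 0)
      (𝓝 (2 / 9 * (1 - 2 + a * (a / 9)) / 4)) := by
    refine tendsto_div_of_hasDerivAt (fun x hx => (h.dA x hx).sub ((hasDerivAt_pow 2 x).const_mul 2))
      (dp 4) (np 4 four_ne_zero) (cA.sub (by fun_prop)) (cp 4) (by simp [h.S0, h.D0]) (by simp) ?_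
    refine (l6.div_const 4).congr' (ev fun x hx => ?_)
    push_cast; field_simp; ring
  refine ⟨?_, l5⟩
  -- `2x - S = (4x² - S²)/(2x + S)` with `S² = 2 · (S² + D²)/2 - D²`. The contributions with `a²`
  -- cancel, so the coefficient `1/36` does not depend on `a`.
  have := ((l7.const_mul (-2)).add (l5.pow 2)).div (h.lim.const_add 2) (by norm_num)
  rw [show (-2 * (2 / 9 * (1 - 2 + a * (a / 9)) / 4) + (a / 9) ^ 2) / (2 + 2) = 1 / 36 by ring] at this
  refine this.congr' (ev fun x hx => ?_)
  have : 0 < S x := (abs_nonneg _).trans_lt (h.pos x hx)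
  have : 2 + S x / x ≠ 0 := by positivity
  simp only [Pi.div_apply]
  rw [div_eq_iff this]
  field_simp
  ring

/-- Bootstrap on the smallest of four margins. As long as the enclosures hold, the integrated bounds
hold up to and including `t`, and the strict polynomial inequalities exclude contact at `t`. -/
theorem bounds (h : CenterPair a S D IS ID A1 B1) (ha : 0 < a) (ha' : a ≤ 0.8) :
    ∀ x ∈ Set.Ioc 0 5, CenterBounds a x (S x) (D x) := by
  obtain ⟨s1, s2⟩ := h.tendsto_start
  set H : ℝ → ℝ := fun x => min (min (sumHi x - S x) (S x - sumLo x))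
    (min (a * difHi x - D x) (D x - a * difLo x)) with hH
  have cps : Continuous sumHi ∧ Continuous sumLo ∧ Continuous difHi ∧ Continuous difLo := by
    unfold sumHi sumLo difHi difLo
    exact ⟨by fun_prop, by fun_prop, by fun_prop, by fun_prop⟩
  obtain ⟨p1, p2, p3, p4⟩ := cps
  have cS : ContinuousOn S (Set.Icc 0 5) := h.cS.mono Set.Icc_subset_Ici_self
  have cD : ContinuousOn D (Set.Icc 0 5) := h.cD.mono Set.Icc_subset_Ici_self
  have hHc : ContinuousOn H (Set.Icc 0 5) := by fun_prop
  have split : ∀ x, 0 < H x → CenterBounds a x (S x) (D x) := fun x hx => by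
    simp only [hH, lt_min_iff, sub_pos] at hx
    exact ⟨hx.1.1.le, hx.1.2.le, hx.2.1.le, hx.2.2.le⟩
  have main := forall_pos_of_bootstrap (h := H) hHc
    (by
      have q1 := s1.eventually_lt_const (show (1 / 36 : ℝ) < 0.0279 by norm_num)
      have q2 := s1.eventually_const_lt (show (0.0277 : ℝ) < 1 / 36 by norm_num)
      have q3 := s2.eventually_lt_const (show a / 9 < a / 9 * 1.001 by linarith)
      have q4 := s2.eventually_const_lt (show a / 9 * 0.999 < a / 9 by linarith)
      have q5 : Set.Ioo (0:ℝ) 0.1 ∈ 𝓝[>] (0:ℝ) := Ioo_mem_nhdsGT (by norm_num)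
      filter_upwards [q1, q2, q3, q4, q5] with x q1 q2 q3 q4 q5
      obtain ⟨hx, hx'⟩ := q5
      rw [div_lt_iff₀ (by positivity)] at q1 q3
      rw [lt_div_iff₀ (by positivity)] at q2 q4
      have hx2 : x ^ 2 ≤ 0.01 := by nlinarith
      have hx5 : x ^ 5 ≤ 0.01 * x ^ 3 := by
        have := mul_le_mul_of_nonneg_right hx2 (show 0 ≤ x ^ 3 by positivity)
        linarith
      have hx50 : 0 ≤ x ^ 5 := by positivity
      have hax2 : 0 < a * x ^ 2 := by positivity
      have hx4 : a * x ^ 4 ≤ 0.01 * (a * x ^ 2) := by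
        have := mul_le_mul_of_nonneg_right hx2 hax2.le
        linarith
      have hx4' : 0 ≤ a * x ^ 4 := by positivity
      have hx6 : a * x ^ 6 ≤ 0.01 * (a * x ^ 4) := by
        have := mul_le_mul_of_nonneg_right hx2 hx4'
        linarith
      simp only [hH, lt_min_iff, sub_pos, sumHi, sumLo, difHi, difLo]
      have : 0 < x ^ 3 := by positivity
      refine ⟨⟨by linarith, by linarith⟩, by linarith, by linarith⟩)
    (by
      intro t ht hprev
      obtain ⟨ht0, ht5⟩ := ht
      have hb1 := h.bounds1 ha (fun x hx => split x (hprev x hx)) t ⟨ht0, le_rfl⟩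
      have hHt : 0 ≤ H t := nonneg_of_forall_Ioo ht0
        ((hHc t ⟨ht0.le, ht5⟩).mono (Set.Icc_subset_Icc_right ht5)) hprev
      simp only [hH, le_min_iff, sub_nonneg] at hHt
      obtain ⟨⟨e1, e2⟩, e3, e4⟩ := hHt
      have hS : 0 < S t := (abs_nonneg _).trans_lt (h.pos t ht0)
      have z2 : t ^ 2 ≤ 25 := by nlinarith
      have hdl : 0 < difLo t := by
        have : difLo t = t ^ 2 * (499/4500 - 113/300000 * t ^ 2) := by unfold difLo; ring
        rw [this]
        apply mul_pos (by positivity); linarith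
      have hsl : 0 < sumLo t := by
        have : sumLo t = t * (2 - 349/12500 * t ^ 2 + 39/1000000 * t ^ 4) := by unfold sumLo; ring
        rw [this]
        apply mul_pos (by positivity)
        have : 0 ≤ t ^ 4 := by positivity
        linarith
      have hD0 : 0 < D t := (mul_pos ha hdl).trans_le e4
      simp only [hH, lt_min_iff, sub_pos]
      have g1 := prodHi_lt ht0 ht5
      have g2 := lt_prodLo ht0 ht5
      have g3 := sqSumHi_lt ha.le ha' ht0 ht5
      have g4 := lt_sqSumLo ha.le ha' ht0 ht5
      have f1 := hb1.A_le
      have f2 := hb1.le_A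
      have f3 := hb1.B_le
      have f4 := hb1.le_B
      have d1 : (a * difLo t) ^ 2 ≤ D t ^ 2 := by
        have := (mul_pos ha hdl).le
        gcongr
      have d2 : D t ^ 2 ≤ (a * difHi t) ^ 2 := by gcongr
      refine ⟨⟨?_, ?_⟩, ?_, ?_⟩
      · by_contra hc
        push Not at hc
        have : sumHi t ^ 2 ≤ S t ^ 2 := by
          have : 0 ≤ sumHi t := hS.le.trans e1
          gcongr
        linarith
      · by_contra hc
        push Not at hc
        have : S t ^ 2 ≤ sumLo t ^ 2 := by gcongr
        linarith
      · by_contra hc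
        push Not at hc
        have k1 : sumLo t * (a * difHi t) ≤ S t * D t := by
          have : 0 ≤ a * difHi t := hD0.le.trans e3
          gcongr
        have k2 := mul_lt_mul_of_pos_left g1 ha
        linarith
      · by_contra hc
        push Not at hc
        have k1 : S t * D t ≤ sumHi t * (a * difLo t) := by
          have : 0 ≤ sumHi t := hS.le.trans e1
          gcongr
        have k2 := mul_lt_mul_of_pos_left g2 ha
        linarith)
  exact fun x hx => split x (main x hx)

theorem bounds1' (h : CenterPair a S D IS ID A1 B1) (ha : 0 < a) (ha' : a ≤ 0.8) :
    ∀ x ∈ Set.Ioc 0 5, CenterBounds1 a x (S x) (D x) (IS x) (ID x) (A1 x) (B1 x) :=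
  h.bounds1 ha fun x hx => h.bounds ha ha' x ⟨hx.1, hx.2.le⟩

end CenterPair

/-- The integral of `(x + n x² - m x³ - k x⁴)³`. -/
noncomputable def cubePoly (n m k t : ℝ) : ℝ :=
  1 / 4 * t ^ 4 + 3 * n / 5 * t ^ 5 + (3 * n ^ 2 - 3 * m) / 6 * t ^ 6
    + (n ^ 3 - 6 * n * m - 3 * k) / 7 * t ^ 7 + (3 * m ^ 2 - 3 * n ^ 2 * m - 6 * n * k) / 8 * t ^ 8
    + (3 * n * m ^ 2 - 3 * n ^ 2 * k + 6 * m * k) / 9 * t ^ 9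
    + (3 * k ^ 2 - m ^ 3 + 6 * n * m * k) / 10 * t ^ 10 + (3 * n * k ^ 2 - 3 * m ^ 2 * k) / 11 * t ^ 11
    + (-3 * m * k ^ 2) / 12 * t ^ 12 + (-k ^ 3) / 13 * t ^ 13

theorem hasDerivAt_cubePoly (n m k x : ℝ) :
    HasDerivAt (cubePoly n m k) ((x + n * x ^ 2 - m * x ^ 3 - k * x ^ 4) ^ 3) x := by
  refine (((((((((((hasDerivAt_pow 4 x).const_mul _).add ((hasDerivAt_pow 5 x).const_mul _)).add
    ((hasDerivAt_pow 6 x).const_mul _)).add ((hasDerivAt_pow 7 x).const_mul _)).add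
    ((hasDerivAt_pow 8 x).const_mul _)).add ((hasDerivAt_pow 9 x).const_mul _)).add
    ((hasDerivAt_pow 10 x).const_mul _)).add ((hasDerivAt_pow 11 x).const_mul _)).add
    ((hasDerivAt_pow 12 x).const_mul _)).add ((hasDerivAt_pow 13 x).const_mul _)).congr_deriv ?_
  push_cast; ring

/-- Lower bound for an integral of a cube. -/
theorem cubePoly_le_of_hasDerivAt {f p : ℝ → ℝ} {t n m k : ℝ} (ht : 0 ≤ t)
    (hc : ContinuousOn f (Set.Icc 0 t)) (h0 : f 0 = 0)
    (hd : ∀ x ∈ Set.Ioo 0 t, HasDerivAt f (p x ^ 3) x)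
    (h : ∀ x ∈ Set.Ioo 0 t, x + n * x ^ 2 - m * x ^ 3 - k * x ^ 4 ≤ p x) :
    cubePoly n m k t ≤ f t := by
  have := sub_le_sub_of_hasDerivAt ht
    (fun x _ => (hasDerivAt_cubePoly n m k x).continuousAt.continuousWithinAt) hc
    (fun x _ => hasDerivAt_cubePoly n m k x) hd (fun x hx => (Odd.pow_le_pow (by decide)).2 (h x hx))
  have e : cubePoly n m k 0 = 0 := by simp [cubePoly]
  linarith

/-! ### Two oppositely shifted half profiles as a centred pair. -/

section pair
variable {a : ℝ} {y y1 J v v1 K : ℝ → ℝ}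

/-- Shifting the zeros `-a` and `a` to the origin makes sum and difference directly comparable; the
shifts survive only as the terms `a D` and `a S`. The subtracted 6 is the sum of the two initial
values `J = K = 3`. -/
theorem HalfProfile.centerPair (hy : HalfProfile (-a) 1 y y1 J) (hv : HalfProfile a 1 v v1 K) :
    CenterPair a (fun x => y (x - a) + v (x + a)) (fun x => y (x - a) - v (x + a))
      (fun x => J (x - a) + K (x + a) - 6) (fun x => J (x - a) - K (x + a))
      (fun x => 2 * (y (x - a) * y1 (x - a) + v (x + a) * v1 (x + a)))
      (fun x => 2 * (y (x - a) * y1 (x - a) - v (x + a) * v1 (x + a))) := by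
  have hx1 : ∀ x, 0 < x → -a < x - a := fun x hx => by linarith
  have hx2 : ∀ x, 0 < x → a < x + a := fun x hx => by linarith
  have s1 : ∀ {f : ℝ → ℝ} {f' x : ℝ}, HasDerivAt f f' (x - a) → HasDerivAt (fun x => f (x - a)) f' x :=
    fun h => HasDerivAt.comp_sub_const _ _ h
  have s2 : ∀ {f : ℝ → ℝ} {f' x : ℝ}, HasDerivAt f f' (x + a) → HasDerivAt (fun x => f (x + a)) f' x :=
    fun h => HasDerivAt.comp_add_const _ _ h
  have c1 : ∀ {f : ℝ → ℝ}, ContinuousOn f (Set.Ici (-a)) →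
      ContinuousOn (fun x => f (x - a)) (Set.Ici 0) := fun h =>
    h.comp (by fun_prop) (fun x hx => by simp only [Set.mem_Ici] at hx ⊢; linarith)
  have c2 : ∀ {f : ℝ → ℝ}, ContinuousOn f (Set.Ici a) →
      ContinuousOn (fun x => f (x + a)) (Set.Ici 0) := fun h =>
    h.comp (by fun_prop) (fun x hx => by simp only [Set.mem_Ici] at hx ⊢; linarith)
  have dy := fun x hx => s1 (hy.dy _ (hx1 x hx))
  have dv := fun x hx => s2 (hv.dy _ (hx2 x hx))
  have dJ := fun x hx => s1 (hy.dJ _ (hx1 x hx))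
  have dK := fun x hx => s2 (hv.dJ _ (hx2 x hx))
  have dp := fun x hx => s1 (hy.dflux (hx1 x hx))
  have dq := fun x hx => s2 (hv.dflux (hx2 x hx))
  have cy := c1 hy.cy
  have cv := c2 hv.cy
  have cy1 := c1 hy.cy1
  have cv1 := c2 hv.cy1
  have e1 : (0:ℝ) - a = -a := zero_sub a
  have e2 : (0:ℝ) + a = a := zero_add a
  refine ⟨fun x hx => ?_, fun x hx => ((dJ x hx).add (dK x hx)).sub_const 6,
    fun x hx => (dJ x hx).sub (dK x hx), fun x hx => ?_, fun x hx => ?_, fun x hx => ?_,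
    fun x hx => ?_, cy.add cv, cy.sub cv, ((c1 hy.cJ).add (c2 hv.cJ)).sub continuousOn_const,
    (c1 hy.cJ).sub (c2 hv.cJ), ((cy.mul cy1).add (cv.mul cv1)).const_mul 2,
    ((cy.mul cy1).sub (cv.mul cv1)).const_mul 2, ?_, ?_, ?_, ?_, ?_, ?_, ?_⟩
  · have p1 := hy.pos _ (hx1 x hx)
    have p2 := hv.pos _ (hx2 x hx)
    rw [abs_lt]; constructor <;> linarith
  · refine (((((dy x hx).add (dv x hx)).pow 2).add (((dy x hx).sub (dv x hx)).pow 2)).div_const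
      2).congr_deriv ?_
    simp only [Pi.add_apply, Pi.sub_apply]; push_cast; ring
  · refine (((dp x hx).add (dq x hx)).const_mul 2).congr_deriv ?_
    ring
  · refine (((dy x hx).add (dv x hx)).mul ((dy x hx).sub (dv x hx))).congr_deriv ?_
    simp only [Pi.add_apply, Pi.sub_apply]; ring
  · refine (((dp x hx).sub (dq x hx)).const_mul 2).congr_deriv ?_
    ring
  · simp [e1, e2, hy.y_start, hv.y_start]
  · simp [e1, e2, hy.y_start, hv.y_start]
  · simp only [e1, e2, hy.J_start, hv.J_start]; norm_num
  · simp [e1, e2, hy.J_start, hv.J_start]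
  · simp [e1, e2, hy.y_start, hv.y_start]
  · simp [e1, e2, hy.y_start, hv.y_start]
  · refine tendsto_div_of_hasDerivAt (fun x hx => (dy x hx).add (dv x hx))
      (fun x _ => hasDerivAt_id' x) (fun x _ => one_ne_zero) (cy.add cv) continuousOn_id
      (by simp [e1, e2, hy.y_start, hv.y_start]) rfl ?_
    have := ((cy1.add cv1) 0 (by simp)).tendsto
    simp only [Pi.add_apply, e1, e2, hy.y1_start, hv.y1_start, one_add_one_eq_two] at this
    simp only [div_one]
    exact this.mono_left (nhdsWithin_mono _ Set.Ioi_subset_Ici_self)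

theorem HalfProfile.cubeInt_lower (hy : HalfProfile (-a) 1 y y1 J) (hv : HalfProfile a 1 v v1 K)
    (ha : 0 < a) (ha' : a ≤ 0.8) :
    73.07 + 55.79 * a + 15.59 * a ^ 2 ≤ cubeInt y y1 J (5 - a) ∧
    46.09 - 29.359 * a + 6.73 * a ^ 2 - 0.5422 * a ^ 3 ≤ cubeInt v v1 K (4.2 + a) := by
  have hb := (hy.centerPair hv).bounds ha ha'
  have a3 : 0 ≤ a ^ 3 := by positivity
  constructor
  -- `y = (S + D)/2`: the coefficients are half those of `sumLo + a · difLo`, with the positive `x⁵`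
  -- term dropped.
  · have := cubePoly_le_of_hasDerivAt (f := fun x => cubeInt y y1 J (x - a)) (p := fun x => y (x - a))
      (t := 5) (n := 0.998 / 18 * a) (m := 0.01396) (k := 0.00339 / 18 * a) (by norm_num)
      (hy.continuousOn_cubeInt.comp (by fun_prop) (fun x hx => by
        simp only [Set.mem_Ici]; linarith [hx.1]))
      (by simp only [zero_sub]; exact hy.cubeInt_start)
      (fun x hx => HasDerivAt.comp_sub_const _ _ (hy.dcubeInt (by linarith [hx.1])))
      (fun x hx => by
        have b := hb x ⟨hx.1, hx.2.le⟩
        have b1 := b.le_S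
        have b2 := b.le_D
        simp only [sumLo, difLo] at b1 b2
        have : 0 ≤ x ^ 5 := pow_nonneg hx.1.le 5
        linarith)
    refine le_trans ?_ this
    have := sq_nonneg a
    norm_num [cubePoly]
    linarith
  -- Now `v = (S - D)/2`, so the upper bound for `D` is used. Stopping at `4.2` keeps the abscissa
  -- `4.2 + a` at most 5 for `a ≤ 0.8`.
  · have := cubePoly_le_of_hasDerivAt (f := fun x => cubeInt v v1 K (x + a)) (p := fun x => v (x + a))
      (t := 4.2) (n := -(1.002 / 18 * a)) (m := 0.01396) (k := -(0.00113 / 18 * a)) (by norm_num)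
      (hv.continuousOn_cubeInt.comp (by fun_prop) (fun x hx => by
        simp only [Set.mem_Ici]; linarith [hx.1]))
      (by simp only [zero_add]; exact hv.cubeInt_start)
      (fun x hx => HasDerivAt.comp_add_const _ _ (hv.dcubeInt (by linarith [hx.1])))
      (fun x hx => by
        have b := hb x ⟨hx.1, by linarith [hx.2]⟩
        have b1 := b.le_S
        have b2 := b.D_le
        simp only [sumLo, difHi] at b1 b2
        have : 0 ≤ x ^ 5 := pow_nonneg hx.1.le 5
        have : 0 ≤ a * x ^ 6 := mul_nonneg ha.le (pow_nonneg hx.1.le 6)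
        linarith)
    refine le_trans ?_ this
    have := sq_nonneg a
    norm_num [cubePoly]
    linarith

theorem HalfProfile.integral_upper (hy : HalfProfile (-a) 1 y y1 J) (hv : HalfProfile a 1 v v1 K)
    (ha : 0 < a) (ha' : a ≤ 0.8) :
    J (5 - a) ≤ 13.44 + 2.28 * a ∧ K (4.2 + a) ≤ 10.78 - 1.32 * a := by
  have hb := (hy.centerPair hv).bounds1' ha ha'
  constructor
  · have b1 := (hb 5 (by norm_num)).IS_le
    have b2 := (hb 5 (by norm_num)).ID_le
    simp only [sumIntHi, difIntHi] at b1 b2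
    norm_num at b1 b2
    linarith
  · have b1 := (hb 4.2 (by norm_num)).IS_le
    have b2 := (hb 4.2 (by norm_num)).le_ID
    simp only [sumIntHi, difIntLo] at b1 b2
    rw [add_comm (4.2:ℝ)] at b1 b2 ⊢
    norm_num at b1 b2 ⊢
    linarith

end pair

/-! ### Ranges and slopes from the energy -/

/-- `(1 - pc)² (1 + 2pc) ≥ 0` replaces the constant `I` by `I (3p²c² - 2p³c³)`, tangent to it at `c
= 1/p`. Then `c²` factors out and a discriminant in `c` decides; `p` is free. -/
theorem cubic_energy_le_quartic {J I T c p k : ℝ} (hc : 0 < c) (hp : 0 ≤ p) (hI : 0 ≤ I) (hk : 0 < k)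
    (h : 0 ≤ 3 * k * (I * p ^ 2 - J) - (I * p ^ 3 - T) ^ 2) :
    3 * J * c ^ 2 - I - 2 * T * c ^ 3 ≤ k * c ^ 4 := by
  have h1 : 0 ≤ I * ((1 - p * c) ^ 2 * (1 + 2 * (p * c))) := by positivity
  have h2 : 0 ≤ k * (k * c ^ 2 + 2 * (T - I * p ^ 3) * c + 3 * (I * p ^ 2 - J)) := by
    have := sq_nonneg (k * c + (T - I * p ^ 3))
    linarith
  have h3 := mul_nonneg (sq_nonneg c) ((mul_nonneg_iff_of_pos_left hk).1 h2)
  linarith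

theorem cubic_energy_le_quadratic {J I T c p b : ℝ} (hc : 0 < c) (hp : 0 ≤ p) (hI : 0 ≤ I)
    (h1 : 0 ≤ T - I * p ^ 3) (h2 : 0 ≤ I * p ^ 2 - J + 3 * b) :
    3 * J * c ^ 2 - I - 2 * T * c ^ 3 ≤ 9 * b * c ^ 2 := by
  have h3 : 0 ≤ I * ((1 - p * c) ^ 2 * (1 + 2 * (p * c))) := by positivity
  have h4 := mul_nonneg (pow_pos hc 3).le h1
  have h5 := mul_nonneg (sq_nonneg c) h2
  linarith

namespace ProfileOn
variable {T X : ℝ} {y y1 J : ℝ → ℝ} {j i : ℝ}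

theorem energy_le_of_bounds (hJ : J X ≤ j) (hI : i ≤ cubeInt y y1 J X) (c : ℝ) :
    energy y y1 J c X ≤ 3 * j * c ^ 2 - i - 2 * X * c ^ 3 := by
  have := mul_le_mul_of_nonneg_right hJ (sq_nonneg c)
  unfold energy
  linarith

theorem slope_sq_le_cubic (h : ProfileOn T y y1 J) (hX : T < X) (hJ : J X ≤ j)
    (hI : i ≤ cubeInt y y1 J X) {x : ℝ} (hx : X ≤ x) :
    9 * (y x * y1 x) ^ 2 ≤ 3 * j * y x ^ 2 - i - 2 * X * y x ^ 3 :=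
  (h.slope_sq_le_energy hX hx).trans (energy_le_of_bounds hJ hI _)

/-- Later values `c` satisfy `3 j c² - i - 2 X c³ ≥ 0`. This cubic increases up to `c = j/X` and
decreases afterwards, so negativity at one point `l` on the left and one point `u` on the right
confines `c`. -/
theorem range_of_energy (h : ProfileOn T y y1 J) (hX : T < X) (hX0 : 0 < X) (hJ : J X ≤ j)
    (hI : i ≤ cubeInt y y1 J X) {l u : ℝ} (hl : 0 ≤ j - X * l) (hu : 0 ≤ X * u - j)
    (hu0 : 0 < u)
    (hl' : 0 < i + 2 * X * l ^ 3 - 3 * j * l ^ 2) (hu' : 0 < i + 2 * X * u ^ 3 - 3 * j * u ^ 2)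
    {x : ℝ} (hx : X ≤ x) : l ≤ y x ∧ y x ≤ u := by
  have hc := h.pos x (hX.trans_le hx)
  have hE : 0 ≤ 3 * j * y x ^ 2 - i - 2 * X * y x ^ 3 :=
    le_trans (by positivity) (h.slope_sq_le_cubic hX hJ hI hx)
  constructor
  · by_contra hlt
    push Not at hlt
    have k1 : 0 ≤ (l - y x) * (3 * (l + y x)) * (j - X * l) :=
      mul_nonneg (mul_nonneg (by linarith) (by linarith)) hl
    have k2 : 0 ≤ X * (l - y x) * ((l - y x) * (l + 2 * y x)) :=
      mul_nonneg (mul_nonneg hX0.le (by linarith)) (mul_nonneg (by linarith) (by linarith))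
    linarith
  · by_contra hlt
    push Not at hlt
    have k1 : 0 ≤ (y x - u) * (3 * (u + y x)) * (X * u - j) :=
      mul_nonneg (mul_nonneg (by linarith) (by linarith)) hu
    have k2 : 0 ≤ X * (y x - u) * ((y x - u) * (u + 2 * y x)) :=
      mul_nonneg (mul_nonneg hX0.le (by linarith)) (mul_nonneg (by linarith) (by linarith))
    linarith

theorem slope_le_mul (h : ProfileOn T y y1 J) (hX : T < X) (hJ : J X ≤ j)
    (hI : i ≤ cubeInt y y1 J X) (hi : 0 ≤ i) {p κ : ℝ} (hp : 0 ≤ p) (hκ : 0 < κ)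
    (hd : 0 ≤ 3 * (9 * κ ^ 2) * (i * p ^ 2 - j) - (i * p ^ 3 - X) ^ 2) {x : ℝ} (hx : X ≤ x) :
    |y1 x| ≤ κ * y x := by
  have hc := h.pos x (hX.trans_le hx)
  have h1 := (h.slope_sq_le_cubic hX hJ hI hx).trans
    (cubic_energy_le_quartic hc hp hi (by positivity) hd)
  refine abs_le_of_sq_le_sq ?_ (by positivity)
  have : 9 * y x ^ 2 * y1 x ^ 2 ≤ 9 * y x ^ 2 * (κ * y x) ^ 2 := by linarith
  exact le_of_mul_le_mul_left this (by positivity)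

theorem slope_le (h : ProfileOn T y y1 J) (hX : T < X) (hJ : J X ≤ j)
    (hI : i ≤ cubeInt y y1 J X) (hi : 0 ≤ i) {p β : ℝ} (hp : 0 ≤ p) (hβ : 0 < β)
    (h1 : 0 ≤ X - i * p ^ 3) (h2 : 0 ≤ i * p ^ 2 - j + 3 * β ^ 2) {x : ℝ} (hx : X ≤ x) :
    |y1 x| ≤ β := by
  have hc := h.pos x (hX.trans_le hx)
  have h1 := (h.slope_sq_le_cubic hX hJ hI hx).trans (cubic_energy_le_quadratic hc hp hi h1 h2)
  refine abs_le_of_sq_le_sq ?_ hβ.le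
  have : 9 * y x ^ 2 * y1 x ^ 2 ≤ 9 * y x ^ 2 * β ^ 2 := by linarith
  exact le_of_mul_le_mul_left this (by positivity)

theorem energy_le_pow (h : ProfileOn T y y1 J) (hX : T < X) (hX5 : X ≤ 5) (hJ : J X ≤ j)
    (hI : i ≤ cubeInt y y1 J X) (hi : 0 ≤ i) {p m : ℝ} (hp : 0 ≤ p)
    (hd : 0 ≤ 3 * 0.359 * (i * p ^ 2 - j) - (i * p ^ 3 - (X + 0.889)) ^ 2)
    (hm : 1.2 ≤ m) (hm' : m ≤ 1.52) : energy y y1 J (m ^ 3) 5 ≤ 2 * m ^ 10 := by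
  have hm0 : 0 < m := by linarith
  have e1 := h.energy_antitone (c := m ^ 3) (by positivity) hX hX5
  have e2 := energy_le_of_bounds hJ hI (m ^ 3)
  have e3 := cubic_energy_le_quartic (c := m ^ 3) (T := X + 0.889) (by positivity) hp hi
    (by norm_num) hd
  -- The energy is at most `0.359 m¹² + 2 · 0.889 m⁹`, and this inequality turns it into `2 m¹⁰`.
  -- The expression is concave in `m` and slightly positive at `1.2` and at `1.52`.
  have e4 : 0 ≤ m - 0.889 - 0.1795 * m ^ 3 := by
    have k := mul_nonneg (mul_nonneg (sub_nonneg.2 hm) (sub_nonneg.2 hm'))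
      (show 0 ≤ m + 2.72 by linarith)
    linarith
  have e5 := mul_nonneg (pow_pos hm0 9).le e4
  linarith

end ProfileOn

/-! ### Explicit ranges, slopes and energies of the two shifted profiles. -/

section pair
variable {a : ℝ} {y y1 J v v1 K : ℝ → ℝ}

/-- The energy criteria are applied at abscissa `5 - a`, where the enclosures give `J` and the
integral of the cube. The tangency parameter `p` is taken polynomial in `a`, so every criterion is a
polynomial inequality on `[0, 0.8]`. -/
theorem HalfProfile.near_bounds (hy : HalfProfile (-a) 1 y y1 J) (hv : HalfProfile a 1 v v1 K)
    (ha : 0 < a) (ha' : a ≤ 0.8) :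
    (∀ x, 5 - a ≤ x → (1.75 + 0.4 * a ≤ y x ∧ y x ≤ 3.45 + 1.75 * a) ∧ |y1 x| ≤ 0.31 * y x ∧
      |y1 x| ≤ 0.88) ∧
    ∀ m, 1.2 ≤ m → m ≤ 1.52 → energy y y1 J (m ^ 3) 5 ≤ 2 * m ^ 10 := by
  have hI := (hy.cubeInt_lower hv ha ha').1
  have hJ := (hy.integral_upper hv ha ha').1
  have hT : -a < 5 - a := by linarith
  have hi : 0 ≤ 73.07 + 55.79 * a + 15.59 * a ^ 2 := by positivity
  have B := fun i j => chordProd_nonneg ha.le ha' i j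
  have q1 : 0 ≤ 3 * (9 * 0.31 ^ 2) * ((73.07 + 55.79 * a + 15.59 * a ^ 2) * (0.45 - 0.11 * a) ^ 2
      - (13.44 + 2.28 * a)) - ((73.07 + 55.79 * a + 15.59 * a ^ 2) * (0.45 - 0.11 * a) ^ 3
      - (5 - a)) ^ 2 := by
    linarith [B 0 10, B 1 9, B 2 8, B 3 7, B 4 6, B 5 5, B 6 4, B 7 3, B 8 2, B 9 1, B 10 0]
  have q2 : 0 ≤ 3 * 0.359 * ((73.07 + 55.79 * a + 15.59 * a ^ 2) * (0.45 - 0.11 * a) ^ 2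
      - (13.44 + 2.28 * a)) - ((73.07 + 55.79 * a + 15.59 * a ^ 2) * (0.45 - 0.11 * a) ^ 3
      - (5 - a + 0.889)) ^ 2 := by
    linarith [B 0 10, B 1 9, B 2 8, B 3 7, B 4 6, B 5 5, B 6 4, B 7 3, B 8 2, B 9 1, B 10 0]
  have q3 : 0 ≤ 5 - a - (73.07 + 55.79 * a + 15.59 * a ^ 2) * (0.401 - 0.113 * a + 0.014 * a ^ 2) ^ 3 := by
    linarith [B 0 8, B 1 7, B 2 6, B 3 5, B 4 4, B 5 3, B 6 2, B 7 1, B 8 0]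
  have q4 : 0 ≤ (73.07 + 55.79 * a + 15.59 * a ^ 2) * (0.401 - 0.113 * a + 0.014 * a ^ 2) ^ 2
      - (13.44 + 2.28 * a) + 3 * 0.88 ^ 2 := by
    linarith [B 0 6, B 1 5, B 2 4, B 3 3, B 4 2, B 5 1, B 6 0]
  have hp : 0 ≤ 0.45 - 0.11 * a := by linarith
  have hp' : 0 ≤ 0.401 - 0.113 * a + 0.014 * a ^ 2 := by
    have := sq_nonneg a
    linarith
  refine ⟨fun x hx => ⟨?_, ?_, ?_⟩, fun m hm hm' => ?_⟩
  · refine hy.toProfileOn.range_of_energy hT (by linarith) hJ hI ?_ ?_ (by linarith)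
      ?_ ?_ hx
    · linarith [B 0 2, B 1 1, B 2 0]
    · linarith [B 0 2, B 1 1, B 2 0]
    · linarith [B 0 4, B 1 3, B 2 2, B 3 1, B 4 0]
    · linarith [B 0 4, B 1 3, B 2 2, B 3 1, B 4 0]
  · exact hy.toProfileOn.slope_le_mul hT hJ hI hi hp (by norm_num) q1 hx
  · exact hy.toProfileOn.slope_le hT hJ hI hi hp' (by norm_num) q3 q4 hx
  · exact hy.toProfileOn.energy_le_pow hT (by linarith) hJ hI hi hp q2 hm hm'

theorem HalfProfile.far_bounds (hy : HalfProfile (-a) 1 y y1 J) (hv : HalfProfile a 1 v v1 K)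
    (ha : 0 < a) (ha' : a ≤ 0.8) :
    (∀ x, 4.2 + a ≤ x → (1.5 - 0.33 * a ≤ v x ∧ v x ≤ 3.4 - 1.0 * a) ∧ |v1 x| ≤ 0.37 * v x ∧
      |v1 x| ≤ 0.72) ∧
    ∀ m, 1.2 ≤ m → m ≤ 1.52 → energy v v1 K (m ^ 3) 5 ≤ 2 * m ^ 10 := by
  have hI := (hy.cubeInt_lower hv ha ha').2
  have hJ := (hy.integral_upper hv ha ha').2
  have hT : a < 4.2 + a := by linarith
  have B := fun i j => chordProd_nonneg ha.le ha' i j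
  have hi : 0 ≤ 46.09 - 29.359 * a + 6.73 * a ^ 2 - 0.5422 * a ^ 3 := by
    linarith [B 0 3, B 1 2, B 2 1, B 3 0]
  have q1 : 0 ≤ 3 * (9 * 0.37 ^ 2) * ((46.09 - 29.359 * a + 6.73 * a ^ 2 - 0.5422 * a ^ 3)
      * (0.506 + 0.15 * a) ^ 2 - (10.78 - 1.32 * a)) - ((46.09 - 29.359 * a + 6.73 * a ^ 2
      - 0.5422 * a ^ 3) * (0.506 + 0.15 * a) ^ 3 - (4.2 + a)) ^ 2 := by
    linarith [B 0 12, B 1 11, B 2 10, B 3 9, B 4 8, B 5 7, B 6 6, B 7 5, B 8 4, B 9 3, B 10 2,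
      B 11 1, B 12 0]
  have q2 : 0 ≤ 3 * 0.359 * ((46.09 - 29.359 * a + 6.73 * a ^ 2 - 0.5422 * a ^ 3)
      * (0.506 + 0.15 * a) ^ 2 - (10.78 - 1.32 * a)) - ((46.09 - 29.359 * a + 6.73 * a ^ 2
      - 0.5422 * a ^ 3) * (0.506 + 0.15 * a) ^ 3 - (4.2 + a + 0.889)) ^ 2 := by
    linarith [B 0 12, B 1 11, B 2 10, B 3 9, B 4 8, B 5 7, B 6 6, B 7 5, B 8 4, B 9 3, B 10 2,
      B 11 1, B 12 0]
  have q3 : 0 ≤ 4.2 + a - (46.09 - 29.359 * a + 6.73 * a ^ 2 - 0.5422 * a ^ 3)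
      * (0.4485 + 0.118 * a + 0.022 * a ^ 2) ^ 3 := by
    linarith [B 0 9, B 1 8, B 2 7, B 3 6, B 4 5, B 5 4, B 6 3, B 7 2, B 8 1, B 9 0]
  have q4 : 0 ≤ (46.09 - 29.359 * a + 6.73 * a ^ 2 - 0.5422 * a ^ 3)
      * (0.4485 + 0.118 * a + 0.022 * a ^ 2) ^ 2 - (10.78 - 1.32 * a) + 3 * 0.72 ^ 2 := by
    linarith [B 0 7, B 1 6, B 2 5, B 3 4, B 4 3, B 5 2, B 6 1, B 7 0]
  have hp : 0 ≤ 0.506 + 0.15 * a := by positivity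
  have hp' : 0 ≤ 0.4485 + 0.118 * a + 0.022 * a ^ 2 := by positivity
  refine ⟨fun x hx => ⟨?_, ?_, ?_⟩, fun m hm hm' => ?_⟩
  · refine hv.toProfileOn.range_of_energy hT (by linarith) hJ hI ?_ ?_ (by linarith)
      ?_ ?_ hx
    · linarith [B 0 2, B 1 1, B 2 0]
    · linarith [B 0 2, B 1 1, B 2 0]
    · linarith [B 0 4, B 1 3, B 2 2, B 3 1, B 4 0]
    · linarith [B 0 4, B 1 3, B 2 2, B 3 1, B 4 0]
  · exact hv.toProfileOn.slope_le_mul hT hJ hI hi hp (by norm_num) q1 hx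
  · exact hv.toProfileOn.slope_le hT hJ hI hi hp' (by norm_num) q3 q4 hx
  · exact hv.toProfileOn.energy_le_pow hT (by linarith) hJ hI hi hp q2 hm hm'

end pair

/-! ### Passing to common coordinates -/

theorem le_affine_of_hasDerivAt {f f' : ℝ → ℝ} {t c0 c1 : ℝ} (ht : 0 ≤ t)
    (hd : ∀ x ∈ Set.Icc 0 t, HasDerivAt f (f' x) x) (h : ∀ x ∈ Set.Icc 0 t, f' x ≤ c0 + c1 * x) :
    f t ≤ f 0 + c0 * t + c1 / 2 * t ^ 2 := by
  have hp : ∀ x : ℝ, HasDerivAt (fun x : ℝ => c0 * x + c1 / 2 * x ^ 2) (c0 + c1 * x) x := fun x => by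
    refine (((hasDerivAt_id' x).const_mul c0).add ((hasDerivAt_pow 2 x).const_mul _)).congr_deriv ?_
    push_cast; ring
  have := sub_le_sub_of_hasDerivAt ht (fun x hx => (hd x hx).continuousAt.continuousWithinAt)
    (fun x _ => (hp x).continuousAt.continuousWithinAt) (fun x hx => hd x ⟨hx.1.le, hx.2.le⟩)
    (fun x _ => hp x) (fun x hx => h x ⟨hx.1.le, hx.2.le⟩)
  norm_num at this
  linarith

theorem affine_le_of_hasDerivAt {f f' : ℝ → ℝ} {t c0 c1 : ℝ} (ht : 0 ≤ t)
    (hd : ∀ x ∈ Set.Icc 0 t, HasDerivAt f (f' x) x) (h : ∀ x ∈ Set.Icc 0 t, c0 + c1 * x ≤ f' x) :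
    f 0 + c0 * t + c1 / 2 * t ^ 2 ≤ f t := by
  have := le_affine_of_hasDerivAt (f := fun x => - f x) (c0 := -c0) (c1 := -c1) ht
    (fun x hx => (hd x hx).neg) (fun x hx => by linarith [h x hx])
  linarith

/-- A piece of a profile traversed forwards, with coordinates `X + t`. -/
theorem forward_segment {X a : ℝ} {p p1 k : ℝ → ℝ} (ha : 0 < a) (ha' : a ≤ 0.8) (hX : X = 5 - a)
    (hp : ∀ t ∈ Set.Icc 0 a, 0 < p t)
    (dp : ∀ t ∈ Set.Icc 0 a, HasDerivAt p (p1 t) t)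
    (df : ∀ t ∈ Set.Icc 0 a, HasDerivAt (fun t => p t * p1 t) (k t) t)
    (dk : ∀ t ∈ Set.Icc 0 a, HasDerivAt k (-((X + t) / 3) * p1 t) t)
    (hs : ∀ t ∈ Set.Icc 0 a, |p1 t| ≤ 0.88)
    (f1 : 0.0812 + 1.5533 * a + 0.7307 * a ^ 2 ≤ p 0 * p1 0)
    (f2 : p 0 * p1 0 ≤ 0.1946 + 1.7088 * a + 0.7574 * a ^ 2)
    (k1 : -1.1921 + 0.4228 * a ^ 2 - 0.3992 * a ≤ k 0)
    (k2 : k 0 ≤ -1.0473 + 0.4471 * a ^ 2 - 0.2269 * a)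
    (y1 : 3.3159 + 1.2684 * a ≤ p 0) (y2 : p 0 ≤ 3.3891 + 1.3412 * a) :
    ∀ t ∈ Set.Icc 0 a, 0 ≤ p1 t ∧ p1 t ≤ 0.06 + 0.52 * a ∧
      k 0 - 5 / 3 * (0.06 + 0.52 * a) * t ≤ k t ∧ k t ≤ k 0 ∧
      -0.49 ≤ (k t - p1 t ^ 2) / p t ∧ (k t - p1 t ^ 2) / p t ≤ -0.19 := by
  have sub : ∀ {t x : ℝ}, t ∈ Set.Icc 0 a → x ∈ Set.Icc 0 t → x ∈ Set.Icc 0 a := fun ht hx =>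
    ⟨hx.1, hx.2.trans ht.2⟩
  have hXt : ∀ t ∈ Set.Icc 0 a, 0 ≤ (X + t) / 3 ∧ (X + t) / 3 ≤ 5 / 3 := fun t ht => by
    constructor <;> linarith [ht.1, ht.2]
  have B := fun i j => chordProd_nonneg ha.le ha' i j
  -- A first pass with the crude slope bound, `22/15 = (5/3) · 0.88`. It gives the sign of `p1`;
  -- monotonicity of `k` and `p` then sharpens the slope bound, and `s6` repeats the estimate with
  -- it.
  have s1 : ∀ t ∈ Set.Icc 0 a, k 0 - 22 / 15 * t ≤ k t := fun t ht => by
    have := affine_le_of_hasDerivAt (c0 := -(22 / 15)) (c1 := 0) ht.1 (fun x hx => dk x (sub ht hx))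
      (fun x hx => by
        obtain ⟨e1, e2⟩ := hXt x (sub ht hx)
        have e3 := (abs_le.1 (hs x (sub ht hx))).2
        have : (X + x) / 3 * p1 x ≤ (X + x) / 3 * 0.88 := by gcongr
        linarith)
    linarith
  have s2 : ∀ t ∈ Set.Icc 0 a, 0 ≤ p1 t := fun t ht => by
    have e := affine_le_of_hasDerivAt (c0 := k 0) (c1 := -(22 / 15)) ht.1
      (fun x hx => df x (sub ht hx)) (fun x hx => by linarith [s1 x (sub ht hx)])
    have e1 : 0 ≤ p t * p1 t := by
      have g1 := mul_nonneg ht.1 (sub_nonneg.2 ht.2)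
      have g2 := mul_le_mul_of_nonneg_right k1 ht.1
      have g3 := mul_nonneg ht.1 ha.le
      have g4 := mul_nonneg ha.le g1
      have g5 : 0 ≤ 0.0812 + 1.5533 * a + 0.7307 * a ^ 2 + (-1.1921 + 0.4228 * a ^ 2 - 0.3992 * a) * t
          - 22 / 30 * t ^ 2 := by
        have h1 := sub_nonneg.2 ht.2
        have h2 : 0 ≤ t * a ^ 2 := mul_nonneg ht.1 (sq_nonneg a)
        have h3 := mul_nonneg h1 ha.le
        have h4 := mul_nonneg h1 (sub_nonneg.2 ha')
        linarith [B 0 3, B 1 2, B 2 1, B 3 0, B 0 2, B 1 1, B 2 0]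
      linarith
    exact (mul_nonneg_iff_of_pos_left (hp t ht)).1 e1
  have s3 : ∀ t ∈ Set.Icc 0 a, k t ≤ k 0 := fun t ht => by
    have := le_affine_of_hasDerivAt (c0 := 0) (c1 := 0) ht.1 (fun x hx => dk x (sub ht hx))
      (fun x hx => by
        have := mul_nonneg (hXt x (sub ht hx)).1 (s2 x (sub ht hx))
        linarith)
    linarith
  have s4 : ∀ t ∈ Set.Icc 0 a, p 0 ≤ p t := fun t ht => by
    have := affine_le_of_hasDerivAt (c0 := 0) (c1 := 0) ht.1 (fun x hx => dp x (sub ht hx))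
      (fun x hx => by linarith [s2 x (sub ht hx)])
    linarith
  have k0 : k 0 ≤ 0 := by nlinarith
  have s5 : ∀ t ∈ Set.Icc 0 a, p1 t ≤ 0.06 + 0.52 * a := fun t ht => by
    have e := le_affine_of_hasDerivAt (c0 := 0) (c1 := 0) ht.1 (fun x hx => df x (sub ht hx))
      (fun x hx => by linarith [s3 x (sub ht hx)])
    have e1 : p 0 * p1 t ≤ p t * p1 t := mul_le_mul_of_nonneg_right (s4 t ht) (s2 t ht)
    have e2 := mul_le_mul_of_nonneg_right y1 (s2 t ht)
    by_contra hc
    push Not at hc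
    have e3 := mul_lt_mul_of_pos_left hc (show 0 < 3.3159 + 1.2684 * a by positivity)
    linarith [B 0 2, B 1 1, B 2 0]
  have s6 : ∀ t ∈ Set.Icc 0 a, k 0 - 5 / 3 * (0.06 + 0.52 * a) * t ≤ k t := fun t ht => by
    have := affine_le_of_hasDerivAt (c0 := -(5 / 3 * (0.06 + 0.52 * a))) (c1 := 0) ht.1
      (fun x hx => dk x (sub ht hx)) (fun x hx => by
        obtain ⟨e1, e2⟩ := hXt x (sub ht hx)
        have : (X + x) / 3 * p1 x ≤ 5 / 3 * (0.06 + 0.52 * a) :=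
          mul_le_mul e2 (s5 x (sub ht hx)) (s2 x (sub ht hx)) (by norm_num)
        linarith)
    linarith
  have s7 : ∀ t ∈ Set.Icc 0 a, p t ≤ p 0 + (0.06 + 0.52 * a) * t := fun t ht => by
    have := le_affine_of_hasDerivAt (c0 := 0.06 + 0.52 * a) (c1 := 0) ht.1
      (fun x hx => dp x (sub ht hx)) (fun x hx => by linarith [s5 x (sub ht hx)])
    linarith
  intro t ht
  have ht1 : (0.06 + 0.52 * a) * t ≤ (0.06 + 0.52 * a) * a := by gcongr; exact ht.2
  have hsq : p1 t ^ 2 ≤ (0.06 + 0.52 * a) ^ 2 := by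
    have := s2 t ht; have := s5 t ht; gcongr
  refine ⟨s2 t ht, s5 t ht, s6 t ht, s3 t ht, ?_, ?_⟩
  · rw [le_div_iff₀ (hp t ht)]
    have := s6 t ht; have := s4 t ht
    linarith [B 0 2, B 1 1, B 2 0]
  · rw [div_le_iff₀ (hp t ht)]
    have := s3 t ht; have := s7 t ht; have := sq_nonneg (p1 t)
    linarith [B 0 2, B 1 1, B 2 0]

/-- A piece of a profile traversed backwards, with coordinates `X - t`. -/
theorem backward_segment {X a : ℝ} {q q1 k : ℝ → ℝ} (ha : 0 < a) (ha' : a ≤ 0.8) (hX : X = 5 + a)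
    (hq : ∀ t ∈ Set.Icc 0 a, 0 < q t)
    (dq : ∀ t ∈ Set.Icc 0 a, HasDerivAt q (-q1 t) t)
    (df : ∀ t ∈ Set.Icc 0 a, HasDerivAt (fun t => q t * q1 t) (-k t) t)
    (dk : ∀ t ∈ Set.Icc 0 a, HasDerivAt k ((X - t) / 3 * q1 t) t)
    (hs : ∀ t ∈ Set.Icc 0 a, |q1 t| ≤ 0.72)
    (f1 : 0.0812 - 1.7088 * a + 0.7307 * a ^ 2 ≤ q 0 * q1 0)
    (f2 : q 0 * q1 0 ≤ 0.1946 - 1.5533 * a + 0.7574 * a ^ 2)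
    (k1 : -1.1921 + 0.4228 * a ^ 2 + 0.2269 * a ≤ k 0)
    (k2 : k 0 ≤ -1.0473 + 0.4471 * a ^ 2 + 0.3992 * a)
    (v1 : 3.3159 - 1.3412 * a ≤ q 0) :
    ∀ t ∈ Set.Icc 0 a, -(0.52 * a) ≤ q1 t ∧ q1 t ≤ 0.295 ∧
      k 0 - 58 / 30 * (0.52 * a) * t ≤ k t ∧ k t ≤ k 0 + 0.5704 * t ∧
      -0.79 ≤ (k t - q1 t ^ 2) / q t ∧ (k t - q1 t ^ 2) / q t ≤ 0.01 := by
  have sub : ∀ {t x : ℝ}, t ∈ Set.Icc 0 a → x ∈ Set.Icc 0 t → x ∈ Set.Icc 0 a := fun ht hx =>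
    ⟨hx.1, hx.2.trans ht.2⟩
  have hXt : ∀ t ∈ Set.Icc 0 a, 0 ≤ (X - t) / 3 ∧ (X - t) / 3 ≤ 58 / 30 := fun t ht => by
    constructor <;> linarith [ht.1, ht.2]
  have B := fun i j => chordProd_nonneg ha.le ha' i j
  have s1 : ∀ t ∈ Set.Icc 0 a, k 0 - 1.392 * t ≤ k t := fun t ht => by
    have := affine_le_of_hasDerivAt (c0 := -1.392) (c1 := 0) ht.1 (fun x hx => dk x (sub ht hx))
      (fun x hx => by
        obtain ⟨e1, e2⟩ := hXt x (sub ht hx)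
        have e3 := (abs_le.1 (hs x (sub ht hx))).1
        have : (X - x) / 3 * (-0.72) ≤ (X - x) / 3 * q1 x := by gcongr
        linarith)
    linarith
  have s2 : ∀ t ∈ Set.Icc 0 a, q1 t ≤ 0.295 := fun t ht => by
    have e := le_affine_of_hasDerivAt (c0 := -k 0) (c1 := 1.392) ht.1
      (fun x hx => df x (sub ht hx)) (fun x hx => by linarith [s1 x (sub ht hx)])
    have e1 := affine_le_of_hasDerivAt (c0 := -0.72) (c1 := 0) ht.1 (fun x hx => dq x (sub ht hx))
      (fun x hx => by linarith [(abs_le.1 (hs x (sub ht hx))).2])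
    by_contra hc
    push Not at hc
    have e2 := mul_lt_mul_of_pos_left hc (hq t ht)
    have g2 := mul_le_mul_of_nonneg_right k1 ht.1
    have h1 := sub_nonneg.2 ht.2
    have h2 := mul_nonneg ht.1 h1
    have h3 := mul_nonneg h1 ha.le
    have h4 := mul_nonneg h1 (sub_nonneg.2 ha')
    have h5 := mul_nonneg (mul_nonneg h1 ha.le) (sub_nonneg.2 ha')
    have h6 := mul_nonneg h1 (sq_nonneg a)
    linarith [B 0 3, B 1 2, B 2 1, B 3 0, B 0 2, B 1 1, B 2 0]
  have s3 : ∀ t ∈ Set.Icc 0 a, k t ≤ k 0 + 0.5704 * t := fun t ht => by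
    have := le_affine_of_hasDerivAt (c0 := 0.5704) (c1 := 0) ht.1 (fun x hx => dk x (sub ht hx))
      (fun x hx => by
        obtain ⟨e1, e2⟩ := hXt x (sub ht hx)
        have e3 := s2 x (sub ht hx)
        have : (X - x) / 3 * q1 x ≤ (X - x) / 3 * 0.295 := by gcongr
        linarith)
    linarith
  have s4 : ∀ t ∈ Set.Icc 0 a, q 0 - 0.295 * t ≤ q t := fun t ht => by
    have := affine_le_of_hasDerivAt (c0 := -0.295) (c1 := 0) ht.1 (fun x hx => dq x (sub ht hx))
      (fun x hx => by linarith [s2 x (sub ht hx)])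
    linarith
  have s5 : ∀ t ∈ Set.Icc 0 a, -(0.52 * a) ≤ q1 t := fun t ht => by
    have e := affine_le_of_hasDerivAt (c0 := -k 0) (c1 := -0.5704) ht.1
      (fun x hx => df x (sub ht hx)) (fun x hx => by linarith [s3 x (sub ht hx)])
    have e1 : 0 ≤ -k 0 * t + -0.5704 / 2 * t ^ 2 := by
      have : 0 ≤ t * (-k 0 - 0.5704 / 2 * t) := by
        apply mul_nonneg ht.1
        linarith [B 0 2, B 1 1, B 2 0, ht.2]
      linarith
    by_contra hc
    push Not at hc
    have e2 := mul_lt_mul_of_pos_left hc (hq t ht)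
    have e3 := mul_le_mul_of_nonneg_right (s4 t ht) (show 0 ≤ 0.52 * a by positivity)
    have e4 := mul_le_mul_of_nonneg_right v1 (show 0 ≤ 0.52 * a by positivity)
    have e5 := mul_nonneg (sub_nonneg.2 ht.2) ha.le
    linarith [B 0 2, B 1 1, B 2 0]
  have s6 : ∀ t ∈ Set.Icc 0 a, k 0 - 58 / 30 * (0.52 * a) * t ≤ k t := fun t ht => by
    have := affine_le_of_hasDerivAt (c0 := -(58 / 30 * (0.52 * a))) (c1 := 0) ht.1
      (fun x hx => dk x (sub ht hx)) (fun x hx => by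
        obtain ⟨e1, e2⟩ := hXt x (sub ht hx)
        have h1 : (X - x) / 3 * -(0.52 * a) ≤ (X - x) / 3 * q1 x :=
          mul_le_mul_of_nonneg_left (s5 x (sub ht hx)) e1
        have h2 : (X - x) / 3 * (0.52 * a) ≤ 58 / 30 * (0.52 * a) := by gcongr
        linarith)
    linarith
  intro t ht
  have hat : a * t ≤ a ^ 2 := by nlinarith [ht.2]
  refine ⟨s5 t ht, s2 t ht, s6 t ht, s3 t ht, ?_, ?_⟩
  · rw [le_div_iff₀ (hq t ht)]
    have h6 := s6 t ht
    have h4 := s4 t ht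
    rcases le_total 0 (q1 t) with h | h
    · have : q1 t ^ 2 ≤ 0.295 ^ 2 := by have := s2 t ht; gcongr
      linarith [B 0 2, B 1 1, B 2 0, ht.2]
    · have : q1 t ^ 2 ≤ (0.52 * a) ^ 2 := by
        apply sq_le_sq' (s5 t ht); linarith
      linarith [B 0 2, B 1 1, B 2 0, ht.2]
  · rw [div_le_iff₀ (hq t ht)]
    have := s3 t ht; have := s4 t ht; have := sq_nonneg (q1 t)
    linarith [B 0 2, B 1 1, B 2 0, ht.2]

/-! ### The pair at abscissa 5 and the exclusion of small shifts. -/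

section pair
variable {a : ℝ} {y y1 J v v1 K : ℝ → ℝ}

set_option maxHeartbeats 1000000 in
/-- State of a pair of shifted profiles at the abscissa `5`. -/
theorem HalfProfile.pair_at_five (hy : HalfProfile (-a) 1 y y1 J) (hv : HalfProfile a 1 v v1 K)
    (ha : 0 < a) (ha' : a ≤ 0.8) :
    phaseEnergy y y1 J v v1 K 5 * √(y 5 + v 5) < (9.8 * a) ^ 2 ∧
    2.55 * a < slowGap y y1 J v v1 K 5 ∧ slowGap y y1 J v v1 K 5 < 3.2 * a := by
  have hC := hy.centerPair hv
  have b := hC.bounds ha ha' 5 (by norm_num)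
  have b' := hC.bounds1' ha ha' 5 (by norm_num)
  obtain ⟨S1, S2, D1, D2⟩ := b
  obtain ⟨I1, I2, E1, E2, A1, A2, B1, B2, -, -, -, -⟩ := b'
  simp only [sumHi, sumLo, difHi, difLo, sumIntHi, sumIntLo, difIntHi, difIntLo, sqSumSlopeHi,
    sqSumSlopeLo, prodSlopeHi, prodSlopeLo] at S1 S2 D1 D2 I1 I2 E1 E2 A1 A2 B1 B2
  norm_num at S1 S2 D1 D2 I1 I2 E1 E2 A1 A2 B1 B2
  have yd : ∀ t ∈ Set.Icc 0 a, -a < 5 - a + t := fun t ht => by linarith [ht.1]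
  have vd : ∀ t ∈ Set.Icc 0 a, a < 5 + a - t := fun t ht => by linarith [ht.2]
  -- The centred enclosures end with `y` at `5 - a` and `v` at `5 + a`. Running `y` forwards and `v`
  -- backwards by `a` brings both to abscissa 5.
  set p : ℝ → ℝ := fun t => y (5 - a + t) with hp
  set p1 : ℝ → ℝ := fun t => y1 (5 - a + t) with hp1
  set kp : ℝ → ℝ := fun t => (J (5 - a + t) - (5 - a + t) * y (5 - a + t)) / 3 with hkp
  set q : ℝ → ℝ := fun t => v (5 + a - t) with hq
  set q1 : ℝ → ℝ := fun t => v1 (5 + a - t) with hq1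
  set kq : ℝ → ℝ := fun t => (K (5 + a - t) - (5 + a - t) * v (5 + a - t)) / 3 with hkq
  have p0 : p 0 = y (5 - a) := by simp [hp]
  have p10 : p1 0 = y1 (5 - a) := by simp [hp1]
  have kp0 : kp 0 = (J (5 - a) - (5 - a) * y (5 - a)) / 3 := by simp [hkp]
  have q0 : q 0 = v (5 + a) := by simp [hq]
  have q10 : q1 0 = v1 (5 + a) := by simp [hq1]
  have kq0 : kq 0 = (K (5 + a) - (5 + a) * v (5 + a)) / 3 := by simp [hkq]
  rw [← p0, ← q0] at S1 S2 D1 D2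
  rw [← p0, ← q0, ← p10, ← q10] at A1 A2 B1 B2
  have kps : kp 0 + kq 0 = (J (5 - a) + K (5 + a) - 5 * (p 0 + q 0) + a * (p 0 - q 0)) / 3 := by
    rw [kp0, kq0, p0, q0]; ring
  have kpd : kp 0 - kq 0 = (J (5 - a) - K (5 + a) - 5 * (p 0 - q 0) + a * (p 0 + q 0)) / 3 := by
    rw [kp0, kq0, p0, q0]; ring
  have aD1 := mul_le_mul_of_nonneg_left D1 ha.le
  have aD2 := mul_le_mul_of_nonneg_left D2 ha.le
  have aS1 := mul_le_mul_of_nonneg_left S1 ha.le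
  have aS2 := mul_le_mul_of_nonneg_left S2 ha.le
  have a2 := sq_nonneg a
  have dp : ∀ t ∈ Set.Icc 0 a, HasDerivAt p (p1 t) t := fun t ht =>
    HasDerivAt.comp_const_add _ _ (hy.dy _ (yd t ht))
  have dp1 : ∀ t ∈ Set.Icc 0 a, HasDerivAt p1 ((kp t - p1 t ^ 2) / p t) t := fun t ht =>
    HasDerivAt.comp_const_add _ _ (hy.dy1 _ (yd t ht))
  have dpf : ∀ t ∈ Set.Icc 0 a, HasDerivAt (fun t => p t * p1 t) (kp t) t := fun t ht =>
    HasDerivAt.comp_const_add (5 - a) t (hy.dflux (yd t ht))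
  have dkp : ∀ t ∈ Set.Icc 0 a, HasDerivAt kp (-((5 - a + t) / 3) * p1 t) t := fun t ht =>
    HasDerivAt.comp_const_add (5 - a) t (hy.dforce (yd t ht))
  have dq : ∀ t ∈ Set.Icc 0 a, HasDerivAt q (-q1 t) t := fun t ht =>
    HasDerivAt.comp_const_sub _ _ (hv.dy _ (vd t ht))
  have dq1 : ∀ t ∈ Set.Icc 0 a, HasDerivAt q1 (-((kq t - q1 t ^ 2) / q t)) t := fun t ht =>
    HasDerivAt.comp_const_sub _ _ (hv.dy1 _ (vd t ht))
  have dqf : ∀ t ∈ Set.Icc 0 a, HasDerivAt (fun t => q t * q1 t) (-kq t) t := fun t ht =>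
    HasDerivAt.comp_const_sub (5 + a) t (hv.dflux (vd t ht))
  have dkq : ∀ t ∈ Set.Icc 0 a, HasDerivAt kq ((5 + a - t) / 3 * q1 t) t := fun t ht =>
    (HasDerivAt.comp_const_sub (5 + a) t (hv.dforce (vd t ht))).congr_deriv (by simp [hq1])
  have pp : ∀ t ∈ Set.Icc 0 a, 0 < p t := fun t ht => hy.pos _ (yd t ht)
  have qp : ∀ t ∈ Set.Icc 0 a, 0 < q t := fun t ht => hv.pos _ (vd t ht)
  have F := forward_segment ha ha' rfl pp dp dpf dkp
    (fun t ht => (((hy.near_bounds hv ha ha').1 _ (by linarith [ht.1])).2).2)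
    (by linarith) (by linarith) (by linarith) (by linarith) (by linarith) (by linarith)
  have G := backward_segment ha ha' rfl qp dq dqf dkq
    (fun t ht => (((hy.far_bounds hv ha ha').1 _ (by linarith [ht.2])).2).2)
    (by linarith) (by linarith) (by linarith) (by linarith) (by linarith)
  have ha_mem : a ∈ Set.Icc 0 a := ⟨ha.le, le_rfl⟩
  have h0_mem : (0:ℝ) ∈ Set.Icc 0 a := ⟨le_rfl, ha.le⟩
  have pa : p a = y 5 := by simp [hp]
  have p1a : p1 a = y1 5 := by simp [hp1]
  have qa : q a = v 5 := by simp [hq]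
  have q1a : q1 a = v1 5 := by simp [hq1]
  -- the slope sum
  have e0 : 0.046 ≤ p1 0 + q1 0 ∧ p1 0 + q1 0 ≤ 0.213 := by
    clear I1 I2 E1 E2 aD1 aD2 aS1 aS2 kps kpd F G
    have hp0 := pp 0 h0_mem
    have hq0 := qp 0 h0_mem
    have hpq := mul_pos hp0 hq0
    -- The enclosures control the fluxes `p p1` and `q q1`, not the slopes. Dividing by `4 p q = S²
    -- - D²` recovers the slope sum.
    have id : 4 * (p 0 * q 0) * (p1 0 + q1 0) = 2 * (p 0 * p1 0 + q 0 * q1 0) * (p 0 + q 0)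
      - 2 * (p 0 * p1 0 - q 0 * q1 0) * (p 0 - q 0) := by ring
    have id2 : 4 * (p 0 * q 0) = (p 0 + q 0) ^ 2 - (p 0 - q 0) ^ 2 := by ring
    obtain ⟨S, hS⟩ : ∃ S, S = p 0 + q 0 := ⟨_, rfl⟩
    obtain ⟨D, hD⟩ : ∃ D, D = p 0 - q 0 := ⟨_, rfl⟩
    obtain ⟨A, hA⟩ : ∃ A, A = 2 * (p 0 * p1 0 + q 0 * q1 0) := ⟨_, rfl⟩
    obtain ⟨W, hW⟩ : ∃ W, W = 2 * (p 0 * p1 0 - q 0 * q1 0) := ⟨_, rfl⟩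
    replace S1 : S ≤ 2169 / 320 := by linarith
    replace S2 : 10611 / 1600 ≤ S := by linarith
    replace D1 : D ≤ a * (515 / 192) := by linarith
    replace D2 : a * (3653 / 1440) ≤ D := by linarith
    replace A1 : A ≤ 0.7782 + 3.0296 * a ^ 2 := by linarith
    replace A2 : 0.325 + 2.923 * a ^ 2 ≤ A := by linarith
    replace B1 : W ≤ a * (992129 / 145152) := by linarith
    replace B2 : a * (214733 / 34560) ≤ W := by linarith
    rw [← hS, ← hD, ← hA, ← hW] at id
    rw [← hS, ← hD] at id2
    have hD0 : 0 ≤ D := by linarith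
    have hS0 : 0 ≤ S := by linarith
    have hW0 : 0 ≤ W := by linarith
    have hA0 : 0 ≤ A := by linarith
    have t1 : (0.325 + 2.923 * a ^ 2) * 6.6318 ≤ A * S := by
      gcongr
      linarith only [A1, A2, B1, B2, D1, D2, S1, S2, ha, sq_nonneg a]
    have t2 : A * S ≤ (0.7782 + 3.0296 * a ^ 2) * 6.7782 := by
      gcongr
      linarith only [A1, A2, B1, B2, D1, D2, S1, S2, ha, sq_nonneg a]
    have t3 : W * D ≤ (a * 6.8352) * (a * 2.6823) := by
      gcongr <;> linarith only [A1, A2, B1, B2, D1, D2, S1, S2, ha, sq_nonneg a]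
    have t4 : (a * 6.2133) * (a * 2.5368) ≤ W * D := by
      gcongr <;> linarith only [A1, A2, B1, B2, D1, D2, S1, S2, ha, sq_nonneg a]
    have t5 : 6.6318 ^ 2 ≤ S ^ 2 := by gcongr; linarith
    have t6 : S ^ 2 ≤ 6.7782 ^ 2 := by gcongr; linarith
    have t7 : D ^ 2 ≤ (a * 2.6823) ^ 2 := by gcongr; linarith
    have t8 : 0 ≤ D ^ 2 := by positivity
    have t9 : a ^ 2 ≤ 0.8 ^ 2 := by gcongr
    constructor
    · by_contra hc
      push Not at hc
      have := mul_lt_mul_of_pos_left hc (show 0 < 4 * (p 0 * q 0) by positivity)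
      linarith only [this, id, id2, t1, t2, t3, t4, t5, t6, t7, t8, t9, a2]
    · by_contra hc
      push Not at hc
      have := mul_lt_mul_of_pos_left hc (show 0 < 4 * (p 0 * q 0) by positivity)
      linarith only [this, id, id2, t1, t2, t3, t4, t5, t6, t7, t8, t9, a2]
  have sub : ∀ {t x : ℝ}, t ∈ Set.Icc 0 a → x ∈ Set.Icc 0 t → x ∈ Set.Icc 0 a := fun ht hx =>
    ⟨hx.1, hx.2.trans ht.2⟩
  have e1 : ∀ t ∈ Set.Icc 0 a, 0.046 - 0.5 * t ≤ p1 t + q1 t ∧ p1 t + q1 t ≤ 0.213 + 0.6 * t := by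
    intro t ht
    have u1 := affine_le_of_hasDerivAt (c0 := -0.5) (c1 := 0) ht.1
      (fun x hx => (dp1 x (sub ht hx)).add (dq1 x (sub ht hx))) (fun x hx => by
        linarith only [(F x (sub ht hx)).2.2.2.2.1, (G x (sub ht hx)).2.2.2.2.2])
    have u2 := le_affine_of_hasDerivAt (c0 := 0.6) (c1 := 0) ht.1
      (fun x hx => (dp1 x (sub ht hx)).add (dq1 x (sub ht hx))) (fun x hx => by
        linarith only [(F x (sub ht hx)).2.2.2.2.2, (G x (sub ht hx)).2.2.2.2.1])
    simp only [Pi.add_apply] at u1 u2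
    constructor <;> linarith only [e0.1, e0.2, u1, u2]
  have hD : p 0 - q 0 + 0.046 * a - 0.25 * a ^ 2 ≤ y 5 - v 5 ∧
      y 5 - v 5 ≤ p 0 - q 0 + 0.213 * a + 0.3 * a ^ 2 := by
    have u1 := affine_le_of_hasDerivAt (c0 := 0.046) (c1 := -0.5) ha.le
      (fun x hx => (dp x hx).sub (dq x hx)) (fun x hx => by linarith only [(e1 x hx).1])
    have u2 := le_affine_of_hasDerivAt (c0 := 0.213) (c1 := 0.6) ha.le
      (fun x hx => (dp x hx).sub (dq x hx)) (fun x hx => by linarith only [(e1 x hx).2])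
    simp only [Pi.sub_apply] at u1 u2
    rw [← pa, ← qa]
    constructor <;> linarith only [u1, u2]
  have hw : ∀ t ∈ Set.Icc 0 a, p 0 + q 0 - 0.295 * t ≤ p t + q t ∧
      p t + q t ≤ p 0 + q 0 + (0.06 + 1.04 * a) * t := by
    intro t ht
    have u1 := affine_le_of_hasDerivAt (c0 := -0.295) (c1 := 0) ht.1
      (fun x hx => (dp x (sub ht hx)).add (dq x (sub ht hx))) (fun x hx => by
        linarith only [(F x (sub ht hx)).1, (G x (sub ht hx)).2.1])
    have u2 := le_affine_of_hasDerivAt (c0 := 0.06 + 1.04 * a) (c1 := 0) ht.1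
      (fun x hx => (dp x (sub ht hx)).add (dq x (sub ht hx))) (fun x hx => by
        linarith only [(F x (sub ht hx)).2.1, (G x (sub ht hx)).1])
    simp only [Pi.add_apply] at u1 u2
    constructor <;> linarith only [u1, u2]
  have hJK : J (5 - a) - K (5 + a) + (p 0 + q 0) * a - 0.1475 * a ^ 2 ≤ J 5 - K 5 ∧
      J 5 - K 5 ≤ J (5 - a) - K (5 + a) + (p 0 + q 0) * a + (0.03 + 0.52 * a) * a ^ 2 := by
    have dd : ∀ t ∈ Set.Icc 0 a, HasDerivAt (fun t => J (5 - a + t) - K (5 + a - t)) (p t + q t) t :=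
      fun t ht => ((HasDerivAt.comp_const_add (5 - a) t (hy.dJ _ (yd t ht))).sub
        (HasDerivAt.comp_const_sub (5 + a) t (hv.dJ _ (vd t ht)))).congr_deriv (by simp [hp, hq])
    have u1 := affine_le_of_hasDerivAt (c0 := p 0 + q 0) (c1 := -0.295) ha.le dd
      (fun x hx => by linarith only [(hw x hx).1])
    have u2 := le_affine_of_hasDerivAt (c0 := p 0 + q 0) (c1 := 0.06 + 1.04 * a) ha.le dd
      (fun x hx => by linarith only [(hw x hx).2])
    simp only [sub_add_cancel, add_sub_cancel_right, add_zero, sub_zero] at u1 u2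
    constructor <;> linarith only [u1, u2]
  have hk : ∀ t ∈ Set.Icc 0 a, kp 0 + kq 0 - (0.1 + 1.872 * a) * t ≤ kp t + kq t ∧
      kp t + kq t ≤ kp 0 + kq 0 + 0.5704 * t := by
    intro t ht
    obtain ⟨-, -, f1, f2, -⟩ := F t ht
    obtain ⟨-, -, g1, g2, -⟩ := G t ht
    have := mul_nonneg ha.le ht.1
    constructor <;> linarith only [f1, f2, g1, g2, this]
  have hP : 2 * (p 0 * p1 0 - q 0 * q1 0) + 2 * (kp 0 + kq 0) * a - (0.1 + 1.872 * a) * a ^ 2 ≤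
      fluxGap y y1 v v1 5 ∧ fluxGap y y1 v v1 5 ≤
      2 * (p 0 * p1 0 - q 0 * q1 0) + 2 * (kp 0 + kq 0) * a + 0.5704 * a ^ 2 := by
    have u1 := affine_le_of_hasDerivAt (c0 := kp 0 + kq 0) (c1 := -(0.1 + 1.872 * a)) ha.le
      (fun x hx => (dpf x hx).sub (dqf x hx)) (fun x hx => by linarith only [(hk x hx).1])
    have u2 := le_affine_of_hasDerivAt (c0 := kp 0 + kq 0) (c1 := 0.5704) ha.le
      (fun x hx => (dpf x hx).sub (dqf x hx)) (fun x hx => by linarith only [(hk x hx).2])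
    simp only [Pi.sub_apply, pa, p1a, qa, q1a] at u1 u2
    simp only [fluxGap]
    constructor <;> linarith only [u1, u2]
  have hS := hw a ha_mem
  rw [pa, qa] at hS
  -- numerical conclusions
  obtain ⟨P, hPd⟩ : ∃ P, P = fluxGap y y1 v v1 5 := ⟨_, rfl⟩
  rw [← hPd] at hP
  have ka1 := mul_le_mul_of_nonneg_left (show -2.3841 + 0.8456 * a ^ 2 ≤ kp 0 + kq 0 by linarith) ha.le
  have ka2 := mul_le_mul_of_nonneg_left (show kp 0 + kq 0 ≤ -2.0946 + 0.8941 * a ^ 2 by linarith) ha.le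
  have B := fun i j => chordProd_nonneg ha.le ha' i j
  have P1 : 1.2 * a ≤ P := by
    linarith [mul_nonneg ha.le (B 0 2), mul_nonneg ha.le (B 1 1), mul_nonneg ha.le (B 2 0)]
  have P2 : P ≤ (2.65 + 2 * a) * a := by
    linarith [mul_nonneg ha.le (B 0 2), mul_nonneg ha.le (B 1 1), mul_nonneg ha.le (B 2 0)]
  have N1 : (2.203 - 0.0295 * a) * a ≤ (J 5 - K 5) / 5 := by
    rw [le_div_iff₀ (by norm_num)]
    linarith
  have N2 : (J 5 - K 5) / 5 ≤ (2.2646 + 0.0895 * a) * a := by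
    rw [div_le_iff₀ (by norm_num)]
    linarith [mul_nonneg ha.le (B 0 2), mul_nonneg ha.le (B 1 1), mul_nonneg ha.le (B 2 0)]
  obtain ⟨N, hN⟩ : ∃ N, N = (J 5 - K 5) / 5 := ⟨_, rfl⟩
  rw [← hN] at N1 N2
  obtain ⟨D, hDd⟩ : ∃ D, D = y 5 - v 5 := ⟨_, rfl⟩
  rw [← hDd] at hD
  obtain ⟨S, hSd⟩ : ∃ S, S = y 5 + v 5 := ⟨_, rfl⟩
  rw [← hSd] at hS
  have D3 : (2.5828 - 0.25 * a) * a ≤ D := by linarith only [hD.1, D2, ha]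
  have D4 : D ≤ (2.8954 + 0.3 * a) * a := by linarith
  have S3 : 6.6318 - 0.295 * a ≤ S := by linarith
  have S4 : S ≤ 6.7782 + 0.892 * a := by linarith [B 0 2, B 1 1, B 2 0]
  clear S1 S2 D1 D2 I1 I2 E1 E2 A1 A2 B1 B2 aD1 aD2 aS1 aS2 ka1 ka2 kps kpd hP hS hD hJK p0 q0 p10
    q10 kp0 kq0 pa p1a qa q1a e0
  have hsg : slowGap y y1 J v v1 K 5 = N + 0.06 * P + 0.024 * (S * D) := by
    simp only [slowGap, meanGap]
    rw [hN, hPd, hSd, hDd]; ring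
  have hpe : phaseEnergy y y1 J v v1 K 5 = 1 / 2 * P ^ 2 + 5 / 3 * S * (D - N) ^ 2 := by
    simp only [phaseEnergy, meanGap]
    rw [hN, hPd, hSd, hDd]
  have hSD1 : (6.6318 - 0.295 * a) * ((2.5828 - 0.25 * a) * a) ≤ S * D := by
    have : 0 ≤ (2.5828 - 0.25 * a) * a := mul_nonneg (by linarith) ha.le
    gcongr
    linarith
  have hD0 : 0 ≤ D := le_trans (mul_nonneg (by linarith) ha.le) D3
  have hSD2 : S * D ≤ (6.7782 + 0.892 * a) * ((2.8954 + 0.3 * a) * a) := by gcongr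
  have aB : ∀ i j, 0 ≤ a * ((a - 0) ^ i * (0.8 - a) ^ j) := fun i j => mul_nonneg ha.le (B i j)
  refine ⟨?_, ?_, ?_⟩
  · rw [hpe, ← hSd]
    have hS75 : S ≤ 7.5 := by linarith
    have hs : √S ≤ 2.75 := Real.sqrt_le_iff.2 ⟨by norm_num, by norm_num; linarith⟩
    have hP2 : P ^ 2 ≤ (4.25 * a) ^ 2 := by
      have : P ≤ 4.25 * a := by linarith [aB 0 1, aB 1 0]
      have : 0 ≤ P := by linarith
      gcongr
    have hDN : (D - N) ^ 2 ≤ (1 * a) ^ 2 := by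
      apply sq_le_sq' <;> linarith [aB 0 1, aB 1 0]
    have hb : 1 / 2 * P ^ 2 + 5 / 3 * S * (D - N) ^ 2 ≤ 1 / 2 * (4.25 * a) ^ 2 + 5 / 3 * 7.5 * (1 * a) ^ 2 := by
      gcongr
    have hb0 : 0 ≤ 1 / 2 * (4.25 * a) ^ 2 + 5 / 3 * 7.5 * (1 * a) ^ 2 := by positivity
    calc (1 / 2 * P ^ 2 + 5 / 3 * S * (D - N) ^ 2) * √S
        ≤ (1 / 2 * (4.25 * a) ^ 2 + 5 / 3 * 7.5 * (1 * a) ^ 2) * 2.75 := by gcongr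
      _ < (9.8 * a) ^ 2 := by
        have : 0 < a ^ 2 := by positivity
        linarith
  · rw [hsg]
    linarith only [aB 0 2, aB 1 1, aB 2 0, hSD1, hSD2, N1, N2, P1, P2, ha]
  · rw [hsg]
    linarith only [aB 0 2, aB 1 1, aB 2 0, hSD1, hSD2, N1, N2, P1, P2, ha]

/-- Small shifts are incompatible with a common limit. -/
theorem HalfProfile.false_of_small_shift (hy : HalfProfile (-a) 1 y y1 J)
    (hv : HalfProfile a 1 v v1 K) (ha : 0 < a) (ha' : a ≤ 0.8) {l : ℝ}
    (hly : Tendsto y atTop (𝓝 l)) (hlv : Tendsto v atTop (𝓝 l)) : False := by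
  obtain ⟨n1, n2⟩ := hy.near_bounds hv ha ha'
  obtain ⟨f1, f2⟩ := hy.far_bounds hv ha ha'
  have hl1 : 1.75 ≤ l := ge_of_tendsto hly (by
    filter_upwards [eventually_ge_atTop 5] with x hx
    linarith [(n1 x (by linarith)).1.1])
  have hl2 : l ≤ 3.4 := le_of_tendsto hlv (by
    filter_upwards [eventually_ge_atTop 5] with x hx
    linarith [(f1 x (by linarith)).1.2])
  have hl0 : 0 ≤ l := by linarith
  -- The ranges of `y` and `v` give `1.75 ≤ l ≤ 3.4`, and `1.2³ ≤ 1.75`, `3.4 ≤ 1.52³`; this is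
  -- where the interval `[12, 15.2]` for `10 m` comes from.
  obtain ⟨m, hm0, hm⟩ : ∃ m : ℝ, 0 ≤ m ∧ m ^ 3 = l :=
    ⟨l ^ (1 / 3 : ℝ), by positivity, by
      rw [← Real.rpow_natCast, ← Real.rpow_mul hl0]; norm_num⟩
  have hm1 : 1.2 ≤ m := by
    by_contra hc
    push Not at hc
    have : m ^ 3 ≤ 1.2 ^ 3 := by gcongr
    norm_num at this
    linarith
  have hm2 : m ≤ 1.52 := by
    by_contra hc
    push Not at hc
    have : 1.52 ^ 3 ≤ m ^ 3 := by gcongr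
    norm_num at this
    linarith
  have hy' := hy.toProfileOn.mono (show -a ≤ a by linarith)
  obtain ⟨g1, g2, g3⟩ := hy.pair_at_five hv ha ha'
  refine hy'.false_of_phaseEnergy_le hv.toProfileOn (by linarith) hm1 hm2 (hm ▸ hly) (hm ▸ hlv)
    (n2 m hm1 hm2) (f2 m hm1 hm2) (fun x hx => ?_) (fun x hx => ?_) (fun X hX hX' =>
      phase_control hy' hv.toProfileOn (by linarith) ha (fun x hx => ?_) (fun x hx => ?_) g1 g2 g3
        hX hX')
  · linarith [(n1 x (by linarith)).1.2]
  · linarith [(f1 x (by linarith)).1.2]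
  · obtain ⟨⟨u1, u2⟩, -⟩ := n1 x (by linarith)
    obtain ⟨⟨w1, w2⟩, -⟩ := f1 x (by linarith)
    constructor <;> linarith
  · obtain ⟨⟨u1, u2⟩, u3, u4⟩ := n1 x (by linarith)
    obtain ⟨⟨w1, w2⟩, w3, w4⟩ := f1 x (by linarith)
    have := abs_add_le (y1 x) (v1 x)
    constructor <;> linarith

end pair

/-! ### Large shifts -/

theorem ProfileOn.energy_nonneg_of_tendsto {T l : ℝ} {y y1 J : ℝ → ℝ} (h : ProfileOn T y y1 J)
    (hl : Tendsto y atTop (𝓝 l)) {x : ℝ} (hx : T < x) : 0 ≤ energy y y1 J l x := by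
  have hc : Continuous fun c => energy y y1 J c x := by unfold energy; fun_prop
  refine ge_of_tendsto ((hc.tendsto l).comp hl) ?_
  filter_upwards [eventually_ge_atTop x] with t ht
  exact le_trans (by positivity) (h.slope_sq_le_energy hx ht)

namespace HalfProfile
variable {T : ℝ} {y y1 J : ℝ → ℝ}

theorem slope_le_sqrt (h : HalfProfile T 1 y y1 J) {x ε : ℝ} (hx : T < x) (hε : 0 ≤ ε) :
    |y1 x| ≤ √(1 - 2 * T * y x / 9 + ε) := by
  have := h.slope_sq_le hx
  apply Real.abs_le_sqrt
  linarith

/-- `y'² ≤ 1 - 2 T y/9` is the energy law of motion with constant acceleration `-T/9`, and its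
extremal solution is the parabola. The square root of the right side is compared with that of the
parabola, and the slope is integrated afterwards. -/
theorem le_quadratic_of_nonpos (h : HalfProfile T 1 y y1 J) (hT : T ≤ 0) {x : ℝ} (hx : T ≤ x) :
    y x ≤ (x - T) - T * (x - T) ^ 2 / 18 := by
  have hN : ∀ t, T ≤ t → 0 < 1 - 2 * T * y t / 9 := fun t ht => by
    have := mul_nonneg (neg_nonneg.2 hT) (h.nonneg ht)
    linarith
  have hu : ∀ t, T ≤ t → √(1 - 2 * T * y t / 9) ≤ 1 - T / 9 * (t - T) := fun t ht => by
    have cy := h.cy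
    have := sub_le_sub_of_hasDerivAt (f := fun t => √(1 - 2 * T * y t / 9))
      (f' := fun t => -(2 * T * y1 t / 9) / (2 * √(1 - 2 * T * y t / 9)))
      (g := fun t => -(T / 9) * (t - T)) (g' := fun _ => -(T / 9) * 1) ht
      (ContinuousOn.sqrt (ContinuousOn.sub continuousOn_const
        (((cy.const_mul (2 * T)).div_const 9).mono Set.Icc_subset_Ici_self)))
      (Continuous.continuousOn (by fun_prop))
      (fun s hs => ((((h.dy s hs.1).const_mul (2 * T)).div_const 9).const_sub 1).sqrt
        (hN s hs.1.le).ne')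
      (fun s _ => ((hasDerivAt_id' s).sub_const T).const_mul _)
      (fun s hs => by
        have hp := Real.sqrt_pos.2 (hN s hs.1.le)
        have h1 := (le_abs_self _).trans (h.slope_le_sqrt hs.1 le_rfl)
        rw [add_zero] at h1
        rw [div_le_iff₀ (by positivity)]
        have := mul_le_mul_of_nonneg_left h1 (neg_nonneg.2 hT)
        linarith)
    simp only [h.y_start, mul_zero, zero_div, sub_zero, Real.sqrt_one, sub_self] at this
    linarith
  have := sub_le_sub_of_hasDerivAt (f := y) (f' := y1)
    (g := fun t => (t - T) - T / 18 * (t - T) ^ 2) (g' := fun t => 1 - T / 9 * (t - T)) hx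
    (h.cy.mono Set.Icc_subset_Ici_self) (Continuous.continuousOn (by fun_prop)) (fun s hs => h.dy s hs.1)
    (fun s _ => by
      have d := (hasDerivAt_id' s).sub_const T
      refine (d.sub ((d.pow 2).const_mul (T / 18))).congr_deriv ?_
      push_cast; ring)
    (fun s hs => by
      have h1 := (le_abs_self _).trans (h.slope_le_sqrt hs.1 le_rfl)
      rw [add_zero] at h1
      exact h1.trans (hu s hs.1.le))
  simp only [h.y_start, sub_self] at this
  linarith

theorem le_quadratic_of_pos (h : HalfProfile T 1 y y1 J) (hT : 0 < T) {x : ℝ} (hx : T ≤ x)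
    (hx' : T * (x - T) ≤ 9) : y x ≤ (x - T) - T * (x - T) ^ 2 / 18 := by
  have hx9 : 0 ≤ 1 - T / 9 * (x - T) := by linarith
  have hN0 : ∀ t, T ≤ t → 0 ≤ 1 - 2 * T * y t / 9 := fun t ht => by
    rcases ht.eq_or_lt with rfl | ht
    · rw [h.y_start]; norm_num
    · have := h.slope_sq_le ht
      have := sq_nonneg (y1 t)
      linarith
  -- For `T > 0` the root may vanish, so it is regularised by `ε`. The hypothesis `T (x - T) ≤ 9`
  -- keeps the comparison before the apex of the parabola, where squaring is legitimate.
  have key : ∀ ε : ℝ, 0 < ε → (1 - T / 9 * (x - T)) ^ 2 ≤ 1 - 2 * T * y x / 9 + ε := fun ε hε => by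
    have hN : ∀ t, T ≤ t → 0 < 1 - 2 * T * y t / 9 + ε := fun t ht => by
      linarith [hN0 t ht]
    have := sub_le_sub_of_hasDerivAt (g := fun t => √(1 - 2 * T * y t / 9 + ε))
      (g' := fun t => -(2 * T * y1 t / 9) / (2 * √(1 - 2 * T * y t / 9 + ε)))
      (f := fun t => -(T / 9) * (t - T)) (f' := fun _ => -(T / 9) * 1) hx (Continuous.continuousOn (by fun_prop))
      (ContinuousOn.sqrt (ContinuousOn.add (ContinuousOn.sub continuousOn_const
        (((h.cy.const_mul (2 * T)).div_const 9).mono Set.Icc_subset_Ici_self)) continuousOn_const))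
      (fun s _ => ((hasDerivAt_id' s).sub_const T).const_mul _)
      (fun s hs => (((((h.dy s hs.1).const_mul (2 * T)).div_const 9).const_sub 1).add_const ε).sqrt
        (hN s hs.1.le).ne')
      (fun s hs => by
        have hp := Real.sqrt_pos.2 (hN s hs.1.le)
        have h1 := (le_abs_self _).trans (h.slope_le_sqrt hs.1 hε.le)
        rw [le_div_iff₀ (by positivity)]
        have := mul_le_mul_of_nonneg_left h1 hT.le
        linarith)
    simp only [h.y_start, mul_zero, zero_div, sub_zero, sub_self] at this
    have h1 : 1 ≤ √(1 + ε) := Real.one_le_sqrt.2 (by linarith)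
    have h2 : 1 - T / 9 * (x - T) ≤ √(1 - 2 * T * y x / 9 + ε) := by linarith
    calc (1 - T / 9 * (x - T)) ^ 2 ≤ √(1 - 2 * T * y x / 9 + ε) ^ 2 := by gcongr
      _ = _ := Real.sq_sqrt (hN x hx).le
  have h1 : (1 - T / 9 * (x - T)) ^ 2 ≤ 1 - 2 * T * y x / 9 := le_of_forall_pos_le_add key
  have h2 : T * y x ≤ T * ((x - T) - T * (x - T) ^ 2 / 18) := by linarith
  exact le_of_mul_le_mul_left h2 hT

/-- Energy lost while climbing to the limit. -/
theorem energy_at_climb (h : HalfProfile T 1 y y1 J) {l : ℝ} (hl : 0 < l)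
    (hq : ∀ x ∈ Set.Ioo T (T + l), y x ≤ (x - T) - T * (x - T) ^ 2 / 18) :
    energy y y1 J l (T + l) ≤ 9 * l ^ 2 - 2 * T * l ^ 3 - 3 / 4 * l ^ 4 - T * l ^ 5 / 45 := by
  -- With `s = x - T`, the loss rate `y³ - 3 y l² + 2 l³` is convex in `y ≥ 0`, hence above its
  -- tangent at `y = s`. That tangent decreases in `y` for `s < l`, so the quadratic upper bound for
  -- `y` may be inserted.
  have hd : ∀ x, HasDerivAt (fun x => (x - T) ^ 4 / 4 - 3 / 2 * l ^ 2 * (x - T) ^ 2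
      + 2 * l ^ 3 * (x - T) + T / 6 * (l ^ 2 / 3 * (x - T) ^ 3 - (x - T) ^ 5 / 5))
      ((x - T) ^ 3 - 3 * (x - T) * l ^ 2 + 2 * l ^ 3 + (l ^ 2 - (x - T) ^ 2) * (T * (x - T) ^ 2 / 6)) x :=
    fun x => by
      have d := (hasDerivAt_id' x).sub_const T
      refine (((((d.pow 4).div_const 4).sub ((d.pow 2).const_mul _)).add (d.const_mul _)).add
        ((((d.pow 3).const_mul _).sub ((d.pow 5).div_const 5)).const_mul _)).congr_deriv ?_
      push_cast; ring
  have := sub_le_sub_of_hasDerivAt (a := T) (b := T + l) (by linarith)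
    (fun x _ => (hd x).continuousAt.continuousWithinAt)
    (g := fun x => - energy y y1 J l x)
    ((h.continuousOn_energy l).neg.mono Set.Icc_subset_Ici_self) (fun x _ => hd x)
    (fun x hx => (h.denergy l hx.1).neg)
    (fun x hx => by
      obtain ⟨s, hs⟩ : ∃ s, s = x - T := ⟨_, rfl⟩
      have h0 := h.pos x hx.1
      have h1 := hq x hx
      rw [← hs] at h1 ⊢
      have hs0 : 0 < s := by linarith [hx.1]
      have hsl : 0 ≤ l ^ 2 - s ^ 2 := by nlinarith [hx.2]
      have h2 : 0 ≤ (y x - s) ^ 2 * (y x + 2 * s) := by positivity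
      have h3 := mul_nonneg hsl (sub_nonneg.2 h1)
      linarith)
  rw [h.energy_start] at this
  simp only [sub_self, add_sub_cancel_left] at this
  linarith

/-- `y1' = -x/9 + I/(9 y³)` with `I = ∫ y³`. If `I ≥ (x - T) y³/10`, integrating twice yields the
cubic. That inequality is bootstrapped: the difference increases while `(x - T) y1 < 3 y`, which
follows from the cubic bound already obtained and the slope bound. -/
theorem ge_cubic (h : HalfProfile T 1 y y1 J) (hT : T ≤ -0.8) :
    ∀ x ∈ Set.Icc T (T + 7), (x - T) - T * (x - T) ^ 2 / 18 - (x - T) ^ 3 / 60 ≤ y x := by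
  have hd : ∀ x, T < x → HasDerivAt (fun x => cubeInt y y1 J x - (x - T) / 10 * y x ^ 3)
      (0.3 * y x ^ 2 * (3 * y x - (x - T) * y1 x)) x := fun x hx => by
    refine ((h.dcubeInt hx).sub ((((hasDerivAt_id' x).sub_const T).div_const 10).mul
      ((h.dy x hx).pow 3))).congr_deriv ?_
    simp only [Pi.pow_apply]; push_cast; ring
  have hc : ContinuousOn (fun x => cubeInt y y1 J x - (x - T) / 10 * y x ^ 3) (Set.Ici T) :=
    h.continuousOn_cubeInt.sub ((Continuous.continuousOn (by fun_prop)).mul (h.cy.pow 3))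
  have pos_of : ∀ x, T < x → (∀ t ∈ Set.Ioo T x, (t - T) * y1 t < 3 * y t) →
      0 < cubeInt y y1 J x - (x - T) / 10 * y x ^ 3 := fun x hx hlt => by
    have := lt_of_hasDerivAt_pos hx (hc.mono Set.Icc_subset_Ici_self) (fun t ht => hd t ht.1)
      (fun t ht => by
        have h1 := h.pos t ht.1
        have h2 := hlt t ht
        apply mul_pos (by positivity); linarith)
    simpa [h.cubeInt_start, h.y_start] using this
  have lower : ∀ x, T ≤ x → (∀ t ∈ Set.Ioo T x, 0 < cubeInt y y1 J t - (t - T) / 10 * y t ^ 3) →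
      (x - T) - T * (x - T) ^ 2 / 18 - (x - T) ^ 3 / 60 ≤ y x := fun x hx hpos => by
    have h1 : ∀ t, T ≤ t → t ≤ x → 1 - T * (t - T) / 9 - (t - T) ^ 2 / 20 ≤ y1 t := fun t ht htx => by
      have := sub_le_sub_of_hasDerivAt (g := y1)
        (f := fun t => - T * (t - T) / 9 - (t - T) ^ 2 / 20) (f' := fun t => -T / 9 - (t - T) / 10) ht
        (Continuous.continuousOn (by fun_prop)) (h.cy1.mono Set.Icc_subset_Ici_self)
        (fun s _ => by
          have d := (hasDerivAt_id' s).sub_const T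
          refine (((d.const_mul (-T)).div_const 9).sub ((d.pow 2).div_const 20)).congr_deriv ?_
          push_cast; ring) (fun s hs => h.dy1' hs.1)
        (fun s hs => by
          have h2 := hpos s ⟨hs.1, hs.2.trans_le htx⟩
          have h3 := pow_pos (h.pos s hs.1) 3
          have h4 : (s - T) / 90 ≤ cubeInt y y1 J s / (9 * y s ^ 3) := by
            rw [le_div_iff₀ (by positivity)]; linarith
          linarith)
      simp only [h.y1_start, sub_self] at this
      norm_num at this
      linarith
    have := sub_le_sub_of_hasDerivAt (g := y)
      (f := fun t => (t - T) - T * (t - T) ^ 2 / 18 - (t - T) ^ 3 / 60)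
      (f' := fun t => 1 - T * (t - T) / 9 - (t - T) ^ 2 / 20) hx
      (Continuous.continuousOn (by fun_prop)) (h.cy.mono Set.Icc_subset_Ici_self)
      (fun s _ => by
        have d := (hasDerivAt_id' s).sub_const T
        refine ((d.sub (((d.pow 2).const_mul T).div_const 18)).sub
          ((d.pow 3).div_const 60)).congr_deriv ?_
        push_cast; ring) (fun s hs => h.dy s hs.1) (fun s hs => h1 s hs.1.le hs.2.le)
    simp only [h.y_start, sub_self] at this
    norm_num at this
    linarith
  have main := forall_pos_of_bootstrap
    (h := fun x => cubeInt y y1 J x - (x - T) / 10 * y x ^ 3) (a := T) (b := T + 7)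
    (hc.mono Set.Icc_subset_Ici_self)
    (by
      have h1 := (h.cy1 T (by simp)).tendsto
      rw [h.y1_start] at h1
      have h2 := (h1.eventually_lt_const (show (1:ℝ) < 1.1 by norm_num)).and
        (h1.eventually_const_lt (show (0.9:ℝ) < 1 by norm_num))
      rw [eventually_nhdsWithin_iff] at h2
      obtain ⟨ε, hε, hb⟩ := Metric.eventually_nhds_iff.1 h2
      have hb' : ∀ t ∈ Set.Ioo T (T + ε), y1 t < 1.1 ∧ 0.9 < y1 t := fun t ht => hb (by
        rw [Real.dist_eq, abs_lt]; constructor <;> linarith [ht.1, ht.2]) ht.1.le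
      filter_upwards [Ioo_mem_nhdsGT (show T < T + ε by linarith)] with x hx
      refine pos_of x hx.1 (fun t ht => ?_)
      have hy : 0.9 * (t - T) ≤ y t := by
        have := sub_le_sub_of_hasDerivAt (g := y) (f := fun t => 0.9 * (t - T))
          (f' := fun _ => 0.9 * 1) ht.1.le (Continuous.continuousOn (by fun_prop)) (h.cy.mono Set.Icc_subset_Ici_self)
          (fun s _ => ((hasDerivAt_id' s).sub_const T).const_mul _) (fun s hs => h.dy s hs.1)
          (fun s hs => by linarith [(hb' s ⟨hs.1, hs.2.trans (ht.2.trans hx.2)⟩).2])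
        simp only [h.y_start, sub_self] at this
        linarith
      have h3 := (hb' t ⟨ht.1, ht.2.trans hx.2⟩).1
      have h4 : (t - T) * y1 t ≤ (t - T) * 1.1 := by
        have := sub_nonneg.2 ht.1.le
        gcongr
      linarith [ht.1])
    (by
      intro x hx hpos
      refine pos_of x hx.1 (fun t ht => ?_)
      have h1 := lower t ht.1.le (fun r hr => hpos r ⟨hr.1, hr.2.trans ht.2⟩)
      have h2 := h.slope_sq_le ht.1
      have hy := h.pos t ht.1
      obtain ⟨s, hs⟩ : ∃ s, s = t - T := ⟨_, rfl⟩
      rw [← hs] at h1 ⊢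
      have hs0 : 0 < s := by linarith [ht.1]
      have hs7 : s ≤ 7 := by linarith [ht.2, hx.2]
      have B := fun i j => chordProd_nonneg hs0.le hs7 i j
      obtain ⟨b, hb⟩ : ∃ b, b = -T * s := ⟨_, rfl⟩
      have hb8 : 0.8 * s ≤ b := by rw [hb]; gcongr; linarith
      have p0 : 0 < 1 + 0.8 * s / 18 - s ^ 2 / 60 := by linarith [B 0 2, B 1 1, B 2 0]
      have q0 : 0 < 9 + 5 / 18 * (0.8 * s) - 0.15 * s ^ 2 := by linarith [B 0 2, B 1 1, B 2 0]
      -- With `b = -T s` the claim `(s y1)² < (3y)²` reduces to this product at `b`. Both factors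
      -- increase with `b`, so only `b = 0.8 s` has to be checked.
      have pq : 1 < (1 + 0.8 * s / 18 - s ^ 2 / 60) * (9 + 5 / 18 * (0.8 * s) - 0.15 * s ^ 2) := by
        linarith [B 0 4, B 1 3, B 2 2, B 3 1, B 4 0]
      have pq' : 1 < (1 + b / 18 - s ^ 2 / 60) * (9 + 5 / 18 * b - 0.15 * s ^ 2) := by
        refine pq.trans_le ?_
        gcongr
        linarith
      have hyp : s * (1 + b / 18 - s ^ 2 / 60) ≤ y t := by
        rw [hb]; linarith
      have h5 : s * (9 + 5 / 18 * b - 0.15 * s ^ 2) ≤ 9 * y t - 2 / 9 * b * s := by linarith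
      have h6 : (s * (1 + b / 18 - s ^ 2 / 60)) * (s * (9 + 5 / 18 * b - 0.15 * s ^ 2)) ≤
          y t * (9 * y t - 2 / 9 * b * s) := by
        apply mul_le_mul hyp h5 _ hy.le
        apply mul_nonneg hs0.le; linarith
      have h7 : s ^ 2 < y t * (9 * y t - 2 / 9 * b * s) := by
        have := mul_lt_mul_of_pos_left pq' (show 0 < s ^ 2 by positivity)
        linarith
      have h8 : (s * y1 t) ^ 2 < (3 * y t) ^ 2 := by
        have := mul_le_mul_of_nonneg_left h2 (sq_nonneg s)
        rw [hb] at h7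
        linarith
      exact lt_of_pow_lt_pow_left₀ 2 (by positivity) h8)
  exact fun x hx => lower x hx.1 (fun t ht => main t ⟨ht.1, ht.2.le.trans hx.2⟩)

/-- Large shifts are incompatible with a common limit. -/
theorem false_of_large_shift {a l : ℝ} {v v1 K : ℝ → ℝ} (hy : HalfProfile (-a) 1 y y1 J)
    (hv : HalfProfile a 1 v v1 K) (ha : 0.8 ≤ a) (hl : 0 < l)
    (hly : Tendsto y atTop (𝓝 l)) (hlv : Tendsto v atTop (𝓝 l)) : False := by
  have ha0 : 0 < a := by linarith
  have hal : a * l ≤ 4.5 := by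
    have h1 := hv.toProfileOn.energy_nonneg_of_tendsto hlv (show a < a + 1 by linarith)
    have h2 := hv.energy_antitone' hl.le le_rfl (show a ≤ a + 1 by linarith)
    rw [hv.energy_start] at h2
    have h3 : 0 ≤ l ^ 2 * (9 - 2 * (a * l)) := by linarith
    have := (mul_nonneg_iff_of_pos_left (by positivity)).1 h3
    linarith
  have e1 := hv.energy_at_climb hl (fun x hx => hv.le_quadratic_of_pos ha0 hx.1.le (by
    have : a * (x - a) ≤ a * l := by gcongr; linarith [hx.2]
    linarith))
  have e2 := hy.energy_at_climb hl (fun x hx =>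
    hy.le_quadratic_of_nonpos (by linarith) hx.1.le)
  have e3 := hv.toProfileOn.energy_nonneg_of_tendsto hlv (show a < a + l by linarith)
  -- The terms with `a` have opposite signs for `y` and `v`. Adding the two climbing estimates
  -- removes them, and the energy of `v` is nonnegative.
  have e4 : energy y y1 J l (-a + l) ≤ 18 * l ^ 2 - 3 / 2 * l ^ 4 := by linarith
  have hl2 : l ≤ 2.51 := by
    have h1 : 0 ≤ l ^ 2 * (9 - 3 / 4 * l ^ 2 - 2 * a * l - a * l ^ 3 / 45) := by linarith
    have h2 := (mul_nonneg_iff_of_pos_left (by positivity)).1 h1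
    by_contra hc
    push Not at hc
    have h3 : 0.8 * 2.51 ≤ a * l := by gcongr
    have h4 : 2.51 ^ 2 ≤ l ^ 2 := by gcongr
    have h5 : 0.8 * 2.51 * 2.51 ^ 2 ≤ a * l * l ^ 2 := by gcongr
    linarith
  have e5 := hy.toProfileOn.energy_nonneg_of_tendsto hly (show -a < -a + 7 by linarith)
  have e6 := hy.toProfileOn.energy_antitone hl.le (show -a < -a + l by linarith)
    (show -a + l ≤ -a + 2.6 by linarith)
  have hd : ∀ x, HasDerivAt (fun x => cubePoly (0.8 / 18) (1 / 60) 0 (x + a) - 3 * l ^ 2 *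
      ((x + a) ^ 2 / 2 + 0.8 / 54 * (x + a) ^ 3 - (x + a) ^ 4 / 240) + 2 * l ^ 3 * (x + a))
      (((x + a) + 0.8 / 18 * (x + a) ^ 2 - 1 / 60 * (x + a) ^ 3 - 0 * (x + a) ^ 4) ^ 3 - 3 * l ^ 2 *
        ((x + a) + 0.8 / 18 * (x + a) ^ 2 - 1 / 60 * (x + a) ^ 3) + 2 * l ^ 3) x := fun x => by
    have d := (hasDerivAt_id' x).add_const a
    refine (((HasDerivAt.comp_add_const x a (hasDerivAt_cubePoly (0.8 / 18) (1 / 60) 0 (x + a))).sub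
      (((((d.pow 2).div_const 2).add ((d.pow 3).const_mul (0.8 / 54))).sub
      ((d.pow 4).div_const 240)).const_mul (3 * l ^ 2))).add (d.const_mul (2 * l ^ 3))).congr_deriv ?_
    push_cast; ring
  -- On `[2.6, 7]`, measured from the zero, the cubic lower bound keeps `y` above `l`. The energy
  -- lost there exceeds the available `18 l² - (3/2) l⁴` for `l ≤ 2.51`, yet the energy at the limit
  -- value must remain nonnegative.
  have e7 := sub_le_sub_of_hasDerivAt (a := -a + 2.6) (b := -a + 7) (by linarith)
    (fun x _ => (hd x).continuousAt.continuousWithinAt)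
    (g := fun x => - energy y y1 J l x)
    (fun x hx => (hy.denergy l (show -a < x by linarith [hx.1])).neg.continuousAt.continuousWithinAt)
    (fun x _ => hd x) (fun x hx => (hy.denergy l (show -a < x by linarith [hx.1])).neg)
    (fun x hx => by
      obtain ⟨s, hs⟩ : ∃ s, s = x + a := ⟨_, rfl⟩
      have h1 := hy.ge_cubic (by linarith) x ⟨by linarith [hx.1], by linarith [hx.2]⟩
      rw [sub_neg_eq_add, ← hs] at h1
      rw [← hs]
      have hs1 : 2.6 ≤ s := by linarith [hx.1]
      have hs2 : s ≤ 7 := by linarith [hx.2]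
      have B := fun i j => chordProd_nonneg hs1 hs2 i j
      obtain ⟨p, hp⟩ : ∃ p, p = s + 0.8 / 18 * s ^ 2 - 1 / 60 * s ^ 3 := ⟨_, rfl⟩
      have hpl : l ≤ p := by
        rw [hp]; linarith [B 0 3, B 1 2, B 2 1, B 3 0]
      have hpy : p ≤ y x := by
        have := mul_le_mul_of_nonneg_right ha (sq_nonneg s)
        rw [hp]; linarith
      rw [zero_mul, sub_zero, ← hp]
      have h2 : 0 ≤ (y x - p) * ((y x - p) * (y x + 2 * p) + 3 * ((p - l) * (p + l))) := by
        have := sub_nonneg.2 hpy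
        have := sub_nonneg.2 hpl
        have : 0 ≤ p + l := by linarith
        have : 0 ≤ y x + 2 * p := by linarith
        positivity
      linarith)
  simp only [neg_add_cancel_comm] at e7
  have B := fun i j => chordProd_nonneg hl.le hl2 i j
  norm_num [cubePoly] at e7
  linarith [B 0 4, B 1 3, B 2 2, B 3 1, B 4 0]

end HalfProfile

theorem tendsto_rescale {l b : ℝ} {y : ℝ → ℝ} (hl : 0 < l) (h : Tendsto y atTop (𝓝 b)) :
    Tendsto (fun x => l ^ 3 * y (x / l)) atTop (𝓝 (l ^ 3 * b)) :=
  (h.comp (tendsto_id.atTop_div_const hl)).const_mul _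

/-- Two half profiles with opposite shifts, equal slopes and a common limit cannot exist. -/
theorem HalfProfile.false_of_shift {a α l : ℝ} {y y1 J v v1 K : ℝ → ℝ}
    (hy : HalfProfile (-a) α y y1 J) (hv : HalfProfile a α v v1 K) (ha : 0 < a) (hα : 0 < α)
    (hl : 0 < l) (hly : Tendsto y atTop (𝓝 l)) (hlv : Tendsto v atTop (𝓝 l)) : False := by
  obtain ⟨m, hm⟩ : ∃ m, m = (√α)⁻¹ := ⟨_, rfl⟩
  have hm0 : 0 < m := by rw [hm]; positivity
  have e : m ^ 2 * α = 1 := by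
    rw [hm, inv_pow, Real.sq_sqrt hα.le, inv_mul_cancel₀ hα.ne']
  have hy' := hy.rescale hm0
  have hv' := hv.rescale hm0
  rw [e, mul_neg] at hy'
  rw [e] at hv'
  rcases le_total (m * a) 0.8 with h | h
  · exact hy'.false_of_small_shift hv' (by positivity) h (tendsto_rescale hm0 hly)
      (tendsto_rescale hm0 hlv)
  · exact hy'.false_of_large_shift hv' h (by positivity) (tendsto_rescale hm0 hly)
      (tendsto_rescale hm0 hlv)

/-! ### The structure of shock profiles -/

namespace IsShockProfile
variable {f : ℝ → ℝ}

/-- The derivative of the flux. -/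
noncomputable def fluxSlope (f : ℝ → ℝ) : ℝ → ℝ := deriv (fun z => f z * deriv f z)

theorem hasDerivAt (h : IsShockProfile f) (z : ℝ) : HasDerivAt f (deriv f z) z :=
  (h.differentiable z).hasDerivAt

theorem hasDerivAt_flux (h : IsShockProfile f) (z : ℝ) :
    HasDerivAt (fun z => f z * deriv f z) (fluxSlope f z) z :=
  (h.differentiable_flux z).hasDerivAt

theorem hasDerivAt_fluxSlope (h : IsShockProfile f) (z : ℝ) :
    HasDerivAt (fluxSlope f) (1 / 3 * z * deriv f z) z := h.ode z

theorem reflect (h : IsShockProfile f) : IsShockProfile (fun z => -f (-z)) := by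
  have d : ∀ z, HasDerivAt (fun z => -f (-z)) (deriv f (-z)) z := fun z =>
    ((h.hasDerivAt (-z)).comp z (hasDerivAt_neg z)).neg.congr_deriv (by ring)
  have dd : deriv (fun z => -f (-z)) = fun z => deriv f (-z) := funext fun z => (d z).deriv
  have e : (fun z => -f (-z) * deriv (fun z => -f (-z)) z) = fun z => -(f (-z) * deriv f (-z)) := by
    rw [dd]; funext z; ring
  have d2 : ∀ z, HasDerivAt (fun z => -f (-z) * deriv (fun z => -f (-z)) z) (fluxSlope f (-z)) z := by
    intro z
    rw [e]
    exact ((h.hasDerivAt_flux (-z)).comp z (hasDerivAt_neg z)).neg.congr_deriv (by ring)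
  have dd2 : deriv (fun z => -f (-z) * deriv (fun z => -f (-z)) z) = fun z => fluxSlope f (-z) :=
    funext fun z => (d2 z).deriv
  refine ⟨fun z => (d z).differentiableAt, fun z => (d2 z).differentiableAt, fun z => ?_, ?_, ?_⟩
  · rw [dd2, (d z).deriv]
    exact ((h.hasDerivAt_fluxSlope (-z)).comp z (hasDerivAt_neg z)).congr_deriv (by ring)
  · simpa using (h.tendsto_atTop.comp tendsto_neg_atBot_atTop).neg
  · exact (h.tendsto_atBot.comp tendsto_neg_atTop_atBot).neg

/-- An antiderivative of `f³` which vanishes at the zeros of `f`. -/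
noncomputable def cubePrimitive (f : ℝ → ℝ) (z : ℝ) : ℝ :=
  z * f z ^ 3 - 9 * (f z ^ 2 * fluxSlope f z - (f z * deriv f z) ^ 2)

theorem hasDerivAt_cubePrimitive (h : IsShockProfile f) (z : ℝ) :
    HasDerivAt (cubePrimitive f) (f z ^ 3) z := by
  have h1 := (hasDerivAt_id' z).mul ((h.hasDerivAt z).pow 3)
  have h2 := ((h.hasDerivAt z).pow 2).mul (h.hasDerivAt_fluxSlope z)
  have h3 := (h.hasDerivAt_flux z).pow 2
  refine (h1.sub ((h2.sub h3).const_mul 9)).congr_deriv ?_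
  simp only [Pi.pow_apply]
  push_cast
  ring

theorem cubePrimitive_zero {z : ℝ} (hz : f z = 0) : cubePrimitive f z = 0 := by
  simp [cubePrimitive, hz]

theorem exists_zero_between (h : IsShockProfile f) {p q : ℝ} (hpq : p < q) (hp : f p = 0)
    (hq : f q = 0) : ∃ z ∈ Set.Ioo p q, f z = 0 := by
  obtain ⟨z, hz, he⟩ := exists_hasDerivAt_eq_slope (cubePrimitive f) (fun z => f z ^ 3) hpq
    (fun z _ => (h.hasDerivAt_cubePrimitive z).continuousAt.continuousWithinAt)
    (fun z _ => h.hasDerivAt_cubePrimitive z)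
  rw [cubePrimitive_zero hp, cubePrimitive_zero hq, sub_self, zero_div] at he
  exact ⟨z, hz, by simpa using he⟩

theorem continuous (h : IsShockProfile f) : Continuous f := h.differentiable.continuous

/-- A point with `f ≠ 0` between two zeros would lie in a gap of the zero set, and
`exists_zero_between` puts a zero inside that gap. -/
theorem eq_zero_between (h : IsShockProfile f) {p q x : ℝ} (hp : f p = 0) (hq : f q = 0)
    (hx : x ∈ Set.Icc p q) : f x = 0 := by
  by_contra hne
  have hcl : ∀ a b, IsCompact (Set.Icc a b ∩ f ⁻¹' {0}) := fun a b =>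
    isCompact_Icc.inter_right (isClosed_singleton.preimage h.continuous)
  obtain ⟨l, hl, hl'⟩ := (hcl p x).exists_isGreatest ⟨p, ⟨le_rfl, hx.1⟩, hp⟩
  obtain ⟨r, hr, hr'⟩ := (hcl x q).exists_isLeast ⟨q, ⟨hx.2, le_rfl⟩, hq⟩
  have hlx : l < x := lt_of_le_of_ne hl.1.2 fun e => hne (e ▸ hl.2)
  have hxr : x < r := lt_of_le_of_ne hr.1.1 fun e => hne (e ▸ hr.2)
  obtain ⟨z, hz, hz0⟩ := h.exists_zero_between (hlx.trans hxr) hl.2 hr.2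
  rcases le_total z x with hzx | hzx
  · exact (hl' ⟨⟨hl.1.1.trans hz.1.le, hzx⟩, hz0⟩).not_gt hz.1
  · exact (hr' ⟨⟨hzx, hz.2.le.trans hr.1.2⟩, hz0⟩).not_gt hz.2

theorem exists_last_zero (h : IsShockProfile f) : ∃ b, f b = 0 ∧ ∀ z, b < z → f z < 0 := by
  obtain ⟨A, hA⟩ := (h.tendsto_atBot.eventually (lt_mem_nhds (by norm_num : (0:ℝ) < 1))).exists
  obtain ⟨B, hB⟩ := eventually_atTop.1
    (h.tendsto_atTop.eventually (gt_mem_nhds (by norm_num : (-1:ℝ) < 0)))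
  set C := max A B with hC
  have hfC : f C < 0 := hB C (le_max_right _ _)
  have hcl : IsCompact (Set.Icc A C ∩ f ⁻¹' {0}) :=
    isCompact_Icc.inter_right (isClosed_singleton.preimage h.continuous)
  obtain ⟨z, hz, hz0⟩ := intermediate_value_Icc' (le_max_left A B) h.continuous.continuousOn
    (⟨hfC.le, hA.le⟩ : (0:ℝ) ∈ Set.Icc (f C) (f A))
  obtain ⟨b, hb, hb'⟩ := hcl.exists_isGreatest ⟨z, hz, hz0⟩
  refine ⟨b, hb.2, fun x hx => ?_⟩
  by_contra hcon
  push Not at hcon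
  rcases le_or_gt C x with hCx | hCx
  · exact (hB x ((le_max_right A B).trans hCx)).not_ge hcon
  · obtain ⟨t, ht, ht0⟩ := intermediate_value_Icc' hCx.le h.continuous.continuousOn
      (⟨hfC.le, hcon⟩ : (0:ℝ) ∈ Set.Icc (f C) (f x))
    exact (hb' ⟨⟨hb.1.1.trans (hx.le.trans ht.1), ht.2⟩, ht0⟩).not_gt (hx.trans_le ht.1)

/-- At a zero the derivative of the flux is the square of the slope. -/
theorem fluxSlope_eq_sq (h : IsShockProfile f) {b : ℝ} (hb : f b = 0) :
    fluxSlope f b = deriv f b ^ 2 := by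
  have h1 := (h.hasDerivAt b).tendsto_slope_zero_right
  have h2 := (h.hasDerivAt_flux b).tendsto_slope_zero_right
  simp only [hb, zero_mul, sub_zero, smul_eq_mul] at h1 h2
  -- The limit of `f²/t²` is computed twice: by l'Hôpital it is the derivative of the flux, directly
  -- it is the squared slope.
  have h3 : Tendsto (fun t => f (b + t) ^ 2 / t ^ 2) (𝓝[>] 0) (𝓝 (fluxSlope f b)) := by
    have hs : ∀ t, HasDerivAt (fun t => b + t) 1 t := fun t => (hasDerivAt_id' t).const_add b
    have h0 : Tendsto (fun t => 2 * (f (b + t) * deriv f (b + t)) / (2 * t)) (𝓝[>] 0)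
        (𝓝 (fluxSlope f b)) := by
      refine h2.congr fun t => ?_
      rw [mul_div_mul_left _ _ two_ne_zero, div_eq_inv_mul]
    refine tendsto_div_of_hasDerivAt (fun t _ => ?_) (fun t _ => ?_) (fun t ht => ?_) ?_ ?_ ?_ ?_ h0
    · refine (((h.hasDerivAt (b + t)).comp t (hs t)).pow 2).congr_deriv ?_
      simp only [Function.comp_apply]
      push_cast
      ring
    · simpa using hasDerivAt_pow 2 t
    · positivity
    · have := h.continuous
      fun_prop
    · fun_prop
    · simp [hb]
    · simp
  have h4 := h1.pow 2
  refine tendsto_nhds_unique h3 (h4.congr fun t => ?_)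
  rw [mul_pow, inv_pow]; ring

/-- A zero to the right of which `f` is negative starts a profile. -/
theorem profileOn (h : IsShockProfile f) {b : ℝ} (hneg : ∀ z, b < z → f z < 0) :
    ProfileOn b (fun z => -f z) (fun z => -deriv f z) (fun z => 3 * fluxSlope f z - z * f z) := by
  refine ⟨fun x hx => neg_pos.2 (hneg x hx), fun x _ => (h.hasDerivAt x).neg, fun x _ => ?_,
    fun x hx => ?_⟩
  · refine (((h.hasDerivAt_fluxSlope x).const_mul 3).sub
      ((hasDerivAt_id' x).mul (h.hasDerivAt x))).congr_deriv ?_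
    ring
  · have hfx := (hneg x hx).ne
    have h1 := ((h.hasDerivAt_flux x).div (h.hasDerivAt x) hfx).neg
    have h2 : (fun z => -deriv f z) =ᶠ[𝓝 x] fun z => -(f z * deriv f z / f z) := by
      filter_upwards [lt_mem_nhds hx] with z hz
      rw [mul_div_cancel_left₀ _ (hneg z hz).ne]
    refine (h1.congr_of_eventuallyEq h2).congr_deriv ?_
    field_simp
    ring

theorem continuous_flux (h : IsShockProfile f) : Continuous fun z => f z * deriv f z :=
  h.differentiable_flux.continuous

theorem continuous_fluxSlope (h : IsShockProfile f) : Continuous (fluxSlope f) :=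
  continuous_iff_continuousAt.2 fun z => (h.hasDerivAt_fluxSlope z).continuousAt

/-- Continuity of `f'` at the zero is not assumed. It follows from `f' = (f f')/f`: dividing
numerator and denominator by `z - b`, the limit is `f'(b)² / f'(b)`, which needs a nonzero slope. -/
theorem halfProfile (h : IsShockProfile f) {b : ℝ} (hb : f b = 0) (hneg : ∀ z, b < z → f z < 0)
    (hd : deriv f b ≠ 0) :
    HalfProfile b (-deriv f b) (fun z => -f z) (fun z => -deriv f z)
      (fun z => 3 * fluxSlope f z - z * f z) := by
  have hp := h.profileOn hneg
  have hc := h.continuous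
  have hc' := h.continuous_fluxSlope
  refine ⟨hp, by fun_prop, fun x hx => ?_, by fun_prop, by simp [hb], rfl, ?_⟩
  · rcases (show b ≤ x from hx).eq_or_lt with rfl | hx
    · have h1 := (hasDerivAt_iff_tendsto_slope.1 (h.hasDerivAt b)).mono_left
        (nhdsWithin_mono b fun z (hz : b < z) => hz.ne')
      have h2 := (hasDerivAt_iff_tendsto_slope.1 (h.hasDerivAt_flux b)).mono_left
        (nhdsWithin_mono b fun z (hz : b < z) => hz.ne')
      have h3 := (h2.div h1 hd).neg
      rw [← continuousWithinAt_Ioi_iff_Ici]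
      have e : -(fluxSlope f b / deriv f b) = -deriv f b := by
        rw [h.fluxSlope_eq_sq hb]; field_simp
      rw [e] at h3
      refine h3.congr' ?_
      filter_upwards [self_mem_nhdsWithin] with z hz
      have hz1 : z - b ≠ 0 := sub_ne_zero.2 (ne_of_gt hz)
      have hz2 := (hneg z hz).ne
      simp only [Pi.div_apply, slope_def_field, hb]
      field_simp
      ring
    · exact (hp.dy1 x hx).continuousAt.continuousWithinAt
  · simp only [hb, h.fluxSlope_eq_sq hb]; ring

/-- The last zero is non-degenerate if it is not to the left of the origin. -/
theorem deriv_ne_zero_of_nonneg (h : IsShockProfile f) {b : ℝ} (hb : f b = 0)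
    (hneg : ∀ z, b < z → f z < 0) (hb0 : 0 ≤ b) : deriv f b ≠ 0 := by
  intro hd
  have hp := h.profileOn hneg
  have hc := h.continuous
  have hc' := h.continuous_fluxSlope
  have hc'' := h.continuous_flux
  -- With zero slope the energy at `b ≥ 0` is `-2 b c³ ≤ 0` for every `c > 0`. It dominates the
  -- squared flux afterwards, so `f` would be constant to the right of `b`.
  have key : ∀ x, b < x → deriv f x = 0 := by
    intro x hx
    have hE : ContinuousOn (energy (fun z => -f z) (fun z => -deriv f z)
        (fun z => 3 * fluxSlope f z - z * f z) (-f x)) (Set.Icc b x) := by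
      have : (energy (fun z => -f z) (fun z => -deriv f z)
        (fun z => 3 * fluxSlope f z - z * f z) (-f x)) = fun z =>
          3 * (3 * fluxSlope f z - z * f z) * (-f x) ^ 2 - (3 * (3 * fluxSlope f z - z * f z) *
          (-f z) ^ 2 - 2 * z * (-f z) ^ 3 - 9 * (f z * deriv f z) ^ 2) - 2 * z * (-f x) ^ 3 := by
        funext z; simp only [energy, cubeInt]; ring
      rw [this]
      fun_prop
    have hm := le_of_hasDerivAt_nonneg hx.le hE.neg (fun t ht => (hp.denergy _ ht.1).neg)
      (fun t ht => by
        have h1 := (neg_pos.2 (hneg t ht.1)).le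
        have h2 := (neg_pos.2 (hneg x hx)).le
        rw [neg_neg]; positivity)
    simp only [Pi.neg_apply] at hm
    have e1 : energy (fun z => -f z) (fun z => -deriv f z)
        (fun z => 3 * fluxSlope f z - z * f z) (-f x) x = 9 * (-f x * -deriv f x) ^ 2 :=
      ProfileOn.energy_self (y := fun z => -f z) (y1 := fun z => -deriv f z) x
    have e2 : energy (fun z => -f z) (fun z => -deriv f z)
        (fun z => 3 * fluxSlope f z - z * f z) (-f x) b = -(2 * b * (-f x) ^ 3) := by
      simp only [energy, cubeInt, hb, h.fluxSlope_eq_sq hb, hd]; ring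
    rw [e1, e2] at hm
    have h3 : 0 ≤ 2 * b * (-f x) ^ 3 := by
      have := neg_pos.2 (hneg x hx)
      positivity
    have h4 : (-f x * -deriv f x) ^ 2 = 0 := le_antisymm (by linarith) (sq_nonneg _)
    have := pow_eq_zero_iff two_ne_zero |>.1 h4
    simpa [(hneg x hx).ne] using this
  have := le_of_hasDerivAt_nonneg (f := f) (by linarith : b ≤ b + 1) hc.continuousOn
    (fun t _ => h.hasDerivAt t) (fun t ht => (key t ht.1).ge)
  linarith [hneg (b + 1) (by linarith)]

/-- A shock profile crosses zero once, with negative slope. -/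
theorem exists_crossing (h : IsShockProfile f) : ∃ b, f b = 0 ∧ deriv f b ≠ 0 ∧
    (∀ z, b < z → f z < 0) ∧ ∀ z, z < b → 0 < f z := by
  obtain ⟨b, hb, hneg⟩ := h.exists_last_zero
  obtain ⟨c, hc, hneg'⟩ := h.reflect.exists_last_zero
  have hc0 : f (-c) = 0 := by simpa using hc
  have hpos : ∀ z, z < -c → 0 < f z := fun z hz => by
    have := hneg' (-z) (by linarith)
    simp only [neg_neg] at this
    linarith
  have hdr : deriv (fun z => -f (-z)) c = deriv f (-c) :=
    (((h.hasDerivAt (-c)).comp c (hasDerivAt_neg c)).neg.congr_deriv (by ring)).deriv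
  have hcb : -c ≤ b := by
    by_contra hlt
    push Not at hlt
    linarith [hneg _ hlt]
  -- Either the last zero `b` is `≥ 0`, or the first zero `-c ≤ b` is `≤ 0`; in both cases one end
  -- of the zero interval is nondegenerate. On an interval of positive length the derivative would
  -- vanish at both ends.
  have hne : deriv f b ≠ 0 ∨ deriv f (-c) ≠ 0 := by
    rcases le_total 0 b with h0 | h0
    · exact Or.inl (h.deriv_ne_zero_of_nonneg hb hneg h0)
    · exact Or.inr (hdr ▸ h.reflect.deriv_ne_zero_of_nonneg hc hneg' (by linarith))
  have heq : -c = b := by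
    by_contra hne'
    have hlt : -c < b := lt_of_le_of_ne hcb hne'
    have hz : ∀ x ∈ Set.Icc (-c) b, f x = 0 := fun x hx => h.eq_zero_between hc0 hb hx
    have aux : ∀ x ∈ Set.Icc (-c) b, deriv f x = 0 := fun x hx => by
      have h1 := (h.hasDerivAt x).hasDerivWithinAt (s := Set.Icc (-c) b)
      have h2 : HasDerivWithinAt f 0 (Set.Icc (-c) b) x :=
        (hasDerivWithinAt_const x (Set.Icc (-c) b) (0:ℝ)).congr hz (hz x hx)
      exact (uniqueDiffOn_Icc hlt x hx).eq_deriv _ h1 h2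
    rcases hne with hn | hn
    · exact hn (aux b ⟨hlt.le, le_rfl⟩)
    · exact hn (aux (-c) ⟨le_rfl, hlt.le⟩)
  refine ⟨b, hb, ?_, hneg, heq ▸ hpos⟩
  rw [heq] at hne
  tauto

/-- The crossing is at the origin, and both halves are half profiles with the same slope. -/
theorem structure_at_origin (h : IsShockProfile f) : f 0 = 0 ∧ ∃ α, 0 < α ∧ ∃ y1 J v1 K,
    HalfProfile 0 α (fun x => f (-x)) y1 J ∧ HalfProfile 0 α (fun x => -f x) v1 K := by
  obtain ⟨b, hb, hd, hneg, hpos⟩ := h.exists_crossing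
  have hv := h.halfProfile hb hneg hd
  have hdr : deriv (fun z => -f (-z)) (-b) = deriv f b := by
    have h1 := h.hasDerivAt (- -b)
    have h2 : HasDerivAt (fun z => -f (-z)) (deriv f b) (-b) := by
      refine (h1.comp (-b) (hasDerivAt_neg (-b))).neg.congr_deriv ?_
      rw [neg_neg]; ring
    exact h2.deriv
  have hy := h.reflect.halfProfile (b := -b) (by simp [hb])
    (fun z hz => neg_neg_of_pos (hpos _ (by linarith))) (by rw [hdr]; exact hd)
  rw [hdr] at hy
  simp only [neg_neg] at hy
  have hα : 0 < -deriv f b := by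
    refine lt_of_le_of_ne ?_ (fun e => hd (by linarith))
    have h1 : Tendsto (slope f b) (𝓝[>] b) (𝓝 (deriv f b)) := (hasDerivAt_iff_tendsto_slope.1 (h.hasDerivAt b)).mono_left
        (nhdsWithin_mono b fun z (hz : b < z) => hz.ne')
    have : deriv f b ≤ 0 := by
      refine le_of_tendsto h1 ?_
      filter_upwards [self_mem_nhdsWithin] with z hz
      rw [slope_def_field, hb, sub_zero]
      exact div_nonpos_of_nonpos_of_nonneg (hneg z hz).le (sub_nonneg.2 (le_of_lt hz))
    linarith
  have t1 : Tendsto (fun x => f (-x)) atTop (𝓝 1) := h.tendsto_atBot.comp tendsto_neg_atTop_atBot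
  have t2 : Tendsto (fun x => -f x) atTop (𝓝 1) := by simpa using h.tendsto_atTop.neg
  have hb0 : b = 0 := by
    rcases lt_trichotomy b 0 with hlt | he | hgt
    · exact (HalfProfile.false_of_shift (a := -b) (by rwa [neg_neg]) hy (by linarith) hα one_pos
        t2 t1).elim
    · exact he
    · exact (HalfProfile.false_of_shift hy hv hgt hα one_pos t1 t2).elim
  subst hb0
  rw [neg_zero] at hy
  exact ⟨hb, _, hα, _, _, _, _, hy, hv⟩

end IsShockProfile

/-! ### Power series with geometrically bounded coefficients -/

/-- The coefficients grow at most geometrically. -/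
def GeomBounded {E : Type*} [NormedAddCommGroup E] (c : ℕ → E) : Prop :=
  ∃ M K : ℝ, 0 < K ∧ ∀ n, ‖c n‖ ≤ M * K ^ n

/-- The sum of the power series with coefficients `c`. -/
noncomputable def powerSum {E : Type*} [NormedAddCommGroup E] [NormedSpace ℝ E] (c : ℕ → E) (x : ℝ) : E :=
  ∑' n, x ^ n • c n

namespace GeomBounded
variable {E : Type*} [NormedAddCommGroup E] [NormedSpace ℝ E] {c : ℕ → E}

theorem of_succ_mul (h : GeomBounded c) : GeomBounded fun n => ((n : ℝ) + 1) • c (n + 1) := by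
  obtain ⟨M, K, hK, hc⟩ := h
  refine ⟨M * K, 2 * K, by positivity, fun n => ?_⟩
  have h2 : (n : ℝ) + 1 ≤ 2 ^ n := by exact_mod_cast Nat.lt_two_pow_self
  have h3 := (norm_nonneg _).trans (hc (n + 1))
  rw [norm_smul, Real.norm_of_nonneg (by positivity)]
  calc ((n : ℝ) + 1) * ‖c (n + 1)‖ ≤ ((n : ℝ) + 1) * (M * K ^ (n + 1)) := by gcongr; exact hc _
    _ ≤ 2 ^ n * (M * K ^ (n + 1)) := by gcongr
    _ = M * K * (2 * K) ^ n := by ring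

theorem summable (h : GeomBounded c) : ∃ r > 0, ∀ x : ℝ, |x| < r → Summable fun n => ‖x ^ n • c n‖ := by
  obtain ⟨M, K, hK, hc⟩ := h
  refine ⟨1 / K, by positivity, fun x hx => ?_⟩
  have hxK : |x| * K < 1 := by rwa [lt_div_iff₀ hK] at hx
  refine Summable.of_nonneg_of_le (fun n => norm_nonneg _) (fun n => ?_)
    ((summable_geometric_of_lt_one (by positivity) hxK).mul_left M)
  rw [norm_smul, norm_pow, Real.norm_eq_abs, mul_pow]
  calc |x| ^ n * ‖c n‖ ≤ |x| ^ n * (M * K ^ n) := by gcongr; exact hc n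
    _ = _ := by ring

theorem eventually_summable (h : GeomBounded c) :
    ∀ᶠ x : ℝ in 𝓝 0, Summable fun n => ‖x ^ n • c n‖ := by
  obtain ⟨r, hr, hs⟩ := h.summable
  filter_upwards [Metric.ball_mem_nhds (0:ℝ) hr] with x hx
  exact hs x (by simpa using hx)

theorem _root_.powerSum_zero (c : ℕ → E) : powerSum c 0 = c 0 := by
  rw [powerSum, tsum_eq_single 0]
  · simp
  · intro n hn; simp [hn]

variable [CompleteSpace E]

theorem analyticAt (h : GeomBounded c) : AnalyticAt ℝ (powerSum c) 0 := by
  refine ⟨(fun n => ContinuousMultilinearMap.mkPiRing ℝ (Fin n) (c n) :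
    FormalMultilinearSeries ℝ ℝ E), hasFPowerSeriesAt_iff.2 ?_⟩
  filter_upwards [h.eventually_summable] with x hx
  simpa [FormalMultilinearSeries.coeff, powerSum] using hx.of_norm.hasSum

theorem eventually_hasDerivAt (h : GeomBounded c) :
    ∀ᶠ x : ℝ in 𝓝 0, HasDerivAt (powerSum c) (powerSum (fun n => ((n : ℝ) + 1) • c (n + 1)) x) x := by
  obtain ⟨r, hr, hs⟩ := h.of_succ_mul.summable
  filter_upwards [Metric.ball_mem_nhds (0:ℝ) (half_pos hr)] with x hx
  have hx' : x ∈ Set.Ioo (-(r / 2)) (r / 2) := by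
    simpa [abs_lt, Real.norm_eq_abs] using hx
  have key := hasDerivAt_tsum_of_isPreconnected (𝕜 := ℝ) (g := fun (n : ℕ) (x : ℝ) => x ^ n • c n)
    (g' := fun (n : ℕ) (x : ℝ) => ((n : ℝ) * x ^ (n - 1)) • c n) (t := Set.Ioo (-(r / 2)) (r / 2))
    (u := fun n : ℕ => ‖((n : ℝ) * (r / 2) ^ (n - 1)) • c n‖) (y₀ := 0) (y := x) ?_ isOpen_Ioo
    isPreconnected_Ioo (fun n y _ => (hasDerivAt_pow n y).smul_const (c n)) ?_
    ⟨by linarith, by linarith⟩ ?_ hx'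
  · refine key.congr_deriv ?_
    have h0 : Summable fun n : ℕ => ((n : ℝ) * x ^ (n - 1)) • c n := by
      rw [← summable_nat_add_iff 1]
      have hxr : |x| < r := by
        rw [abs_lt]; constructor <;> linarith [hx'.1, hx'.2]
      refine (hs x hxr).of_norm.congr fun n => ?_
      simp [smul_smul, mul_comm]
    rw [h0.tsum_eq_zero_add]
    simp [powerSum, smul_smul, mul_comm]
  · rw [← summable_nat_add_iff 1]
    refine (hs (r / 2) (by rw [abs_of_pos (by positivity)]; linarith)).congr fun n => ?_
    simp [smul_smul, mul_comm]
  · intro n y hy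
    have : |y| ≤ r / 2 := abs_le.2 ⟨hy.1.le, hy.2.le⟩
    rw [norm_smul, norm_smul, norm_mul, norm_mul, norm_pow, norm_pow, Real.norm_eq_abs y,
      Real.norm_of_nonneg (by positivity : 0 ≤ r / 2)]
    gcongr
  · refine summable_of_ne_finset_zero (s := {0}) fun n hn => ?_
    simp [zero_pow (by simpa using hn)]

end GeomBounded

/-! ### Autonomous systems with quadratic right-hand side. -/

section Quadratic

variable {E F G : Type*} [NormedAddCommGroup E] [NormedSpace ℝ E] [NormedAddCommGroup F]
  [NormedSpace ℝ F] [NormedAddCommGroup G] [NormedSpace ℝ G]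

open Finset in
/-- The Cauchy product for a continuous bilinear map. -/
theorem ContinuousLinearMap.hasSum_sum_antidiagonal [CompleteSpace E] [CompleteSpace F]
    [CompleteSpace G] (B : E →L[ℝ] F →L[ℝ] G) {f : ℕ → E} {g : ℕ → F}
    (hf : Summable fun n => ‖f n‖) (hg : Summable fun n => ‖g n‖) :
    HasSum (fun n => ∑ p ∈ antidiagonal n, B (f p.1) (g p.2)) (B (∑' n, f n) (∑' n, g n)) := by
  have h : Summable fun p : ℕ × ℕ => B (f p.1) (g p.2) := by
    refine Summable.of_norm_bounded (g := fun p : ℕ × ℕ => ‖B‖ * (‖f p.1‖ * ‖g p.2‖))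
      ((hf.mul_of_nonneg hg (fun _ => norm_nonneg _) fun _ => norm_nonneg _).mul_left _) fun p => ?_
    rw [← mul_assoc]
    exact B.le_opNorm₂ _ _
  obtain ⟨T, hT⟩ := h
  have h1 := hT.prod_fiberwise fun i => (B (f i)).hasSum hg.of_norm.hasSum
  have h2 := (B.flip (∑' n, g n)).hasSum hf.of_norm.hasSum
  simp only [ContinuousLinearMap.flip_apply] at h2
  rw [← h1.unique h2]
  have h3 := ((HasAntidiagonal.sigmaAntidiagonalEquivProd (A := ℕ)).hasSum_iff.2 hT).sigma
    fun n => hasSum_fintype _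
  convert! h3 using 2 with n
  rw [← Finset.sum_finset_coe]
  rfl

/-- The Taylor coefficients of the solution of `z' = B z z`. -/
noncomputable def quadraticCoeff (B : E →L[ℝ] E →L[ℝ] E) (z : E) : ℕ → E
  | 0 => z
  | n + 1 => ((n : ℝ) + 1)⁻¹ • ∑ i : Fin (n + 1),
      B (quadraticCoeff B z i) (quadraticCoeff B z (n - i))

theorem quadraticCoeff_succ (B : E →L[ℝ] E →L[ℝ] E) (z : E) (n : ℕ) :
    ((n : ℝ) + 1) • quadraticCoeff B z (n + 1) = ∑ p ∈ Finset.HasAntidiagonal.antidiagonal n,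
      B (quadraticCoeff B z p.1) (quadraticCoeff B z p.2) := by
  rw [quadraticCoeff, smul_smul, mul_inv_cancel₀ (by positivity), one_smul,
    Finset.Nat.sum_antidiagonal_eq_sum_range_succ
      (fun i j => B (quadraticCoeff B z i) (quadraticCoeff B z j)),
    Fin.sum_univ_eq_sum_range (fun i => B (quadraticCoeff B z i) (quadraticCoeff B z (n - i)))]

theorem lipschitzOnWith_quadratic (B : E →L[ℝ] E →L[ℝ] E) (R : NNReal) :
    LipschitzOnWith (2 * ‖B‖₊ * R) (fun z => B z z) (Metric.closedBall 0 R) := by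
  refine LipschitzOnWith.of_dist_le_mul fun u hu v hv => ?_
  rw [mem_closedBall_zero_iff] at hu hv
  rw [dist_eq_norm, dist_eq_norm]
  have e : B u u - B v v = B u (u - v) + B (u - v) v := by simp
  rw [e]
  push_cast
  have h1 := B.le_opNorm₂ u (u - v)
  have h2 := B.le_opNorm₂ (u - v) v
  have h3 : ‖B‖ * ‖u‖ * ‖u - v‖ ≤ ‖B‖ * R * ‖u - v‖ := by gcongr
  have h4 : ‖B‖ * ‖u - v‖ * ‖v‖ ≤ ‖B‖ * ‖u - v‖ * R := by gcongr
  refine (norm_add_le _ _).trans ?_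
  linarith

/-- Induction: the `n + 1` terms of the convolution are compensated by the factor `n + 1` on the
left of the recursion. The summand 1 in the ratio only keeps it positive. -/
theorem geomBounded_quadraticCoeff (B : E →L[ℝ] E →L[ℝ] E) (z : E) :
    GeomBounded (quadraticCoeff B z) := by
  refine ⟨‖z‖, ‖B‖ * ‖z‖ + 1, by positivity, fun n => ?_⟩
  induction n using Nat.strong_induction_on with
  | _ n ih =>
    cases n with
    | zero => simp [quadraticCoeff]
    | succ n =>
      have h := congrArg norm (quadraticCoeff_succ B z n)
      rw [norm_smul, Real.norm_of_nonneg (by positivity)] at h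
      have hs : ‖∑ p ∈ Finset.HasAntidiagonal.antidiagonal n, B (quadraticCoeff B z p.1) (quadraticCoeff B z p.2)‖ ≤
          ∑ p ∈ Finset.HasAntidiagonal.antidiagonal n, ‖z‖ * (‖B‖ * ‖z‖ + 1) ^ (n + 1) := by
        refine norm_sum_le_of_le _ fun p hp => ?_
        have hpn := Finset.HasAntidiagonal.mem_antidiagonal.1 hp
        refine (B.le_opNorm₂ _ _).trans ?_
        have h1 := ih p.1 (by omega)
        have h2 := ih p.2 (by omega)
        calc ‖B‖ * ‖quadraticCoeff B z p.1‖ * ‖quadraticCoeff B z p.2‖ ≤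
            ‖B‖ * (‖z‖ * (‖B‖ * ‖z‖ + 1) ^ p.1) * (‖z‖ * (‖B‖ * ‖z‖ + 1) ^ p.2) := by gcongr
          _ = ‖z‖ * (‖B‖ * ‖z‖ + 1) ^ n * (‖B‖ * ‖z‖) := by rw [← hpn]; ring
          _ ≤ ‖z‖ * (‖B‖ * ‖z‖ + 1) ^ n * (‖B‖ * ‖z‖ + 1) := by gcongr; linarith
          _ = _ := by ring
      rw [Finset.sum_const, Finset.Nat.card_antidiagonal, nsmul_eq_mul, ← h] at hs
      push_cast at hs
      exact le_of_mul_le_mul_left hs (by positivity)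

/-- Solutions of quadratic autonomous systems exist locally and are analytic. -/
theorem eventually_hasDerivAt_quadratic [CompleteSpace E] (B : E →L[ℝ] E →L[ℝ] E) (z : E) :
    ∀ᶠ x : ℝ in 𝓝 0, HasDerivAt (powerSum (quadraticCoeff B z))
      (B (powerSum (quadraticCoeff B z) x) (powerSum (quadraticCoeff B z) x)) x := by
  have hg := geomBounded_quadraticCoeff B z
  filter_upwards [hg.eventually_hasDerivAt, hg.eventually_summable] with x h1 h2
  refine h1.congr_deriv ?_
  have h3 := (B.hasSum_sum_antidiagonal h2 h2).tsum_eq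
  rw [powerSum, powerSum, ← h3]
  refine tsum_congr fun n => ?_
  rw [quadraticCoeff_succ, Finset.smul_sum]
  refine Finset.sum_congr rfl fun p hp => ?_
  rw [← Finset.HasAntidiagonal.mem_antidiagonal.1 hp]
  simp [smul_smul, pow_add, mul_comm]

/-- Two solutions of a quadratic system which agree at the left end of an interval agree. -/
theorem eqOn_of_quadratic (B : E →L[ℝ] E →L[ℝ] E) {u v : ℝ → E} {a b : ℝ}
    (hu : ContinuousOn u (Set.Icc a b)) (hv : ContinuousOn v (Set.Icc a b))
    (hu' : ∀ t ∈ Set.Ico a b, HasDerivWithinAt u (B (u t) (u t)) (Set.Ici t) t)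
    (hv' : ∀ t ∈ Set.Ico a b, HasDerivWithinAt v (B (v t) (v t)) (Set.Ici t) t)
    (h : u a = v a) : Set.EqOn u v (Set.Icc a b) := by
  obtain ⟨R, hR⟩ := (isCompact_Icc.image_of_continuousOn hu).isBounded.exists_norm_le
  obtain ⟨S, hS⟩ := (isCompact_Icc.image_of_continuousOn hv).isBounded.exists_norm_le
  obtain ⟨N, hN⟩ : ∃ N : NNReal, N = Real.toNNReal (max R S) := ⟨_, rfl⟩
  have hle : max R S ≤ N := by rw [hN]; exact Real.le_coe_toNNReal _
  refine ODE_solution_unique_of_mem_Icc_right (v := fun _ z => B z z)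
    (s := fun _ => Metric.closedBall 0 N) (fun t _ => lipschitzOnWith_quadratic B N) hu hu'
    (fun t ht => ?_) hv hv' (fun t ht => ?_) h
  · rw [mem_closedBall_zero_iff]
    exact ((hR _ ⟨t, ⟨ht.1, ht.2.le⟩, rfl⟩).trans (le_max_left _ _)).trans hle
  · rw [mem_closedBall_zero_iff]
    exact ((hS _ ⟨t, ⟨ht.1, ht.2.le⟩, rfl⟩).trans (le_max_right _ _)).trans hle

/-- The power series with initial value `u t` also solves the system, and local uniqueness
identifies it with `u`. -/
theorem analyticAt_of_quadratic [CompleteSpace E] (B : E →L[ℝ] E →L[ℝ] E) {u : ℝ → E} {t : ℝ}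
    (hu : ∀ᶠ x in 𝓝 t, HasDerivAt u (B (u x) (u x)) x) : AnalyticAt ℝ u t := by
  set P := powerSum (quadraticCoeff B (u t)) with hP
  have hP0 : P 0 = u t := by rw [hP, powerSum_zero, quadraticCoeff]
  have hPa : AnalyticAt ℝ P 0 := (geomBounded_quadraticCoeff B (u t)).analyticAt
  have hs : Tendsto (fun x => x - t) (𝓝 t) (𝓝 0) := by
    have : Continuous fun x : ℝ => x - t := by fun_prop
    simpa using this.tendsto t
  have hv : ∀ᶠ x in 𝓝 t, HasDerivAt (fun x => P (x - t)) (B (P (x - t)) (P (x - t))) x := by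
    filter_upwards [hs.eventually (eventually_hasDerivAt_quadratic B (u t))] with x hx
    exact hx.comp_sub_const x t
  obtain ⟨N, hN⟩ : ∃ N : NNReal, N = ‖u t‖₊ + 1 := ⟨_, rfl⟩
  have hNt : ‖u t‖ < N := by rw [hN]; simp
  have hu1 : ∀ᶠ x in 𝓝 t, u x ∈ Metric.closedBall (0:E) N := by
    have hc : ContinuousAt u t := hu.self_of_nhds.continuousAt
    filter_upwards [hc.norm.eventually (gt_mem_nhds hNt)] with x hx
    rw [mem_closedBall_zero_iff]; exact le_of_lt hx
  have hv1 : ∀ᶠ x in 𝓝 t, P (x - t) ∈ Metric.closedBall (0:E) N := by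
    have hc := hv.self_of_nhds.continuousAt.norm
    have : ‖P (t - t)‖ < N := by rwa [sub_self, hP0]
    filter_upwards [hc.eventually (gt_mem_nhds this)] with x hx
    rw [mem_closedBall_zero_iff]; exact le_of_lt hx
  have heq := ODE_solution_unique_of_eventually (v := fun _ z => B z z)
    (s := fun _ => Metric.closedBall (0:E) N)
    (Eventually.of_forall fun _ => lipschitzOnWith_quadratic B N) (hu.and hu1) (hv.and hv1)
    (by rw [sub_self, hP0])
  refine AnalyticAt.congr ?_ heq.symm
  have : AnalyticAt ℝ P (t - t) := by rwa [sub_self]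
  exact this.comp_of_eq (f := fun x => x - t) (analyticAt_id.sub analyticAt_const) rfl

end Quadratic

/-! ### The power series solution at the origin -/

theorem GeomBounded.of_tail {E : Type*} [NormedAddCommGroup E] {c : ℕ → E}
    (h : GeomBounded fun n => c (n + 1)) : GeomBounded c := by
  obtain ⟨M, K, hK, hc⟩ := h
  have hM : 0 ≤ M := by simpa using (norm_nonneg _).trans (hc 0)
  refine ⟨‖c 0‖ + M / K, K, hK, fun n => ?_⟩
  cases n with
  | zero => rw [pow_zero, mul_one]; have : 0 ≤ M / K := by positivity
            linarith
  | succ n =>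
    refine (hc n).trans ?_
    have e : (‖c 0‖ + M / K) * K ^ (n + 1) = ‖c 0‖ * K ^ (n + 1) + M * K ^ n := by
      field_simp
      ring
    rw [e]
    have : 0 ≤ ‖c 0‖ * K ^ (n + 1) := by positivity
    linarith

theorem powerSum_eq_add_mul {c : ℕ → ℝ} {x : ℝ} (h : Summable fun n => ‖x ^ n • c n‖) :
    powerSum c x = c 0 + x * powerSum (fun n => c (n + 1)) x := by
  rw [powerSum, h.of_norm.tsum_eq_zero_add, powerSum, ← tsum_mul_left]
  congr 1
  · simp
  · refine tsum_congr fun n => ?_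
    simp only [smul_eq_mul]; ring

/-- The coefficients of `y / x` for the solution `y` with slope `1` at the origin. -/
noncomputable def originCoeff : ℕ → ℝ
  | 0 => 1
  | 1 => 0
  | n + 2 => -(1 / 2) * ∑ i : Fin (n + 1), originCoeff (i + 1) * originCoeff (n + 1 - i)
      - (n + 1) / (3 * (n + 2) * (n + 3) * (n + 4)) * originCoeff n

theorem originCoeff_add_two (n : ℕ) : originCoeff (n + 2) =
    -(1 / 2) * ∑ i ∈ Finset.range (n + 1), originCoeff (i + 1) * originCoeff (n + 1 - i)
      - (n + 1) / (3 * (n + 2) * (n + 3) * (n + 4)) * originCoeff n := by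
  rw [originCoeff, Fin.sum_univ_eq_sum_range
    (fun i => originCoeff (i + 1) * originCoeff (n + 1 - i))]

theorem sum_inv_sq_le (n : ℕ) : ∑ i ∈ Finset.range (n + 1), 1 / ((i : ℝ) + 1) ^ 2 ≤ 2 := by
  have : ∑ i ∈ Finset.range (n + 1), 1 / ((i : ℝ) + 1) ^ 2 ≤ 2 - 1 / ((n : ℝ) + 1) := by
    induction n with
    | zero => norm_num
    | succ n ih =>
      rw [Finset.sum_range_succ]
      push_cast
      have e : 2 - 1 / ((n : ℝ) + 1 + 1) - (2 - 1 / ((n : ℝ) + 1) + 1 / ((n : ℝ) + 1 + 1) ^ 2) =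
        1 / (((n : ℝ) + 1) * ((n : ℝ) + 1 + 1) ^ 2) := by field_simp; ring
      have : 0 ≤ 1 / (((n : ℝ) + 1) * ((n : ℝ) + 1 + 1) ^ 2) := by positivity
      linarith
  have h2 : 0 ≤ 1 / ((n : ℝ) + 1) := by positivity
  linarith

/-- `1/(p²q²) ≤ 2/(p + q)² · (1/p² + 1/q²)` is `(p - q)² ≥ 0`. So the sequence `1/(n+1)²` reproduces
itself under convolution up to a constant. -/
theorem sum_inv_sq_mul_inv_sq_le (n : ℕ) : ∑ i ∈ Finset.range (n + 1),
    1 / ((i : ℝ) + 1) ^ 2 * (1 / (((n - i : ℕ) : ℝ) + 1) ^ 2) ≤ 8 / ((n : ℝ) + 2) ^ 2 := by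
  have h : ∀ i ∈ Finset.range (n + 1), 1 / ((i : ℝ) + 1) ^ 2 * (1 / (((n - i : ℕ) : ℝ) + 1) ^ 2) ≤
      2 / ((n : ℝ) + 2) ^ 2 * (1 / ((i : ℝ) + 1) ^ 2 + 1 / (((n - i : ℕ) : ℝ) + 1) ^ 2) := by
    intro i hi
    have hi' : i ≤ n := Nat.lt_succ_iff.1 (Finset.mem_range.1 hi)
    obtain ⟨p, hp⟩ : ∃ p : ℝ, p = (i : ℝ) + 1 := ⟨_, rfl⟩
    obtain ⟨q, hq⟩ : ∃ q : ℝ, q = ((n - i : ℕ) : ℝ) + 1 := ⟨_, rfl⟩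
    have hp0 : 0 < p := by rw [hp]; positivity
    have hq0 : 0 < q := by rw [hq]; positivity
    have e : (n : ℝ) + 2 = p + q := by rw [hp, hq, Nat.cast_sub hi']; ring
    rw [e, ← hp, ← hq]
    have e2 : 2 / (p + q) ^ 2 * (1 / p ^ 2 + 1 / q ^ 2) - 1 / p ^ 2 * (1 / q ^ 2) =
      (p - q) ^ 2 / ((p + q) ^ 2 * p ^ 2 * q ^ 2) := by field_simp; ring
    have : 0 ≤ (p - q) ^ 2 / ((p + q) ^ 2 * p ^ 2 * q ^ 2) := by positivity
    linarith
  refine (Finset.sum_le_sum h).trans ?_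
  rw [← Finset.mul_sum, Finset.sum_add_distrib]
  have h1 := sum_inv_sq_le n
  have h2 : ∑ i ∈ Finset.range (n + 1), 1 / (((n - i : ℕ) : ℝ) + 1) ^ 2 =
      ∑ i ∈ Finset.range (n + 1), 1 / ((i : ℝ) + 1) ^ 2 := by
    rw [← Finset.sum_range_reflect]
    refine Finset.sum_congr rfl fun i hi => ?_
    have hi' : i ≤ n := Nat.lt_succ_iff.1 (Finset.mem_range.1 hi)
    congr 4
    omega
  rw [h2]
  calc 2 / ((n : ℝ) + 2) ^ 2 * _ ≤ 2 / ((n : ℝ) + 2) ^ 2 * (2 + 2) := by gcongr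
    _ = _ := by ring

/-- The equation is singular at the origin, so the quadratic term of the recursion carries no factor
decaying in `n`; a majorant stable under convolution is needed. With constant `1/8` the convolution
uses `1/2 · 8/64 = 1/16`, and the linear term fits in the other `1/16`. -/
theorem abs_originCoeff_succ_le (n : ℕ) : |originCoeff (n + 1)| ≤ 1 / 8 * (1 / ((n : ℝ) + 1) ^ 2) := by
  induction n using Nat.strong_induction_on with
  | _ n ih =>
    cases n with
    | zero => simp [originCoeff]
    | succ n =>
      rw [originCoeff_add_two]
      have hs : |∑ i ∈ Finset.range (n + 1), originCoeff (i + 1) * originCoeff (n + 1 - i)| ≤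
          1 / 64 * (8 / ((n : ℝ) + 2) ^ 2) := by
        refine le_trans ?_ (mul_le_mul_of_nonneg_left (sum_inv_sq_mul_inv_sq_le n) (by norm_num))
        rw [Finset.mul_sum]
        refine Finset.abs_sum_le_sum_abs _ _ |>.trans (Finset.sum_le_sum fun i hi => ?_)
        have hi' : i ≤ n := Nat.lt_succ_iff.1 (Finset.mem_range.1 hi)
        have h1 := ih i (by omega)
        have h2 := ih (n - i) (by omega)
        rw [show n + 1 - i = n - i + 1 by omega, abs_mul]
        calc |originCoeff (i + 1)| * |originCoeff (n - i + 1)| ≤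
            (1 / 8 * (1 / ((i : ℝ) + 1) ^ 2)) * (1 / 8 * (1 / (((n - i : ℕ) : ℝ) + 1) ^ 2)) := by
              gcongr
          _ = _ := by ring
      have ht : |((n : ℝ) + 1) / (3 * (n + 2) * (n + 3) * (n + 4)) * originCoeff n| ≤
          1 / 16 * (1 / ((n : ℝ) + 2) ^ 2) := by
        rw [abs_mul, abs_of_nonneg (by positivity)]
        cases n with
        | zero => norm_num [originCoeff]
        | succ m =>
          refine (mul_le_mul_of_nonneg_left (ih m (by omega)) (by positivity)).trans ?_
          push_cast
          have hm : (0:ℝ) ≤ m := m.cast_nonneg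
          rw [div_mul_eq_mul_div, div_le_iff₀ (by positivity), ← sub_nonneg]
          have e : 1 / 16 * (1 / ((m : ℝ) + 1 + 2) ^ 2) * (3 * ((m:ℝ) + 1 + 2) * (m + 1 + 3) * (m + 1 + 4)) -
            ((m : ℝ) + 1 + 1) * (1 / 8 * (1 / ((m : ℝ) + 1) ^ 2)) =
            (3 * ((m:ℝ) + 4) * (m + 5) * (m + 1) ^ 2 - 2 * (m + 2) * (m + 3)) /
              (16 * (m + 3) * (m + 1) ^ 2) := by
            field_simp; ring
          rw [e]
          apply div_nonneg _ (by positivity)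
          have : 3 * ((m:ℝ) + 4) * (m + 5) * (m + 1) ^ 2 - 2 * (m + 2) * (m + 3) =
            3 * m ^ 4 + 33 * m ^ 3 + 115 * m ^ 2 + 137 * m + 48 := by ring
          rw [this]; positivity
      push_cast
      rw [show (n : ℝ) + 1 + 1 = n + 2 by ring]
      refine (abs_sub _ _).trans ?_
      rw [abs_mul, abs_neg, abs_of_pos (by norm_num : (0:ℝ) < 1 / 2)]
      have e : 1 / 8 * (1 / ((n : ℝ) + 2) ^ 2) = 1 / 2 * (1 / 64 * (8 / ((n : ℝ) + 2) ^ 2)) +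
        1 / 16 * (1 / ((n : ℝ) + 2) ^ 2) := by ring
      rw [e]
      gcongr

theorem geomBounded_originCoeff : GeomBounded originCoeff := by
  refine GeomBounded.of_tail ⟨1 / 8, 1, one_pos, fun n => ?_⟩
  rw [one_pow, mul_one, Real.norm_eq_abs]
  refine (abs_originCoeff_succ_le n).trans ?_
  have : 1 / ((n : ℝ) + 1) ^ 2 ≤ 1 := by
    rw [div_le_one (by positivity)]
    have : (0:ℝ) ≤ n := n.cast_nonneg
    nlinarith
  linarith

theorem originCoeff_odd (n : ℕ) : Odd n → originCoeff n = 0 := by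
  induction n using Nat.strong_induction_on with
  | _ n ih =>
    intro hn
    match n, ih, hn with
    | 0, _, hn => simp at hn
    | 1, _, _ => rw [originCoeff]
    | n + 2, ih, hn =>
      have hn' : Odd n := by
        rw [Nat.odd_iff] at hn ⊢; omega
      rw [originCoeff_add_two, ih n (by omega) hn', Finset.sum_eq_zero]
      · simp
      · intro i hi
        have hi' : i ≤ n := Nat.lt_succ_iff.1 (Finset.mem_range.1 hi)
        rcases Nat.even_or_odd (i + 1) with he | ho
        · rw [ih (n + 1 - i) (by omega), mul_zero]
          rw [Nat.even_iff] at he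
          rw [Nat.odd_iff] at hn ⊢
          omega
        · rw [ih (i + 1) (by omega) ho, zero_mul]

/-- The coefficients of the square of the series. -/
noncomputable def originConv (n : ℕ) : ℝ :=
  ∑ p ∈ Finset.HasAntidiagonal.antidiagonal n, originCoeff p.1 * originCoeff p.2

theorem originConv_zero : originConv 0 = 1 := by simp [originConv, originCoeff]

theorem originConv_one : originConv 1 = 0 := by
  rw [originConv, Finset.Nat.sum_antidiagonal_eq_sum_range_succ (fun i j => originCoeff i * originCoeff j)]
  simp [Finset.sum_range_succ, originCoeff]

theorem originConv_add_two (n : ℕ) : originConv (n + 2) =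
    -(2 * ((n + 1) / (3 * (n + 2) * (n + 3) * (n + 4)) * originCoeff n)) := by
  rw [originConv, Finset.Nat.sum_antidiagonal_eq_sum_range_succ (fun i j => originCoeff i * originCoeff j),
    Finset.sum_range_succ, Finset.sum_range_succ']
  have e : ∀ i ∈ Finset.range (n + 1), originCoeff (i + 1) * originCoeff (n + 2 - (i + 1)) =
      originCoeff (i + 1) * originCoeff (n + 1 - i) := fun i _ => by
    congr 2
    omega
  rw [Finset.sum_congr rfl e, tsub_self, tsub_zero, originCoeff_add_two n]
  simp only [originCoeff]
  ring

/-- There is an odd analytic function near the origin which solves the profile equation. -/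
theorem exists_origin_solution : ∃ y y1 J : ℝ → ℝ, AnalyticAt ℝ y 0 ∧ AnalyticAt ℝ y1 0 ∧ Function.Odd y ∧ y 0 = 0 ∧
    y1 0 = 1 ∧ J 0 = 3 ∧ ∀ᶠ x in 𝓝 0, HasDerivAt y (y1 x) x ∧ HasDerivAt J (y x) x ∧
      HasDerivAt (fun x => y x * y1 x) ((J x - x * y x) / 3) x := by
  have ha := geomBounded_originCoeff
  obtain ⟨Yc, hY⟩ : ∃ Yc : ℕ → ℝ, Yc = fun n => Nat.casesOn n 0 originCoeff := ⟨_, rfl⟩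
  have hY0 : Yc 0 = 0 := by simp [hY]
  have hYs : (fun n => Yc (n + 1)) = originCoeff := by rw [hY]
  have gY : GeomBounded Yc := GeomBounded.of_tail (by rw [hYs]; exact ha)
  obtain ⟨Jc, hJ⟩ : ∃ Jc : ℕ → ℝ, Jc = fun n => Nat.casesOn n 3 fun n => Yc n / (n + 1) := ⟨_, rfl⟩
  have hJ0 : Jc 0 = 3 := by simp [hJ]
  have hJs : ∀ n, Jc (n + 1) = Yc n / (n + 1) := by intro n; rw [hJ]
  have gJ : GeomBounded Jc := by
    apply GeomBounded.of_tail
    obtain ⟨M, K, hK, hc⟩ := gY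
    refine ⟨M, K, hK, fun n => ?_⟩
    show ‖Jc (n + 1)‖ ≤ _
    rw [hJs, norm_div, Real.norm_of_nonneg (by positivity : 0 ≤ (n:ℝ) + 1)]
    exact (div_le_self (norm_nonneg _) (by linarith [n.cast_nonneg (α := ℝ)])).trans (hc n)
  -- The series of `y²/2`, whose derivative is the flux. The recursion for `originCoeff` makes its
  -- second derivative equal to `(J - x y)/3`. Past the first four coefficients it is dominated
  -- termwise by `originCoeff`.
  obtain ⟨Qc, hQ⟩ : ∃ Qc : ℕ → ℝ, Qc = fun n => Nat.casesOn n 0 fun n =>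
    Nat.casesOn n 0 fun n => originConv n / 2 := ⟨_, rfl⟩
  have hQ0 : Qc 0 = 0 := by simp [hQ]
  have hQ1 : Qc 1 = 0 := by simp [hQ]
  have hQs : ∀ n, Qc (n + 2) = originConv n / 2 := by intro n; rw [hQ]
  have gQ : GeomBounded Qc := by
    apply GeomBounded.of_tail
    apply GeomBounded.of_tail
    apply GeomBounded.of_tail
    apply GeomBounded.of_tail
    obtain ⟨M, K, hK, hc⟩ := ha
    refine ⟨M, K, hK, fun n => (hc n).trans' ?_⟩
    show ‖Qc (n + 2 + 2)‖ ≤ _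
    rw [hQs, originConv_add_two, neg_div, norm_neg, mul_div_cancel_left₀ _ two_ne_zero, norm_mul,
      Real.norm_of_nonneg (by positivity)]
    apply mul_le_of_le_one_left (norm_nonneg _)
    rw [div_le_one (by positivity)]
    have : (0:ℝ) ≤ n := n.cast_nonneg
    nlinarith [mul_nonneg (mul_nonneg this this) this, mul_nonneg this this]
  have hodd : Function.Odd (powerSum Yc) := by
    intro x
    simp only [powerSum]
    rw [← tsum_neg]
    refine tsum_congr fun n => ?_
    cases n with
    | zero => simp [hY0]
    | succ n =>
      have e : Yc (n + 1) = originCoeff n := congrFun hYs n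
      rw [e]
      rcases Nat.even_or_odd n with he | ho
      · rw [(he.add_one).neg_pow, neg_smul]
      · rw [originCoeff_odd n ho]; simp
  refine ⟨powerSum Yc, powerSum fun n => ((n : ℝ) + 1) • Yc (n + 1), powerSum Jc, gY.analyticAt,
    gY.of_succ_mul.analyticAt, hodd,
    ?_, ?_, ?_, ?_⟩
  · rw [powerSum_zero, hY0]
  · rw [powerSum_zero, congrFun hYs 0, originCoeff]; simp
  · rw [powerSum_zero, hJ0]
  · have hsq : ∀ᶠ x in 𝓝 (0:ℝ), powerSum Yc x ^ 2 / 2 = powerSum Qc x := by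
      filter_upwards [ha.eventually_summable, gY.eventually_summable, gQ.eventually_summable]
        with x h1 h2 h3
      rw [powerSum_eq_add_mul h2, hYs, hY0]
      have h4 := ((ContinuousLinearMap.mul ℝ ℝ).hasSum_sum_antidiagonal h1 h1).tsum_eq
      have h5 : powerSum Qc x = x ^ 2 * (powerSum originConv x / 2) := by
        rw [powerSum, h3.of_norm.tsum_eq_zero_add, Summable.tsum_eq_zero_add, hQ0, hQ1, powerSum,
          ← tsum_div_const, ← tsum_mul_left]
        · simp only [smul_zero, zero_add]
          refine tsum_congr fun n => ?_
          rw [hQs]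
          simp only [smul_eq_mul]; ring
        · exact (summable_nat_add_iff 1).2 h3.of_norm
      have h6 : powerSum originConv x = powerSum originCoeff x ^ 2 := by
        rw [sq]
        refine Eq.trans (tsum_congr fun n => ?_) h4
        rw [originConv, Finset.smul_sum]
        refine Finset.sum_congr rfl fun p hp => ?_
        rw [← Finset.HasAntidiagonal.mem_antidiagonal.1 hp]
        simp only [smul_eq_mul, ContinuousLinearMap.mul_apply']
        ring
      rw [h5, h6]; ring
    have hflux : ∀ᶠ x in 𝓝 (0:ℝ), powerSum Yc x * powerSum (fun n => ((n : ℝ) + 1) • Yc (n + 1)) x =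
        powerSum (fun n => ((n : ℝ) + 1) • Qc (n + 1)) x := by
      filter_upwards [gY.eventually_hasDerivAt, gQ.eventually_hasDerivAt, hsq.eventually_nhds]
        with x h1 h2 h3
      have h4 := ((h1.pow 2).div_const 2).congr_of_eventuallyEq (f₁ := powerSum Qc)
        (by filter_upwards [h3] with z hz; simp [← hz])
      have := h4.unique h2
      rw [← this]
      push_cast
      ring
    filter_upwards [gY.eventually_hasDerivAt, gJ.eventually_hasDerivAt, hflux.eventually_nhds,
      gQ.of_succ_mul.eventually_hasDerivAt, gY.eventually_summable, gJ.eventually_summable,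
      gQ.of_succ_mul.of_succ_mul.eventually_summable]
      with x h1 h2 h3 h4 h5 h6 h9
    refine ⟨h1, h2.congr_deriv ?_, (h4.congr_of_eventuallyEq h3).congr_deriv ?_⟩
    · congr 1
      funext n
      rw [hJs]
      simp only [smul_eq_mul]
      field_simp
    · rw [powerSum_eq_add_mul h6, hJ0]
      have e2 : HasSum (fun n => x ^ n * Yc n) (powerSum Yc x) := h5.of_norm.hasSum
      have e3 : HasSum (fun n => x ^ n * Jc (n + 1)) (powerSum (fun n => Jc (n + 1)) x) := by
        refine (Summable.of_norm_bounded (g := fun n => ‖x ^ n • Yc n‖) h5 fun n => ?_).hasSum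
        rw [hJs, smul_eq_mul, norm_mul, norm_mul, norm_div,
          Real.norm_of_nonneg (by positivity : 0 ≤ (n:ℝ) + 1)]
        gcongr
        exact div_le_self (norm_nonneg _) (by linarith [n.cast_nonneg (α := ℝ)])
      rw [powerSum_eq_add_mul h9]
      have e4 : powerSum (fun n : ℕ => (((n + 1 : ℕ) : ℝ) + 1) • (((n + 1 + 1 : ℕ) : ℝ) + 1) •
          Qc (n + 1 + 1 + 1)) x = (powerSum (fun n => Jc (n + 1)) x - powerSum Yc x) / 3 := by
        rw [← ((e3.sub e2).div_const 3).tsum_eq]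
        refine tsum_congr fun n => ?_
        rw [smul_eq_mul, ← mul_sub, mul_div_assoc]
        congr 1
        beta_reduce
        cases n with
        | zero => rw [hQs, hJs, originConv_one, hY0]; simp
        | succ n =>
          have e6 : Yc (n + 1) = originCoeff n := congrFun hYs n
          rw [hJs, e6, hQs, originConv_add_two]
          simp only [smul_eq_mul]
          push_cast
          field_simp
          ring
      rw [e4]
      have e7 : Qc (0 + 1 + 1) = 1 / 2 := by rw [hQs 0, originConv_zero]
      rw [e7]
      norm_num
      ring

/-! ### The profile equation as a quadratic system -/

theorem hasDerivAt_slope_of_flux {y y1 J : ℝ → ℝ} {x : ℝ} (hyx : y x ≠ 0)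
    (hy : HasDerivAt y (y1 x) x)
    (hf : HasDerivAt (fun x => y x * y1 x) ((J x - x * y x) / 3) x) :
    HasDerivAt y1 (((J x - x * y x) / 3 - y1 x ^ 2) / y x) x := by
  have h2 : y1 =ᶠ[𝓝 x] fun z => y z * y1 z / y z := by
    filter_upwards [hy.continuousAt.eventually_ne hyx] with z hz
    rw [mul_div_cancel_left₀ _ hz]
  refine ((hf.div hy hyx).congr_of_eventuallyEq h2).congr_deriv ?_
  field_simp

/-- The right hand side of the profile equation in the variables `1, x, 1/y, y'/y, (y y')'/y`. -/
noncomputable def profileField : (Fin 5 → ℝ) →L[ℝ] (Fin 5 → ℝ) →L[ℝ] (Fin 5 → ℝ) :=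
  (LinearMap.mk₂ ℝ (fun u v : Fin 5 → ℝ => (![0, u 0 * v 0, -(u 3 * v 2), u 4 * v 2 - 2 * (u 3 * v 3),
    -(u 1 * v 3) / 3 - u 4 * v 3] : Fin 5 → ℝ))
    (fun u u' v => by ext i; fin_cases i <;> simp <;> ring)
    (fun c u v => by ext i; fin_cases i <;> simp <;> ring)
    (fun u v v' => by ext i; fin_cases i <;> simp <;> ring)
    (fun c u v => by ext i; fin_cases i <;> simp <;> ring)).mkContinuous₂ 3 (fun u v => by
      have h : ∀ i j, |u i * v j| ≤ ‖u‖ * ‖v‖ := fun i j => by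
        rw [abs_mul]
        exact mul_le_mul (norm_le_pi_norm u i) (norm_le_pi_norm v j) (abs_nonneg _) (norm_nonneg _)
      have h0 : 0 ≤ ‖u‖ * ‖v‖ := by positivity
      have a1 := abs_le.1 (h 0 0)
      have a2 := abs_le.1 (h 3 2)
      have a3 := abs_le.1 (h 4 2)
      have a4 := abs_le.1 (h 3 3)
      have a5 := abs_le.1 (h 1 3)
      have a6 := abs_le.1 (h 4 3)
      rw [mul_assoc]
      refine (pi_norm_le_iff_of_nonneg (by positivity)).2 fun i => ?_
      rw [Real.norm_eq_abs]
      fin_cases i <;> simp only [LinearMap.mk₂_apply] <;> simp [-abs_mul] <;> (try rw [abs_le]) <;>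
        (try constructor) <;> linarith [a1.1, a1.2, a2.1, a2.2, a3.1, a3.2, a4.1, a4.2, a5.1, a5.2, a6.1, a6.2])

theorem profileField_apply (u v : Fin 5 → ℝ) : profileField u v = ![0, u 0 * v 0, -(u 3 * v 2),
    u 4 * v 2 - 2 * (u 3 * v 3), -(u 1 * v 3) / 3 - u 4 * v 3] := rfl

noncomputable def profileState (y y1 J : ℝ → ℝ) (x : ℝ) : Fin 5 → ℝ :=
  ![1, x, (y x)⁻¹, y1 x / y x, (J x - x * y x) / 3 / y x]

theorem hasDerivAt_profileState {y y1 J : ℝ → ℝ} {x : ℝ} (hyx : y x ≠ 0)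
    (hy : HasDerivAt y (y1 x) x) (hJ : HasDerivAt J (y x) x)
    (hy1 : HasDerivAt y1 (((J x - x * y x) / 3 - y1 x ^ 2) / y x) x) :
    HasDerivAt (profileState y y1 J)
      (profileField (profileState y y1 J x) (profileState y y1 J x)) x := by
  rw [hasDerivAt_pi]
  intro i
  fin_cases i
  · exact hasDerivAt_const x (1:ℝ)
  · refine (hasDerivAt_id' x).congr_deriv ?_
    simp [profileField_apply, profileState]
  · refine (hy.inv hyx).congr_deriv ?_
    simp [profileField_apply, profileState]
    field_simp
  · refine (hy1.div hy hyx).congr_deriv ?_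
    simp [profileField_apply, profileState]
    field_simp
    ring
  · refine (((hJ.sub ((hasDerivAt_id' x).mul hy)).div_const 3).div hy hyx).congr_deriv ?_
    simp [profileField_apply, profileState]
    field_simp

theorem ProfileOn.hasDerivAt_state {T : ℝ} {y y1 J : ℝ → ℝ} (h : ProfileOn T y y1 J) {x : ℝ}
    (hx : T < x) : HasDerivAt (profileState y y1 J)
      (profileField (profileState y y1 J x) (profileState y y1 J x)) x :=
  hasDerivAt_profileState (h.pos x hx).ne' (h.dy x hx) (h.dJ x hx) (h.dy1 x hx)

theorem ProfileOn.analyticAt {T : ℝ} {y y1 J : ℝ → ℝ} (h : ProfileOn T y y1 J) {x : ℝ}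
    (hx : T < x) : AnalyticAt ℝ y x := by
  have h1 : AnalyticAt ℝ (profileState y y1 J) x := by
    apply analyticAt_of_quadratic profileField
    filter_upwards [lt_mem_nhds hx] with z hz using h.hasDerivAt_state hz
  have h2 : AnalyticAt ℝ (fun z => profileState y y1 J z 2) x :=
    ((ContinuousLinearMap.proj (R := ℝ) (φ := fun _ : Fin 5 => ℝ) 2).analyticAt _).comp h1
  have h3 := h2.inv (by simpa [profileState] using (h.pos x hx).ne')
  refine h3.congr (Eventually.of_forall fun z => ?_)
  simp [profileState]

/-- Reading off a profile from a solution of the quadratic system. -/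
theorem profileOn_of_state {T : ℝ} {z : ℝ → Fin 5 → ℝ} (h1 : ∀ x, T < x → z x 1 = x) (h2 : ∀ x, T < x → 0 < z x 2)
    (hd : ∀ x, T < x → HasDerivAt z (profileField (z x) (z x)) x) :
    ProfileOn T (fun x => (z x 2)⁻¹) (fun x => z x 3 / z x 2)
      (fun x => 3 * (z x 4 / z x 2) + x * (z x 2)⁻¹) := by
  have d2 : ∀ x, T < x → HasDerivAt (fun x => z x 2) (-(z x 3 * z x 2)) x := fun x hx => by
    simpa [profileField_apply] using hasDerivAt_pi.1 (hd x hx) 2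
  have d3 : ∀ x, T < x → HasDerivAt (fun x => z x 3) (z x 4 * z x 2 - 2 * (z x 3 * z x 3)) x :=
    fun x hx => by simpa [profileField_apply] using hasDerivAt_pi.1 (hd x hx) 3
  have d4 : ∀ x, T < x → HasDerivAt (fun x => z x 4) (-(x * z x 3) / 3 - z x 4 * z x 3) x :=
    fun x hx => by simpa [profileField_apply, h1 x hx] using hasDerivAt_pi.1 (hd x hx) 4
  refine ⟨fun x hx => inv_pos.2 (h2 x hx), fun x hx => ?_, fun x hx => ?_, fun x hx => ?_⟩
  · have := (h2 x hx).ne'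
    refine ((d2 x hx).inv this).congr_deriv ?_
    field_simp
  · have := (h2 x hx).ne'
    refine ((((d4 x hx).div (d2 x hx) this).const_mul 3).add
      ((hasDerivAt_id' x).mul ((d2 x hx).inv this))).congr_deriv ?_
    simp only [Pi.inv_apply]
    field_simp
    ring
  · have := (h2 x hx).ne'
    refine ((d3 x hx).div (d2 x hx) this).congr_deriv ?_
    field_simp
    ring

/-! ### Global existence -/

theorem hasDerivAt_energy {y y1 J : ℝ → ℝ} {x : ℝ} (c : ℝ) (hpos : y x ≠ 0)
    (hy : HasDerivAt y (y1 x) x) (hJ : HasDerivAt J (y x) x)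
    (hy1 : HasDerivAt y1 (((J x - x * y x) / 3 - y1 x ^ 2) / y x) x) :
    HasDerivAt (energy y y1 J c) (-((y x - c) ^ 2 * (y x + 2 * c))) x := by
  have i1 := (hJ.const_mul 3).mul (hy.pow 2)
  have i2 := ((hasDerivAt_id' x).const_mul 2).mul (hy.pow 3)
  have i3 := ((hy.mul hy1).pow 2).const_mul 9
  have e1 := (hJ.const_mul 3).mul_const (c ^ 2)
  have e2 := ((hasDerivAt_id' x).const_mul 2).mul_const (c ^ 3)
  refine ((e1.sub ((i1.sub i2).sub i3)).sub e2).congr_deriv ?_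
  simp only [Pi.pow_apply, Pi.mul_apply]
  push_cast
  field_simp
  ring

/-- Monotonicity of the energy from `a` gives `9 (y y')² ≤ 3 J(a) y² - I(a) - 2 a y³`. Hence the
slope is bounded, and since `I(a) > 0` also `y` is bounded away from 0: none of the variables of the
quadratic system can blow up. -/
theorem profile_apriori {y y1 J : ℝ → ℝ} {a t X : ℝ} (ha : 0 < a) (hat : a ≤ t) (htX : t ≤ X)
    (cy : ContinuousOn y (Set.Icc a t)) (cy1 : ContinuousOn y1 (Set.Icc a t))
    (cJ : ContinuousOn J (Set.Icc a t)) (hpos : ∀ x ∈ Set.Icc a t, 0 < y x)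
    (hy : ∀ x ∈ Set.Ioo a t, HasDerivAt y (y1 x) x) (hJ : ∀ x ∈ Set.Ioo a t, HasDerivAt J (y x) x)
    (hy1 : ∀ x ∈ Set.Ioo a t, HasDerivAt y1 (((J x - x * y x) / 3 - y1 x ^ 2) / y x) x)
    (hI : 0 < cubeInt y y1 J a) :
    |y1 t| ≤ √(J a / 3) ∧ cubeInt y y1 J a ≤ 3 * J a * y t ^ 2 ∧ y t ≤ y a + √(J a / 3) * (X - a) ∧
      |(J t - t * y t) / 3| ≤ |(J a - a * y a) / 3| + X * √(J a / 3) * (X - a) := by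
  have key : ∀ s ∈ Set.Icc a t, 9 * (y s * y1 s) ^ 2 ≤
      3 * J a * y s ^ 2 - cubeInt y y1 J a - 2 * a * y s ^ 3 := by
    intro s hs
    have hsub : Set.Icc a s ⊆ Set.Icc a t := Set.Icc_subset_Icc_right hs.2
    have hc : ContinuousOn (energy y y1 J (y s)) (Set.Icc a s) := by
      have := cy.mono hsub; have := cy1.mono hsub; have := cJ.mono hsub
      unfold energy cubeInt
      fun_prop
    have hm := le_of_hasDerivAt_nonneg hs.1 hc.neg
      (f' := fun x => - -((y x - y s) ^ 2 * (y x + 2 * y s))) (fun x hx => by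
        have hx' : x ∈ Set.Ioo a t := ⟨hx.1, hx.2.trans_le hs.2⟩
        exact (hasDerivAt_energy (y s) (hpos x ⟨hx'.1.le, hx'.2.le⟩).ne' (hy x hx') (hJ x hx')
          (hy1 x hx')).neg)
      (fun x hx => by
        have h1 := hpos x ⟨hx.1.le, hx.2.le.trans hs.2⟩
        have h2 := hpos s hs
        rw [neg_neg]; positivity)
    simp only [Pi.neg_apply, ProfileOn.energy_self] at hm
    have : energy y y1 J (y s) a = 3 * J a * y s ^ 2 - cubeInt y y1 J a - 2 * a * y s ^ 3 := rfl
    linarith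
  have hslope : ∀ s ∈ Set.Icc a t, |y1 s| ≤ √(J a / 3) := by
    intro s hs
    have h1 := hpos s hs
    have h2 := key s hs
    apply Real.abs_le_sqrt
    have h3 : 0 ≤ y s ^ 2 * (J a / 3 - y1 s ^ 2) := by
      have : 0 ≤ 2 * a * y s ^ 3 := by positivity
      nlinarith
    have := (mul_nonneg_iff_of_pos_left (by positivity)).1 h3
    linarith
  have htm : t ∈ Set.Icc a t := ⟨hat, le_rfl⟩
  obtain ⟨P, hP⟩ : ∃ P, P = √(J a / 3) := ⟨_, rfl⟩
  have hP0 : 0 ≤ P := by rw [hP]; positivity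
  rw [← hP] at hslope ⊢
  have hX : 0 < X := by linarith
  refine ⟨hslope t htm, ?_, ?_, ?_⟩
  · have h1 := key t htm
    have h2 := hpos t htm
    have : 0 ≤ 2 * a * y t ^ 3 := by positivity
    have := sq_nonneg (y t * y1 t)
    linarith
  · have := sub_le_sub_of_hasDerivAt (g := fun s => P * s) (g' := fun _ => P * 1) hat cy (by fun_prop) hy
      (fun x _ => (hasDerivAt_id' x).const_mul P) (fun x hx => by
        have := (abs_le.1 (hslope x ⟨hx.1.le, hx.2.le⟩)).2; linarith)
    have : P * (t - a) ≤ P * (X - a) := by gcongr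
    linarith
  · obtain ⟨G, hG⟩ : ∃ G : ℝ → ℝ, G = fun s => (J s - s * y s) / 3 := ⟨_, rfl⟩
    have hGc : ContinuousOn G (Set.Icc a t) := by rw [hG]; fun_prop
    have hGd : ∀ x ∈ Set.Ioo a t, HasDerivAt G (-(x / 3) * y1 x) x := fun x hx => by
      rw [hG]
      refine (((hJ x hx).sub ((hasDerivAt_id' x).mul (hy x hx))).div_const 3).congr_deriv ?_
      ring
    have hb : ∀ x ∈ Set.Ioo a t, |-(x / 3) * y1 x| ≤ X * P := fun x hx => by
      have hx0 : 0 < x := ha.trans hx.1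
      rw [abs_mul, abs_neg, abs_of_pos (by positivity)]
      have h1 := hslope x ⟨hx.1.le, hx.2.le⟩
      have h2 : x / 3 ≤ X := by linarith [hx.2]
      gcongr
    have u := sub_le_sub_of_hasDerivAt (g := fun s => X * P * s) (g' := fun _ => X * P * 1) hat hGc
      (by fun_prop) hGd (fun x _ => (hasDerivAt_id' x).const_mul (X * P)) (fun x hx => by
        have := (abs_le.1 (hb x hx)).2; linarith)
    have l := sub_le_sub_of_hasDerivAt (f := fun s => -(X * P) * s) (f' := fun _ => -(X * P) * 1) hat
      (by fun_prop) hGc (fun x _ => (hasDerivAt_id' x).const_mul (-(X * P))) hGd (fun x hx => by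
        have := (abs_le.1 (hb x hx)).1; linarith)
    have e1 : (J t - t * y t) / 3 = G t := by rw [hG]
    have e2 : (J a - a * y a) / 3 = G a := by rw [hG]
    rw [e1, e2]
    have h1 := abs_le.1 (le_refl |G a|)
    have : X * P * (t - a) ≤ X * P * (X - a) := by gcongr
    rw [abs_le]
    constructor <;> linarith [h1.1, h1.2]

/-- Quadratic systems with clamped right hand side have global solutions. -/
theorem exists_clamped_solution {E : Type*} [NormedAddCommGroup E] [NormedSpace ℝ E] [CompleteSpace E]
    (B : E →L[ℝ] E →L[ℝ] E) {κ : E → E} {R : NNReal} (hκ : LipschitzWith 1 κ) (hR : ∀ z, ‖κ z‖ ≤ R)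
    (z0 : E) {a b : ℝ} (hab : a ≤ b) : ∃ z : ℝ → E, z a = z0 ∧ ∀ t ∈ Set.Icc a b,
      HasDerivWithinAt z (B (κ (z t)) (κ (z t))) (Set.Icc a b) t := by
  have hL : LipschitzWith (2 * ‖B‖₊ * R * 1) fun z => B (κ z) (κ z) := by
    rw [← lipschitzOnWith_univ]
    exact (lipschitzOnWith_quadratic B R).comp (hκ.lipschitzOnWith (s := Set.univ))
      (fun z _ => by rw [mem_closedBall_zero_iff]; exact hR z)
  have hP : IsPicardLindelof (fun _ z => B (κ z) (κ z)) (⟨a, le_rfl, hab⟩ : Set.Icc a b) z0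
      (‖B‖₊ * R * R * (b - a).toNNReal) 0 (‖B‖₊ * R * R) (2 * ‖B‖₊ * R * 1) := by
    refine ⟨fun t _ => hL.lipschitzOnWith, fun x _ => continuousOn_const, fun t _ x _ => ?_, ?_⟩
    · push_cast
      refine (B.le_opNorm₂ _ _).trans ?_
      gcongr <;> exact hR x
    · simp [hab]
  exact hP.exists_eq_forall_mem_Icc_hasDerivWithinAt₀

/-- Coordinatewise clamping. -/
def boxClamp (R : ℝ) (z : Fin 5 → ℝ) : Fin 5 → ℝ := fun i => max (-R) (min R (z i))

theorem lipschitzWith_boxClamp (R : ℝ) : LipschitzWith 1 (boxClamp R) := by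
  refine LipschitzWith.mk_one fun u v => ?_
  refine (dist_pi_le_iff dist_nonneg).2 fun i => ?_
  refine le_trans ?_ (dist_le_pi_dist u v i)
  have h := ((LipschitzWith.id (α := ℝ)).const_min R).const_max (-R)
  simpa [boxClamp] using h.dist_le_mul (u i) (v i)

theorem norm_boxClamp_le {R : ℝ} (hR : 0 ≤ R) (z : Fin 5 → ℝ) : ‖boxClamp R z‖ ≤ R := by
  refine (pi_norm_le_iff_of_nonneg hR).2 fun i => ?_
  rw [Real.norm_eq_abs, abs_le]
  exact ⟨le_max_left _ _, max_le (by linarith) (min_le_left _ _)⟩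

theorem boxClamp_eq {R : ℝ} {z : Fin 5 → ℝ} (h : ‖z‖ ≤ R) : boxClamp R z = z := by
  funext i
  have := abs_le.1 ((norm_le_pi_norm z i).trans h)
  rw [boxClamp, min_eq_right this.2, max_eq_right this.1]

set_option maxHeartbeats 1000000 in
/-- The profile equation can be solved up to any given point. -/
theorem exists_state_on_Icc {a b : ℝ} {z0 : Fin 5 → ℝ} (ha : 0 < a) (hab : a ≤ b) (h0 : z0 0 = 1)
    (h1 : z0 1 = a) (h2 : 0 < z0 2)
    (hI : 0 < 3 * (3 * (z0 4 / z0 2) + a * (z0 2)⁻¹) * (z0 2)⁻¹ ^ 2 - 2 * a * (z0 2)⁻¹ ^ 3 -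
      9 * ((z0 2)⁻¹ * (z0 3 / z0 2)) ^ 2) :
    ∃ z : ℝ → Fin 5 → ℝ, z a = z0 ∧ ∀ t ∈ Set.Icc a b,
      HasDerivWithinAt z (profileField (z t) (z t)) (Set.Icc a b) t ∧ z t 1 = t ∧ 0 < z t 2 := by
  obtain ⟨J0, hJ0⟩ : ∃ J0, J0 = 3 * (z0 4 / z0 2) + a * (z0 2)⁻¹ := ⟨_, rfl⟩
  obtain ⟨I0, hI0⟩ : ∃ I0, I0 = 3 * J0 * (z0 2)⁻¹ ^ 2 - 2 * a * (z0 2)⁻¹ ^ 3 -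
      9 * ((z0 2)⁻¹ * (z0 3 / z0 2)) ^ 2 := ⟨_, rfl⟩
  rw [← hJ0, ← hI0] at hI
  have hy0 : 0 < (z0 2)⁻¹ := inv_pos.2 h2
  have hJpos : 0 < J0 := by
    have e1 : 0 ≤ 2 * a * (z0 2)⁻¹ ^ 3 := by positivity
    have e2 := sq_nonneg ((z0 2)⁻¹ * (z0 3 / z0 2))
    have : 0 < (3 * (z0 2)⁻¹ ^ 2) * J0 := by linarith
    exact (mul_pos_iff_of_pos_left (by positivity)).1 this
  obtain ⟨P, hP⟩ : ∃ P, P = √(J0 / 3) := ⟨_, rfl⟩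
  have hP0 : 0 ≤ P := by rw [hP]; positivity
  obtain ⟨δ, hδ⟩ : ∃ δ, δ = √(I0 / (3 * J0)) := ⟨_, rfl⟩
  have hδ0 : 0 < δ := by rw [hδ]; positivity
  have hba : 0 ≤ b - a := by linarith
  have hb0 : 0 < b := by linarith
  obtain ⟨Ym, hYm⟩ : ∃ Ym, Ym = (z0 2)⁻¹ + P * (b - a) := ⟨_, rfl⟩
  have hYm0 : 0 < Ym := by rw [hYm]; positivity
  obtain ⟨Fm, hFm⟩ : ∃ Fm, Fm = |(J0 - a * (z0 2)⁻¹) / 3| + b * P * (b - a) := ⟨_, rfl⟩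
  have hFm0 : 0 ≤ Fm := by rw [hFm]; positivity
  -- Each component is bounded a priori by one of the summands, so the norm stays strictly below `R`
  -- and the clamp is never active.
  obtain ⟨R, hR⟩ : ∃ R, R = 2 + b + δ⁻¹ + P * δ⁻¹ + Fm * δ⁻¹ := ⟨_, rfl⟩
  have hδi : 0 < δ⁻¹ := inv_pos.2 hδ0
  have hq1 : 0 ≤ P * δ⁻¹ := by positivity
  have hq2 : 0 ≤ Fm * δ⁻¹ := by positivity
  have hR0 : 0 ≤ R := by rw [hR]; linarith
  obtain ⟨z, hz0, hz⟩ := exists_clamped_solution profileField (R := ⟨R, hR0⟩)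
    (lipschitzWith_boxClamp R) (norm_boxClamp_le hR0) z0 hab
  have hzc : ContinuousOn z (Set.Icc a b) := fun t ht => (hz t ht).continuousWithinAt
  -- the bounds which close the continuation argument
  have close : ∀ t ∈ Set.Icc a b, (∀ x ∈ Set.Ioo a t, ‖z x‖ ≤ R) →
      (∀ x ∈ Set.Icc a t, 0 < z x 2) → z t 1 = t ∧ ‖z t‖ < R ∧ (2 * Ym)⁻¹ < z t 2 := by
    intro t ht hxR hx
    have hsub : Set.Icc a t ⊆ Set.Icc a b := Set.Icc_subset_Icc_right ht.2
    have hd : ∀ x ∈ Set.Ioo a t, HasDerivAt z (profileField (z x) (z x)) x := by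
      intro x hx'
      have := hz x (hsub ⟨hx'.1.le, hx'.2.le⟩)
      rw [boxClamp_eq (hxR x hx')] at this
      exact this.hasDerivAt (Icc_mem_nhds hx'.1 (hx'.2.trans_le ht.2))
    have hci : ∀ i, ContinuousOn (fun x => z x i) (Set.Icc a t) := fun i =>
      (continuous_apply i).comp_continuousOn (hzc.mono hsub)
    have const : ∀ (f f' : ℝ → ℝ) (_ : ContinuousOn f (Set.Icc a t))
        (_ : ∀ x ∈ Set.Ioo a t, HasDerivAt f (f' x) x) (_ : ∀ x ∈ Set.Ioo a t, f' x = 0),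
        ∀ s ∈ Set.Icc a t, f s = f a := by
      intro f f' hc hdf hf0 s hs
      have hc' := hc.mono (Set.Icc_subset_Icc_right hs.2)
      have m1 := le_of_hasDerivAt_nonneg hs.1 hc' (fun x hx => hdf x ⟨hx.1, hx.2.trans_le hs.2⟩)
        (fun x hx => (hf0 x ⟨hx.1, hx.2.trans_le hs.2⟩).ge)
      have m2 := le_of_hasDerivAt_nonneg hs.1 hc'.neg
        (fun x hx => (hdf x ⟨hx.1, hx.2.trans_le hs.2⟩).neg)
        (fun x hx => by simp [hf0 x ⟨hx.1, hx.2.trans_le hs.2⟩])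
      simp only [Pi.neg_apply] at m2
      linarith
    have c0 : ∀ x ∈ Set.Icc a t, z x 0 = 1 := by
      intro x hx'
      rw [const (fun x => z x 0) (fun _ => 0) (hci 0) (fun x hx => by
        simpa [profileField_apply] using hasDerivAt_pi.1 (hd x hx) 0) (fun _ _ => rfl) x hx', hz0, h0]
    have c1 : ∀ x ∈ Set.Icc a t, z x 1 = x := by
      intro x hx'
      have := const (fun x => z x 1 - x) (fun _ => 0) ((hci 1).sub continuousOn_id) (fun x hx => by
        refine ((hasDerivAt_pi.1 (hd x hx) 1).sub (hasDerivAt_id' x)).congr_deriv ?_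
        simp [profileField_apply, c0 x ⟨hx.1.le, hx.2.le⟩]) (fun _ _ => rfl) x hx'
      rw [hz0, h1] at this
      linarith
    have d2 : ∀ x ∈ Set.Ioo a t, HasDerivAt (fun x => z x 2) (-(z x 3 * z x 2)) x := fun x hx => by
      simpa [profileField_apply] using hasDerivAt_pi.1 (hd x hx) 2
    have d3 : ∀ x ∈ Set.Ioo a t, HasDerivAt (fun x => z x 3)
        (z x 4 * z x 2 - 2 * (z x 3 * z x 3)) x :=
      fun x hx => by simpa [profileField_apply] using hasDerivAt_pi.1 (hd x hx) 3
    have d4 : ∀ x ∈ Set.Ioo a t, HasDerivAt (fun x => z x 4) (-(x * z x 3) / 3 - z x 4 * z x 3) x :=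
      fun x hx => by
        simpa [profileField_apply, c1 x ⟨hx.1.le, hx.2.le⟩] using hasDerivAt_pi.1 (hd x hx) 4
    have p2 : ∀ x ∈ Set.Icc a t, z x 2 ≠ 0 := fun x hx' => (hx x hx').ne'
    have ap := profile_apriori (y := fun x => (z x 2)⁻¹) (y1 := fun x => z x 3 / z x 2)
      (J := fun x => 3 * (z x 4 / z x 2) + x * (z x 2)⁻¹) ha ht.1 ht.2 ((hci 2).inv₀ p2)
      ((hci 3).div (hci 2) p2)
      ((((hci 4).div (hci 2) p2).const_mul 3).add (continuousOn_id.mul ((hci 2).inv₀ p2)))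
      (fun x hx' => inv_pos.2 (hx x hx'))
      (fun x hx' => by
        have := p2 x ⟨hx'.1.le, hx'.2.le⟩
        refine ((d2 x hx').inv this).congr_deriv ?_
        field_simp)
      (fun x hx' => by
        have := p2 x ⟨hx'.1.le, hx'.2.le⟩
        refine ((((d4 x hx').div (d2 x hx') this).const_mul 3).add
          ((hasDerivAt_id' x).mul ((d2 x hx').inv this))).congr_deriv ?_
        simp only [Pi.inv_apply]
        field_simp
        ring)
      (fun x hx' => by
        have := p2 x ⟨hx'.1.le, hx'.2.le⟩
        refine ((d3 x hx').div (d2 x hx') this).congr_deriv ?_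
        field_simp
        ring)
      (by simp only [cubeInt, hz0]; rw [← hJ0, ← hI0]; exact hI)
    simp only [cubeInt, hz0] at ap
    rw [← hJ0, ← hI0, ← hP, ← hYm, ← hFm] at ap
    obtain ⟨b1, b2, b3, b4⟩ := ap
    have htt : t ∈ Set.Icc a t := ⟨ht.1, le_rfl⟩
    have hw := hx t htt
    have e4 : (3 * (z t 4 / z t 2) + t * (z t 2)⁻¹ - t * (z t 2)⁻¹) / 3 = z t 4 / z t 2 := by ring
    rw [e4, abs_div, abs_of_pos hw, div_le_iff₀ hw] at b4
    rw [abs_div, abs_of_pos hw, div_le_iff₀ hw] at b1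
    have hwδ : z t 2 ≤ δ⁻¹ := by
      rw [le_inv_comm₀ hw hδ0, hδ, Real.sqrt_le_iff]
      refine ⟨(inv_pos.2 hw).le, ?_⟩
      rw [div_le_iff₀ (by positivity)]
      linarith
    refine ⟨c1 t htt, ?_, ?_⟩
    · rw [pi_norm_lt_iff (by rw [hR]; linarith)]
      have hPw : P * z t 2 ≤ P * δ⁻¹ := by gcongr
      have hFw : Fm * z t 2 ≤ Fm * δ⁻¹ := by gcongr
      intro i
      rw [Real.norm_eq_abs]
      fin_cases i
      · simp only [Fin.zero_eta, Fin.isValue, c0 t htt, abs_one]; linarith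
      · simp only [Fin.mk_one, Fin.isValue, c1 t htt]
        rw [abs_of_pos (ha.trans_le ht.1)]; linarith [ht.2]
      · show |z t 2| < R
        rw [abs_of_pos hw]; linarith
      · show |z t 3| < R
        linarith
      · show |z t 4| < R
        linarith
    · rw [inv_lt_comm₀ (by positivity) hw]
      linarith
  have haa : ∀ x ∈ Set.Icc a a, x = a := fun x hx => le_antisymm hx.2 hx.1
  have ε0 : 0 < (2 * Ym)⁻¹ := by positivity
  have start : ‖z a‖ < R ∧ (2 * Ym)⁻¹ < z a 2 := by
    refine (close a ⟨le_rfl, hab⟩ (fun x hx => absurd (hx.1.trans hx.2) (lt_irrefl a)) ?_).2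
    intro x hx
    rw [haa x hx, hz0]
    exact h2
  have main : ∀ t ∈ Set.Icc a b, ‖z t‖ < R ∧ (2 * Ym)⁻¹ < z t 2 := by
    have hh : ContinuousOn (fun t => min (R - ‖z t‖) (z t 2 - (2 * Ym)⁻¹)) (Set.Icc a b) := by
      have : ContinuousOn (fun x => z x 2) (Set.Icc a b) :=
        (continuous_apply 2).comp_continuousOn hzc
      have := hzc.norm
      fun_prop
    intro t ht
    rcases ht.1.eq_or_lt with rfl | hat
    · exact start
    have hb := forall_pos_of_bootstrap hh ?_ ?_ t ⟨hat, ht.2⟩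
    · simp only [lt_min_iff, sub_pos] at hb
      exact hb
    · have hlt : a < b := hat.trans_le ht.2
      have hc : Tendsto (fun t => min (R - ‖z t‖) (z t 2 - (2 * Ym)⁻¹)) (𝓝[>] a)
          (𝓝 (min (R - ‖z a‖) (z a 2 - (2 * Ym)⁻¹))) := by
        have := (hh a ⟨le_rfl, hab⟩).tendsto
        refine this.mono_left ?_
        rw [← nhdsWithin_Ioo_eq_nhdsGT hlt]
        exact nhdsWithin_mono _ Set.Ioo_subset_Icc_self
      exact hc.eventually (lt_mem_nhds (by simp only [lt_min_iff, sub_pos]; exact start))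
    · intro s hs hpos
      simp only [lt_min_iff, sub_pos] at hpos ⊢
      have hsb : s ∈ Set.Icc a b := ⟨hs.1.le, hs.2⟩
      have hcl : ∀ x ∈ Set.Icc a s, ‖z x‖ ≤ R ∧ (2 * Ym)⁻¹ ≤ z x 2 := by
        have hcs : ContinuousOn z (Set.Icc a s) := hzc.mono (Set.Icc_subset_Icc_right hs.2)
        have h2c : ContinuousOn (fun x => z x 2) (Set.Icc a s) :=
          (continuous_apply 2).comp_continuousOn hcs
        rw [← closure_Ioo hs.1.ne] at hcs h2c ⊢
        intro x hx
        exact ⟨ContinuousWithinAt.closure_le hx ((hcs x hx).norm.mono subset_closure)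
          continuousWithinAt_const fun y hy => (hpos y hy).1.le,
          ContinuousWithinAt.closure_le hx continuousWithinAt_const ((h2c x hx).mono subset_closure)
           fun y hy => (hpos y hy).2.le⟩
      exact (close s hsb (fun x hx => (hcl x ⟨hx.1.le, hx.2.le⟩).1)
        fun x hx => ε0.trans_le (hcl x hx).2).2
  refine ⟨z, hz0, fun t ht => ?_⟩
  have hd := hz t ht
  rw [boxClamp_eq (main t ht).1.le] at hd
  have hc := close t ht (fun x hx => (main x ⟨hx.1.le, hx.2.le.trans ht.2⟩).1.le)
    fun x hx => ε0.trans (main x ⟨hx.1, hx.2.trans ht.2⟩).2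
  exact ⟨hd, hc.1, ε0.trans hc.2.2⟩

theorem ProfileOn.congr {T : ℝ} {y y1 J v v1 K : ℝ → ℝ} (h : ProfileOn T y y1 J)
    (e : ∀ x, T < x → v x = y x) (e1 : ∀ x, T < x → v1 x = y1 x) (e2 : ∀ x, T < x → K x = J x) :
    ProfileOn T v v1 K := by
  have he : ∀ {u w : ℝ → ℝ} {x : ℝ}, (∀ x, T < x → u x = w x) → T < x → u =ᶠ[𝓝 x] w :=
    fun hu hx => by filter_upwards [lt_mem_nhds hx] with z hz using hu z hz
  refine ⟨fun x hx => by rw [e x hx]; exact h.pos x hx, fun x hx => ?_, fun x hx => ?_, fun x hx => ?_⟩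
  · rw [e1 x hx]; exact (h.dy x hx).congr_of_eventuallyEq (he e hx)
  · rw [e x hx]; exact (h.dJ x hx).congr_of_eventuallyEq (he e2 hx)
  · rw [e x hx, e1 x hx, e2 x hx]; exact (h.dy1 x hx).congr_of_eventuallyEq (he e1 hx)

/-- The profile equation has global solutions. -/
theorem exists_state {a : ℝ} {z0 : Fin 5 → ℝ} (ha : 0 < a) (h0 : z0 0 = 1)
    (h1 : z0 1 = a) (h2 : 0 < z0 2)
    (hI : 0 < 3 * (3 * (z0 4 / z0 2) + a * (z0 2)⁻¹) * (z0 2)⁻¹ ^ 2 - 2 * a * (z0 2)⁻¹ ^ 3 -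
      9 * ((z0 2)⁻¹ * (z0 3 / z0 2)) ^ 2) :
    ∃ z : ℝ → Fin 5 → ℝ, z a = z0 ∧ ∀ t, a ≤ t →
      HasDerivWithinAt z (profileField (z t) (z t)) (Set.Ici a) t ∧ z t 1 = t ∧ 0 < z t 2 := by
  have hex : ∀ n : ℕ, ∃ z : ℝ → Fin 5 → ℝ, z a = z0 ∧ ∀ t ∈ Set.Icc a (a + n),
      HasDerivWithinAt z (profileField (z t) (z t)) (Set.Icc a (a + n)) t ∧ z t 1 = t ∧
        0 < z t 2 := fun n =>
    exists_state_on_Icc ha (by linarith [n.cast_nonneg (α := ℝ)]) h0 h1 h2 hI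
  choose z hz0 hz using hex
  have hagree : ∀ m n : ℕ, m ≤ n → Set.EqOn (z m) (z n) (Set.Icc a (a + m)) := by
    intro m n hmn
    have hmn' : (m : ℝ) ≤ n := by exact_mod_cast hmn
    have hsub : Set.Icc a (a + m) ⊆ Set.Icc a (a + n) := Set.Icc_subset_Icc_right (by linarith)
    refine eqOn_of_quadratic profileField (fun t ht => (hz m t ht).1.continuousWithinAt)
      (fun t ht => ((hz n t (hsub ht)).1.mono hsub).continuousWithinAt)
      (fun t ht => (hz m t ⟨ht.1, ht.2.le⟩).1.mono_of_mem_nhdsWithin (Icc_mem_nhdsGE_of_mem ht))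
      (fun t ht => ((hz n t (hsub ⟨ht.1, ht.2.le⟩)).1.mono hsub).mono_of_mem_nhdsWithin
        (Icc_mem_nhdsGE_of_mem ht)) (by rw [hz0, hz0])
  have hZ : ∀ (n : ℕ), ∀ t ∈ Set.Icc a (a + n), z ⌈t - a⌉₊ t = z n t := by
    intro n t ht
    refine hagree _ n (Nat.ceil_le.2 (by linarith [ht.2])) ⟨ht.1, ?_⟩
    linarith [Nat.le_ceil (t - a)]
  refine ⟨fun t => z ⌈t - a⌉₊ t, hz0 _, fun t ht => ?_⟩
  obtain ⟨n, hn⟩ := exists_nat_gt (t - a)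
  have htn : t ∈ Set.Icc a (a + n) := ⟨ht, by linarith⟩
  obtain ⟨d, e1, e2⟩ := hz n t htn
  beta_reduce
  rw [hZ n t htn]
  refine ⟨?_, e1, e2⟩
  refine ((d.congr (hZ n) (hZ n t htn)).mono_of_mem_nhdsWithin ?_)
  rw [← Set.Ici_inter_Iic]
  exact inter_mem self_mem_nhdsWithin (mem_nhdsWithin_of_mem_nhds (Iic_mem_nhds (by linarith)))

/-- Existence of the half profile with slope `1` at the origin; it continues analytically. -/
theorem exists_halfProfile : ∃ y y1 J : ℝ → ℝ, HalfProfile 0 1 y y1 J ∧ ∃ p : ℝ → ℝ, AnalyticAt ℝ p 0 ∧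
    Function.Odd p ∧ ∃ a > 0, ∀ x ∈ Set.Icc 0 a, y x = p x := by
  obtain ⟨p, p1, K, hpa, hp1a, hodd, hp0, hp10, hK0, hev⟩ := exists_origin_solution
  have hpos : ∀ᶠ x in 𝓝[>] (0:ℝ), 0 < p x := by
    have h1 : Tendsto (slope p 0) (𝓝[>] 0) (𝓝 (p1 0)) :=
      (hasDerivAt_iff_tendsto_slope.1 hev.self_of_nhds.1).mono_left
        (nhdsWithin_mono _ fun z (hz : (0:ℝ) < z) => hz.ne')
    rw [hp10] at h1
    filter_upwards [h1.eventually (lt_mem_nhds one_pos), self_mem_nhdsWithin] with x hx hx0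
    rw [slope_def_field, hp0, sub_zero, sub_zero] at hx
    exact (div_pos_iff_of_pos_right hx0).1 hx
  obtain ⟨r, hr, hrp⟩ : ∃ r > 0, ∀ x ∈ Set.Ioo 0 r, 0 < p x := by
    rw [eventually_nhdsWithin_iff] at hpos
    obtain ⟨ε, hε, hb⟩ := Metric.eventually_nhds_iff.1 hpos
    exact ⟨ε, hε, fun x hx => hb (by simpa [abs_of_pos hx.1] using hx.2) hx.1⟩
  obtain ⟨s, hs, hsp⟩ := Metric.eventually_nhds_iff.1 hev
  obtain ⟨a, ha⟩ : ∃ a, a = min r s / 2 := ⟨_, rfl⟩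
  have hmin : 0 < min r s := lt_min hr hs
  have ha0 : 0 < a := by rw [ha]; positivity
  have har : a < r := by have := min_le_left r s; linarith
  have has : a < s := by have := min_le_right r s; linarith
  have hpp : ∀ x, 0 < x → x ≤ a → 0 < p x := fun x h1 h2 => hrp x ⟨h1, h2.trans_lt har⟩
  have hd : ∀ x, 0 ≤ x → x ≤ a → HasDerivAt p (p1 x) x ∧ HasDerivAt K (p x) x ∧
      HasDerivAt (fun x => p x * p1 x) ((K x - x * p x) / 3) x := fun x h1 h2 =>
    hsp (by rw [Real.dist_eq, sub_zero, abs_of_nonneg h1]; linarith)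
  have hd1 : ∀ x, 0 < x → x ≤ a → HasDerivAt p1 (((K x - x * p x) / 3 - p1 x ^ 2) / p x) x :=
    fun x h1 h2 => hasDerivAt_slope_of_flux (hpp x h1 h2).ne' (hd x h1.le h2).1 (hd x h1.le h2).2.2
  have hst : ∀ x, 0 < x → x ≤ a → HasDerivAt (profileState p p1 K)
      (profileField (profileState p p1 K x) (profileState p p1 K x)) x := fun x h1 h2 =>
    hasDerivAt_profileState (hpp x h1 h2).ne' (hd x h1.le h2).1 (hd x h1.le h2).2.1 (hd1 x h1 h2)
  have cp1 : ∀ x, 0 ≤ x → x ≤ a → ContinuousAt p1 x := fun x h1 h2 => by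
    rcases h1.eq_or_lt with rfl | h1
    · exact hp1a.continuousAt
    · exact (hd1 x h1 h2).continuousAt
  have hI : 0 < cubeInt p p1 K a := by
    have e : ∀ x, energy p p1 K 0 x = -cubeInt p p1 K x := fun x => by simp [energy]
    have := lt_of_hasDerivAt_pos (f := fun x => -energy p p1 K 0 x) ha0 (by
      have c1 : ContinuousOn p (Set.Icc 0 a) := fun x hx =>
        (hd x hx.1 hx.2).1.continuousAt.continuousWithinAt
      have c2 : ContinuousOn p1 (Set.Icc 0 a) := fun x hx => (cp1 x hx.1 hx.2).continuousWithinAt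
      have c3 : ContinuousOn K (Set.Icc 0 a) := fun x hx =>
        (hd x hx.1 hx.2).2.1.continuousAt.continuousWithinAt
      unfold energy cubeInt
      fun_prop) (fun x hx => (hasDerivAt_energy 0 (hpp x hx.1 hx.2.le).ne' (hd x hx.1.le hx.2.le).1
        (hd x hx.1.le hx.2.le).2.1 (hd1 x hx.1 hx.2.le)).neg) (fun x hx => by
        have := hpp x hx.1 hx.2.le
        rw [neg_neg, sub_zero, mul_zero, add_zero]; positivity)
    simp only [e, neg_neg] at this
    refine lt_of_eq_of_lt ?_ this
    simp [cubeInt, hp0]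
  have hpa0 := hpp a ha0 le_rfl
  obtain ⟨Z, hZ0, hZ⟩ := exists_state (z0 := profileState p p1 K a) ha0 rfl rfl
    (inv_pos.2 hpa0) (by
      refine hI.trans_eq ?_
      simp only [profileState, cubeInt]
      simp
      field_simp
      ring)
  classical
  -- The series solution is followed up to `a` and the global solution of the quadratic system
  -- afterwards. Both satisfy the system, so the one-sided derivatives at `a` agree.
  obtain ⟨W, hW⟩ : ∃ W : ℝ → Fin 5 → ℝ, W = fun t => if t ≤ a then profileState p p1 K t else Z t :=
    ⟨_, rfl⟩
  have hWl : ∀ t, t ≤ a → W t = profileState p p1 K t := fun t ht => by rw [hW]; simp [ht]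
  have hWr : ∀ t, a ≤ t → W t = Z t := fun t ht => by
    rcases ht.eq_or_lt with rfl | ht
    · rw [hWl _ le_rfl, hZ0]
    · rw [hW]; simp [ht.not_ge]
  have hWd : ∀ t, 0 < t → HasDerivAt W (profileField (W t) (W t)) t := by
    intro t ht
    rcases lt_trichotomy t a with hlt | rfl | hgt
    · rw [hWl t hlt.le]
      refine (hst t ht hlt.le).congr_of_eventuallyEq ?_
      filter_upwards [gt_mem_nhds hlt] with x hx using hWl x (le_of_lt hx)
    · have d1 : HasDerivWithinAt W (profileField (W t) (W t)) (Set.Iic t) t := by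
        rw [hWl t le_rfl]
        exact (hst t ht le_rfl).hasDerivWithinAt.congr (fun x hx => hWl x hx) (hWl t le_rfl)
      have d2 : HasDerivWithinAt W (profileField (W t) (W t)) (Set.Ici t) t := by
        rw [hWr t le_rfl]
        exact (hZ t le_rfl).1.congr (fun x hx => hWr x hx) (hWr t le_rfl)
      have := d1.union d2
      rwa [Set.Iic_union_Ici, hasDerivWithinAt_univ] at this
    · rw [hWr t hgt.le]
      refine ((hZ t hgt.le).1.hasDerivAt (Ici_mem_nhds hgt)).congr_of_eventuallyEq ?_
      filter_upwards [lt_mem_nhds hgt] with x hx using hWr x (le_of_lt hx)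
  have hP := profileOn_of_state (T := 0) (z := W) (fun x hx => by
      rcases le_total x a with h | h
      · rw [hWl x h]; rfl
      · rw [hWr x h]; exact (hZ x h).2.1) (fun x hx => by
      rcases le_total x a with h | h
      · rw [hWl x h]; exact inv_pos.2 (hpp x hx h)
      · rw [hWr x h]; exact (hZ x h).2.2) hWd
  have g : ∀ (u w : ℝ → ℝ), (∀ x, 0 < x → x ≤ a → w x = u x) →
      (∀ x, 0 < x → ContinuousAt w x) → ContinuousAt u 0 →
      (∀ x, 0 < x → (if x ≤ a then u x else w x) = w x) ∧
      ContinuousOn (fun x => if x ≤ a then u x else w x) (Set.Ici 0) := by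
    intro u w huw hw hu
    have e : ∀ x, 0 < x → (if x ≤ a then u x else w x) = w x := fun x hx => by
      split_ifs with h
      · exact (huw x hx h).symm
      · rfl
    refine ⟨e, fun x hx => ?_⟩
    rcases (show (0:ℝ) ≤ x from hx).eq_or_lt with rfl | hx
    · refine (hu.congr ?_).continuousWithinAt
      filter_upwards [gt_mem_nhds ha0] with x hx
      simp [le_of_lt hx]
    · refine ((hw x hx).congr ?_).continuousWithinAt
      filter_upwards [lt_mem_nhds hx] with t ht using (e t ht).symm
  obtain ⟨g1, g2⟩ := g p (fun x => (W x 2)⁻¹) (fun x hx hxa => by simp [hWl x hxa, profileState])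
    (fun x hx => (hP.dy x hx).continuousAt) (hd 0 le_rfl ha0.le).1.continuousAt
  obtain ⟨k1, k2⟩ := g p1 (fun x => W x 3 / W x 2) (fun x hx hxa => by
      have := (hpp x hx hxa).ne'
      rw [hWl x hxa]; simp [profileState]; field_simp)
    (fun x hx => (hP.dy1 x hx).continuousAt) (cp1 0 le_rfl ha0.le)
  obtain ⟨j1, j2⟩ := g K (fun x => 3 * (W x 4 / W x 2) + x * (W x 2)⁻¹) (fun x hx hxa => by
      have := (hpp x hx hxa).ne'
      rw [hWl x hxa]; simp [profileState]; field_simp; ring)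
    (fun x hx => (hP.dJ x hx).continuousAt) (hd 0 le_rfl ha0.le).2.1.continuousAt
  refine ⟨_, _, _, ⟨hP.congr g1 k1 j1, g2, k2, j2, ?_, ?_, ?_⟩, p, hpa, hodd, a, ha0, fun x hx => ?_⟩
  · simp [ha0.le, hp0]
  · simp [ha0.le, hp10]
  · simp [ha0.le, hK0]
  · simp [hx.2]

/-- Half profiles which start at the origin have a positive limit. -/
theorem HalfProfile.exists_limit {α : ℝ} {y y1 J : ℝ → ℝ} (h : HalfProfile 0 α y y1 J) :
    ∃ l, 0 < l ∧ Tendsto y atTop (𝓝 l) := by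
  -- With `c = y x1` and `d = y x2`, `E_c/c + E_d/d` decreases at rate at least `2 (y - c)² + 2 (y -
  -- d)² ≥ (c - d)²`. It starts at `9 α² (c + d)` and is nonnegative at `x1`. First this bounds `y`,
  -- then it gives the Cauchy property.
  have key : ∀ x1 x2, 0 < x1 → x1 ≤ x2 →
      x1 * (y x1 - y x2) ^ 2 ≤ 9 * α ^ 2 * (y x1 + y x2) := by
    intro x1 x2 h1 h12
    obtain ⟨c, hc⟩ : ∃ c, c = y x1 := ⟨_, rfl⟩
    obtain ⟨d, hd⟩ : ∃ d, d = y x2 := ⟨_, rfl⟩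
    have hc0 : 0 < c := hc ▸ h.pos x1 h1
    have hd0 : 0 < d := hd ▸ h.pos x2 (h1.trans_le h12)
    have e1 : 0 ≤ energy y y1 J c x1 := by
      have := h.slope_sq_le_energy h1 le_rfl; rw [← hc] at this; exact this.trans' (by positivity)
    have e2 : 0 ≤ energy y y1 J d x1 := by
      have := h.slope_sq_le_energy h1 h12; rw [← hd] at this; exact this.trans' (by positivity)
    have hm := sub_le_sub_of_hasDerivAt
      (f := fun x => energy y y1 J c x / c + energy y y1 J d x / d)
      (g := fun x => -((c - d) ^ 2) * x) (g' := fun _ => -((c - d) ^ 2) * 1) h1.le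
      ((((h.continuousOn_energy c).mono fun t ht => ht.1).div_const c).add
        (((h.continuousOn_energy d).mono fun t ht => ht.1).div_const d)) (by fun_prop)
      (fun x hx => ((h.denergy c hx.1).div_const c).add ((h.denergy d hx.1).div_const d))
      (fun x _ => (hasDerivAt_id' x).const_mul _) (fun x hx => by
        have hy := h.pos x hx.1
        have q : ∀ c, 0 < c → -((y x - c) ^ 2 * (y x + 2 * c)) / c ≤ -(2 * (y x - c) ^ 2) := by
          intro c hc
          rw [div_le_iff₀ hc]
          have : 0 ≤ (y x - c) ^ 2 * y x := by positivity
          linarith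
        have := q c hc0
        have := q d hd0
        have := sq_nonneg (y x - c + (y x - d))
        linarith)
    simp only [h.energy_start] at hm
    have e3 : (9 * α ^ 2 * c ^ 2 - 2 * 0 * c ^ 3) / c = 9 * α ^ 2 * c := by field_simp; ring
    have e4 : (9 * α ^ 2 * d ^ 2 - 2 * 0 * d ^ 3) / d = 9 * α ^ 2 * d := by field_simp; ring
    rw [e3, e4] at hm
    have e5 : 0 ≤ energy y y1 J c x1 / c := by positivity
    have e6 : 0 ≤ energy y y1 J d x1 / d := by positivity
    rw [← hc, ← hd]
    linarith
  obtain ⟨k, hk⟩ : ∃ k, k = 9 * α ^ 2 := ⟨_, rfl⟩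
  have hk0 : 0 ≤ k := by rw [hk]; positivity
  rw [← hk] at key
  have hy1 := h.pos 1 one_pos
  obtain ⟨M, hM⟩ : ∃ M, M = 3 * y 1 + k := ⟨_, rfl⟩
  have hbd : ∀ x, 1 ≤ x → y x ≤ M := by
    intro x hx
    by_contra hcon
    push Not at hcon
    have := key 1 x one_pos hx
    have h1 : 0 < y x - y 1 - (2 * y 1 + k) := by linarith
    nlinarith [mul_pos h1 hy1, mul_nonneg h1.le hk0, mul_pos hy1 hy1, mul_nonneg hk0 hy1.le,
      mul_pos h1 h1]
  have hM0 : 0 < M := by rw [hM]; positivity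
  have hcau : CauchySeq y := by
    rw [Metric.cauchySeq_iff']
    intro ε hε
    obtain ⟨N, hN⟩ : ∃ N, N = 1 + 2 * k * M / ε ^ 2 := ⟨_, rfl⟩
    have hN1 : 1 ≤ N := by
      have : 0 ≤ 2 * k * M / ε ^ 2 := by positivity
      linarith
    refine ⟨N, fun n hn => ?_⟩
    rw [Real.dist_eq]
    have h1 := key N n (by linarith) hn
    have h2 : k * (y N + y n) ≤ k * (M + M) := by
      gcongr
      · exact hbd N hN1
      · exact hbd n (hN1.trans hn)
    have h3 : N * ε ^ 2 = ε ^ 2 + 2 * k * M := by rw [hN]; field_simp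
    have h4 : (y N - y n) ^ 2 < ε ^ 2 := by
      have h5 : N * (y N - y n) ^ 2 < N * ε ^ 2 := by
        have : 0 < ε ^ 2 := by positivity
        linarith
      exact lt_of_mul_lt_mul_left h5 (by linarith)
    rw [abs_sub_comm]
    exact abs_lt_of_sq_lt_sq h4 hε.le
  obtain ⟨l, hl⟩ := cauchySeq_tendsto_of_complete hcau
  have hI := h.cubeInt_pos one_pos
  have hlow : ∀ x, 1 ≤ x → cubeInt y y1 J 1 ≤ 3 * J 1 * y x ^ 2 := by
    intro x hx
    have h1 := h.slope_sq_le_energy one_pos hx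
    have h2 : energy y y1 J (y x) 1 = 3 * J 1 * y x ^ 2 - cubeInt y y1 J 1 - 2 * 1 * y x ^ 3 := rfl
    have h3 : 0 ≤ 2 * 1 * y x ^ 3 := by
      have := h.pos x (by linarith); positivity
    have := sq_nonneg (y x * y1 x)
    linarith
  have hlim : cubeInt y y1 J 1 ≤ 3 * J 1 * l ^ 2 := by
    refine ge_of_tendsto ((hl.pow 2).const_mul (3 * J 1)) ?_
    filter_upwards [eventually_ge_atTop 1] with x hx using hlow x hx
  have hl0 : 0 ≤ l := ge_of_tendsto hl (by
    filter_upwards [eventually_ge_atTop 1] with x hx using (h.pos x (by linarith)).le)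
  refine ⟨l, lt_of_le_of_ne hl0 fun e => ?_, hl⟩
  rw [← e] at hlim
  simp at hlim
  linarith

/-! ### Uniqueness of the half profile at the origin -/

namespace HalfProfile
variable {y y1 J v v1 K : ℝ → ℝ}

theorem exists_slope_ge_half (h : HalfProfile 0 1 y y1 J) :
    ∃ δ > 0, ∀ x ∈ Set.Icc 0 δ, x / 2 ≤ y x := by
  have h1 := (h.cy1 0 (by simp)).tendsto
  rw [h.y1_start] at h1
  have h2 := h1.eventually (lt_mem_nhds (by norm_num : (1 / 2 : ℝ) < 1))
  rw [eventually_nhdsWithin_iff] at h2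
  obtain ⟨ε, hε, hb⟩ := Metric.eventually_nhds_iff.1 h2
  refine ⟨ε / 2, by positivity, fun x hx => ?_⟩
  have := sub_le_sub_of_hasDerivAt (f := fun x => 1 / 2 * x) (f' := fun _ => 1 / 2 * 1) hx.1
    (by fun_prop) (h.cy.mono fun t ht => ht.1) (fun t _ => (hasDerivAt_id' t).const_mul _)
    (fun t ht => h.dy t ht.1) (fun t ht => by
      have : 1 / 2 < y1 t := hb (by
        rw [Real.dist_eq, sub_zero, abs_of_pos ht.1]; linarith [ht.2, hx.2]) ht.1.le
      linarith)
  rw [h.y_start] at this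
  linarith

theorem abs_le_of_abs_deriv_le {f f' g g' : ℝ → ℝ} {t : ℝ} (ht : 0 ≤ t)
    (hf : ContinuousOn f (Set.Icc 0 t)) (hg : ContinuousOn g (Set.Icc 0 t))
    (hdf : ∀ x ∈ Set.Ioo 0 t, HasDerivAt f (f' x) x) (hdg : ∀ x ∈ Set.Ioo 0 t, HasDerivAt g (g' x) x)
    (h : ∀ x ∈ Set.Ioo 0 t, |f' x| ≤ g' x) (f0 : f 0 = 0) (g0 : g 0 = 0) : |f t| ≤ g t := by
  have u := sub_le_sub_of_hasDerivAt ht hf hg hdf hdg fun x hx => (abs_le.1 (h x hx)).2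
  have l := sub_le_sub_of_hasDerivAt ht hf.neg hg (fun x hx => (hdf x hx).neg) hdg
    fun x hx => by linarith [(abs_le.1 (h x hx)).1]
  simp only [Pi.neg_apply, f0, g0] at u l
  rw [abs_le]; constructor <;> linarith

/-- With `M` the maximum of `|y - v|`, three integrations bound half the gap of the squares by `M
x³/3`. Division by `(y + v)/2 ≥ x/2` gives `M ≤ (2/3) M`, so `M = 0`; the singularity at the zero
costs one power of `x` and three are available. -/
theorem eqOn_start (h : HalfProfile 0 1 y y1 J) (g : HalfProfile 0 1 v v1 K) :
    ∃ δ > 0, y δ = v δ ∧ y1 δ = v1 δ ∧ J δ = K δ ∧ ∀ x ∈ Set.Icc 0 δ, y x = v x := by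
  obtain ⟨δ₁, hδ₁, hy⟩ := h.exists_slope_ge_half
  obtain ⟨δ₂, hδ₂, hv⟩ := g.exists_slope_ge_half
  obtain ⟨δ, hδ⟩ : ∃ δ, δ = min (min δ₁ δ₂) 1 := ⟨_, rfl⟩
  have hδ0 : 0 < δ := by rw [hδ]; positivity
  have hδa : δ ≤ δ₁ := hδ ▸ (min_le_left _ _).trans (min_le_left _ _)
  have hδb : δ ≤ δ₂ := hδ ▸ (min_le_left _ _).trans (min_le_right _ _)
  have hδc : δ ≤ 1 := hδ ▸ min_le_right _ _
  have cI : ∀ t, Set.Icc (0:ℝ) t ⊆ Set.Ici 0 := fun t x hx => hx.1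
  obtain ⟨m, hm, hmax⟩ := isCompact_Icc.exists_isMaxOn (Set.nonempty_Icc.2 hδ0.le)
    ((h.cy.mono (cI _)).sub (g.cy.mono (cI _))).abs
  obtain ⟨M, hM⟩ : ∃ M, M = |y m - v m| := ⟨_, rfl⟩
  have hM0 : 0 ≤ M := by rw [hM]; positivity
  have hle : ∀ x ∈ Set.Icc 0 δ, |y x - v x| ≤ M := fun x hx => by
    rw [hM]; exact hmax hx
  have hN : ∀ x ∈ Set.Icc 0 δ, |J x - K x| ≤ M * x := fun x hx =>
    abs_le_of_abs_deriv_le (f := fun x => J x - K x) (g := fun x => M * x) (g' := fun _ => M * 1) hx.1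
      ((h.cJ.mono (cI _)).sub (g.cJ.mono (cI _))) (by fun_prop)
      (fun t ht => (h.dJ t ht.1).sub (g.dJ t ht.1)) (fun t _ => (hasDerivAt_id' t).const_mul M)
      (fun t ht => by rw [mul_one]; exact hle t ⟨ht.1.le, ht.2.le.trans hx.2⟩)
      (by rw [h.J_start, g.J_start, sub_self]) (by simp)
  have hcy := h.cy; have hcv := g.cy; have hcy1 := h.cy1; have hcv1 := g.cy1
  have hP : ∀ x ∈ Set.Icc 0 δ, |y x * y1 x - v x * v1 x| ≤ M * x ^ 2 := fun x hx =>
    abs_le_of_abs_deriv_le (f := fun x => y x * y1 x - v x * v1 x) (g := fun x => M * x ^ 2)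
      (g' := fun x => M * (2 * x)) hx.1
      ((by fun_prop : ContinuousOn (fun x => y x * y1 x - v x * v1 x) (Set.Ici 0)).mono (cI _)) (by fun_prop)
      (fun t ht => (h.dflux ht.1).sub (g.dflux ht.1))
      (fun t _ => by simpa using (hasDerivAt_pow 2 t).const_mul M)
      (fun t ht => by
        have ht' : t ∈ Set.Icc 0 δ := ⟨ht.1.le, ht.2.le.trans hx.2⟩
        have h1 := abs_le.1 (hN t ht')
        have h2 : |t * (y t - v t)| ≤ t * M := by
          rw [abs_mul, abs_of_pos ht.1]; gcongr; exact ht.1.le; exact hle t ht'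
        have h2 := abs_le.1 h2
        have : 0 ≤ M * t := mul_nonneg hM0 ht.1.le
        rw [abs_le]; constructor <;> linarith [h1.1, h1.2, h2.1, h2.2])
      (by rw [h.y_start, g.y_start]; ring) (by simp)
  have hB : ∀ x ∈ Set.Icc 0 δ, |(y x ^ 2 - v x ^ 2) / 2| ≤ M * x ^ 3 / 3 := fun x hx =>
    abs_le_of_abs_deriv_le (f := fun x => (y x ^ 2 - v x ^ 2) / 2) (g := fun x => M * x ^ 3 / 3)
      (g' := fun x => M * x ^ 2) hx.1
      ((by fun_prop : ContinuousOn (fun x => (y x ^ 2 - v x ^ 2) / 2) (Set.Ici 0)).mono (cI _)) (by fun_prop)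
      (fun t ht => by
        refine (((h.dy t ht.1).pow 2).sub ((g.dy t ht.1).pow 2)).div_const 2 |>.congr_deriv
          (g' := y t * y1 t - v t * v1 t) ?_
        push_cast; ring)
      (fun t _ => (((hasDerivAt_pow 3 t).const_mul M).div_const 3).congr_deriv (by push_cast; ring))
      (fun t ht => hP t ⟨ht.1.le, ht.2.le.trans hx.2⟩)
      (by rw [h.y_start, g.y_start]; ring) (by simp)
  have hd : ∀ x ∈ Set.Icc 0 δ, |y x - v x| ≤ 2 / 3 * M := by
    intro x hx
    rcases hx.1.eq_or_lt with rfl | hx0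
    · rw [h.y_start, g.y_start]; simp; exact hM0
    have h1 := hB x hx
    have h2 := hy x ⟨hx.1, hx.2.trans hδa⟩
    have h3 := hv x ⟨hx.1, hx.2.trans hδb⟩
    have hs : x ≤ y x + v x := by linarith
    have e : (y x ^ 2 - v x ^ 2) / 2 = (y x + v x) / 2 * (y x - v x) := by ring
    rw [e, abs_mul, abs_of_pos (by linarith)] at h1
    have h4 : x / 2 * |y x - v x| ≤ (y x + v x) / 2 * |y x - v x| := by gcongr
    have h5 : x / 2 * |y x - v x| ≤ x / 2 * (2 / 3 * M) := by
      have : M * x ^ 3 / 3 ≤ x / 2 * (2 / 3 * M) := by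
        have hx1 : x ≤ 1 := hx.2.trans hδc
        have : M * x * (x ^ 2) ≤ M * x * 1 := by gcongr; nlinarith
        linarith
      linarith
    exact le_of_mul_le_mul_left h5 (by positivity)
  have hM00 : M = 0 := by
    have := hd m hm
    rw [← hM] at this
    linarith
  have heq : ∀ x ∈ Set.Icc 0 δ, y x = v x := fun x hx => by
    have := hle x hx
    rw [hM00] at this
    linarith [abs_nonpos_iff.1 this]
  have hδm : δ ∈ Set.Icc 0 δ := ⟨hδ0.le, le_rfl⟩
  refine ⟨δ, hδ0, heq δ hδm, ?_, ?_, heq⟩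
  · have := hP δ hδm
    rw [hM00, zero_mul, abs_nonpos_iff, heq δ hδm, ← mul_sub] at this
    have hvδ := (g.pos δ hδ0).ne'
    have := (mul_eq_zero.1 this).resolve_left hvδ
    linarith
  · have := hN δ hδm
    rw [hM00, zero_mul, abs_nonpos_iff] at this
    linarith

theorem eq_of_slope_one (h : HalfProfile 0 1 y y1 J) (g : HalfProfile 0 1 v v1 K) {x : ℝ}
    (hx : 0 ≤ x) : y x = v x := by
  obtain ⟨δ, hδ, e, e1, e2, e3⟩ := h.eqOn_start g
  rcases le_total x δ with hxδ | hxδ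
  · exact e3 x ⟨hx, hxδ⟩
  have hs := eqOn_of_quadratic profileField (u := profileState y y1 J) (v := profileState v v1 K)
    (a := δ) (b := x)
    (fun t ht => (h.hasDerivAt_state (hδ.trans_le ht.1)).continuousAt.continuousWithinAt)
    (fun t ht => (g.hasDerivAt_state (hδ.trans_le ht.1)).continuousAt.continuousWithinAt)
    (fun t ht => (h.hasDerivAt_state (hδ.trans_le ht.1)).hasDerivWithinAt)
    (fun t ht => (g.hasDerivAt_state (hδ.trans_le ht.1)).hasDerivWithinAt)
    (by simp only [profileState, e, e1, e2]) ⟨hxδ, le_rfl⟩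
  have := congrFun hs 2
  simpa [profileState] using this

/-- Half profiles at the origin are determined by their limit. -/
theorem eq_of_tendsto {α β l : ℝ} (h : HalfProfile 0 α y y1 J) (g : HalfProfile 0 β v v1 K)
    (hα : 0 < α) (hβ : 0 < β) (hl : 0 < l) (hy : Tendsto y atTop (𝓝 l)) (hv : Tendsto v atTop (𝓝 l))
    {x : ℝ} (hx : 0 ≤ x) : y x = v x := by
  have scale : ∀ {α : ℝ}, 0 < α → ∃ m, 0 < m ∧ m ^ 2 * α = 1 := fun {α} hα =>
    ⟨(√α)⁻¹, by positivity, by rw [inv_pow, Real.sq_sqrt hα.le, inv_mul_cancel₀ hα.ne']⟩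
  obtain ⟨m, hm, em⟩ := scale hα
  obtain ⟨n, hn, en⟩ := scale hβ
  have h' := h.rescale hm
  have g' := g.rescale hn
  rw [mul_zero, em] at h'
  rw [mul_zero, en] at g'
  have key : ∀ x, 0 ≤ x → m ^ 3 * y (x / m) = n ^ 3 * v (x / n) := fun x hx =>
    h'.eq_of_slope_one g' hx
  have hlim : m ^ 3 * l = n ^ 3 * l := by
    refine tendsto_nhds_unique (tendsto_rescale hm hy) ((tendsto_rescale hn hv).congr' ?_)
    filter_upwards [eventually_ge_atTop 0] with x hx using (key x hx).symm
  have hmn : m = n := by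
    have := mul_right_cancel₀ hl.ne' hlim
    exact (pow_left_inj₀ hm.le hn.le three_ne_zero).1 this
  have := key (x * m) (by positivity)
  rw [← hmn, mul_div_cancel_right₀ _ hm.ne'] at this
  exact mul_left_cancel₀ (by positivity) this

/-! ### The odd extension -/

/-- The odd function with values `-y` on the positive half-line. -/
noncomputable def _root_.oddReflection (y : ℝ → ℝ) (z : ℝ) : ℝ := if z ≤ 0 then y (-z) else -y z

theorem _root_.oddReflection_odd (hy : y 0 = 0) : Function.Odd (oddReflection y) := by
  intro z
  rcases lt_trichotomy z 0 with h | rfl | h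
  · simp [oddReflection, h.le, h.not_ge]
  · simp [oddReflection, hy]
  · simp [oddReflection, h.le, h.not_ge]

/-- Away from 0 this is the equation of `y`, transported by symmetry. At 0 each of the three
derivatives exists because the candidate, a function of `|z|` or `z` times one, is continuous there.
-/
theorem isShockProfile_oddReflection {α : ℝ} (h : HalfProfile 0 α y y1 J)
    (hl : Tendsto y atTop (𝓝 1)) : IsShockProfile (oddReflection y) := by
  have cabs : ∀ {u : ℝ → ℝ}, ContinuousOn u (Set.Ici 0) → Continuous fun z => u |z| := fun hu =>
    hu.comp_continuous continuous_abs fun z => abs_nonneg z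
  have eneg : ∀ {z}, z < 0 → (fun z => oddReflection y z) =ᶠ[𝓝 z] fun z => y (-z) := fun hz => by
    filter_upwards [gt_mem_nhds hz] with t ht
    simp [oddReflection, le_of_lt ht]
  have epos : ∀ {z}, 0 < z → (fun z => oddReflection y z) =ᶠ[𝓝 z] fun z => -y z := fun hz => by
    filter_upwards [lt_mem_nhds hz] with t ht
    simp [oddReflection, not_le.2 ht]
  have labs : ∀ {u : ℝ → ℝ} {z : ℝ}, z < 0 → (fun z => u |z|) =ᶠ[𝓝 z] fun z => u (-z) := fun hz => by
    filter_upwards [gt_mem_nhds hz] with t ht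
    rw [abs_of_neg ht]
  have rabs : ∀ {u : ℝ → ℝ} {z : ℝ}, 0 < z → (fun z => u |z|) =ᶠ[𝓝 z] u := fun hz => by
    filter_upwards [lt_mem_nhds hz] with t ht
    rw [abs_of_pos ht]
  have hn : ∀ z : ℝ, HasDerivAt (fun z : ℝ => -z) (-1) z := hasDerivAt_neg
  have hc : Continuous (oddReflection y) := by
    have : oddReflection y = fun z => if z ≤ 0 then y |z| else -y |z| := by
      funext z
      rcases le_or_gt z 0 with hz | hz
      · simp [oddReflection, hz, abs_of_nonpos hz]
      · simp [oddReflection, hz.not_ge, abs_of_pos hz]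
    rw [this]
    refine Continuous.if_le (cabs h.cy) (cabs h.cy).neg continuous_id continuous_const ?_
    rintro z rfl
    simp [h.y_start]
  have c1 : Continuous fun z => -y1 |z| := (cabs h.cy1).neg
  have d1 : ∀ z, HasDerivAt (oddReflection y) (-y1 |z|) z := by
    have hne : ∀ z, z ≠ 0 → HasDerivAt (oddReflection y) (-y1 |z|) z := fun z hz => by
      rcases hz.lt_or_gt with hz | hz
      · rw [abs_of_neg hz]
        exact (((h.dy (-z) (by linarith)).comp z (hn z)).congr_of_eventuallyEq (eneg hz)).congr_deriv
          (by ring)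
      · rw [abs_of_pos hz]
        exact (h.dy z hz).neg.congr_of_eventuallyEq (epos hz)
    intro z
    rcases eq_or_ne z 0 with rfl | hz
    · exact hasDerivAt_of_hasDerivAt_of_ne hne hc.continuousAt c1.continuousAt
    · exact hne z hz
  have hd1 : deriv (oddReflection y) = fun z => -y1 |z| := funext fun z => (d1 z).deriv
  have cF : ContinuousOn (fun x => (J x - x * y x) / 3) (Set.Ici 0) := by
    have := h.cJ; have := h.cy; fun_prop
  have c2 : Continuous fun z => (J |z| - |z| * y |z|) / 3 := cabs cF
  have d2 : ∀ z, HasDerivAt (fun z => oddReflection y z * -y1 |z|) ((J |z| - |z| * y |z|) / 3) z := by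
    have hne : ∀ z, z ≠ 0 →
        HasDerivAt (fun z => oddReflection y z * -y1 |z|) ((J |z| - |z| * y |z|) / 3) z := fun z hz => by
      rcases hz.lt_or_gt with hz | hz
      · have d := ((h.dflux (x := -z) (by linarith)).comp z (hn z)).neg
        refine (d.congr_of_eventuallyEq ?_).congr_deriv ?_
        · filter_upwards [eneg hz, labs (u := y1) hz] with t h1 h2
          rw [h1, h2]; simp
        · rw [abs_of_neg hz]; ring
      · have d := h.dflux (x := z) hz
        refine (d.congr_of_eventuallyEq ?_).congr_deriv ?_
        · filter_upwards [epos hz, rabs (u := y1) hz] with t h1 h2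
          rw [h1, h2]; simp
        · rw [abs_of_pos hz]
    intro z
    rcases eq_or_ne z 0 with rfl | hz
    · exact hasDerivAt_of_hasDerivAt_of_ne hne (hc.mul c1).continuousAt c2.continuousAt
    · exact hne z hz
  have hd2 : deriv (fun z => oddReflection y z * deriv (oddReflection y) z) =
      fun z => (J |z| - |z| * y |z|) / 3 := by
    rw [hd1]; exact funext fun z => (d2 z).deriv
  have d3 : ∀ z, HasDerivAt (fun z => (J |z| - |z| * y |z|) / 3) (1 / 3 * z * -y1 |z|) z := by
    have hne : ∀ z, z ≠ 0 →
        HasDerivAt (fun z => (J |z| - |z| * y |z|) / 3) (1 / 3 * z * -y1 |z|) z := fun z hz => by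
      rcases hz.lt_or_gt with hz | hz
      · have d := (h.dforce (x := -z) (by linarith)).comp z (hn z)
        refine (d.congr_of_eventuallyEq (labs (u := fun x => (J x - x * y x) / 3) hz)).congr_deriv ?_
        rw [abs_of_neg hz]; ring
      · have d := h.dforce (x := z) hz
        refine (d.congr_of_eventuallyEq (rabs (u := fun x => (J x - x * y x) / 3) hz)).congr_deriv ?_
        rw [abs_of_pos hz]; ring
    intro z
    rcases eq_or_ne z 0 with rfl | hz
    · exact hasDerivAt_of_hasDerivAt_of_ne hne c2.continuousAt
        (((continuous_const.mul continuous_id).mul c1).continuousAt)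
    · exact hne z hz
  refine ⟨fun z => (d1 z).differentiableAt, fun z => ?_, fun z => ?_, ?_, ?_⟩
  · rw [hd1]; exact (d2 z).differentiableAt
  · rw [hd2, hd1]; exact d3 z
  · refine (hl.comp tendsto_neg_atBot_atTop).congr' ?_
    filter_upwards [eventually_le_atBot 0] with z hz
    simp [oddReflection, hz]
  · refine hl.neg.congr' ?_
    filter_upwards [eventually_gt_atTop 0] with z hz
    simp [oddReflection, not_le.2 hz]

theorem analyticOnNhd_oddReflection {α a : ℝ} {p : ℝ → ℝ} (h : HalfProfile 0 α y y1 J)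
    (hp : AnalyticAt ℝ p 0) (hodd : Function.Odd p) (ha : 0 < a)
    (hyp : ∀ x ∈ Set.Icc 0 a, y x = p x) : AnalyticOnNhd ℝ (oddReflection y) Set.univ := by
  intro z _
  rcases lt_trichotomy z 0 with hz | rfl | hz
  · have h1 : AnalyticAt ℝ y (-z) := h.toProfileOn.analyticAt (by linarith)
    refine (h1.comp (f := fun z => -z) analyticAt_id.neg).congr ?_
    filter_upwards [gt_mem_nhds hz] with t ht
    simp [oddReflection, le_of_lt ht]
  · refine (hp.neg).congr ?_
    filter_upwards [Icc_mem_nhds (neg_lt_zero.2 ha) ha] with t ht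
    rcases le_or_gt t 0 with h0 | h0
    · rw [oddReflection, if_pos h0, hyp _ ⟨by linarith, by linarith [ht.1]⟩, hodd t]; rfl
    · rw [oddReflection, if_neg h0.not_ge, hyp _ ⟨h0.le, ht.2⟩]; rfl
  · refine (h.toProfileOn.analyticAt hz).neg.congr ?_
    filter_upwards [lt_mem_nhds hz] with t ht
    simp [oddReflection, not_le.2 ht]

end HalfProfile

theorem proposition3p1 :
    ∃ g : ℝ → ℝ, IsShockProfile g ∧
      (∀ f : ℝ → ℝ, IsShockProfile f → f = g) ∧
      Function.Odd g ∧
      AnalyticOnNhd ℝ g Set.univ ∧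
      ∀ z : ℝ, z < 0 → 0 < g z := by
  obtain ⟨y0, y1, J, h0, p, hp, hodd, a, ha, hyp⟩ := exists_halfProfile
  obtain ⟨l, hl, hlim⟩ := h0.exists_limit
  -- The scaling that turns the limit `l` of the slope-one half profile into 1.
  obtain ⟨m, hm, hml⟩ : ∃ m, 0 < m ∧ m ^ 3 * l = 1 := by
    refine ⟨l⁻¹ ^ ((3:ℝ)⁻¹), by positivity, ?_⟩
    have e : (l⁻¹ ^ ((3:ℝ)⁻¹)) ^ 3 = l⁻¹ := by
      rw [← Real.rpow_natCast, ← Real.rpow_mul (by positivity)]; norm_num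
    rw [e, inv_mul_cancel₀ hl.ne']
  have h := h0.rescale hm
  rw [mul_zero, mul_one] at h
  obtain ⟨y, hy⟩ : ∃ y : ℝ → ℝ, y = fun x => m ^ 3 * y0 (x / m) := ⟨_, rfl⟩
  have hylim : Tendsto y atTop (𝓝 1) := by
    rw [hy, ← hml]; exact tendsto_rescale hm hlim
  rw [← hy] at h
  refine ⟨oddReflection y, h.isShockProfile_oddReflection hylim, fun f hf => ?_,
    oddReflection_odd h.y_start, ?_, fun z hz => ?_⟩
  · obtain ⟨f0, α, hα, v1, K, w1, L, hv, hw⟩ := hf.structure_at_origin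
    have t1 : Tendsto (fun x => f (-x)) atTop (𝓝 1) := hf.tendsto_atBot.comp tendsto_neg_atTop_atBot
    have t2 : Tendsto (fun x => -f x) atTop (𝓝 1) := by simpa using hf.tendsto_atTop.neg
    have hm2 : 0 < m ^ 2 := by positivity
    funext z
    rcases le_or_gt z 0 with hz | hz
    · have := hv.eq_of_tendsto h hα hm2 one_pos t1 hylim (neg_nonneg.2 hz)
      rw [neg_neg] at this
      rw [oddReflection, if_pos hz, this]
    · have := hw.eq_of_tendsto h hα hm2 one_pos t2 hylim hz.le
      rw [oddReflection, if_neg hz.not_ge, ← this, neg_neg]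
  · refine h.analyticOnNhd_oddReflection (p := fun x => m ^ 3 * p (x / m)) (a := m * a) ?_ ?_
      (by positivity) fun x hx => ?_
    · have e : AnalyticAt ℝ (fun x : ℝ => x / m) 0 := analyticAt_id.div_const
      refine analyticAt_const.mul ?_
      exact AnalyticAt.comp_of_eq (g := p) hp e (by simp)
    · intro x
      simp only [neg_div, hodd (x / m), mul_neg]
    · rw [hy]
      beta_reduce
      rw [hyp]
      refine ⟨div_nonneg hx.1 hm.le, ?_⟩
      rw [div_le_iff₀ hm]; linarith [hx.2]
  · rw [oddReflection, if_pos hz.le]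
    exact h.pos _ (by linarith)
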